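/- Operads are coloured operads in sets, with identities. Let $P$ be a planar, symmetric or cyclic operad. An operation $p$ of arity $n$ has half-edges $0,1,\dots,n$, half-edge $0$ being its output (root) and $1,\dots,n$ its inputs; in a cyclic operad the right action of $S_n$ on operations of arity $n$ is extended to an action of the permutations of $\{0,\dots,n\}$, compatibly with composition. A \emph{nice grading} $\psi$ on $P$ assigns to each operation an integer such that $\psi(p\circ_i q)=\psi(p)+\psi(q)$, $\psi(\mathrm{id}_c)=0$, $\psi(p^\sigma)=\psi(p)$ (for all permutations $\sigma$ that act), $\psi(p)\ge -1$ for all $p$, operations with $\psi(p)=-1$ have arity $0$, and $\psi(q)=-1$ whenever $p\circ_i q$ is an identity operation for some binary operation $p$ and some $i$. The \emph{twisted arrow category} $\mathrm{Tw}(P)$ has the operations of $P$ as objects. Let $F(U(P))\sqcup P$ be the operad (of the same kind, with the same colours) generated by the set of operations of $P$, called variables, and by a copy of $P$, factored by the relations of $P$. A morphism $p\to q$ is an element of $F(U(P))\sqcup P$ with exactly one variable, this variable being $p$, whose evaluation in $P$ is $q$; composition is substitution for the variable. Every morphism from $p$ is represented by a reduced tree: a source vertex marked by $p$, a non-source vertex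 marked by an operation of $P$ attached to each half-edge of $p$ (for planar and symmetric operads, the output of $p$ is attached to an input of a lower vertex, and each input of $p$ is attached to the output of an upper vertex; for cyclic operads, one non-source vertex is attached to each of the $n+1$ half-edges of $p$, by any of its half-edges), and a numbering of the leaves (the planar one if $P$ is planar). Let $R_{\psi=-1}$ be the class of morphisms represented by a reduced tree with the trivial (planar) numbering of leaves whose non-source vertices are all marked by identity operations or by operations of grading $-1$. Let $R_{\psi\ge 0}$ be the class of morphisms represented by a reduced tree whose non-source vertices all have grading at least $0$. Let $I$ be the class of isomorphisms of $\mathrm{Tw}(P)$, and put $R_-=I\circ R_{\psi=-1}$ and $R_+=R_{\psi\ge 0}\circ I$. A pair $(L,R)$ of subcategories of a category with a degree map from objects to ordinals is a \emph{generalized Reedy structure} if: (1) $(L,R)$ is an orthogonal factorization system, i.e. $L$ and $R$ contain all isomorphisms and every morphism factors as $r\circ l$ with $l\in L$, $r\in R$, uniquely up to unique isomorphism of factorizations; (2) non-isomorphisms in $L$ strictly decrease degree; (3) non-isomorphisms in $R$ strictly increase degree; (4) isomorphisms preserve degree; (5) if $f\in L$, $\theta$ is an isomorphism and $\theta\circ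 f=f$, then $\theta=\mathrm{id}$. \textbf{Theorem.} Let $P$ be a planar, symmetric or cyclic operad with a nice grading $\psi$, and let the degree map on $\mathrm{Tw}(P)$ be $\psi$ (its values $-1,0,1,\dots$ being identified with the ordinals $0,1,2,\dots$). Then $(R_-,R_+)$ is a generalized Reedy structure on $\mathrm{Tw}(P)$ if and only if every operation of $P$ of grading $0$ has arity $1$ and the category $P(\psi=0)$, whose objects are the colours and whose morphisms are the operations of grading $0$ (and arity $1$), is a groupoid. -/

import Mathlib

universe u v w

open CategoryTheory

namespace TwistedArrow

/-! ## Planar, symmetric and cyclic coloured operads in sets -/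

/-- The three sorts of operads under consideration. -/
inductive Kind
  | planar
  | symmetric
  | cyclic

/-- The permutations of the half-edges `0, 1, …, n` of an operation of arity `n` that act on
operations (half-edge `0` is the output, half-edge `k + 1` is the input with index `k`): none but
the identity for planar operads, the permutations of the inputs for symmetric operads, and all
permutations for cyclic operads. -/
def Kind.Allows (κ : Kind) {n : ℕ} (σ : Equiv.Perm (Fin (n + 1))) : Prop :=
  match κ with
  | .planar => σ = 1
  | .symmetric => σ 0 = 0
  | .cyclic => True

/-- Let `q` have arity `m`. The half-edge `k ≠ i + 1` of `p` is this half-edge of `p ∘ᵢ q`. -/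
def outerEdge (i m k : ℕ) : ℕ := if k ≤ i then k else k + m - 1

/-- The half-edge `k ≠ 0` of `q` is this half-edge of `p ∘ᵢ q`. -/
def innerEdge (i k : ℕ) : ℕ := i + k

/-- `π` is the permutation of the half-edges of a composite induced by a permutation `σ` of the
half-edges of the outer operation that sends the input `i` to the input `i'`, and a permutation `ρ`
of the half-edges of the inner operation that fixes its output. -/
structure IsBlockPerm {n m N : ℕ} (i i' : ℕ) (σ : Equiv.Perm (Fin (n + 1)))
    (ρ : Equiv.Perm (Fin (m + 1))) (π : Equiv.Perm (Fin (N + 1))) : Prop where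
  source : ∀ k : Fin (n + 1), (k : ℕ) = i + 1 → (σ k : ℕ) = i' + 1
  root : ρ 0 = 0
  outer : ∀ (k : Fin (n + 1)) (x : Fin (N + 1)), (k : ℕ) ≠ i + 1 →
    (x : ℕ) = outerEdge i m k → (π x : ℕ) = outerEdge i' m (σ k)
  inner : ∀ (k : Fin (m + 1)) (x : Fin (N + 1)), k ≠ 0 →
    (x : ℕ) = innerEdge i k → (π x : ℕ) = innerEdge i' (ρ k)

/-- A `C`-coloured operad in sets of kind `κ`, with partial compositions `p ∘ᵢ q` and a right action
of permutations. Inputs are indexed from `0`. All operations form one type; the set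
`P(c₁, …, cₙ; c₀)` consists of the operations `p` with `inputs p = [c₁, …, cₙ]` and `output p = c₀`.
For `κ = planar` the action carries no information, for `κ = symmetric` this is a coloured symmetric
operad, for `κ = cyclic` it is a cyclic operad, that is, the action of the symmetric group `Sₙ` on
the operations of arity `n` is extended to `Sₙ₊₁`, compatibly with composition
(single-coloured if `C` has one element). -/
structure Operad (κ : Kind) (C : Type u) where
  Op : Type v
  inputs : Op → List C
  output : Op → C
  /-- identity operations -/
  one : C → Op
  /-- `comp p i q _` is `p ∘ᵢ q`, defined if the output of `q` has the colour of the input `i` -/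
  comp : (p : Op) → (i : ℕ) → (q : Op) → (inputs p)[i]? = some (output q) → Op
  /-- `act p n σ _ _` is `p^σ`, where `n` is the arity of `p` -/
  act : (p : Op) → (n : ℕ) → (σ : Equiv.Perm (Fin (n + 1))) →
    (inputs p).length = n → κ.Allows σ → Op
  inputs_one : ∀ c, inputs (one c) = [c]
  output_one : ∀ c, output (one c) = c
  inputs_comp : ∀ p i q h,
    inputs (comp p i q h) = (inputs p).take i ++ inputs q ++ (inputs p).drop (i + 1)
  output_comp : ∀ p i q h, output (comp p i q h) = output p
  length_act : ∀ p n σ h hσ, (inputs (act p n σ h hσ)).length = n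
  /-- the half-edge `k` of `p^σ` is the half-edge `σ k` of `p` -/
  edges_act : ∀ p n σ h hσ (k : Fin (n + 1)),
    (output (act p n σ h hσ) :: inputs (act p n σ h hσ))[(k : ℕ)]? =
      (output p :: inputs p)[(σ k : ℕ)]?
  comp_one : ∀ p i c h, comp p i (one c) h = p
  one_comp : ∀ c p h, comp (one c) 0 p h = p
  /-- sequential associativity -/
  comp_assoc : ∀ p i q j r h₁ h₂ h₃ h₄,
    comp (comp p i q h₁) (i + j) r h₂ = comp p i (comp q j r h₃) h₄
  /-- parallel associativity -/
  comp_comm : ∀ p i q j r h₁ h₂ h₃ h₄,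
    comp (comp p i q h₁) (i + j + (inputs q).length) r h₂ = comp (comp p (i + j + 1) r h₃) i q h₄
  act_one : ∀ p n h hσ, act p n 1 h hσ = p
  act_act : ∀ p n σ ρ h hσ h' hρ hσρ,
    act (act p n σ h hσ) n ρ h' hρ = act p n (σ * ρ) h hσρ
  /-- equivariance of composition -/
  comp_act : ∀ p n σ h hσ i i' q m ρ h' hρ h₁ h₂ N π hN hπ, IsBlockPerm i i' σ ρ π →
    comp (act p n σ h hσ) i (act q m ρ h' hρ) h₁ = act (comp p i' q h₂) N π hN hπ
  /-- for cyclic operads: `(p ∘₁ q)^τ = q^τ ∘ₙ p^τ`, where `τ = (0 1 … )`, the arity `n` of `q` is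
  positive, and inputs are indexed from `1` in this formula -/
  comp_rotate : κ = .cyclic → ∀ p m hm q n (hn : (inputs q).length = n + 1) h₁ N hN hτ hτ' hτ'' h₂,
    act (comp p 0 q h₁) N (finRotate (N + 1)) hN hτ =
      comp (act q (n + 1) (finRotate (n + 2)) hn hτ') n (act p m (finRotate (m + 1)) hm hτ'') h₂

namespace Operad

variable {κ : Kind} {C : Type u}

/-- The number of inputs. -/
def arity (P : Operad.{u, v} κ C) (p : P.Op) : ℕ := (P.inputs p).length

/-- Morphisms of operads that are the identity on colours. -/
structure Hom (P T : Operad.{u, v} κ C) where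
  map : P.Op → T.Op
  inputs_map : ∀ p, T.inputs (map p) = P.inputs p
  output_map : ∀ p, T.output (map p) = P.output p
  map_one : ∀ c, map (P.one c) = T.one c
  map_comp : ∀ p i q h h', map (P.comp p i q h) = T.comp (map p) i (map q) h'
  map_act : ∀ p n σ h hσ h', map (P.act p n σ h hσ) = T.act (map p) n σ h' hσ

/-- A nice grading. -/
structure NiceGrading (P : Operad.{u, v} κ C) where
  deg : P.Op → ℤ
  deg_comp : ∀ p i q h, deg (P.comp p i q h) = deg p + deg q
  deg_one : ∀ c, deg (P.one c) = 0
  deg_act : ∀ p n σ h hσ, deg (P.act p n σ h hσ) = deg p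
  neg_one_le : ∀ p, -1 ≤ deg p
  /-- operations of grading `-1` have arity `0` -/
  arity_eq_zero : ∀ p, deg p = -1 → P.arity p = 0
  /-- units of binary operations have grading `-1` -/
  deg_unit : ∀ p i q h c, P.arity p = 2 → P.comp p i q h = P.one c → deg q = -1

/-! ## The operad `F(U(P)) ⊔ P` and the twisted arrow category -/

/-- Formal operadic expressions in two copies of the set `X` of operations of `P`: the elements of
the first copy are the variables, those of the second copy are the constants. -/
inductive Expr (X : Type v) : Type v
  | var (p : X)
  | const (p : X)
  | comp (t : Expr X) (i : ℕ) (s : Expr X)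
  | act (n : ℕ) (σ : Equiv.Perm (Fin (n + 1))) (t : Expr X)

/-- The multiset of variables. -/
def Expr.vars {X : Type v} : Expr X → Multiset X
  | .var p => {p}
  | .const _ => 0
  | .comp t _ s => t.vars + s.vars
  | .act _ _ t => t.vars

/-- Substitution for the variables. -/
def Expr.bind {X : Type v} (k : X → Expr X) : Expr X → Expr X
  | .var p => k p
  | .const p => .const p
  | .comp t i s => .comp (t.bind k) i (s.bind k)
  | .act n σ t => .act n σ (t.bind k)

/-- `p ∘ᵢ q` if it is defined. -/
noncomputable def comp? (T : Operad.{u, v} κ C) (p : T.Op) (i : ℕ) (q : T.Op) : Option T.Op :=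
  open Classical in
  if h : (T.inputs p)[i]? = some (T.output q) then some (T.comp p i q h) else none

/-- `p^σ` if it is defined. -/
noncomputable def act? (T : Operad.{u, v} κ C) (p : T.Op) (n : ℕ)
    (σ : Equiv.Perm (Fin (n + 1))) : Option T.Op :=
  open Classical in
  if h : (T.inputs p).length = n ∧ κ.Allows σ then some (T.act p n σ h.1 h.2) else none

/-- The value in `T` of an expression, for a given meaning `f` of the constants and `g` of the
variables; it is `none` if the expression is not well-formed. -/
noncomputable def interp (T : Operad.{u, v} κ C) {X : Type v} (f g : X → T.Op) :
    Expr X → Option T.Op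
  | .var p => some (g p)
  | .const p => some (f p)
  | .comp t i s => (T.interp f g t).bind fun p => (T.interp f g s).bind fun q => T.comp? p i q
  | .act n σ t => (T.interp f g t).bind fun p => T.act? p n σ

/-- The evaluation map to `P`. -/
noncomputable def eval (P : Operad.{u, v} κ C) : Expr P.Op → Option P.Op := P.interp id id

/-- Two expressions represent the same element of the operad `F(U(P)) ⊔ P`, the operad generated by
the set of operations of `P` (variables) and by a copy of `P`, factored by the relations that hold
in `P`. By the universal property of this operad (which is one of the `T` below), this means that
they have the same value in every operad `T` under `P` for all values in `T`, of the right colours,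
of the variables. -/
def Same (P : Operad.{u, v} κ C) (e e' : Expr P.Op) : Prop :=
  ∀ (T : Operad.{u, v} κ C) (f : Hom P T) (g : P.Op → T.Op),
    (∀ p, T.inputs (g p) = P.inputs p) → (∀ p, T.output (g p) = P.output p) →
      T.interp f.map g e = T.interp f.map g e'

/-- The well-formed expressions with exactly one variable `p` and with evaluation `q`. -/
def Rep (P : Operad.{u, v} κ C) (p q : P.Op) : Type v :=
  {e : Expr P.Op // e.vars = {p} ∧ P.eval e = some q}

instance repSetoid (P : Operad.{u, v} κ C) (p q : P.Op) : Setoid (P.Rep p q) where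
  r e e' := P.Same e.1 e'.1
  iseqv :=
    { refl := fun _ _ _ _ _ _ => rfl
      symm := fun h T f g h₁ h₂ => (h T f g h₁ h₂).symm
      trans := fun h h' T f g h₁ h₂ => (h T f g h₁ h₂).trans (h' T f g h₁ h₂) }

theorem Expr.vars_bind {X : Type v} (k : X → Expr X) (e : Expr X) :
    (e.bind k).vars = e.vars.bind fun p => (k p).vars := by
  induction e with
  | var p => simp [Expr.bind, Expr.vars]
  | const p => simp [Expr.bind, Expr.vars]
  | comp t i s iht ihs => simp [Expr.bind, Expr.vars, iht, ihs]
  | act n σ t ih => simp [Expr.bind, Expr.vars, ih]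

theorem Expr.bind_bind {X : Type v} (k l : X → Expr X) (e : Expr X) :
    (e.bind k).bind l = e.bind fun p => (k p).bind l := by
  induction e with
  | var p => rfl
  | const p => rfl
  | comp t i s iht ihs => simp [Expr.bind, iht, ihs]
  | act n σ t ih => simp [Expr.bind, ih]

theorem Expr.bind_eq_self {X : Type v} (k : X → Expr X) (e : Expr X)
    (h : ∀ p ∈ e.vars, k p = .var p) : e.bind k = e := by
  induction e with
  | var p => exact h p (by simp [Expr.vars])
  | const p => rfl
  | comp t i s iht ihs =>
    simp only [Expr.vars, Multiset.mem_add] at h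
    simp [Expr.bind, iht fun p hp => h p (.inl hp), ihs fun p hp => h p (.inr hp)]
  | act n σ t ih => simp [Expr.bind, ih h]

theorem interp_bind (T : Operad.{u, v} κ C) {X : Type v} (f g g' : X → T.Op) (k : X → Expr X)
    (e : Expr X) (h : ∀ p ∈ e.vars, T.interp f g (k p) = some (g' p)) :
    T.interp f g (e.bind k) = T.interp f g' e := by
  induction e with
  | var p => exact h p (by simp [Expr.vars])
  | const p => rfl
  | comp t i s iht ihs =>
    simp only [Expr.vars, Multiset.mem_add] at h
    simp [Expr.bind, interp, iht fun p hp => h p (.inl hp), ihs fun p hp => h p (.inr hp)]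
  | act n σ t ih => simp [Expr.bind, interp, ih h]

/-- A well-formed expression has values everywhere, of the same colours as its evaluation. -/
theorem exists_interp {P T : Operad.{u, v} κ C} (f g : P.Op → T.Op)
    (hf : ∀ p, T.inputs (f p) = P.inputs p) (hf' : ∀ p, T.output (f p) = P.output p)
    (hg : ∀ p, T.inputs (g p) = P.inputs p) (hg' : ∀ p, T.output (g p) = P.output p)
    (e : Expr P.Op) (q : P.Op) (he : P.eval e = some q) :
    ∃ x, T.interp f g e = some x ∧ T.inputs x = P.inputs q ∧ T.output x = P.output q := by
  induction e generalizing q with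
  | var p =>
    obtain rfl : p = q := by simpa [eval, interp] using he
    exact ⟨g p, rfl, hg p, hg' p⟩
  | const p =>
    obtain rfl : p = q := by simpa [eval, interp] using he
    exact ⟨f p, rfl, hf p, hf' p⟩
  | comp t i s iht ihs =>
    simp only [eval, interp, Option.bind_eq_some_iff] at he
    obtain ⟨a, ha, b, hb, hab⟩ := he
    obtain ⟨x, hx, hx₁, hx₂⟩ := iht a ha
    obtain ⟨y, hy, hy₁, hy₂⟩ := ihs b hb
    unfold comp? at hab
    split at hab
    · rename_i hc
      cases hab
      have hc' : (T.inputs x)[i]? = some (T.output y) := by rw [hx₁, hy₂, hc]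
      refine ⟨T.comp x i y hc', ?_, ?_, ?_⟩
      · simp [interp, hx, hy, comp?, hc']
      · rw [T.inputs_comp, P.inputs_comp, hx₁, hy₁]
      · rw [T.output_comp, P.output_comp, hx₂]
    · cases hab
  | act n σ t ih =>
    simp only [eval, interp, Option.bind_eq_some_iff] at he
    obtain ⟨a, ha, hab⟩ := he
    obtain ⟨x, hx, hx₁, hx₂⟩ := ih a ha
    unfold act? at hab
    split at hab
    · rename_i hc
      cases hab
      have hc' : (T.inputs x).length = n ∧ κ.Allows σ := by rwa [hx₁]
      have key : T.output (T.act x n σ hc'.1 hc'.2) :: T.inputs (T.act x n σ hc'.1 hc'.2) =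
          P.output (P.act a n σ hc.1 hc.2) :: P.inputs (P.act a n σ hc.1 hc.2) := by
        apply List.ext_getElem?
        intro k
        by_cases hk : k < n + 1
        · have h₁ := T.edges_act x n σ hc'.1 hc'.2 ⟨k, hk⟩
          have h₂ := P.edges_act a n σ hc.1 hc.2 ⟨k, hk⟩
          exact h₁.trans (Eq.trans (by rw [hx₁, hx₂]) h₂.symm)
        · rw [List.getElem?_eq_none, List.getElem?_eq_none] <;>
            simp only [List.length_cons, length_act] <;> omega
      refine ⟨T.act x n σ hc'.1 hc'.2, ?_, (List.cons.inj key).2, (List.cons.inj key).1⟩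
      simp [interp, hx, act?, hc']
    · cases hab

/-- The twisted arrow category `Tw(P)`: its objects are the operations of `P`. -/
abbrev Tw (P : Operad.{u, v} κ C) : Type v := P.Op

/-- The identity expression. -/
def Rep.id (P : Operad.{u, v} κ C) (p : P.Op) : P.Rep p p := ⟨.var p, rfl, rfl⟩

/-- Substitution of an expression with evaluation `q` for the variable `q`. -/
def Rep.comp {P : Operad.{u, v} κ C} {p q r : P.Op} (t : P.Rep p q) (s : P.Rep q r) : P.Rep p r :=
  ⟨s.1.bind fun _ => t.1, by rw [Expr.vars_bind, s.2.1, Multiset.singleton_bind, t.2.1], by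
    refine Eq.trans (P.interp_bind _root_.id _root_.id _root_.id _ _ fun x hx => ?_) s.2.2
    rw [s.2.1, Multiset.mem_singleton] at hx
    rw [hx]
    exact t.2.2⟩

theorem Rep.comp_same {P : Operad.{u, v} κ C} {p q r : P.Op} (t t' : P.Rep p q) (ht : t ≈ t')
    (s s' : P.Rep q r) (hs : s ≈ s') : t.comp s ≈ t'.comp s' := by
  intro T f g h₁ h₂
  obtain ⟨x, hx, hx₁, hx₂⟩ :=
    exists_interp f.map g f.inputs_map f.output_map h₁ h₂ t.1 q t.2.2
  have hx' : T.interp f.map g t'.1 = some x := (ht T f g h₁ h₂).symm.trans hx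
  classical
  have key : ∀ (y : P.Rep p q) (z : P.Rep q r), T.interp f.map g y.1 = some x →
      T.interp f.map g (z.1.bind fun _ => y.1) =
        T.interp f.map (fun a => if a = q then x else g a) z.1 := by
    intro y z hy
    refine T.interp_bind _ _ _ _ _ fun a ha => ?_
    rw [z.2.1, Multiset.mem_singleton] at ha
    simp [ha, hy]
  refine (key t s hx).trans (Eq.trans ?_ (key t' s' hx').symm)
  refine hs T f _ (fun a => ?_) (fun a => ?_)
  · split
    · rename_i h; rw [h, hx₁]
    · exact h₁ a
  · split
    · rename_i h; rw [h, hx₂]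
    · exact h₂ a

/-- A morphism `p ⟶ q` of `Tw(P)` is an element of `F(U(P)) ⊔ P` with exactly one variable, this
variable being `p`, and with evaluation `q`. Composition is substitution. -/
instance (P : Operad.{u, v} κ C) : Category.{v} P.Tw where
  Hom p q := Quotient (P.repSetoid p q)
  id p := Quotient.mk _ (Rep.id P p)
  comp f g := Quotient.map₂ Rep.comp Rep.comp_same f g
  id_comp {p q} f := by
    induction f using Quotient.inductionOn with
    | h t =>
      refine congrArg (Quotient.mk _) (Subtype.ext ?_)
      refine Expr.bind_eq_self _ _ fun x hx => ?_
      rw [t.2.1, Multiset.mem_singleton] at hx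
      rw [hx]
      rfl
  comp_id f := by
    induction f using Quotient.inductionOn with
    | h t => rfl
  assoc f g h := by
    induction f using Quotient.inductionOn with
    | h t =>
      induction g using Quotient.inductionOn with
      | h s =>
        induction h using Quotient.inductionOn with
        | h r =>
          exact congrArg (Quotient.mk _) (Subtype.ext (Expr.bind_bind _ _ r.1).symm)

/-- The morphism `f` of `Tw(P)` is represented by the expression `e`. -/
def Represents {P : Operad.{u, v} κ C} {p q : P.Tw} (f : p ⟶ q) (e : Expr P.Op) : Prop :=
  ∃ h : e.vars = {p} ∧ P.eval e = some q, f = Quotient.mk (P.repSetoid p q) ⟨e, h⟩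

/-! ## Reduced trees and the two classes of morphisms -/

/-- The operations in the list are composed into the inputs `k, k + 1, …` of `t`. -/
def graft {X : Type v} (t : Expr X) : ℕ → List X → Expr X
  | _, [] => t
  | k, a :: as => .comp (graft t (k + 1) as) k (.const a)

/-- A tree with source vertex `p`, with vertices `as` attached to the inputs of `p`, and with the
output of `p` attached to the input `i` of the vertex `a₀`; the leaves are in planar order. -/
def rootedTree {X : Type v} (p : X) (as : List X) (a₀ : X) (i : ℕ) : Expr X :=
  .comp (.const a₀) i (graft (.var p) 0 as)

/-- A tree with source vertex `p`, with vertices `as` attached to the inputs of `p`, and with the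
output of `p` attached to the output of the vertex `a₀` of arity `0`; the leaves, `M` in number, are
in planar order. It is well-formed only in cyclic operads, as the rotation makes the output of the
composite of `p` and `as` its last input. -/
def cappedTree {X : Type v} (p : X) (as : List X) (a₀ : X) (M : ℕ) : Expr X :=
  .comp (.act M (finRotate (M + 1)) (graft (.var p) 0 as)) (M - 1) (.const a₀)

variable {P : Operad.{u, v} κ C}

/-- The class of morphisms represented by a reduced tree with trivial permutation on leaves
and with all non-source vertices marked by identities or by operations of grading `-1`. -/
def RNegOne (ψ : P.NiceGrading) : MorphismProperty P.Tw := fun p _ f =>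
  ∃ (as : List P.Op) (a₀ : P.Op), as.length = P.arity p ∧
    (∀ a ∈ a₀ :: as, (∃ c, a = P.one c) ∨ ψ.deg a = -1) ∧
    (Represents f (rootedTree p as a₀ 0) ∨
      P.arity a₀ = 0 ∧ ∃ M, Represents f (cappedTree p as a₀ M))

/-- The class of morphisms represented by a reduced tree, with any permutation `σ` on leaves, with
all non-source vertices of grading at least `0`. -/
def RNonneg (ψ : P.NiceGrading) : MorphismProperty P.Tw := fun p _ f =>
  ∃ (as : List P.Op) (a₀ : P.Op) (N : ℕ) (σ : Equiv.Perm (Fin (N + 1))), as.length = P.arity p ∧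
    (∀ a ∈ a₀ :: as, 0 ≤ ψ.deg a) ∧
    ((∃ i, Represents f (.act N σ (rootedTree p as a₀ i))) ∨
      P.arity a₀ = 0 ∧ ∃ M, Represents f (.act N σ (cappedTree p as a₀ M)))

/-- `R₋`: a morphism of grading `-1` followed by an isomorphism. -/
def RMinus (ψ : P.NiceGrading) : MorphismProperty P.Tw := fun p q f =>
  ∃ (r : P.Tw) (l : p ⟶ r) (θ : r ⟶ q), RNegOne ψ l ∧ IsIso θ ∧ f = l ≫ θ

/-- `R₊`: an isomorphism followed by a morphism of non-negative grading. -/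
def RPlus (ψ : P.NiceGrading) : MorphismProperty P.Tw := fun p q f =>
  ∃ (r : P.Tw) (θ : p ⟶ r) (l : r ⟶ q), IsIso θ ∧ RNonneg ψ l ∧ f = θ ≫ l

/-- The degree map on `Tw(P)` given by a nice grading. The grading takes values in
`{-1, 0, 1, …}`, which is identified with the ordinal `ω` by its order isomorphism `n ↦ n + 1`. -/
noncomputable def degree (ψ : P.NiceGrading) (p : P.Tw) : Ordinal.{0} := ((ψ.deg p + 1).toNat : ℕ)

/-! ## The category of unary operations of grading `0` -/

/-- The category `P(ψ = 0)`: its objects are the colours. -/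
def GradeZero (_ψ : P.NiceGrading) : Type u := C

/-- The category structure: morphisms are the operations of arity `1` and grading `0`. -/
instance (ψ : P.NiceGrading) : Category.{v} (GradeZero ψ) where
  Hom c d := {p : P.Op // P.inputs p = [c] ∧ P.output p = d ∧ ψ.deg p = 0}
  id c := ⟨P.one c, P.inputs_one c, P.output_one c, ψ.deg_one c⟩
  comp f g := ⟨P.comp g.1 0 f.1 (by rw [g.2.1, f.2.2.1]; rfl),
    by rw [P.inputs_comp, g.2.1, f.2.1]; rfl,
    by rw [P.output_comp, g.2.2.1],
    by rw [ψ.deg_comp, f.2.2.2, g.2.2.2]; rfl⟩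
  id_comp f := Subtype.ext (P.comp_one _ _ _ _)
  comp_id f := Subtype.ext (P.one_comp _ _ _)
  assoc f g h := Subtype.ext (P.comp_assoc _ 0 _ 0 _ _ _ _ _).symm

end Operad

/-! ## Generalized Reedy structures -/

/-- An orthogonal factorization system: two subcategories that contain all isomorphisms, such that
every morphism has a factorization, unique up to unique isomorphism of factorizations. -/
structure IsOrthogonalFactorizationSystem {D : Type u} [Category.{v} D]
    (L R : MorphismProperty D) : Prop where
  left_mul : L.IsMultiplicative
  right_mul : R.IsMultiplicative
  left_iso : ∀ ⦃X Y : D⦄ (f : X ⟶ Y), IsIso f → L f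
  right_iso : ∀ ⦃X Y : D⦄ (f : X ⟶ Y), IsIso f → R f
  exists_fac : ∀ ⦃X Y : D⦄ (f : X ⟶ Y), ∃ (Z : D) (l : X ⟶ Z) (r : Z ⟶ Y), L l ∧ R r ∧ l ≫ r = f
  unique_fac : ∀ ⦃X Y Z Z' : D⦄ (l : X ⟶ Z) (r : Z ⟶ Y) (l' : X ⟶ Z') (r' : Z' ⟶ Y),
    L l → R r → L l' → R r' → l ≫ r = l' ≫ r' →
      ∃! e : Z ≅ Z', l ≫ e.hom = l' ∧ e.hom ≫ r' = r

/-- A generalized Reedy structure with degree map `deg`. -/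
structure IsGeneralizedReedy {D : Type u} [Category.{v} D] (Rm Rp : MorphismProperty D)
    (deg : D → Ordinal.{w}) : Prop where
  fac : IsOrthogonalFactorizationSystem Rm Rp
  deg_minus : ∀ ⦃X Y : D⦄ (f : X ⟶ Y), Rm f → ¬ IsIso f → deg Y < deg X
  deg_plus : ∀ ⦃X Y : D⦄ (f : X ⟶ Y), Rp f → ¬ IsIso f → deg X < deg Y
  deg_iso : ∀ ⦃X Y : D⦄ (f : X ⟶ Y), IsIso f → deg X = deg Y
  eq_id : ∀ ⦃X Y : D⦄ (f : X ⟶ Y) (θ : Y ⟶ Y), Rm f → IsIso θ → f ≫ θ = f → θ = 𝟙 Y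

end TwistedArrow

/-!
A morphism `p ⟶ q` of `Tw(P)` is an expression with one variable `p`, up to equality of the values in
all operads `T` under `P`. It is therefore a family of functions `app F f`, one for each `F : P → T`
(`hom_ext`), and whatever is to be read off from a morphism can be read off from its values in a
suitably chosen `T`.

The operad used for this is the extension `ext T` of an operad `T`. Besides the operations of `T` it
contains sets of *labelled operations*: operations of `T` whose half-edges carry distinct labels,
which are half-edges of a given operation `t` or the mark `-1`. An operation of `T` that is composed
with `t` at some half-edge is contracted with the labelled operation if the label of this half-edge
occurs, and otherwise only renames the labels. That this is an operad amounts to the associativity of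
contraction (`Labelled.Contr.assoc`).

Three facts follow by evaluation in `ext T`.

* The value at an identity operation labelled by `-1` and by a half-edge `j` of `p` is the vertex of
  the tree that is attached to `j`. Hence the map from the leaves to the half-edges of `p` and the
  gradings `D j` of the vertices are well defined (`IsTrack`, `IsTrack.unique`). These gradings are
  additive under composition (`IsTrack.comp`), their sum is `ψ q - ψ p` (`IsTrack.deg_eq`), and they
  vanish for isomorphisms (`IsTrack.iso`).
* A vertex of grading `-1` has arity `0`, so that it is not affected by further compositions and can
  be recovered from any composite (`RNegOne.eq_of_comp_eq`).
* Composition with an operation of arity `0` is an epimorphism, as every operation at the target is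
  the value at an operation in which the label of the input concerned is missing (`epi_eL`).

Every morphism is given by a tree (`exists_decorates`, `exists_tree`). Attaching the vertices of
grading `-1` first and the others afterwards yields the factorization (`exists_factorization`).

If the operations of grading `0` are unary and invertible, then a morphism is an isomorphism if all
`D j` vanish (`isIso_of_deg_eq_zero`), it is in `R₊` if and only if all `D j` are non-negative
(`rPlus_iff`), and in `R₋` if and only if none of them is positive (`rMinus_iff`). The axioms of a
generalized Reedy structure are then immediate from the facts above (`isGeneralizedReedy`).

Conversely, an operation `p` of grading `0` is the target of a morphism from an identity operation
that attaches `p`. This morphism is in `R₊` and preserves the degree, so that it is an isomorphism.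
Hence `p` has arity `1` (`arity_eq_one_of_deg_eq_zero`), and the inverse of the morphism supplies a
right inverse of `p` of grading `0` (`exists_right_inverse`).
-/

namespace TwistedArrow

/-! ### Permutations of half-edges -/

theorem Kind.allows_one (κ : Kind) {n : ℕ} : κ.Allows (1 : Equiv.Perm (Fin (n + 1))) := by
  cases κ <;> simp [Kind.Allows]

theorem Kind.Allows.mul {κ : Kind} {n : ℕ} {σ ρ : Equiv.Perm (Fin (n + 1))} (hσ : κ.Allows σ)
    (hρ : κ.Allows ρ) : κ.Allows (σ * ρ) := by
  cases κ <;> simp_all [Kind.Allows]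

theorem Kind.Allows.inv {κ : Kind} {n : ℕ} {σ : Equiv.Perm (Fin (n + 1))} (hσ : κ.Allows σ) :
    κ.Allows σ⁻¹ := by
  cases κ
  · simp_all [Kind.Allows]
  · simp only [Kind.Allows] at *
    rw [Equiv.Perm.inv_eq_iff_eq, hσ]
  · trivial

theorem Kind.Allows.map_zero {κ : Kind} (hκ : κ ≠ .cyclic) {n : ℕ}
    {σ : Equiv.Perm (Fin (n + 1))} (hσ : κ.Allows σ) : σ 0 = 0 := by
  cases κ <;> simp_all [Kind.Allows]

theorem Kind.allows_cyclic {κ : Kind} (hκ : κ = .cyclic) {n : ℕ}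
    (σ : Equiv.Perm (Fin (n + 1))) : κ.Allows σ := by
  subst hκ; trivial

theorem perm_of_getElem?_perm {α : Type*} {N : ℕ} {a b : List α} (ha : a.length = N)
    (hb : b.length = N) (σ : Equiv.Perm (Fin N)) (h : ∀ k : Fin N, a[(k : ℕ)]? = b[(σ k : ℕ)]?) :
    a.Perm b := by
  subst hb
  have h1 : a = List.ofFn (b.get ∘ σ) := by
    apply List.ext_getElem (by simp [ha])
    intro k hk hk'
    have := h ⟨k, ha ▸ hk⟩
    rw [List.getElem?_eq_getElem hk, List.getElem?_eq_getElem (σ _).2] at this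
    simpa using this
  rw [h1]
  exact (σ.ofFn_comp_perm b.get).trans (by rw [List.ofFn_get])

theorem exists_perm_of_perm {α : Type*} {N : ℕ} {a b : List α} (h : a.Perm b) (hb : b.Nodup)
    (hN : b.length = N) : ∃ σ : Equiv.Perm (Fin N), ∀ k : Fin N, a[(k : ℕ)]? = b[(σ k : ℕ)]? := by
  classical
  have hlen := h.length_eq
  have hmem : ∀ k : Fin N, a[(k : ℕ)]'(by omega) ∈ b := fun k => h.subset (List.getElem_mem _)
  let f : Fin N → Fin N := fun k => ⟨b.idxOf (a[(k : ℕ)]'(by omega)), by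
    exact hN ▸ List.idxOf_lt_length_iff.2 (hmem k)⟩
  have hf : ∀ k : Fin N, a[(k : ℕ)]? = b[(f k : ℕ)]? := by
    intro k
    rw [List.getElem?_eq_getElem (by omega), List.getElem?_eq_getElem (by rw [hN]; exact (f k).2)]
    simp [f]
  have hinj : Function.Injective f := by
    intro k l hkl
    have := (hf k).trans ((by rw [hkl]) : b[(f k : ℕ)]? = b[(f l : ℕ)]?) |>.trans (hf l).symm
    exact Fin.ext ((List.getElem?_inj (by omega) (h.nodup_iff.2 hb)).1 this)
  exact ⟨Equiv.ofBijective f (Finite.injective_iff_bijective.1 hinj), hf⟩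

namespace Operad

variable {κ : Kind} {C : Type u}

theorem act_congr (T : Operad.{u, v} κ C) {p p' : T.Op} (hp : p = p') (n : ℕ)
    (σ : Equiv.Perm (Fin (n + 1))) (h h' hσ) : T.act p n σ h hσ = T.act p' n σ h' hσ := by
  subst hp; rfl

theorem comp_congr (T : Operad.{u, v} κ C) {p p' q q' : T.Op} (hp : p = p') (hq : q = q')
    {i i' : ℕ} (hi : i = i') (h h') : T.comp p i q h = T.comp p' i' q' h' := by
  subst hp hq hi; rfl

/-- The colours of the half-edges. -/
def hedges (T : Operad.{u, v} κ C) (p : T.Op) : List C := T.output p :: T.inputs p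

@[simp] theorem length_hedges (T : Operad.{u, v} κ C) (p : T.Op) :
    (T.hedges p).length = T.arity p + 1 := rfl

/-- In a cyclic operad the identities are invariant under rotation. -/
theorem act_one_finRotate (T : Operad.{u, v} κ C) (hκ : κ = .cyclic) (c : C) (h hσ) :
    T.act (T.one c) 1 (finRotate 2) h hσ = T.one c := by
  have hall : ∀ {n : ℕ} (σ : Equiv.Perm (Fin (n + 1))), κ.Allows σ := Kind.allows_cyclic hκ
  let p := T.act (T.one c) 1 (finRotate 2)⁻¹ h (hall _)
  have hp : (T.inputs p).length = 1 := T.length_act _ _ _ _ _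
  have hpp : T.act p 1 (finRotate 2) hp hσ = T.one c := by
    rw [T.act_act _ _ _ _ _ _ _ _ (hall _)]
    have : ∀ τ hτ, τ = 1 → T.act (T.one c) 1 τ h hτ = T.one c := by
      rintro τ hτ rfl; exact T.act_one _ _ _ _
    exact this _ _ (by simp)
  have hr : ∀ τ hτ, (T.inputs (T.act (T.one c) 1 τ h hτ))[0]? = some (T.output (T.one c)) := by
    intro τ hτ
    have h1 := T.edges_act (T.one c) 1 τ h hτ 1
    have h2 : ∀ k : Fin 2, ([c, c] : List C)[(k : ℕ)]? = some c := by
      intro k; fin_cases k <;> rfl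
    rw [T.inputs_one, T.output_one, h2] at h1
    rw [T.output_one]
    exact h1
  have hr' := hr (finRotate 2) hσ
  have h1 := T.comp_rotate hκ p 1 hp (T.one c) 0 h (hr _ _) 1
    (by rw [T.inputs_comp]; simp [hp, T.inputs_one]) (hall _) (hall _) (hall _) (by
      rw [hpp]; exact hr')
  have h2 := T.act_congr (T.comp_one p 0 c (hr _ _)) 1 (finRotate 2)
    (by rw [T.inputs_comp]; simp [hp, T.inputs_one]) hp (hall _)
  have h3 := hpp.symm.trans (h2.symm.trans h1)
  exact (h3.trans ((T.comp_congr rfl hpp rfl _ hr').trans (T.comp_one _ _ _ _))).symm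

/-! ### Labelled operations -/

/-- An operation of `T` together with a label for each of its half-edges. -/
structure Labelled (T : Operad.{u, v} κ C) (L : Type) where
  op : T.Op
  root : L
  ins : List L
  len : ins.length = T.arity op

namespace Labelled

variable {T : Operad.{u, v} κ C} {L L' : Type}

/-- The labels, that of the output first. -/
def edges (x : Labelled T L) : List L := x.root :: x.ins

/-- The labels paired with the colours of the half-edges that they mark. -/
def cols (x : Labelled T L) : List (L × C) := x.edges.zip (T.hedges x.op)

@[simp] theorem length_edges (x : Labelled T L) : x.edges.length = T.arity x.op + 1 := by
  simp [edges, x.len]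

@[simp] theorem length_cols (x : Labelled T L) : x.cols.length = T.arity x.op + 1 := by
  simp [cols]

theorem cols_fst (x : Labelled T L) : x.cols.map Prod.fst = x.edges :=
  List.map_fst_zip (by simp)

theorem mem_edges_iff {x : Labelled T L} {l : L} : l ∈ x.edges ↔ ∃ c, (l, c) ∈ x.cols := by
  rw [← cols_fst]; simp

theorem eq_of_edges {x y : Labelled T L} (h : x.op = y.op) (h' : x.edges = y.edges) : x = y := by
  cases x; cases y
  simp only [edges, List.cons.injEq] at h'
  simp_all

/-- Labelled operations that differ by an allowed renumbering of the half-edges. -/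
def Rel (x y : Labelled T L) : Prop :=
  ∃ (n : ℕ) (σ : Equiv.Perm (Fin (n + 1))) (h : (T.inputs x.op).length = n) (hσ : κ.Allows σ),
    y.op = T.act x.op n σ h hσ ∧ ∀ k : Fin (n + 1), y.edges[(k : ℕ)]? = x.edges[(σ k : ℕ)]?

theorem Rel.refl (x : Labelled T L) : x.Rel x :=
  ⟨_, 1, rfl, κ.allows_one, (T.act_one _ _ _ _).symm, fun _ => rfl⟩

theorem Rel.symm {x y : Labelled T L} (h : x.Rel y) : y.Rel x := by
  obtain ⟨n, σ, h, hσ, h₁, h₂⟩ := h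
  refine ⟨n, σ⁻¹, by rw [h₁, T.length_act], hσ.inv, ?_, fun k => ?_⟩
  · have h0 : κ.Allows (σ * σ⁻¹) := hσ.mul hσ.inv
    have := T.act_act x.op n σ σ⁻¹ h hσ (T.length_act _ _ _ _ _) hσ.inv h0
    have h3 : T.act x.op n (σ * σ⁻¹) h h0 = x.op := by
      have : ∀ τ (hτ : κ.Allows τ), τ = 1 → T.act x.op n τ h hτ = x.op := by
        rintro τ hτ rfl; exact T.act_one _ _ _ _
      exact this _ _ (by simp)
    rw [h3] at this
    exact this.symm.trans (T.act_congr h₁.symm _ _ _ _ _)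
  · have := h₂ (σ⁻¹ k)
    simpa using this.symm

theorem Rel.trans {x y z : Labelled T L} (h : x.Rel y) (h' : y.Rel z) : x.Rel z := by
  obtain ⟨n, σ, h, hσ, h₁, h₂⟩ := h
  obtain ⟨m, ρ, h', hρ, h₁', h₂'⟩ := h'
  obtain rfl : m = n := by rw [← h', h₁, T.length_act]
  refine ⟨m, σ * ρ, h, hσ.mul hρ, ?_, fun k => ?_⟩
  · rw [h₁', ← T.act_act x.op m σ ρ h hσ (T.length_act _ _ _ _ _) hρ]
    congr 1
  · rw [h₂', h₂]; rfl

theorem Rel.arity_eq {x y : Labelled T L} (h : x.Rel y) : T.arity x.op = T.arity y.op := by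
  obtain ⟨n, σ, h, hσ, h₁, h₂⟩ := h
  rw [arity, arity, h₁, T.length_act, h]

/-- A renumbering permutes the half-edges together with their colours. -/
theorem Rel.cols_perm {x y : Labelled T L} (h : x.Rel y) : y.cols.Perm x.cols := by
  have ha := h.arity_eq
  obtain ⟨n, σ, h, hσ, h₁, h₂⟩ := h
  have hn : T.arity x.op = n := h
  refine perm_of_getElem?_perm (N := n + 1) (by rw [length_cols]; omega)
    (by rw [length_cols]; omega) σ fun k => ?_
  simp only [cols, List.zip, List.getElem?_zipWith, h₂ k]
  have := T.edges_act x.op n σ h hσ k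
  rw [← h₁] at this
  simp only [hedges, this]

theorem Rel.edges_perm {x y : Labelled T L} (h : x.Rel y) : y.edges.Perm x.edges := by
  rw [← cols_fst, ← cols_fst]
  exact h.cols_perm.map _

theorem Rel.root_eq {x y : Labelled T L} (hκ : κ ≠ .cyclic) (h : x.Rel y) : y.root = x.root := by
  obtain ⟨n, σ, h, hσ, h₁, h₂⟩ := h
  have := h₂ 0
  rw [hσ.map_zero hκ] at this
  simpa [edges] using this

/-- A renumbering that fixes all labels is trivial if the labels are distinct. -/
theorem Rel.op_eq {x y : Labelled T L} (h : x.Rel y) (hx : x.edges.Nodup)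
    (he : x.edges = y.edges) : x.op = y.op := by
  obtain ⟨n, σ, h, hσ, h₁, h₂⟩ := h
  have : σ = 1 := by
    ext k
    have h3 := h₂ k
    rw [← he] at h3
    have hn : T.arity x.op = n := h
    exact ((List.getElem?_inj (by rw [length_edges, hn]; exact k.2) hx).1 h3).symm
  subst this
  rw [h₁, T.act_one]

/-- Renumbering of the half-edges of a labelled operation. -/
def act (x : Labelled T L) (n : ℕ) (σ : Equiv.Perm (Fin (n + 1)))
    (h : (T.inputs x.op).length = n) (hσ : κ.Allows σ) : Labelled T L where
  op := T.act x.op n σ h hσ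
  root := x.edges[(σ 0 : ℕ)]'(by
    have hn : T.arity x.op = n := h
    rw [length_edges, hn]; exact (σ 0).2)
  ins := List.ofFn fun k : Fin n => x.edges[(σ k.succ : ℕ)]'(by
    have hn : T.arity x.op = n := h
    rw [length_edges, hn]; exact (σ k.succ).2)
  len := by rw [List.length_ofFn, arity, T.length_act]

theorem edges_act (x : Labelled T L) (n : ℕ) (σ : Equiv.Perm (Fin (n + 1)))
    (h : (T.inputs x.op).length = n) (hσ : κ.Allows σ) (k : Fin (n + 1)) :
    (x.act n σ h hσ).edges[(k : ℕ)]? = x.edges[(σ k : ℕ)]? := by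
  have hn : x.edges.length = n + 1 := by rw [length_edges]; exact congrArg (· + 1) h
  rw [List.getElem?_eq_getElem (i := (σ k : ℕ)) (by rw [hn]; exact (σ k).2)]
  refine Fin.cases ?_ (fun k => ?_) k
  · simp [edges, act]
  · simp [edges, act]

theorem rel_act (x : Labelled T L) (n : ℕ) (σ : Equiv.Perm (Fin (n + 1)))
    (h : (T.inputs x.op).length = n) (hσ : κ.Allows σ) : x.Rel (x.act n σ h hσ) :=
  ⟨n, σ, h, hσ, rfl, x.edges_act n σ h hσ⟩

/-- In a cyclic operad, any half-edge can be put at any position. -/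
theorem exists_rel_getElem? (hκ : κ = .cyclic) (x : Labelled T L) {l : L} (hl : l ∈ x.edges)
    {k : ℕ} (hk : k < T.arity x.op + 1) : ∃ y, x.Rel y ∧ y.edges[k]? = some l := by
  obtain ⟨i, hi, rfl⟩ := List.getElem_of_mem hl
  rw [length_edges] at hi
  refine ⟨x.act _ (Equiv.swap ⟨k, hk⟩ ⟨i, hi⟩) rfl (Kind.allows_cyclic hκ _), rel_act _ _ _ _ _, ?_⟩
  have := x.edges_act _ (Equiv.swap ⟨k, hk⟩ ⟨i, hi⟩) rfl (Kind.allows_cyclic hκ _) ⟨k, hk⟩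
  simp only [Equiv.swap_apply_left] at this
  rw [this, List.getElem?_eq_getElem]

/-- Relabelling of the half-edges. -/
def map (g : L → L') (x : Labelled T L) : Labelled T L' where
  op := x.op
  root := g x.root
  ins := x.ins.map g
  len := by rw [List.length_map, x.len]

@[simp] theorem map_op (g : L → L') (x : Labelled T L) : (x.map g).op = x.op := rfl
@[simp] theorem edges_map (g : L → L') (x : Labelled T L) : (x.map g).edges = x.edges.map g := rfl

theorem cols_map (g : L → L') (x : Labelled T L) :
    (x.map g).cols = x.cols.map fun a => (g a.1, a.2) := by
  simp only [cols, edges_map, map_op, List.zip_map_left]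
  rfl

theorem map_map {L'' : Type} (g : L → L') (g' : L' → L'') (x : Labelled T L) :
    (x.map g).map g' = x.map (g' ∘ g) :=
  eq_of_edges rfl (by simp)

theorem map_congr {g g' : L → L'} {x : Labelled T L} (h : ∀ l ∈ x.edges, g l = g' l) :
    x.map g = x.map g' :=
  eq_of_edges rfl (by simpa using h)

theorem map_eq_self {g : L → L} {x : Labelled T L} (h : ∀ l ∈ x.edges, g l = l) :
    x.map g = x :=
  eq_of_edges rfl (by simpa using List.map_congr_left h)

theorem Rel.map {x y : Labelled T L} (g : L → L') (h : x.Rel y) : (x.map g).Rel (y.map g) := by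
  obtain ⟨n, σ, h, hσ, h₁, h₂⟩ := h
  exact ⟨n, σ, h, hσ, h₁, fun k => by simp [h₂ k]⟩

/-- A renumbering of a relabelled operation comes from a renumbering of the operation itself. -/
theorem Rel.of_map {x : Labelled T L} {y : Labelled T L'} {g : L → L'} (h : (x.map g).Rel y) :
    ∃ y', x.Rel y' ∧ y = y'.map g := by
  obtain ⟨n, σ, h, hσ, h₁, h₂⟩ := h
  refine ⟨x.act n σ h hσ, rel_act _ _ _ _ _, eq_of_edges h₁ ?_⟩
  have hn : T.arity x.op = n := h
  apply List.ext_getElem?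
  intro k
  by_cases hk : k < n + 1
  · have h3 := h₂ ⟨k, hk⟩
    have h4 := x.edges_act n σ h hσ ⟨k, hk⟩
    simp only at h3 h4
    rw [h3, edges_map, edges_map, List.getElem?_map, List.getElem?_map, h4]
  · have h5 : T.arity y.op = n := by rw [h₁]; exact T.length_act _ _ _ _ _
    have h6 : T.arity (x.act n σ h hσ).op = n := T.length_act _ _ _ _ _
    rw [List.getElem?_eq_none, List.getElem?_eq_none] <;>
      simp [h5, h6] <;> omega

/-! ### Contraction of half-edges -/

/-- `x ∘ᵢ y` with the induced labels. -/
def comp (x : Labelled T L) (i : ℕ) (y : Labelled T L)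
    (h : (T.inputs x.op)[i]? = some (T.output y.op)) : Labelled T L where
  op := T.comp x.op i y.op h
  root := x.root
  ins := x.ins.take i ++ y.ins ++ x.ins.drop (i + 1)
  len := by
    have := x.len
    have := y.len
    simp only [arity] at *
    rw [T.inputs_comp]
    simp [*]

/-- `z` is the composite of `x` and `y` along an input of `x` and the output of `y`, both labelled
by `e`. -/
def Std (e : L) (x y z : Labelled T L) : Prop :=
  ∃ i h, x.ins[i]? = some e ∧ y.root = e ∧ z = x.comp i y h

theorem zip_splice {α β : Type*} {a a' : List α} {b b' : List β} (h : a.length = b.length)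
    (h' : a'.length = b'.length) (i : ℕ) :
    (a.take i ++ a' ++ a.drop (i + 1)).zip (b.take i ++ b' ++ b.drop (i + 1)) =
      (a.zip b).take i ++ a'.zip b' ++ (a.zip b).drop (i + 1) := by
  rw [List.zip_append (by simp [h, h']), List.zip_append (by simp [h])]
  simp [List.zip, List.take_zipWith, List.drop_zipWith]

theorem cons_splice_perm {α : Type*} {a b : List α} {i : ℕ} {e : α} (h : a[i]? = some e) :
    (e :: (a.take i ++ b ++ a.drop (i + 1))).Perm (a ++ b) := by
  obtain ⟨hi, rfl⟩ := List.getElem?_eq_some_iff.1 h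
  have h1 : a = a.take i ++ a[i] :: a.drop (i + 1) := by simp
  conv_rhs => rw [h1]
  rw [List.append_assoc, List.append_assoc]
  refine List.perm_middle.symm.trans ?_
  refine List.Perm.append_left _ ?_
  rw [List.cons_append]
  exact (List.perm_append_comm).cons _

/-- A composite loses the two half-edges that are joined, which have a common colour. -/
theorem Std.cols_perm {e : L} {x y z : Labelled T L} (h : Std e x y z) :
    ∃ c, ((e, c) :: (e, c) :: z.cols).Perm (x.cols ++ y.cols) := by
  obtain ⟨i, h, h1, h2, rfl⟩ := h
  refine ⟨T.output y.op, ?_⟩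
  have hx := x.len
  have hy := y.len
  have e1 : (x.comp i y h).cols = (x.root, T.output x.op) ::
      ((x.ins.zip (T.inputs x.op)).take i ++ y.ins.zip (T.inputs y.op) ++
        (x.ins.zip (T.inputs x.op)).drop (i + 1)) := by
    rw [← zip_splice hx hy]
    simp only [cols, edges, hedges, comp, T.inputs_comp, T.output_comp, List.zip_cons_cons]
  have e2 : (x.ins.zip (T.inputs x.op))[i]? = some (e, T.output y.op) := by
    rw [List.getElem?_zip_eq_some]; exact ⟨h1, h⟩
  rw [e1]
  have e3 : x.cols = (x.root, T.output x.op) :: x.ins.zip (T.inputs x.op) := rfl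
  have e4 : y.cols = (e, T.output y.op) :: y.ins.zip (T.inputs y.op) := by rw [← h2]; rfl
  rw [e3, e4]
  refine ((List.Perm.swap _ _ _).cons _).trans ?_
  refine (List.Perm.swap _ _ _).trans ?_
  rw [List.cons_append]
  refine List.Perm.cons _ ?_
  refine (List.Perm.cons _ (cons_splice_perm e2)).trans ?_
  exact List.perm_middle.symm

theorem edges_comp (x : Labelled T L) (i : ℕ) (y : Labelled T L) (h) :
    (x.comp i y h).edges = x.edges.take (i + 1) ++ y.ins ++ x.edges.drop (i + 2) := by
  simp [edges, comp]

theorem lt_arity_of_comp {x y : Labelled T L} {i : ℕ}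
    (h : (T.inputs x.op)[i]? = some (T.output y.op)) : i < T.arity x.op :=
  (List.getElem?_eq_some_iff.1 h).1

theorem arity_comp (x : Labelled T L) (i : ℕ) (y : Labelled T L) (h) :
    T.arity (x.comp i y h).op + 1 = T.arity x.op + T.arity y.op := by
  have := lt_arity_of_comp h
  have e : T.inputs (x.comp i y h).op = _ := T.inputs_comp x.op i y.op h
  simp only [arity, e] at *
  simp
  omega

theorem edges_comp_outer (x : Labelled T L) (i : ℕ) (y : Labelled T L) (h) {k : ℕ}
    (hk : k ≠ i + 1) :
    (x.comp i y h).edges[outerEdge i (T.arity y.op) k]? = x.edges[k]? := by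
  have hi := lt_arity_of_comp h
  have hy := y.len
  have hx := x.length_edges
  rw [edges_comp, List.append_assoc, outerEdge]
  split_ifs with hki
  · rw [List.getElem?_append_left (by simp; omega)]
    rw [List.getElem?_take_of_lt (by omega)]
  · rw [List.getElem?_append_right (by simp; omega), List.getElem?_append_right (by simp; omega)]
    rw [List.getElem?_drop]
    congr 1
    simp
    omega

theorem edges_comp_inner (x : Labelled T L) (i : ℕ) (y : Labelled T L) (h) {k : ℕ}
    (hk : k ≠ 0) (hk' : k ≤ T.arity y.op) :
    (x.comp i y h).edges[innerEdge i k]? = y.edges[k]? := by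
  have hi := lt_arity_of_comp h
  have hy := y.len
  have hx := x.len
  rw [edges_comp, List.append_assoc, innerEdge]
  rw [List.getElem?_append_right (by simp [edges]; omega), List.getElem?_append_left (by simp [edges]; omega)]
  obtain ⟨k, rfl⟩ := Nat.exists_eq_succ_of_ne_zero hk
  simp only [edges, List.getElem?_cons_succ]
  congr 1
  rw [List.length_take, List.length_cons]
  omega

/-- Every half-edge of a composite comes from one of the factors. -/
theorem edge_cases {n m N i x : ℕ} (hi : i < n) (hN : N + 1 = n + m) (hx : x < N + 1) :
    (∃ k < n + 1, k ≠ i + 1 ∧ x = outerEdge i m k) ∨ ∃ k ≤ m, k ≠ 0 ∧ x = innerEdge i k := by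
  by_cases h1 : x ≤ i
  · exact .inl ⟨x, by omega, by omega, by simp [outerEdge, h1]⟩
  · by_cases h2 : x ≤ i + m
    · exact .inr ⟨x - i, by omega, by omega, by simp [innerEdge]; omega⟩
    · refine .inl ⟨x + 1 - m, by omega, by omega, ?_⟩
      rw [outerEdge, if_neg (by omega)]
      omega

/-- The labels of `x` and `y` are distinct, with the possible exception of a common label `e`. -/
structure Meet (e : L) (x y : Labelled T L) : Prop where
  left : x.edges.Nodup
  right : y.edges.Nodup
  eq_of_mem : ∀ l ∈ x.edges, l ∈ y.edges → l = e

theorem Meet.symm {e : L} {x y : Labelled T L} (h : Meet e x y) : Meet e y x :=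
  ⟨h.2, h.1, fun l h1 h2 => h.3 l h2 h1⟩

theorem Meet.congr {e : L} {x y x' y' : Labelled T L} (h : Meet e x y) (hx : x.Rel x')
    (hy : y.Rel y') : Meet e x' y' :=
  ⟨hx.edges_perm.nodup_iff.2 h.1, hy.edges_perm.nodup_iff.2 h.2, fun l h1 h2 =>
    h.3 l (hx.edges_perm.subset h1) (hy.edges_perm.subset h2)⟩

/-- `z` is, up to renumbering, the composite of `x` and `y` along half-edges labelled by `e`. -/
def Contr (e : L) (x y z : Labelled T L) : Prop :=
  ∃ x' y' z', x.Rel x' ∧ y.Rel y' ∧ z'.Rel z ∧ (Std e x' y' z' ∨ Std e y' x' z')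

theorem Std.contr {e : L} {x y z : Labelled T L} (h : Std e x y z) : Contr e x y z :=
  ⟨x, y, z, .refl _, .refl _, .refl _, .inl h⟩

theorem Contr.symm {e : L} {x y z : Labelled T L} (h : Contr e x y z) : Contr e y x z := by
  obtain ⟨x', y', z', h1, h2, h3, h4⟩ := h
  exact ⟨y', x', z', h2, h1, h3, h4.symm⟩

theorem Contr.congr {e : L} {x y z x₁ y₁ z₁ : Labelled T L} (h : Contr e x y z) (hx : x.Rel x₁)
    (hy : y.Rel y₁) (hz : z.Rel z₁) : Contr e x₁ y₁ z₁ := by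
  obtain ⟨x', y', z', h1, h2, h3, h4⟩ := h
  exact ⟨x', y', z', hx.symm.trans h1, hy.symm.trans h2, h3.trans hz, h4⟩

theorem Contr.cols_perm {e : L} {x y z : Labelled T L} (h : Contr e x y z) :
    ∃ c, ((e, c) :: (e, c) :: z.cols).Perm (x.cols ++ y.cols) := by
  obtain ⟨x', y', z', h1, h2, h3, h4⟩ := h
  have : ∃ c, ((e, c) :: (e, c) :: z'.cols).Perm (x'.cols ++ y'.cols) := by
    rcases h4 with h4 | h4
    · exact h4.cols_perm
    · obtain ⟨c, hc⟩ := h4.cols_perm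
      exact ⟨c, hc.trans List.perm_append_comm⟩
  obtain ⟨c, hc⟩ := this
  exact ⟨c, ((h3.cols_perm.cons _).cons _).trans (hc.trans (h1.cols_perm.append h2.cols_perm))⟩

theorem Contr.edges_perm {e : L} {x y z : Labelled T L} (h : Contr e x y z) :
    (e :: e :: z.edges).Perm (x.edges ++ y.edges) := by
  obtain ⟨c, hc⟩ := h.cols_perm
  simpa [cols_fst] using hc.map Prod.fst

theorem Contr.mem_left {e : L} {x y z : Labelled T L} (hm : Meet e x y) (h : Contr e x y z) :
    e ∈ x.edges := by
  classical
  by_contra he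
  have h1 := h.edges_perm.count_eq e
  have h2 := List.nodup_iff_count_le_one.1 hm.2 e
  rw [List.count_append, List.count_eq_zero.2 he] at h1
  simp at h1
  omega

theorem Contr.mem_right {e : L} {x y z : Labelled T L} (hm : Meet e x y) (h : Contr e x y z) :
    e ∈ y.edges := h.symm.mem_left hm.symm

theorem Contr.nodup {e : L} {x y z : Labelled T L} (hm : Meet e x y) (h : Contr e x y z) :
    z.edges.Nodup := by
  classical
  rw [List.nodup_iff_count_le_one]
  intro l
  have h1 := h.edges_perm.count_eq l
  have h2 := List.nodup_iff_count_le_one.1 hm.1 l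
  have h3 := List.nodup_iff_count_le_one.1 hm.2 l
  rw [List.count_append, List.count_cons, List.count_cons] at h1
  by_cases hl : l = e
  · subst hl; simp at h1; omega
  · by_contra hc
    have h4 : l ∈ x.edges := List.count_pos_iff.1 (by omega)
    have h5 : l ∈ y.edges := List.count_pos_iff.1 (by omega)
    exact hl (hm.3 l h4 h5)

theorem Contr.not_mem {e : L} {x y z : Labelled T L} (hm : Meet e x y) (h : Contr e x y z) :
    e ∉ z.edges := by
  classical
  have h1 := h.edges_perm.count_eq e
  have h2 := List.nodup_iff_count_le_one.1 hm.1 e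
  have h3 := List.nodup_iff_count_le_one.1 hm.2 e
  rw [List.count_append, List.count_cons, List.count_cons] at h1
  intro hc
  have := List.count_pos_iff.2 hc
  simp at h1
  omega

theorem Contr.mem_iff {e : L} {x y z : Labelled T L} (hm : Meet e x y) (h : Contr e x y z)
    {l : L} : l ∈ z.edges ↔ l ≠ e ∧ (l ∈ x.edges ∨ l ∈ y.edges) := by
  have h1 := h.edges_perm.mem_iff (a := l)
  have h2 := h.not_mem hm
  simp only [List.mem_cons, List.mem_append] at h1
  constructor
  · intro hl
    exact ⟨fun he => h2 (he ▸ hl), h1.1 (.inr (.inr hl))⟩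
  · rintro ⟨hl, h3⟩
    simpa [hl] using h1.2 h3

theorem Contr.cols_subset {e : L} {x y z : Labelled T L} (h : Contr e x y z) {a : L × C}
    (ha : a ∈ z.cols) : a ∈ x.cols ∨ a ∈ y.cols := by
  obtain ⟨c, hc⟩ := h.cols_perm
  simpa using hc.subset (List.mem_cons_of_mem _ (List.mem_cons_of_mem _ ha))

theorem cols_unique {x : Labelled T L} (hx : x.edges.Nodup) {l : L} {c c' : C}
    (h : (l, c) ∈ x.cols) (h' : (l, c') ∈ x.cols) : c = c' := by
  rw [← cols_fst] at hx
  have := List.inj_on_of_nodup_map hx h h' rfl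
  exact (Prod.mk.inj this).2

/-- Half-edges that are joined have the same colour. -/
theorem Contr.exists_col {e : L} {x y z : Labelled T L} (hm : Meet e x y) (h : Contr e x y z) :
    ∃ c, (e, c) ∈ x.cols ∧ (e, c) ∈ y.cols := by
  classical
  obtain ⟨c, hc⟩ := h.cols_perm
  have h1 := h.mem_left hm
  have h2 := h.mem_right hm
  obtain ⟨c1, h1⟩ := mem_edges_iff.1 h1
  obtain ⟨c2, h2⟩ := mem_edges_iff.1 h2
  have h0 := h.not_mem hm
  rw [mem_edges_iff] at h0
  push Not at h0
  have e1 := hc.symm.subset (List.mem_append_left _ h1)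
  have e2 := hc.symm.subset (List.mem_append_right _ h2)
  simp only [List.mem_cons, h0, or_false, or_self, Prod.mk.injEq, true_and] at e1 e2
  exact ⟨c, e1 ▸ h1, e2 ▸ h2⟩

/-- Composition along an input and an output is compatible with renumbering. This is the
equivariance of composition, the permutation of the half-edges of the composite being determined by
the labels, which are distinct. -/
theorem Std.rel {e : L} {x y z x' y' z' : Labelled T L} (hm : Meet e x y) (hx : x.Rel x')
    (hy : y.Rel y') (h : Std e x y z) (h' : Std e x' y' z') : z.Rel z' := by
  have hm' := hm.congr hx hy
  have hz := h.contr.nodup hm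
  have hz' := h'.contr.nodup hm'
  have hp : z'.edges.Perm z.edges := by
    have h1 := h.contr.edges_perm
    have h2 := h'.contr.edges_perm
    have h3 := hx.edges_perm.append hy.edges_perm
    exact (List.perm_cons _).1 ((List.perm_cons _).1 (h2.trans (h3.trans h1.symm)))
  have hxa := hx.arity_eq
  have hya := hy.arity_eq
  obtain ⟨i, hc, hi, he, rfl⟩ := h
  obtain ⟨i', hc', hi', he', rfl⟩ := h'
  have ha := arity_comp x i y hc
  have ha' := arity_comp x' i' y' hc'
  have hil := lt_arity_of_comp hc
  have hil' := lt_arity_of_comp hc'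
  obtain ⟨n, σ, hn, hσ, hop, hlab⟩ := hx
  obtain ⟨m, ρ, hm', hρ, hop', hlab'⟩ := hy
  have hxn : T.arity x.op = n := hn
  have hym : T.arity y.op = m := hm'
  obtain ⟨π, hπ⟩ := exists_perm_of_perm hp hz (x.comp i y hc).length_edges
  have hsrc : ∀ k : Fin (n + 1), (k : ℕ) = i' + 1 → (σ k : ℕ) = i + 1 := by
    intro k hk
    have h1 := hlab k
    rw [hk] at h1
    have h2 : x'.edges[i' + 1]? = x.edges[i + 1]? := by simp [edges, hi, hi']
    exact (List.getElem?_inj (by rw [length_edges]; omega) hm.1).1 (h1.symm.trans h2)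
  have hroot : ρ 0 = 0 := by
    have h1 := hlab' 0
    have h2 : y'.edges[0]? = y.edges[0]? := by simp [edges, he, he']
    exact Fin.ext ((List.getElem?_inj (by rw [length_edges, hym]; exact (ρ 0).2) hm.2).1
      (h1.symm.trans h2))
  have hB : IsBlockPerm i' i σ ρ π := by
    refine ⟨hsrc, hroot, fun k a hk ha => ?_, fun k a hk ha => ?_⟩
    · have h1 : (σ k : ℕ) ≠ i + 1 := by
        intro hc
        have h2 := hsrc ⟨i' + 1, by omega⟩ rfl
        have h3 := σ.injective (Fin.ext (hc.trans h2.symm))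
        exact hk (congrArg Fin.val h3)
      have h2 := edges_comp_outer x i y hc h1
      have h3 := edges_comp_outer x' i' y' hc' hk
      rw [← hya, hym, ← ha, hπ a, hlab k, ← h2, hym] at h3
      exact (List.getElem?_inj (by rw [length_edges]; exact (π a).2) hz).1 h3
    · have h1 : ρ k ≠ 0 := fun hc => hk (ρ.injective (hc.trans hroot.symm))
      have h1' : ((ρ k : Fin (m + 1)) : ℕ) ≠ 0 := fun hc => h1 (Fin.ext hc)
      have h2 := edges_comp_inner x i y hc h1' (by omega)
      have h3 := edges_comp_inner x' i' y' hc' (k := k) (fun hc => hk (Fin.ext hc)) (by omega)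
      rw [← ha, hπ a, hlab' k, ← h2] at h3
      exact (List.getElem?_inj (by rw [length_edges]; exact (π a).2) hz).1 h3
  have hall : κ.Allows π := by
    cases κ with
    | planar =>
      have h1 : σ = 1 := hσ
      have h2 : ρ = 1 := hρ
      subst h1 h2
      ext a
      have hN : T.arity (x.comp i y hc).op + 1 = n + m := by omega
      have hi'i : i' = i := by
        have := hsrc ⟨i' + 1, by omega⟩ rfl
        simpa using this
      subst hi'i
      rcases edge_cases (i := i') (x := a) (n := n) (m := m) (by omega) hN a.2 with
        ⟨k, hk, hk1, hk2⟩ | ⟨k, hk, hk1, hk2⟩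
      · rw [hB.outer ⟨k, hk⟩ a hk1 hk2]; simp [hk2]
      · rw [hB.inner ⟨k, by omega⟩ a (fun hc => hk1 (congrArg Fin.val hc)) hk2]; simp [hk2]
    | symmetric =>
      have h1 : σ 0 = 0 := hσ
      refine Fin.ext ?_
      rw [hB.outer 0 0 (by simp) (by simp [outerEdge]), h1]
      simp [outerEdge]
    | cyclic => trivial
  refine ⟨_, π, rfl, hall, ?_, hπ⟩
  have h1 := T.comp_act x.op n σ hn hσ i' i y.op m ρ hm' hρ
    (by rw [← hop, ← hop']; exact hc') hc _ π rfl hall hB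
  exact (T.comp_congr hop hop' rfl _ _).trans h1

theorem edges_act_finRotate (x : Labelled T L) (n : ℕ) (h : (T.inputs x.op).length = n) (hσ) :
    (x.act n (finRotate (n + 1)) h hσ).edges = x.ins ++ [x.root] := by
  have hn : T.arity x.op = n := h
  have h5 : T.arity (x.act n (finRotate (n + 1)) h hσ).op = n := T.length_act _ _ _ _ _
  have hl := x.len
  apply List.ext_getElem?
  intro k
  by_cases hk : k < n + 1
  · have h3 := x.edges_act n (finRotate (n + 1)) h hσ ⟨k, hk⟩
    rw [h3]
    by_cases hk' : k = n
    · subst hk'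
      have : (⟨k, hk⟩ : Fin (k + 1)) = Fin.last k := rfl
      rw [this, finRotate_last]
      rw [List.getElem?_append_right (by omega)]
      simp [edges, hl, hn]
    · rw [finRotate_of_lt (by omega)]
      rw [List.getElem?_append_left (by omega)]
      simp [edges]
  · rw [List.getElem?_eq_none, List.getElem?_eq_none]
    · simp; omega
    · rw [length_edges]; omega

/-- In a cyclic operad either of two joined operations can be regarded as the lower one: a rotation
turns the composite at the first input of `x` into a composite at the last input of `y`. -/
theorem Std.rotate {e : L} (hκ : κ = .cyclic) {x y z : Labelled T L} (h : Std e x y z)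
    (hx : x.edges[1]? = some e) (hnd : x.edges.Nodup) (hy : 0 < T.arity y.op) :
    ∃ x' y' z', x.Rel x' ∧ y.Rel y' ∧ z.Rel z' ∧ Std e y' x' z' := by
  obtain ⟨i, hc, hi, he, rfl⟩ := h
  have hi0 : i = 0 := by
    have h1 : x.edges[i + 1]? = some e := by simpa [edges] using hi
    have := (List.getElem?_inj (by rw [length_edges]; have := lt_arity_of_comp hc; omega) hnd).1
      (h1.trans hx.symm)
    omega
  subst hi0
  obtain ⟨n, hn⟩ : ∃ n, T.arity y.op = n + 1 := ⟨T.arity y.op - 1, by omega⟩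
  let x' := x.act _ (finRotate _) rfl (Kind.allows_cyclic hκ _)
  let y' := y.act (n + 1) (finRotate _) hn (Kind.allows_cyclic hκ _)
  let z' := (x.comp 0 y hc).act _ (finRotate _) rfl (Kind.allows_cyclic hκ _)
  have ex : x'.edges = x.ins ++ [x.root] := edges_act_finRotate _ _ _ _
  have ey : y'.edges = y.ins ++ [y.root] := edges_act_finRotate _ _ _ _
  have ez : z'.edges = (x.comp 0 y hc).ins ++ [x.root] := edges_act_finRotate _ _ _ _
  have hly := y.len
  have hlx := x.len
  have hex : x'.root = e := by
    have h1 : x'.edges[0]? = some e := by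
      rw [ex, List.getElem?_append_left (by have := lt_arity_of_comp hc; omega), hi]
    simpa [edges] using h1
  have hy' : y'.edges[n + 1]? = some e := by
    rw [ey, List.getElem?_append_right (by omega), hly, hn]
    simp [he]
  have hy'' : y'.ins[n]? = some e := by simpa [edges] using hy'
  have hy0 : T.output y.op = (T.inputs x.op)[0]'(lt_arity_of_comp hc) := by
    rw [List.getElem?_eq_getElem (lt_arity_of_comp hc)] at hc
    exact (Option.some.inj hc).symm
  have hcol : (T.inputs y'.op)[n]? = some (T.output x'.op) := by
    have h1 := T.edges_act y.op (n + 1) (finRotate _) hn (Kind.allows_cyclic hκ _) (Fin.last _)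
    have h2 := T.edges_act x.op _ (finRotate _) rfl (Kind.allows_cyclic hκ _) 0
    rw [finRotate_last] at h1
    rw [finRotate_of_lt (by have := lt_arity_of_comp hc; simpa [arity] using this)] at h2
    simp only [Fin.val_last, List.getElem?_cons_succ, Fin.val_zero, List.getElem?_cons_zero] at h1 h2
    refine h1.trans ?_
    rw [← hc]
    exact h2.symm
  refine ⟨x', y', z', rel_act _ _ _ _ _, rel_act _ _ _ _ _, rel_act _ _ _ _ _, n, hcol, hy'', hex,
    eq_of_edges (T.comp_rotate hκ _ _ _ _ _ _ _ _ _ _ _ _ _) ?_⟩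
  rw [edges_comp, ez, ey]
  have h4 : (y.ins ++ [y.root]).drop (n + 2) = [] :=
    List.drop_eq_nil_of_le (by rw [List.length_append, hly, hn]; rfl)
  have h3 : x'.ins = x.ins.drop 1 ++ [x.root] := by
    have : x'.edges.drop 1 = (x.ins ++ [x.root]).drop 1 := by rw [ex]
    rw [List.drop_append_of_le_length (by have := lt_arity_of_comp hc; omega)] at this
    simpa [edges] using this
  rw [h3, List.take_append_of_le_length (by omega), List.take_of_length_le (by omega), h4]
  simp [comp]

/-- The composite along two half-edges is unique up to renumbering. -/
theorem Contr.rel {e : L} {x y z z' : Labelled T L} (hm : Meet e x y) (h : Contr e x y z)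
    (h' : Contr e x y z') : z.Rel z' := by
  have key : ∀ {x y x₁ y₁ x₂ y₂ z₁ z₂ : Labelled T L}, Meet e x y → x.Rel x₁ → y.Rel y₁ →
      x.Rel x₂ → y.Rel y₂ → Std e x₁ y₁ z₁ → Std e y₂ x₂ z₂ → z₁.Rel z₂ := by
    intro x y x₁ y₁ x₂ y₂ z₁ z₂ hm hx₁ hy₁ hx₂ hy₂ h₁ h₂
    have hm₁ := hm.congr hx₁ hy₁
    by_cases hκ : κ = .cyclic
    · have h₁' := h₁
      obtain ⟨i, hc, hi, he, rfl⟩ := h₁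
      obtain ⟨j, hd, hj, he', rfl⟩ := h₂
      obtain ⟨x₃, hx₃, h1⟩ := exists_rel_getElem? hκ x₁ (l := e) (k := 1)
        (List.mem_cons_of_mem _ (List.mem_of_getElem? hi))
        (by have := lt_arity_of_comp hc; omega)
      have hm₃ := hm₁.congr hx₃ (.refl _)
      have h1' : x₃.ins[0]? = some e := by simpa [edges] using h1
      have hcol : (T.inputs x₃.op)[0]? = some (T.output y₁.op) := by
        obtain ⟨c, hc1, hc2⟩ := h₁'.contr.exists_col hm₁
        have h4 : (e, T.output y₁.op) ∈ y₁.cols := by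
          rw [← he]; simp [cols, edges, hedges]
        rw [cols_unique hm₁.2 h4 hc2]
        have h5 := hx₃.cols_perm.symm.subset hc1
        have hlt := lt_arity_of_comp hc
        have hlt' : 0 < (T.inputs x₃.op).length := by
          have := hx₃.arity_eq; simp only [arity] at *; omega
        have h6 : (e, (T.inputs x₃.op)[0]) ∈ x₃.cols := by
          refine List.mem_of_getElem? (i := 1) ?_
          rw [cols, List.getElem?_zip_eq_some]
          exact ⟨h1, by simp [hedges]⟩
        rw [List.getElem?_eq_getElem hlt', cols_unique hm₃.1 h6 h5]
      have h₃ : Std e x₃ y₁ (x₃.comp 0 y₁ hcol) := ⟨0, hcol, h1', he, rfl⟩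
      have hr := Std.rel hm₁ hx₃ (.refl _) h₁' h₃
      obtain ⟨x₄, y₄, z₄, hx₄, hy₄, hz₄, h₄⟩ := h₃.rotate hκ h1 hm₃.1 (by
        have := lt_arity_of_comp hd
        have h6 := hy₁.arity_eq
        have h7 := hy₂.arity_eq
        omega)
      refine hr.trans (hz₄.trans ?_)
      exact Std.rel (hm₃.congr hx₄ hy₄).symm (hy₄.symm.trans (hy₁.symm.trans hy₂))
        (hx₄.symm.trans (hx₃.symm.trans (hx₁.symm.trans hx₂))) h₄ ⟨j, hd, hj, he', rfl⟩
    · exfalso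
      obtain ⟨i, hc, hi, he, rfl⟩ := h₁
      obtain ⟨j, hd, hj, he', rfl⟩ := h₂
      have h1 := hx₁.root_eq hκ
      have h2 := hx₂.root_eq hκ
      have h3 := hm₁.1
      rw [edges, List.nodup_cons] at h3
      exact h3.1 (by rw [h1, ← h2, he']; exact List.mem_of_getElem? hi)
  obtain ⟨x₁, y₁, z₁, hx₁, hy₁, hz₁, h₁⟩ := h
  obtain ⟨x₂, y₂, z₂, hx₂, hy₂, hz₂, h₂⟩ := h'
  refine hz₁.symm.trans (Rel.trans ?_ hz₂)
  rcases h₁ with h₁ | h₁ <;> rcases h₂ with h₂ | h₂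
  · exact Std.rel (hm.congr hx₁ hy₁) (hx₁.symm.trans hx₂) (hy₁.symm.trans hy₂) h₁ h₂
  · exact key hm hx₁ hy₁ hx₂ hy₂ h₁ h₂
  · exact (key hm hx₂ hy₂ hx₁ hy₁ h₂ h₁).symm
  · exact Std.rel (hm.congr hx₁ hy₁).symm (hy₁.symm.trans hy₂) (hx₁.symm.trans hx₂) h₁ h₂

/-! ### Associativity of contraction -/

theorem getElem?_splice_inner {α : Type*} (l m : List α) {i j : ℕ} (hl : i ≤ l.length)
    (hm : j < m.length) : (l.take i ++ m ++ l.drop (i + 1))[i + j]? = m[j]? := by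
  rw [List.append_assoc, List.getElem?_append_right (by simp),
    List.getElem?_append_left (by simp; omega)]
  congr 1
  simp
  omega

theorem getElem?_splice_right {α : Type*} (l m : List α) {i : ℕ} (j : ℕ) (hl : i < l.length) :
    (l.take i ++ m ++ l.drop (i + 1))[i + j + m.length]? = l[i + j + 1]? := by
  rw [List.append_assoc, List.getElem?_append_right (by simp; omega),
    List.getElem?_append_right (by simp; omega), List.getElem?_drop]
  congr 1
  simp
  omega

theorem getElem?_splice_left {α : Type*} (l m : List α) (i j : ℕ) (hl : i + j + 1 < l.length) :
    (l.take (i + j + 1) ++ m ++ l.drop (i + j + 1 + 1))[i]? = l[i]? := by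
  rw [List.append_assoc, List.getElem?_append_left (by simp; omega),
    List.getElem?_take_of_lt (by omega)]

/-- Operations of matching colours can be composed along an input and an output with the same label.
-/
theorem exists_std {e : L} {c : C} {x y : Labelled T L} (hx : x.edges.Nodup)
    (hy : y.edges.Nodup) (hex : (e, c) ∈ x.cols) (hey : (e, c) ∈ y.cols) (h : e ∈ x.ins)
    (h' : y.root = e) : ∃ z, Std e x y z := by
  obtain ⟨i, hi, hie⟩ := List.getElem_of_mem h
  have hl := x.len
  have h1 : (e, T.output y.op) ∈ y.cols := by rw [← h']; simp [cols, edges, hedges]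
  have hi' : i < (T.inputs x.op).length := hi.trans_eq hl
  have h2 : (e, (T.inputs x.op)[i]) ∈ x.cols := by
    refine List.mem_of_getElem? (i := i + 1) ?_
    rw [cols, List.getElem?_zip_eq_some]
    exact ⟨by simp [edges, hi, hie], by simp [hedges]⟩
  refine ⟨_, i, ?_, by rw [List.getElem?_eq_getElem hi, hie], h', rfl⟩
  rw [List.getElem?_eq_getElem hi', cols_unique hx h2 hex, cols_unique hy h1 hey]

/-- Associativity for operations stacked on top of each other. -/
theorem Std.assoc {e f : L} {u v w a b : Labelled T L} (h : Std e u v a) (h' : Std f v w b) :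
    ∃ z, Std f a w z ∧ Std e u b z := by
  obtain ⟨i, hc, hi, he, rfl⟩ := h
  obtain ⟨j, hd, hj, hf, rfl⟩ := h'
  have hil := lt_arity_of_comp hc
  have hjl := lt_arity_of_comp hd
  have hlu := u.len
  have hlv := v.len
  have h2 : (T.inputs (u.comp i v hc).op)[i + j]? = some (T.output w.op) := by
    rw [← hd]
    exact (congrArg (·[i + j]?) (T.inputs_comp _ _ _ _)).trans
      (getElem?_splice_inner _ _ hil.le hjl)
  have h3 : (T.inputs u.op)[i]? = some (T.output (v.comp j w hd).op) := by
    rw [hc]; exact congrArg _ (T.output_comp _ _ _ _).symm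
  refine ⟨u.comp i (v.comp j w hd) h3,
    ⟨i + j, h2, (getElem?_splice_inner _ _ (by omega) (by omega)).trans hj, hf, ?_⟩, i, h3, hi, he, rfl⟩
  refine eq_of_edges (T.comp_assoc _ _ _ _ _ _ _ _ _).symm ?_
  simp only [edges, comp]
  congr 1
  have h4 : (u.ins.take i).length = i := by simp; omega
  have h5 : ∀ (A B D : List L), A.length = i → j < B.length →
      (A ++ B ++ D).take (i + j) = A ++ B.take j ∧
        (A ++ B ++ D).drop (i + j + 1) = B.drop (j + 1) ++ D := by
    intro A B D hA hB
    subst hA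
    constructor
    · rw [List.append_assoc, List.take_length_add_append, List.take_append_of_le_length hB.le]
    · rw [List.append_assoc, add_assoc, List.drop_length_add_append,
        List.drop_append_of_le_length hB]
  rw [(h5 _ _ _ h4 (by omega)).1, (h5 _ _ _ h4 (by omega)).2]
  simp

theorem splice_comm {α : Type*} (l m m' : List α) {i j : ℕ} (h : i + j + 1 < l.length) :
    (l.take i ++ m ++ l.drop (i + 1)).take (i + j + m.length) ++ m' ++
        (l.take i ++ m ++ l.drop (i + 1)).drop (i + j + m.length + 1) =
      (l.take (i + j + 1) ++ m' ++ l.drop (i + j + 1 + 1)).take i ++ m ++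
        (l.take (i + j + 1) ++ m' ++ l.drop (i + j + 1 + 1)).drop (i + 1) := by
  obtain ⟨A, l, rfl, hA⟩ : ∃ A l', l = A ++ l' ∧ A.length = i :=
    ⟨l.take i, l.drop i, by simp, by simp; omega⟩
  obtain ⟨B, l, rfl, hB⟩ : ∃ B l', l = B ++ l' ∧ B.length = j + 1 :=
    ⟨l.take (j + 1), l.drop (j + 1), by simp, by simp at h ⊢; omega⟩
  subst hA
  obtain ⟨b, B, rfl⟩ := List.exists_cons_of_length_eq_add_one hB
  obtain rfl : j = B.length := by simpa using hB.symm
  have hT : ∀ (X : List α) n, X.length ≤ n → X.take n = X := fun X n => List.take_of_length_le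
  have hD : ∀ (X : List α) n, X.length ≤ n → X.drop n = [] := fun X n => List.drop_eq_nil_of_le
  have h1 : B.length + (m.length + 1) - m.length = B.length + 1 := by omega
  simp only [List.append_assoc, List.cons_append, List.take_append, List.drop_append, add_assoc,
    add_tsub_cancel_left]
  simp [hT, hD, List.drop_append, h1]
  omega

theorem Std.comm_of_lt {e f : L} {u v w : Labelled T L} {i j : ℕ} (hij : i < j)
    (hc : (T.inputs v.op)[i]? = some (T.output u.op)) (hi : v.ins[i]? = some e) (he : u.root = e)
    (hd : (T.inputs v.op)[j]? = some (T.output w.op)) (hj : v.ins[j]? = some f)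
    (hf : w.root = f) : ∃ z, Std f (v.comp i u hc) w z ∧ Std e (v.comp j w hd) u z := by
  obtain ⟨j, rfl⟩ := Nat.exists_eq_add_of_lt hij
  have hil := lt_arity_of_comp hc
  have hjl := lt_arity_of_comp hd
  have hlu := u.len
  have hlv := v.len
  have h2 : (T.inputs (v.comp i u hc).op)[i + j + (T.inputs u.op).length]? =
      some (T.output w.op) := by
    rw [← hd]
    exact (congrArg (·[i + j + (T.inputs u.op).length]?) (T.inputs_comp _ _ _ _)).trans
      (getElem?_splice_right _ _ _ hil)
  have h3 : (T.inputs (v.comp (i + j + 1) w hd).op)[i]? = some (T.output u.op) := by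
    rw [← hc]
    exact (congrArg (·[i]?) (T.inputs_comp _ _ _ _)).trans (getElem?_splice_left _ _ _ _ hjl)
  refine ⟨_, ⟨i + j + (T.inputs u.op).length, h2, ?_, hf, rfl⟩, i, h3, ?_, he, ?_⟩
  · rw [← hj]
    have : (T.inputs u.op).length = u.ins.length := hlu.symm
    rw [this]
    exact getElem?_splice_right _ _ _ (by omega)
  · rw [← hi]
    exact getElem?_splice_left _ _ _ _ (by omega)
  · refine eq_of_edges (T.comp_comm _ _ _ _ _ _ _ _ _) ?_
    have hk : (T.inputs u.op).length = u.ins.length := hlu.symm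
    simp only [edges, comp, hk]
    congr 1
    exact splice_comm _ _ _ (by omega)

/-- Associativity for operations composed into two inputs of the same operation. -/
theorem Std.comm {e f : L} {u v w a b : Labelled T L} (hef : e ≠ f) (h : Std e v u a)
    (h' : Std f v w b) : ∃ z, Std f a w z ∧ Std e b u z := by
  obtain ⟨i, hc, hi, he, rfl⟩ := h
  obtain ⟨j, hd, hj, hf, rfl⟩ := h'
  rcases lt_trichotomy i j with hij | rfl | hij
  · exact Std.comm_of_lt hij hc hi he hd hj hf
  · exact absurd (Option.some.inj (hi.symm.trans hj)) hef
  · obtain ⟨z, h1, h2⟩ := Std.comm_of_lt hij hd hj hf hc hi he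
    exact ⟨z, h2, h1⟩

/-- Three labelled operations that form a chain `u - v - w`, joined by `e` and `f`. -/
structure Chain3 (e f : L) (u v w : Labelled T L) : Prop where
  left : Meet e u v
  right : Meet f v w
  disj : ∀ l ∈ u.edges, l ∉ w.edges

theorem Chain3.symm {e f : L} {u v w : Labelled T L} (h : Chain3 e f u v w) :
    Chain3 f e w v u :=
  ⟨h.2.symm, h.1.symm, fun l h1 h2 => h.3 l h2 h1⟩

theorem Chain3.congr {e f : L} {u v w u' v' w' : Labelled T L} (h : Chain3 e f u v w)
    (hu : u.Rel u') (hv : v.Rel v') (hw : w.Rel w') : Chain3 e f u' v' w' :=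
  ⟨h.1.congr hu hv, h.2.congr hv hw, fun l h1 h2 =>
    h.3 l (hu.edges_perm.subset h1) (hw.edges_perm.subset h2)⟩

theorem Chain3.meet {e f : L} {u v w a : Labelled T L} (h : Chain3 e f u v w)
    (ha : Contr e u v a) : Meet f a w := by
  refine ⟨ha.nodup h.1, h.2.2, fun l h1 h2 => ?_⟩
  rcases ((ha.mem_iff h.1).1 h1).2 with h3 | h3
  · exact absurd h2 (h.3 l h3)
  · exact h.2.3 l h3 h2

theorem exists_rel_root (hκ : κ = .cyclic) (x : Labelled T L) {l : L} (hl : l ∈ x.edges) :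
    ∃ y, x.Rel y ∧ y.root = l := by
  obtain ⟨y, h1, h2⟩ := exists_rel_getElem? hκ x hl (k := 0) (by omega)
  exact ⟨y, h1, by simpa [edges] using h2⟩

theorem mem_ins_of_ne {x : Labelled T L} {l : L} (h : l ∈ x.edges) (h' : l ≠ x.root) :
    l ∈ x.ins := by
  simpa [edges, h'] using h

/-- Without cyclic symmetry there is no choice of the lower operation in a contraction. -/
theorem Contr.orient (hκ : κ ≠ .cyclic) {e : L} {x y z : Labelled T L} (hm : Meet e x y)
    (h : Contr e x y z) :
    (e ∈ x.ins ∧ y.root = e ∧ z.root = x.root) ∨ (e ∈ y.ins ∧ x.root = e ∧ z.root = y.root) := by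
  have h0 := hm.1
  have h0' := hm.2
  rw [edges, List.nodup_cons] at h0 h0'
  have hx := h.mem_left hm
  have hy := h.mem_right hm
  obtain ⟨x', y', z', h1, h2, h3, ⟨i, hc, hi, he, hzz⟩ | ⟨i, hc, hi, he, hzz⟩⟩ := h
  · have h5 : z'.root = x'.root := by rw [hzz]; rfl
    refine .inl ⟨mem_ins_of_ne hx ?_, (h2.root_eq hκ).symm.trans he,
      (h3.root_eq hκ).trans (h5.trans (h1.root_eq hκ))⟩
    rintro rfl
    have h4 := (hm.congr h1 h2).1
    rw [edges, List.nodup_cons] at h4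
    exact h4.1 (by rw [h1.root_eq hκ]; exact List.mem_of_getElem? hi)
  · have h5 : z'.root = y'.root := by rw [hzz]; rfl
    refine .inr ⟨mem_ins_of_ne hy ?_, (h1.root_eq hκ).symm.trans he,
      (h3.root_eq hκ).trans (h5.trans (h2.root_eq hκ))⟩
    rintro rfl
    have h4 := (hm.congr h1 h2).2
    rw [edges, List.nodup_cons] at h4
    exact h4.1 (by rw [h2.root_eq hκ]; exact List.mem_of_getElem? hi)

/-- A contractible chain can be rooted at one of its vertices: at the one that carries the output
of the composite. -/
theorem Chain3.exists_rooted {e f : L} {u v w a z : Labelled T L} (h : Chain3 e f u v w)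
    (ha : Contr e u v a) (hz : Contr f a w z) :
    ∃ u' v' w', u.Rel u' ∧ v.Rel v' ∧ w.Rel w' ∧
      ((e ∈ u'.ins ∧ v'.root = e ∧ f ∈ v'.ins ∧ w'.root = f) ∨
        (u'.root = e ∧ e ∈ v'.ins ∧ f ∈ v'.ins ∧ w'.root = f) ∨
          (u'.root = e ∧ e ∈ v'.ins ∧ v'.root = f ∧ f ∈ w'.ins)) := by
  have hm := h.meet ha
  have heu := ha.mem_left h.1
  have hev := ha.mem_right h.1
  have hfa := hz.mem_left hm
  have hfw := hz.mem_right hm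
  have hfu : f ∉ u.edges := fun hc => h.3 f hc hfw
  have hfv : f ∈ v.edges := (((ha.mem_iff h.1).1 hfa).2).resolve_left hfu
  have hef : e ≠ f := by rintro rfl; exact hfu heu
  by_cases hκ : κ = .cyclic
  · have hr : z.root ∈ z.edges := List.mem_cons_self
    obtain ⟨hrf, hr⟩ := (hz.mem_iff hm).1 hr
    have hins : ∀ {x x' : Labelled T L} {l : L}, x.Rel x' → l ∈ x.edges → l ≠ x'.root →
        l ∈ x'.ins := fun h1 h2 h3 => mem_ins_of_ne (h1.edges_perm.symm.subset h2) h3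
    obtain ⟨u₁, hu₁, hu₁'⟩ := exists_rel_root hκ u heu
    obtain ⟨w₁, hw₁, hw₁'⟩ := exists_rel_root hκ w hfw
    rcases hr with hr | hr
    · obtain ⟨hre, hr⟩ := (ha.mem_iff h.1).1 hr
      rcases hr with hr | hr
      · obtain ⟨u', hu', hu''⟩ := exists_rel_root hκ u hr
        obtain ⟨v', hv', hv''⟩ := exists_rel_root hκ v hev
        exact ⟨u', v', w₁, hu', hv', hw₁, .inl ⟨hins hu' heu (by rw [hu'']; exact hre.symm), hv'',
          hins hv' hfv (by rw [hv'']; exact hef.symm), hw₁'⟩⟩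
      · obtain ⟨v', hv', hv''⟩ := exists_rel_root hκ v hr
        exact ⟨u₁, v', w₁, hu₁, hv', hw₁, .inr (.inl ⟨hu₁',
          hins hv' hev (by rw [hv'']; exact hre.symm),
          hins hv' hfv (by rw [hv'']; exact hrf.symm), hw₁'⟩)⟩
    · obtain ⟨w', hw', hw''⟩ := exists_rel_root hκ w hr
      obtain ⟨v', hv', hv''⟩ := exists_rel_root hκ v hfv
      exact ⟨u₁, v', w', hu₁, hv', hw', .inr (.inr ⟨hu₁',
          hins hv' hev (by rw [hv'']; exact hef), hv'',
          hins hw' hfw (by rw [hw'']; exact hrf.symm)⟩)⟩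
  · refine ⟨u, v, w, .refl _, .refl _, .refl _, ?_⟩
    have hand := hm.1
    rw [edges, List.nodup_cons] at hand
    rcases ha.orient hκ h.1 with ⟨h1, h2, h3⟩ | ⟨h1, h2, h3⟩ <;>
      rcases hz.orient hκ hm with ⟨h4, h5, h6⟩ | ⟨h4, h5, h6⟩
    · exact .inl ⟨h1, h2, mem_ins_of_ne hfv (by rw [h2]; exact hef.symm), h5⟩
    · exact absurd (by rw [← h5, h3]; exact List.mem_cons_self) hfu
    · refine .inr (.inl ⟨h2, h1, mem_ins_of_ne hfv ?_, h5⟩)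
      rintro rfl
      exact hand.1 (h3 ▸ h4)
    · exact .inr (.inr ⟨h2, h1, h3.symm.trans h5, h4⟩)

/-- Associativity of contraction. Once the chain is rooted, this is associativity for stacked
operations if the root is at one of the ends, and for two inputs of `v` otherwise. -/
theorem Contr.assoc {e f : L} {u v w a z : Labelled T L} (h : Chain3 e f u v w)
    (ha : Contr e u v a) (hz : Contr f a w z) : ∃ b, Contr f v w b ∧ Contr e u b z := by
  have hm := h.meet ha
  obtain ⟨c, hcu, hcv⟩ := ha.exists_col h.1
  have heu := ha.mem_left h.1
  have hfw := hz.mem_right hm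
  have hef : e ≠ f := by rintro rfl; exact h.3 e heu hfw
  obtain ⟨d, hda, hdw⟩ := hz.exists_col hm
  have hdv : (f, d) ∈ v.cols := by
    refine (ha.cols_subset hda).resolve_left fun hc => ?_
    exact h.3 f (mem_edges_iff.2 ⟨_, hc⟩) hfw
  obtain ⟨u', v', w', hu, hv, hw, hroot⟩ := h.exists_rooted ha hz
  have h' := h.congr hu hv hw
  have hcu' := hu.cols_perm.symm.subset hcu
  have hcv' := hv.cols_perm.symm.subset hcv
  have hdv' := hv.cols_perm.symm.subset hdv
  have hdw' := hw.cols_perm.symm.subset hdw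
  have key : ∃ a' b' z', Contr e u' v' a' ∧ Contr f a' w' z' ∧ Contr f v' w' b' ∧
      Contr e u' b' z' := by
    rcases hroot with ⟨h1, h2, h3, h4⟩ | ⟨h1, h2, h3, h4⟩ | ⟨h1, h2, h3, h4⟩
    · obtain ⟨a', ha'⟩ := exists_std h'.1.1 h'.1.2 hcu' hcv' h1 h2
      obtain ⟨b', hb'⟩ := exists_std h'.2.1 h'.2.2 hdv' hdw' h3 h4
      obtain ⟨z', h5, h6⟩ := ha'.assoc hb'
      exact ⟨a', b', z', ha'.contr, h5.contr, hb'.contr, h6.contr⟩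
    · obtain ⟨a', ha'⟩ := exists_std h'.1.2 h'.1.1 hcv' hcu' h2 h1
      obtain ⟨b', hb'⟩ := exists_std h'.2.1 h'.2.2 hdv' hdw' h3 h4
      obtain ⟨z', h5, h6⟩ := Std.comm hef ha' hb'
      exact ⟨a', b', z', ha'.contr.symm, h5.contr, hb'.contr, h6.contr.symm⟩
    · obtain ⟨a', ha'⟩ := exists_std h'.1.2 h'.1.1 hcv' hcu' h2 h1
      obtain ⟨b', hb'⟩ := exists_std h'.2.2 h'.2.1 hdw' hdv' h4 h3
      obtain ⟨z', h5, h6⟩ := hb'.assoc ha'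
      exact ⟨a', b', z', ha'.contr.symm, h6.contr.symm, hb'.contr.symm, h5.contr.symm⟩
  obtain ⟨a', b', z', h1, h2, h3, h4⟩ := key
  have haa : a'.Rel a := (h1.congr hu.symm hv.symm (.refl _)).rel h.1 ha
  have hzz : z'.Rel z := (h2.congr haa hw.symm (.refl _)).rel hm hz
  exact ⟨b', h3.congr hv.symm hw.symm (.refl _), h4.congr hu.symm (.refl _) hzz⟩

theorem Contr.assoc' {e f : L} {u v w b z : Labelled T L} (h : Chain3 e f u v w)
    (hb : Contr f v w b) (hz : Contr e u b z) : ∃ a, Contr e u v a ∧ Contr f a w z := by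
  obtain ⟨a, h1, h2⟩ := Contr.assoc h.symm hb.symm hz.symm
  exact ⟨a, h1.symm, h2.symm⟩

/-! ### Relabelling and contraction -/

theorem Std.map {e : L} {x y z : Labelled T L} (g : L → L') (h : Std e x y z) :
    Std (g e) (x.map g) (y.map g) (z.map g) := by
  obtain ⟨i, hc, hi, he, rfl⟩ := h
  refine ⟨i, hc, by simp [Labelled.map, hi], by simp [Labelled.map, he], eq_of_edges rfl ?_⟩
  simp [edges, comp, Labelled.map]

theorem Contr.map {e : L} {x y z : Labelled T L} (g : L → L') (h : Contr e x y z) :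
    Contr (g e) (x.map g) (y.map g) (z.map g) := by
  obtain ⟨x', y', z', h1, h2, h3, h4⟩ := h
  exact ⟨_, _, _, h1.map g, h2.map g, h3.map g, h4.imp (·.map g) (·.map g)⟩

theorem Std.of_map {e : L} {x y : Labelled T L} {z' : Labelled T L'} {g : L → L'}
    (hx : ∀ l ∈ x.edges, g l = g e → l = e) (hy : ∀ l ∈ y.edges, g l = g e → l = e)
    (h : Std (g e) (x.map g) (y.map g) z') : ∃ z, z' = z.map g ∧ Std e x y z := by
  obtain ⟨i, hc, hi, he, rfl⟩ := h
  simp only [Labelled.map, List.getElem?_map, Option.map_eq_some_iff] at hi he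
  obtain ⟨l, hl, hl'⟩ := hi
  have h1 : x.ins[i]? = some e := by
    rw [hl, hx l (List.mem_cons_of_mem _ (List.mem_of_getElem? hl)) hl']
  have h2 : y.root = e := hy _ List.mem_cons_self he
  refine ⟨x.comp i y hc, eq_of_edges rfl ?_, i, hc, h1, h2, rfl⟩
  simp [edges, comp, Labelled.map]

/-- A contraction of relabelled operations comes from a contraction, if the relabelling does not
identify the label of the joined half-edges with another one. -/
theorem Contr.of_map {e : L} {x y : Labelled T L} {z' : Labelled T L'} {g : L → L'}
    (hx : ∀ l ∈ x.edges, g l = g e → l = e) (hy : ∀ l ∈ y.edges, g l = g e → l = e)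
    (h : Contr (g e) (x.map g) (y.map g) z') : ∃ z, z' = z.map g ∧ Contr e x y z := by
  obtain ⟨x₁, y₁, z₁, h1', h2', h3, h4⟩ := h
  obtain ⟨x', h1, rfl⟩ := h1'.of_map
  obtain ⟨y', h2, rfl⟩ := h2'.of_map
  have hx' : ∀ l ∈ x'.edges, g l = g e → l = e := fun l hl => hx l (h1.edges_perm.subset hl)
  have hy' : ∀ l ∈ y'.edges, g l = g e → l = e := fun l hl => hy l (h2.edges_perm.subset hl)
  rcases h4 with h4 | h4
  · obtain ⟨z, rfl, h5⟩ := h4.of_map hx' hy'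
    obtain ⟨z', h6, rfl⟩ := h3.of_map
    exact ⟨z', rfl, x', y', z, h1, h2, h6, .inl h5⟩
  · obtain ⟨z, rfl, h5⟩ := h4.of_map hy' hx'
    obtain ⟨z', h6, rfl⟩ := h3.of_map
    exact ⟨z', rfl, x', y', z, h1, h2, h6, .inr h5⟩

/-! ### Contraction with identities -/

theorem map_replace [DecidableEq L] {l : List L} (hl : l.Nodup) {i : ℕ} {e e' : L}
    (h : l[i]? = some e) :
    l.map (fun k => if k = e then e' else k) = l.take i ++ [e'] ++ l.drop (i + 1) := by
  apply List.ext_getElem?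
  intro k
  obtain ⟨hi, he⟩ := List.getElem?_eq_some_iff.1 h
  rw [List.getElem?_map]
  rcases lt_trichotomy k i with hk | rfl | hk
  · rw [List.append_assoc, List.getElem?_append_left (by simp; omega),
      List.getElem?_take_of_lt hk]
    rw [List.getElem?_eq_getElem (by omega), Option.map_some, if_neg]
    intro hc
    have := (List.Nodup.getElem_inj_iff hl).1 (hc.trans he.symm)
    omega
  · rw [List.append_assoc, List.getElem?_append_right (by simp), h]
    simp [Nat.min_eq_left hi.le]
  · rw [List.getElem?_append_right (by simp; omega), List.getElem?_drop]
    have : i + 1 + (k - (List.take i l ++ [e']).length) = k := by simp; omega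
    rw [this]
    by_cases hkl : k < l.length
    · rw [List.getElem?_eq_getElem (by omega), Option.map_some, if_neg]
      intro hc
      have := (List.Nodup.getElem_inj_iff hl).1 (hc.trans he.symm)
      omega
    · rw [List.getElem?_eq_none (by omega)]; rfl

/-- Contraction with an identity operation, in the cases in which an input is joined to an output.
-/
theorem contr_one_aux [DecidableEq L] {e e' : L} {c : C} {x i : Labelled T L}
    (hx : x.edges.Nodup) (hc : (e, c) ∈ x.cols) (hi : i.op = T.one c)
    (h : (e ∈ x.ins ∧ i.edges = [e, e']) ∨ (x.root = e ∧ i.edges = [e', e])) :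
    Contr e x i (x.map fun k => if k = e then e' else k) := by
  have hone : ∀ {a b : L}, i.edges = [a, b] → i.root = a ∧ i.ins = [b] := by
    intro a b hab
    simpa [edges] using hab
  rcases h with ⟨h1, h2⟩ | ⟨h1, h2⟩
  · obtain ⟨h3, h4⟩ := hone h2
    obtain ⟨k, hk, hke⟩ := List.getElem_of_mem h1
    have hkx : x.edges[k + 1]? = some e := by simp [edges, hk, hke]
    have hk' : k < (T.inputs x.op).length := hk.trans_eq x.len
    have hcol : (e, (T.inputs x.op)[k]) ∈ x.cols := by
      refine List.mem_of_getElem? (i := k + 1) ?_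
      rw [cols, List.getElem?_zip_eq_some]
      exact ⟨hkx, by simp [hedges, hk']⟩
    have hcc : (T.inputs x.op)[k]? = some (T.output (T.one c)) := by
      rw [List.getElem?_eq_getElem hk', cols_unique hx hcol hc, T.output_one]
    have hcc' : (T.inputs x.op)[k]? = some (T.output i.op) := by rw [hi, hcc]
    refine (show Std e x i _ from ⟨k, hcc', by rw [List.getElem?_eq_getElem hk, hke], h3,
      eq_of_edges ?_ ?_⟩).contr
    · exact (T.comp_one _ _ _ hcc).symm.trans (T.comp_congr rfl hi.symm rfl _ _)
    · rw [edges_comp, h4, edges_map, map_replace hx hkx]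
  · obtain ⟨h3, h4⟩ := hone h2
    have hcol : (e, T.output x.op) ∈ x.cols := by rw [← h1]; simp [cols, edges, hedges]
    have hcc : (T.inputs (T.one c))[0]? = some (T.output x.op) := by
      rw [T.inputs_one, cols_unique hx hcol hc]; rfl
    have hcc' : (T.inputs i.op)[0]? = some (T.output x.op) := by rw [hi, hcc]
    refine Contr.symm (show Std e i x _ from ⟨0, hcc', by rw [h4]; rfl, h1,
      eq_of_edges ?_ ?_⟩).contr
    · exact (T.one_comp _ _ hcc).symm.trans (T.comp_congr hi.symm rfl rfl _ _)
    · rw [edges_comp, edges_map, map_replace hx (i := 0) (by simp [edges, h1])]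
      simp [edges, h3, h4]

/-- Contraction with an identity operation is a relabelling. -/
theorem contr_one [DecidableEq L] {e e' : L} {c : C} {x i : Labelled T L}
    (hx : x.edges.Nodup) (hc : (e, c) ∈ x.cols) (hi : i.op = T.one c)
    (hie : (i.edges = [e, e'] ∧ (κ ≠ .cyclic → e ∈ x.ins)) ∨
      (i.edges = [e', e] ∧ (κ ≠ .cyclic → x.root = e))) :
    Contr e x i (x.map fun k => if k = e then e' else k) := by
  by_cases hκ : κ = .cyclic
  · have hlen : (T.inputs i.op).length = 1 := by rw [hi, T.inputs_one]; rfl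
    let i' := i.act 1 (finRotate 2) hlen (Kind.allows_cyclic hκ _)
    have hi' : i'.op = T.one c :=
      (T.act_congr hi _ _ _ (by rw [T.inputs_one]; rfl) _).trans
        (T.act_one_finRotate hκ c _ _)
    have he' : i'.edges = i.ins ++ [i.root] := edges_act_finRotate _ _ _ _
    have hrel : i.Rel i' := rel_act _ _ _ _ _
    have hmem : e ∈ x.edges := mem_edges_iff.2 ⟨c, hc⟩
    have hr : e ∈ x.ins ∨ x.root = e := by
      rcases List.mem_cons.1 hmem with h | h
      · exact .inr h.symm
      · exact .inl h
    have hrot : ∀ {a b : L}, i.edges = [a, b] → i'.edges = [b, a] := by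
      intro a b hab
      have : i.root = a ∧ i.ins = [b] := by simpa [edges] using hab
      rw [he', this.1, this.2]; rfl
    rcases hr with hr | hr <;> rcases hie with ⟨h1, -⟩ | ⟨h1, -⟩
    · exact contr_one_aux hx hc hi (.inl ⟨hr, h1⟩)
    · exact (contr_one_aux hx hc hi' (.inl ⟨hr, hrot h1⟩)).congr (.refl _) hrel.symm (.refl _)
    · exact (contr_one_aux hx hc hi' (.inr ⟨hr, hrot h1⟩)).congr (.refl _) hrel.symm (.refl _)
    · exact contr_one_aux hx hc hi (.inr ⟨hr, h1⟩)
  · exact contr_one_aux hx hc hi (hie.imp (fun h => ⟨h.2 hκ, h.1⟩) (fun h => ⟨h.2 hκ, h.1⟩))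

/-! ### Gluing -/

/-- Contraction along `e` if `x` has a half-edge with this label; otherwise `x` is unchanged. -/
def Glue (e : L) (x y z : Labelled T L) : Prop :=
  (e ∈ x.edges ∧ Contr e x y z) ∨ (e ∉ x.edges ∧ x.Rel z)

theorem Glue.congr {e : L} {x y z x' y' z' : Labelled T L} (h : Glue e x y z) (hx : x.Rel x')
    (hy : y.Rel y') (hz : z.Rel z') : Glue e x' y' z' := by
  rcases h with ⟨h1, h2⟩ | ⟨h1, h2⟩
  · exact .inl ⟨hx.edges_perm.symm.subset h1, h2.congr hx hy hz⟩
  · exact .inr ⟨fun hc => h1 (hx.edges_perm.subset hc), hx.symm.trans (h2.trans hz)⟩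

theorem Glue.cols_subset {e : L} {x y z : Labelled T L} (h : Glue e x y z) {a : L × C}
    (ha : a ∈ z.cols) : a ∈ x.cols ∨ a ∈ y.cols := by
  rcases h with ⟨h1, h2⟩ | ⟨h1, h2⟩
  · exact h2.cols_subset ha
  · exact .inl (h2.cols_perm.subset ha)

theorem Glue.nodup {e : L} {x y z : Labelled T L} (hm : Meet e x y) (h : Glue e x y z) :
    z.edges.Nodup := by
  rcases h with ⟨h1, h2⟩ | ⟨h1, h2⟩
  · exact h2.nodup hm
  · exact h2.edges_perm.nodup_iff.2 hm.1

theorem Glue.mem_iff {e : L} {x y z : Labelled T L} (hm : Meet e x y) (h : Glue e x y z) {l : L} :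
    l ∈ z.edges ↔ l ≠ e ∧ (l ∈ x.edges ∨ (e ∈ x.edges ∧ l ∈ y.edges)) := by
  rcases h with ⟨h1, h2⟩ | ⟨h1, h2⟩
  · rw [h2.mem_iff hm]; simp [h1]
  · rw [h2.edges_perm.mem_iff]
    simp only [h1, false_and, or_false]
    exact ⟨fun h => ⟨fun hc => h1 (hc ▸ h), h⟩, And.right⟩

theorem glue_map {e : L} {x y : Labelled T L} {z' : Labelled T L'} {g : L → L'}
    (hx : ∀ l ∈ x.edges, g l = g e → l = e) (hy : ∀ l ∈ y.edges, g l = g e → l = e) :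
    Glue (g e) (x.map g) (y.map g) z' ↔ ∃ z, z' = z.map g ∧ Glue e x y z := by
  have hmem : g e ∈ (x.map g).edges ↔ e ∈ x.edges := by
    rw [edges_map, List.mem_map]
    exact ⟨fun ⟨l, h1, h2⟩ => hx l h1 h2 ▸ h1, fun h => ⟨e, h, rfl⟩⟩
  constructor
  · rintro (⟨h1, h2⟩ | ⟨h1, h2⟩)
    · obtain ⟨z, rfl, h3⟩ := h2.of_map hx hy
      exact ⟨z, rfl, .inl ⟨hmem.1 h1, h3⟩⟩
    · obtain ⟨z, h3, rfl⟩ := h2.of_map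
      exact ⟨z, rfl, .inr ⟨fun hc => h1 (hmem.2 hc), h3⟩⟩
  · rintro ⟨z, rfl, ⟨h1, h2⟩ | ⟨h1, h2⟩⟩
    · exact .inl ⟨hmem.2 h1, h2.map g⟩
    · exact .inr ⟨fun hc => h1 (hmem.1 hc), h2.map g⟩

/-- Gluing two operations that are joined to each other amounts to gluing their composite. If `x`
does not have the label `e`, neither of them is seen by `x`. -/
theorem glue_chain {e f : L} {x y w v z : Labelled T L} (h : Chain3 e f x y w)
    (hv : Contr f y w v) : (∃ t, Glue e x y t ∧ Glue f t w z) ↔ Glue e x v z := by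
  have hfy := hv.mem_left h.2
  have hfw := hv.mem_right h.2
  have hfx : f ∉ x.edges := fun hc => h.3 f hc hfw
  constructor
  · rintro ⟨t, ⟨h1, h2⟩ | ⟨h1, h2⟩, h3⟩
    · have hef : f ≠ e := by rintro rfl; exact hfx h1
      have hft : f ∈ t.edges := (h2.mem_iff h.1).2 ⟨hef, .inr hfy⟩
      rcases h3 with ⟨h3, h4⟩ | ⟨h3, h4⟩
      · obtain ⟨b, h5, h6⟩ := Contr.assoc h h2 h4
        exact .inl ⟨h1, h6.congr (.refl _) (h5.rel h.2 hv) (.refl _)⟩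
      · exact absurd hft h3
    · rcases h3 with ⟨h3, h4⟩ | ⟨h3, h4⟩
      · exact absurd (h2.edges_perm.subset h3) hfx
      · exact .inr ⟨h1, h2.trans h4⟩
  · rintro (⟨h1, h2⟩ | ⟨h1, h2⟩)
    · obtain ⟨t, h3, h4⟩ := Contr.assoc' h hv h2
      exact ⟨t, .inl ⟨h1, h3⟩, .inl ⟨h4.mem_left (h.meet h3), h4⟩⟩
    · exact ⟨x, .inr ⟨h1, .refl _⟩, .inr ⟨hfx, h2⟩⟩

theorem Glue.comm {e f : L} {x y w z t : Labelled T L} (h : Chain3 e f y x w)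
    (hey : e ∈ y.edges) (hfw : f ∈ w.edges) (h1 : Glue e x y t) (h2 : Glue f t w z) :
    ∃ t, Glue f x w t ∧ Glue e t y z := by
  have hfy : f ∉ y.edges := fun hc => h.3 f hc hfw
  have hew : e ∉ w.edges := h.3 e hey
  have hef : e ≠ f := by rintro rfl; exact hfy hey
  by_cases he : e ∈ x.edges
  · have h1 := (h1.resolve_right fun h => h.1 he).2
    by_cases hf : f ∈ x.edges
    · have hft := (h1.mem_iff h.1.symm).2 ⟨hef.symm, .inl hf⟩
      have h2 := (h2.resolve_right fun h => h.1 hft).2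
      obtain ⟨b, h3, h4⟩ := Contr.assoc h h1.symm h2
      exact ⟨b, .inl ⟨hf, h3⟩, .inl ⟨(h3.mem_iff h.2).2 ⟨hef, .inl he⟩, h4.symm⟩⟩
    · have hft : f ∉ t.edges := fun hc => (((h1.mem_iff h.1.symm).1 hc).2).elim hf hfy
      have h2 := (h2.resolve_left fun h => hft h.1).2
      exact ⟨x, .inr ⟨hf, .refl _⟩, .inl ⟨he, h1.congr (.refl _) (.refl _) h2⟩⟩
  · have h1 := (h1.resolve_left fun h => he h.1).2
    have h2' := h2.congr h1.symm (.refl _) (.refl _)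
    refine ⟨z, h2', .inr ⟨fun hc => ?_, .refl _⟩⟩
    exact (((h2'.mem_iff h.2).1 hc).2).elim he (fun h => hew h.2)

/-- Operations that are glued at different labels of `x` can be glued in any order. -/
theorem glue_comm {e f : L} {x y w z : Labelled T L} (h : Chain3 e f y x w)
    (hey : e ∈ y.edges) (hfw : f ∈ w.edges) :
    (∃ t, Glue e x y t ∧ Glue f t w z) ↔ ∃ t, Glue f x w t ∧ Glue e t y z :=
  ⟨fun ⟨_, h1, h2⟩ => h1.comm h hey hfw h2, fun ⟨_, h1, h2⟩ => h1.comm h.symm hfw hey h2⟩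

/-! ### Sets of labelled operations -/

/-- The operation `p` whose half-edges are labelled by their numbers. -/
def can (p : T.Op) : Labelled T ℤ where
  op := p
  root := 0
  ins := (List.range (T.arity p)).map fun k : ℕ => (k : ℤ) + 1
  len := by simp

@[simp] theorem can_op (p : T.Op) : (can p).op = p := rfl

theorem edges_can (p : T.Op) : (can p).edges = (List.range (T.arity p + 1)).map
    fun k : ℕ => (k : ℤ) := by
  rw [List.range_succ_eq_map]
  simp [edges, can]

theorem mem_edges_map {x : Labelled T L} {g : L → L'} {l : L'} :
    l ∈ (x.map g).edges ↔ ∃ a ∈ x.edges, g a = l := by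
  rw [edges_map, List.mem_map]

theorem getElem?_can (p : T.Op) {k : ℕ} (hk : k < T.arity p + 1) :
    (can p).edges[k]? = some (k : ℤ) := by
  rw [edges_can, List.getElem?_map, List.getElem?_range hk]; rfl

theorem mem_can {p : T.Op} {l : ℤ} : l ∈ (can p).edges ↔ 0 ≤ l ∧ l ≤ T.arity p := by
  rw [edges_can]
  simp only [List.mem_map, List.mem_range]
  constructor
  · rintro ⟨k, h1, rfl⟩; omega
  · rintro ⟨h1, h2⟩; exact ⟨l.toNat, by omega, by omega⟩

theorem nodup_can (p : T.Op) : (can p).edges.Nodup := by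
  rw [edges_can]
  exact List.nodup_range.map Nat.cast_injective

/-- The label in `p ∘ᵢ q` of the half-edge `l` of `p`, where `q` has arity `m`; the half-edge which
is joined with `q` is labelled by `e`. -/
def outL (e : ℤ) (i m : ℕ) (l : ℤ) : ℤ := if l = i + 1 then e else if l ≤ i then l else l + m - 1

/-- The label in `p ∘ᵢ q` of the half-edge `l` of `q`; the half-edge which is joined with `p` is
labelled by `e`. -/
def innL (e : ℤ) (i : ℕ) (l : ℤ) : ℤ := if l = 0 then e else if l < 0 then l else i + l

/-- The half-edge of `p^σ` that is the half-edge `l` of `p`. -/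
def permL {n : ℕ} (σ : Equiv.Perm (Fin (n + 1))) (l : ℤ) : ℤ :=
  if h : 0 ≤ l ∧ l < n + 1 then (σ⁻¹ ⟨l.toNat, by omega⟩ : Fin (n + 1)) else l

theorem permL_of_neg {n : ℕ} (σ : Equiv.Perm (Fin (n + 1))) {l : ℤ} (h : l < 0) :
    permL σ l = l := by
  rw [permL, dif_neg (by omega)]

theorem permL_coe {n : ℕ} (σ : Equiv.Perm (Fin (n + 1))) (k : Fin (n + 1)) :
    permL σ (σ k : ℕ) = (k : ℕ) := by
  rw [permL, dif_pos ⟨by omega, by omega⟩]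
  simp

theorem exists_fin_of_mem {n : ℕ} (σ : Equiv.Perm (Fin (n + 1))) {l : ℤ} (h : 0 ≤ l)
    (h' : l ≤ n) : ∃ k : Fin (n + 1), l = (σ k : ℕ) ∧ permL σ l = (k : ℕ) := by
  refine ⟨σ⁻¹ ⟨l.toNat, by omega⟩, by simp; omega, ?_⟩
  rw [permL, dif_pos ⟨by omega, by omega⟩]

theorem permL_bounds {n : ℕ} (σ : Equiv.Perm (Fin (n + 1))) {l : ℤ} (h : 0 ≤ l)
    (h' : l ≤ n) : 0 ≤ permL σ l ∧ permL σ l ≤ n := by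
  obtain ⟨k, h1, h2⟩ := exists_fin_of_mem σ h h'
  omega

theorem permL_one {n : ℕ} (l : ℤ) : permL (1 : Equiv.Perm (Fin (n + 1))) l = l := by
  rw [permL]
  split_ifs with h
  · simp; omega
  · rfl

theorem permL_mul {n : ℕ} (σ ρ : Equiv.Perm (Fin (n + 1))) (l : ℤ) :
    permL (σ * ρ) l = permL ρ (permL σ l) := by
  by_cases h : 0 ≤ l ∧ l ≤ n
  · obtain ⟨k, h1, h2⟩ := exists_fin_of_mem (σ * ρ) h.1 h.2
    rw [h2, h1, Equiv.Perm.mul_apply, permL_coe, permL_coe]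
  · have h1 : ∀ τ : Equiv.Perm (Fin (n + 1)), permL τ l = l := fun τ => by
      rw [permL, dif_neg (by omega)]
    rw [h1, h1, h1]

theorem permL_injective {n : ℕ} (σ : Equiv.Perm (Fin (n + 1))) : Function.Injective (permL σ) := by
  intro a b hab
  have h1 := congrArg (permL σ⁻¹) hab
  rwa [← permL_mul, ← permL_mul, mul_inv_cancel, permL_one, permL_one] at h1

theorem permL_finRotate {n : ℕ} {l : ℤ} (h : 0 ≤ l) (h' : l ≤ n) :
    permL (finRotate (n + 1)) l = if l = 0 then (n : ℤ) else l - 1 := by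
  obtain ⟨k, h1, h2⟩ := exists_fin_of_mem (finRotate (n + 1)) h h'
  rw [h2]
  by_cases hk : (k : ℕ) = n
  · have : k = Fin.last n := Fin.ext hk
    subst this
    rw [finRotate_last] at h1
    simp at h1
    simp [h1]
  · have hk' : (k : ℕ) < n := by omega
    have h3 : ((finRotate (n + 1) k : Fin (n + 1)) : ℕ) = k + 1 := by
      have := finRotate_of_lt hk'
      exact congrArg Fin.val this
    rw [h3] at h1
    rw [if_neg (by omega)]
    omega

/-- The action of a permutation on an operation is its action on the labels of the half-edges. -/
theorem rel_can_act (p : T.Op) (n : ℕ) (σ : Equiv.Perm (Fin (n + 1))) (h hσ) :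
    ((can p).map (permL σ)).Rel (can (T.act p n σ h hσ)) := by
  have hn : T.arity p = n := h
  have hn' : T.arity (T.act p n σ h hσ) = n := T.length_act _ _ _ _ _
  refine ⟨n, σ, h, hσ, rfl, fun k => ?_⟩
  rw [getElem?_can _ (by rw [hn']; exact k.2), edges_map, List.getElem?_map,
    getElem?_can _ (by rw [hn]; exact (σ k).2)]
  simp [permL_coe]

/-- The operadic composite is the contraction of the two operations, with their half-edges labelled
by the corresponding half-edges of the composite. -/
theorem std_can {p q : T.Op} {i : ℕ} (h : (T.inputs p)[i]? = some (T.output q)) (e : ℤ) :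
    Std e ((can p).map (outL e i (T.arity q))) ((can q).map (innL e i)) (can (T.comp p i q h)) := by
  have hi : i < T.arity p := (List.getElem?_eq_some_iff.1 h).1
  refine ⟨i, h, ?_, by simp [Labelled.map, can, innL], eq_of_edges rfl ?_⟩
  · simp [Labelled.map, can, List.getElem?_range hi, outL]
  · have hN := arity_comp ((can p).map (outL e i (T.arity q))) i ((can q).map (innL e i)) h
    have hN' : T.arity (T.comp p i q h) + 1 = T.arity p + T.arity q := hN
    apply List.ext_getElem?
    intro k
    by_cases hk : k < T.arity (T.comp p i q h) + 1
    · rw [getElem?_can _ hk]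
      rcases edge_cases hi hN' hk with ⟨k, hk1, hk2, rfl⟩ | ⟨k, hk1, hk2, rfl⟩
      · have := edges_comp_outer ((can p).map (outL e i (T.arity q))) i
          ((can q).map (innL e i)) h hk2
        refine Eq.symm (this.trans ?_)
        rw [edges_map, List.getElem?_map, getElem?_can _ hk1, Option.map_some]
        congr 1
        simp only [outL, outerEdge]
        split_ifs <;> omega
      · have := edges_comp_inner ((can p).map (outL e i (T.arity q))) i
          ((can q).map (innL e i)) h hk2 hk1
        refine Eq.symm (this.trans ?_)
        rw [edges_map, List.getElem?_map, getElem?_can _ (by omega), Option.map_some]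
        congr 1
        simp only [innL, innerEdge]
        split_ifs <;> omega
    · rw [List.getElem?_eq_none, List.getElem?_eq_none]
      · rw [length_edges]; exact Nat.le_of_not_lt hk
      · rw [length_edges]; exact Nat.le_of_not_lt hk

/-- The labels of `x` are half-edges of `t` of the right colours, or the mark `-1`, and the output
of `t` is a label of the output of `x` only, unless the operad is cyclic. -/
structure Fits (t : T.Op) (x : Labelled T ℤ) : Prop where
  nodup : x.edges.Nodup
  cols : ∀ a ∈ x.cols, a.1 = -1 ∨ a ∈ (can t).cols
  orient : κ ≠ .cyclic → x.root ≤ 0 ∧ (0 ∈ x.edges → x.root = 0)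

theorem Fits.bounds {t : T.Op} {x : Labelled T ℤ} (h : Fits t x) {l : ℤ} (hl : l ∈ x.edges) :
    -1 ≤ l ∧ l ≤ T.arity t := by
  obtain ⟨c, hc⟩ := mem_edges_iff.1 hl
  rcases h.cols _ hc with h1 | h1
  · simp only at h1; omega
  · have := mem_can.1 (mem_edges_iff.2 ⟨_, h1⟩); omega

theorem Fits.rel {t : T.Op} {x y : Labelled T ℤ} (h : Fits t x) (hxy : x.Rel y) : Fits t y := by
  refine ⟨hxy.edges_perm.nodup_iff.2 h.1, fun a ha => h.2 a (hxy.cols_perm.subset ha),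
    fun hκ => ?_⟩
  rw [hxy.root_eq hκ, hxy.edges_perm.mem_iff]
  exact h.3 hκ

theorem meet_map {e : L'} {g g' : L → L'} {x y : Labelled T L} (hx : x.edges.Nodup)
    (hy : y.edges.Nodup) (h1 : ∀ a ∈ x.edges, ∀ b ∈ x.edges, g a = g b → a = b)
    (h2 : ∀ a ∈ y.edges, ∀ b ∈ y.edges, g' a = g' b → a = b)
    (h12 : ∀ a ∈ x.edges, ∀ b ∈ y.edges, g a = g' b → g a = e) : Meet e (x.map g) (y.map g') := by
  refine ⟨hx.map_on h1, hy.map_on h2, fun l ha hb => ?_⟩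
  obtain ⟨a, ha', rfl⟩ := mem_edges_map.1 ha
  obtain ⟨b, hb', hab⟩ := mem_edges_map.1 hb
  exact h12 a ha' b hb' hab.symm

theorem chain3_map {e f : L'} {g₁ g₂ g₃ : L → L'} {x y w : Labelled T L} (hx : x.edges.Nodup)
    (hy : y.edges.Nodup) (hw : w.edges.Nodup)
    (h1 : ∀ a ∈ x.edges, ∀ b ∈ x.edges, g₁ a = g₁ b → a = b)
    (h2 : ∀ a ∈ y.edges, ∀ b ∈ y.edges, g₂ a = g₂ b → a = b)
    (h3 : ∀ a ∈ w.edges, ∀ b ∈ w.edges, g₃ a = g₃ b → a = b)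
    (h12 : ∀ a ∈ x.edges, ∀ b ∈ y.edges, g₁ a = g₂ b → g₁ a = e)
    (h23 : ∀ a ∈ y.edges, ∀ b ∈ w.edges, g₂ a = g₃ b → g₂ a = f)
    (h13 : ∀ a ∈ x.edges, ∀ b ∈ w.edges, g₁ a ≠ g₃ b) :
    Chain3 e f (x.map g₁) (y.map g₂) (w.map g₃) := by
  refine ⟨meet_map hx hy h1 h2 h12, meet_map hy hw h2 h3 h23, fun l ha hb => ?_⟩
  obtain ⟨a, ha', rfl⟩ := mem_edges_map.1 ha
  obtain ⟨b, hb', hab⟩ := mem_edges_map.1 hb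
  exact h13 a ha' b hb' hab.symm

/-- `y` is glued to the elements of `A`, after relabelling by `g`. -/
def glueSet (e : ℤ) (A : Set (Labelled T ℤ)) (g : ℤ → ℤ) (y : Labelled T ℤ) :
    Set (Labelled T ℤ) :=
  {z | ∃ x ∈ A, Glue e (x.map g) y z}

/-- A relabelling after the first of two gluings can be done before it. -/
theorem glueSet_glueSet {e e' f : ℤ} {A : Set (Labelled T ℤ)} {g g' : ℤ → ℤ}
    {y w z : Labelled T ℤ} (he : g' e = e')
    (hA : ∀ x ∈ A, ∀ l ∈ x.edges, g' (g l) = e' → g l = e)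
    (hy : ∀ l ∈ y.edges, g' l = e' → l = e) :
    z ∈ glueSet f (glueSet e A g y) g' w ↔
      ∃ x ∈ A, ∃ t, Glue e' (x.map (g' ∘ g)) (y.map g') t ∧ Glue f t w z := by
  subst he
  have key : ∀ x ∈ A, ∀ t', Glue (g' e) (x.map (g' ∘ g)) (y.map g') t' ↔
      ∃ t, t' = t.map g' ∧ Glue e (x.map g) y t := by
    intro x hx t'
    rw [← map_map]
    refine glue_map (fun l hl => ?_) hy
    obtain ⟨a, ha, rfl⟩ := mem_edges_map.1 hl
    exact hA x hx a ha
  constructor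
  · rintro ⟨t, ⟨x, hx, h1⟩, h2⟩
    exact ⟨x, hx, _, (key x hx _).2 ⟨t, rfl, h1⟩, h2⟩
  · rintro ⟨x, hx, t', h1, h2⟩
    obtain ⟨t, rfl, h3⟩ := (key x hx _).1 h1
    exact ⟨t, ⟨x, hx, h3⟩, h2⟩

/-- The label of the joined half-edges can be chosen freely. -/
theorem glueSet_eq {e e' : ℤ} {A : Set (Labelled T ℤ)} {g g' : ℤ → ℤ} {y : Labelled T ℤ}
    {h h' : ℤ → ℤ}
    (hm : ∀ x ∈ A, Meet e (x.map g) (y.map h))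
    (hA : ∀ x ∈ A, ∀ l ∈ x.edges, (g l = e ∧ g' l = e') ∨ (g l ≠ e ∧ g l ≠ e' ∧ g' l = g l))
    (hy : ∀ l ∈ y.edges, (h l = e ∧ h' l = e') ∨ (h l ≠ e ∧ h l ≠ e' ∧ h' l = h l)) :
    glueSet e A g (y.map h) ⊆ glueSet e' A g' (y.map h') := by
  rintro z ⟨x, hx, hz⟩
  refine ⟨x, hx, ?_⟩
  let s : ℤ → ℤ := fun l => if l = e then e' else l
  have h1 : x.map g' = (x.map g).map s := by
    rw [map_map]
    refine map_congr fun l hl => ?_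
    rcases hA x hx l hl with ⟨h1, h2⟩ | ⟨h1, h2, h3⟩
    · simp [s, h1, h2]
    · simp [s, h1, h3]
  have h2 : y.map h' = (y.map h).map s := by
    rw [map_map]
    refine map_congr fun l hl => ?_
    rcases hy l hl with ⟨h1, h2⟩ | ⟨h1, h2, h3⟩
    · simp [s, h1, h2]
    · simp [s, h1, h3]
  have h3 : s e = e' := by simp [s]
  have h4 : z = z.map s := by
    refine (map_eq_self fun l hl => ?_).symm
    have := ((hz.mem_iff (hm x hx)).1 hl).1
    simp [s, this]
  rw [h1, h2, h4, ← h3]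
  refine (glue_map (fun l hl => ?_) (fun l hl => ?_)).2 ⟨z, rfl, hz⟩
  · obtain ⟨a, ha, rfl⟩ := mem_edges_map.1 hl
    rw [h3]
    rcases hA x hx a ha with ⟨h1, h2⟩ | ⟨h1, h2, -⟩
    · exact fun _ => h1
    · intro h5
      simp only [s, if_neg h1] at h5
      exact absurd h5 h2
  · obtain ⟨a, ha, rfl⟩ := mem_edges_map.1 hl
    rw [h3]
    rcases hy a ha with ⟨h1, h2⟩ | ⟨h1, h2, -⟩
    · exact fun _ => h1
    · intro h5
      simp only [s, if_neg h1] at h5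
      exact absurd h5 h2

/-- Composition with `q` at the input `i`. -/
def compL (A : Set (Labelled T ℤ)) (i : ℕ) (q : T.Op) : Set (Labelled T ℤ) :=
  glueSet (-2) A (outL (-2) i (T.arity q)) ((can q).map (innL (-2) i))

/-- Composition into the input `i` of `p`, for operations of arity `m`. -/
def compR (p : T.Op) (i : ℕ) (A : Set (Labelled T ℤ)) (m : ℕ) : Set (Labelled T ℤ) :=
  glueSet (-2) A (innL (-2) i) ((can p).map (outL (-2) i m))

theorem meet_outL {t : T.Op} {x : Labelled T ℤ} (hx : Fits t x) (e : ℤ) (he : e < -1) (i : ℕ)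
    (q : T.Op) : Meet e (x.map (outL e i (T.arity q))) ((can q).map (innL e i)) := by
  refine meet_map hx.1 (nodup_can q) ?_ ?_ ?_ <;> intro a ha b hb <;>
    (try have := hx.bounds ha) <;> (try have := hx.bounds hb) <;> (try have := mem_can.1 ha) <;>
    (try have := mem_can.1 hb) <;> simp only [outL, innL] <;> split_ifs <;> omega

theorem meet_innL {t : T.Op} {x : Labelled T ℤ} (hx : Fits t x) (e : ℤ) (he : e < -1) (i : ℕ)
    (p : T.Op) : Meet e (x.map (innL e i)) ((can p).map (outL e i (T.arity t))) := by
  refine meet_map hx.1 (nodup_can p) ?_ ?_ ?_ <;> intro a ha b hb <;>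
    (try have := hx.bounds ha) <;> (try have := hx.bounds hb) <;> (try have := mem_can.1 ha) <;>
    (try have := mem_can.1 hb) <;> simp only [outL, innL] <;> split_ifs <;> omega

/-- The label of the joined half-edges need not be `-2`, which is thus left free for a further
composition. -/
theorem compL_eq {t : T.Op} {A : Set (Labelled T ℤ)} (hA : ∀ x ∈ A, Fits t x) (e : ℤ)
    (he : e < -1) (i : ℕ) (q : T.Op) :
    compL A i q = glueSet e A (outL e i (T.arity q)) ((can q).map (innL e i)) := by
  refine Set.Subset.antisymm ?_ ?_ <;>
    refine glueSet_eq (fun x hx => meet_outL (hA x hx) _ (by omega) _ _) (fun x hx l hl => ?_)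
      (fun l hl => ?_) <;>
    (try have := (hA x hx).bounds hl) <;> (try have := mem_can.1 hl) <;>
    simp only [outL, innL] <;> split_ifs <;> omega

/-- The label of the joined half-edges need not be `-2`, which is thus left free for a further
composition. -/
theorem compR_eq {t : T.Op} {A : Set (Labelled T ℤ)} (hA : ∀ x ∈ A, Fits t x) (e : ℤ)
    (he : e < -1) (i : ℕ) (p : T.Op) :
    compR p i A (T.arity t) = glueSet e A (innL e i) ((can p).map (outL e i (T.arity t))) := by
  refine Set.Subset.antisymm ?_ ?_ <;>
    refine glueSet_eq (fun x hx => meet_innL (hA x hx) _ (by omega) _ _) (fun x hx l hl => ?_)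
      (fun l hl => ?_) <;>
    (try have := (hA x hx).bounds hl) <;> (try have := mem_can.1 hl) <;>
    simp only [outL, innL] <;> split_ifs <;> omega

variable {A : Set (Labelled T ℤ)} {t : T.Op}

/-! ### Associativity of the composition of sets -/

theorem arity_comp_op {p q : T.Op} {i : ℕ} (h : (T.inputs p)[i]? = some (T.output q)) :
    T.arity (T.comp p i q h) + 1 = T.arity p + T.arity q ∧ i < T.arity p :=
  ⟨arity_comp (can p) i (can q) h, (List.getElem?_eq_some_iff.1 h).1⟩

theorem contr_can_map {p q : T.Op} {i : ℕ} (h : (T.inputs p)[i]? = some (T.output q)) {e : ℤ}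
    (g g₁ g₂ : ℤ → ℤ) (he : g (-2) = e)
    (h₁ : ∀ l : ℤ, 0 ≤ l → l ≤ T.arity p → g₁ l = g (outL (-2) i (T.arity q) l))
    (h₂ : ∀ l : ℤ, 0 ≤ l → l ≤ T.arity q → g₂ l = g (innL (-2) i l)) :
    Contr e ((can p).map g₁) ((can q).map g₂) ((can (T.comp p i q h)).map g) := by
  have := ((std_can h (-2)).map g).contr
  rw [map_map, map_map, he] at this
  rwa [map_congr (g := g₁) fun l hl => h₁ l (mem_can.1 hl).1 (mem_can.1 hl).2,
    map_congr (g := g₂) fun l hl => h₂ l (mem_can.1 hl).1 (mem_can.1 hl).2]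

/-- Gluing two operations that are joined to each other amounts to gluing their composite; the
hypotheses say that the relabellings on both sides agree. -/
theorem glueSet_chain {e e' f : ℤ} {A : Set (Labelled T ℤ)} {g g' g'' h k : ℤ → ℤ}
    {y w v : Labelled T ℤ} (he : g' e = e')
    (hA : ∀ x ∈ A, ∀ l ∈ x.edges, (g' (g l) = e' → g l = e) ∧ g' (g l) = g'' l)
    (hy : ∀ l ∈ y.edges, g' (h l) = e' → h l = e)
    (hc : ∀ x ∈ A, Chain3 e' f (x.map g'') (y.map (g' ∘ h)) (w.map k))
    (hv : Contr f (y.map (g' ∘ h)) (w.map k) v) :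
    glueSet f (glueSet e A g (y.map h)) g' (w.map k) = glueSet e' A g'' v := by
  ext z
  rw [glueSet_glueSet he (fun x hx l hl => (hA x hx l hl).1)]
  · refine exists_congr fun x => and_congr_right fun hx => ?_
    rw [map_congr (g := g' ∘ g) fun l hl => (hA x hx l hl).2, map_map]
    exact glue_chain (hc x hx) hv
  · intro l hl
    obtain ⟨a, ha, rfl⟩ := mem_edges_map.1 hl
    exact hy a ha

/-- Operations that are glued at different labels can be glued in any order; the hypotheses say that
the relabellings on both sides agree. -/
theorem glueSet_comm {e e' f a b : ℤ} {A : Set (Labelled T ℤ)} {g g' g₂ g₂' h h₂ k k₂ : ℤ → ℤ}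
    {y w : Labelled T ℤ} (he : g' e = e') (hf : g₂' a = f)
    (hA : ∀ x ∈ A, ∀ l ∈ x.edges, (g' (g l) = e' → g l = e) ∧ g' (g l) = g₂' (g₂ l) ∧
      (g₂' (g₂ l) = f → g₂ l = a))
    (hy : ∀ l ∈ y.edges, (g' (h l) = e' → h l = e) ∧ g' (h l) = h₂ l)
    (hw : ∀ l ∈ w.edges, (g₂' (k₂ l) = f → k₂ l = a) ∧ g₂' (k₂ l) = k l)
    (hc : ∀ x ∈ A, Chain3 e' f (y.map h₂) (x.map (g' ∘ g)) (w.map k))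
    (hey : b ∈ y.edges ∧ h₂ b = e') {b' : ℤ} (hfw : b' ∈ w.edges ∧ k b' = f) :
    glueSet f (glueSet e A g (y.map h)) g' (w.map k) =
      glueSet e' (glueSet a A g₂ (w.map k₂)) g₂' (y.map h₂) := by
  ext z
  rw [glueSet_glueSet he (fun x hx l hl => (hA x hx l hl).1),
    glueSet_glueSet hf (fun x hx l hl => (hA x hx l hl).2.2)]
  · refine exists_congr fun x => and_congr_right fun hx => ?_
    have e1 : x.map (g₂' ∘ g₂) = x.map (g' ∘ g) :=
      map_congr fun l hl => (hA x hx l hl).2.1.symm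
    have e2 : y.map (g' ∘ h) = y.map h₂ := map_congr fun l hl => (hy l hl).2
    have e3 : w.map (g₂' ∘ k₂) = w.map k := map_congr fun l hl => (hw l hl).2
    rw [map_map, map_map, e1, e2, e3]
    exact glue_comm (hc x hx) (mem_edges_map.2 ⟨b, hey⟩) (mem_edges_map.2 ⟨b', hfw⟩)
  · intro l hl
    obtain ⟨a, ha, rfl⟩ := mem_edges_map.1 hl
    exact (hw a ha).1
  · intro l hl
    obtain ⟨a, ha, rfl⟩ := mem_edges_map.1 hl
    exact (hy a ha).1

/-- This and the following five lemmas are the associativity laws for a set of labelled operations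
and two operations of `T`. In each of them the half-edges joined first are labelled by `-3`, the
label `-2` being used for the others, and the relabellings are compared by cases. -/
theorem compL_compL_inner (hA : ∀ x ∈ A, Fits t x) {q r : T.Op} {i j : ℕ}
    (h : (T.inputs q)[j]? = some (T.output r)) :
    compL (compL A i q) (i + j) r = compL A i (T.comp q j r h) := by
  obtain ⟨har, hj⟩ := arity_comp_op h
  rw [compL_eq hA (-3) (by norm_num) i q, compL_eq hA (-3) (by norm_num), compL]
  refine glueSet_chain ?_ (fun x hx l hl => ?_) (fun l hl => ?_) (fun x hx => ?_)
    (contr_can_map h _ _ _ ?_ ?_ ?_)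
  · simp only [outL]; split_ifs <;> omega
  · have := (hA x hx).bounds hl
    simp only [outL]; split_ifs <;> omega
  · have := mem_can.1 hl
    simp only [outL, innL]; split_ifs <;> omega
  · refine chain3_map (hA x hx).1 (nodup_can _) (nodup_can _) ?_ ?_ ?_ ?_ ?_ ?_ <;>
      intro a ha b hb <;> (try have := (hA x hx).bounds ha) <;> (try have := (hA x hx).bounds hb) <;>
      (try have := mem_can.1 ha) <;> (try have := mem_can.1 hb) <;>
      simp only [outL, innL, Function.comp] <;> split_ifs <;> omega
  · simp only [innL]; split_ifs <;> first | omega | contradiction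
  · intro l h1 h2
    simp only [outL, innL, Function.comp]; split_ifs <;> first | omega | contradiction
  · intro l h1 h2
    simp only [innL]; split_ifs <;> first | omega | contradiction

theorem compL_compR_inner (hA : ∀ x ∈ A, Fits t x) {p r : T.Op} {i j : ℕ}
    (hi : i < T.arity p) {u : T.Op} (hu : T.arity u + 1 = T.arity t + T.arity r)
    (hj : j < T.arity t) (hA' : ∀ x ∈ compL A j r, Fits u x) :
    compL (compR p i A (T.arity t)) (i + j) r = compR p i (compL A j r) (T.arity u) := by
  rw [compR_eq hA (-3) (by norm_num) i p, compR_eq hA' (-3) (by norm_num), compL, compL]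
  refine glueSet_comm (b := i + 1) (b' := 0) ?_ ?_ (fun x hx l hl => ?_) (fun l hl => ?_)
    (fun l hl => ?_) (fun x hx => ?_) ⟨mem_can.2 ?_, ?_⟩ ⟨mem_can.2 ?_, ?_⟩
  · simp only [outL]; split_ifs <;> omega
  · simp only [innL]; split_ifs <;> first | omega | contradiction
  · have := (hA x hx).bounds hl
    simp only [outL, innL]; split_ifs <;> first | omega | contradiction
  · have := mem_can.1 hl
    simp only [outL]; split_ifs <;> omega
  · have := mem_can.1 hl
    simp only [innL]; split_ifs <;> first | omega | contradiction
  · refine chain3_map (nodup_can _) (hA x hx).1 (nodup_can _) ?_ ?_ ?_ ?_ ?_ ?_ <;>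
      intro a ha b hb <;> (try have := (hA x hx).bounds ha) <;> (try have := (hA x hx).bounds hb) <;>
      (try have := mem_can.1 ha) <;> (try have := mem_can.1 hb) <;>
      simp only [outL, innL, Function.comp] <;> split_ifs <;> omega
  · omega
  · simp [outL]
  · omega
  · simp [innL]

theorem compR_compR (hA : ∀ x ∈ A, Fits t x) {p q : T.Op} {i j : ℕ}
    (h : (T.inputs p)[i]? = some (T.output q)) (hj : j < T.arity q) {u : T.Op}
    (hu : T.arity u + 1 = T.arity q + T.arity t) :
    compR (T.comp p i q h) (i + j) A (T.arity t) =
      compR p i (compR q j A (T.arity t)) (T.arity u) := by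
  obtain ⟨har, hi⟩ := arity_comp_op h
  rw [compR_eq hA (-3) (by norm_num) _ (T.comp p i q h), compR_eq hA (-3) (by norm_num) j q, compR]
  refine (glueSet_chain ?_ (fun x hx l hl => ?_) (fun l hl => ?_) (fun x hx => ?_)
    (contr_can_map h _ _ _ ?_ ?_ ?_).symm).symm
  · simp only [innL]; split_ifs <;> first | omega | contradiction
  · have := (hA x hx).bounds hl
    simp only [innL]; split_ifs <;> first | omega | contradiction
  · have := mem_can.1 hl
    simp only [outL, innL]; split_ifs <;> omega
  · refine chain3_map (hA x hx).1 (nodup_can _) (nodup_can _) ?_ ?_ ?_ ?_ ?_ ?_ <;>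
      intro a ha b hb <;> (try have := (hA x hx).bounds ha) <;> (try have := (hA x hx).bounds hb) <;>
      (try have := mem_can.1 ha) <;> (try have := mem_can.1 hb) <;>
      simp only [outL, innL, Function.comp] <;> split_ifs <;> first | omega | contradiction
  · simp only [outL]; split_ifs <;> omega
  · intro l h1 h2
    simp only [outL]; split_ifs <;> omega
  · intro l h1 h2
    simp only [innL, outL, Function.comp]; split_ifs <;> first | omega | contradiction

theorem compL_compL_comm (hA : ∀ x ∈ A, Fits t x) {q r : T.Op} {i j : ℕ} {u : T.Op}
    (hA' : ∀ x ∈ compL A (i + j + 1) r, Fits u x) :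
    compL (compL A i q) (i + j + T.arity q) r = compL (compL A (i + j + 1) r) i q := by
  rw [compL_eq hA (-3) (by norm_num) i q, compL_eq hA' (-3) (by norm_num), compL, compL]
  refine glueSet_comm (b := 0) (b' := 0) ?_ ?_ (fun x hx l hl => ?_) (fun l hl => ?_)
    (fun l hl => ?_) (fun x hx => ?_) ⟨mem_can.2 ?_, ?_⟩ ⟨mem_can.2 ?_, ?_⟩
  · simp only [outL]; split_ifs <;> omega
  · simp only [outL]; split_ifs <;> omega
  · have := (hA x hx).bounds hl
    simp only [outL]; push_cast; split_ifs <;> omega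
  · have := mem_can.1 hl
    simp only [outL, innL]; push_cast; split_ifs <;> omega
  · have := mem_can.1 hl
    simp only [innL, outL]; push_cast; split_ifs <;> omega
  · refine chain3_map (nodup_can _) (hA x hx).1 (nodup_can _) ?_ ?_ ?_ ?_ ?_ ?_ <;>
      intro a ha b hb <;> (try have := (hA x hx).bounds ha) <;> (try have := (hA x hx).bounds hb) <;>
      (try have := mem_can.1 ha) <;> (try have := mem_can.1 hb) <;>
      simp only [outL, innL, Function.comp] <;> push_cast <;> split_ifs <;> omega
  · omega
  · simp [innL]
  · omega
  · simp [innL]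

theorem compL_compR_outer (hA : ∀ x ∈ A, Fits t x) {p r : T.Op} {i j : ℕ}
    (h : (T.inputs p)[i + j + 1]? = some (T.output r)) :
    compL (compR p i A (T.arity t)) (i + j + T.arity t) r =
      compR (T.comp p (i + j + 1) r h) i A (T.arity t) := by
  obtain ⟨har, hi⟩ := arity_comp_op h
  rw [compR_eq hA (-3) (by norm_num) _ (T.comp p _ r h), compR_eq hA (-3) (by norm_num) i p, compL]
  refine (glueSet_chain ?_ (fun x hx l hl => ?_) (fun l hl => ?_) (fun x hx => ?_)
    (contr_can_map h _ _ _ ?_ ?_ ?_))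
  · simp only [outL]; split_ifs <;> omega
  · have := (hA x hx).bounds hl
    simp only [innL, outL]; push_cast; split_ifs <;> omega
  · have := mem_can.1 hl
    simp only [outL]; push_cast; split_ifs <;> omega
  · refine chain3_map (hA x hx).1 (nodup_can _) (nodup_can _) ?_ ?_ ?_ ?_ ?_ ?_ <;>
      intro a ha b hb <;> (try have := (hA x hx).bounds ha) <;> (try have := (hA x hx).bounds hb) <;>
      (try have := mem_can.1 ha) <;> (try have := mem_can.1 hb) <;>
      simp only [outL, innL, Function.comp] <;> push_cast <;> split_ifs <;> omega
  · simp only [outL]; split_ifs <;> omega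
  · intro l h1 h2
    simp only [outL, Function.comp]; push_cast; split_ifs <;> omega
  · intro l h1 h2
    simp only [innL, outL]; push_cast; split_ifs <;> omega

theorem compR_comp_outer (hA : ∀ x ∈ A, Fits t x) {p q : T.Op} {i j : ℕ}
    (h : (T.inputs p)[i]? = some (T.output q)) :
    compR (T.comp p i q h) (i + j + T.arity q) A (T.arity t) =
      compL (compR p (i + j + 1) A (T.arity t)) i q := by
  obtain ⟨har, hi⟩ := arity_comp_op h
  rw [compR_eq hA (-3) (by norm_num) _ (T.comp p i q h),
    compR_eq hA (-3) (by norm_num) (i + j + 1) p, compL]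
  refine (glueSet_chain ?_ (fun x hx l hl => ?_) (fun l hl => ?_) (fun x hx => ?_)
    (contr_can_map h _ _ _ ?_ ?_ ?_)).symm
  · simp only [outL]; split_ifs <;> omega
  · have := (hA x hx).bounds hl
    simp only [innL, outL]; push_cast; split_ifs <;> omega
  · have := mem_can.1 hl
    simp only [outL]; push_cast; split_ifs <;> omega
  · refine chain3_map (hA x hx).1 (nodup_can _) (nodup_can _) ?_ ?_ ?_ ?_ ?_ ?_ <;>
      intro a ha b hb <;> (try have := (hA x hx).bounds ha) <;> (try have := (hA x hx).bounds hb) <;>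
      (try have := mem_can.1 ha) <;> (try have := mem_can.1 hb) <;>
      simp only [outL, innL, Function.comp] <;> push_cast <;> split_ifs <;> omega
  · simp only [outL]; split_ifs <;> omega
  · intro l h1 h2
    simp only [outL, Function.comp]; push_cast; split_ifs <;> omega
  · intro l h1 h2
    simp only [innL, outL]; push_cast; split_ifs <;> omega

/-! ### Permutations and identities acting on sets -/

theorem glueSet_closed {e : ℤ} {g : ℤ → ℤ} {y z z' : Labelled T ℤ} (hz : z ∈ glueSet e A g y)
    (h : z.Rel z') : z' ∈ glueSet e A g y := by
  obtain ⟨x, hx, hz⟩ := hz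
  exact ⟨x, hx, hz.congr (.refl _) (.refl _) h⟩

theorem Fits.glue_cols {x y z : Labelled T ℤ} {u : T.Op} {g : ℤ → ℤ} (hx : Fits t x)
    (hm : Meet (-2) (x.map g) y) (hg : g (-1) = -1)
    (hp : Contr (-2) ((can t).map g) y (can u)) (hz : Glue (-2) (x.map g) y z) :
    ∀ a ∈ z.cols, a.1 = -1 ∨ a ∈ (can u).cols := by
  intro a ha
  have hne : a.1 ≠ -2 := ((hz.mem_iff hm).1 (mem_edges_iff.2 ⟨a.2, ha⟩)).1
  obtain ⟨c, hc⟩ := hp.cols_perm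
  have key : a ∈ ((can t).map g).cols ++ y.cols → a ∈ (can u).cols := by
    intro h
    have h1 := hc.symm.subset h
    simp only [List.mem_cons] at h1
    rcases h1 with rfl | rfl | h1
    · exact absurd rfl hne
    · exact absurd rfl hne
    · exact h1
  rcases hz.cols_subset ha with h1 | h1
  · rw [cols_map] at h1
    obtain ⟨b, hb, rfl⟩ := List.mem_map.1 h1
    rcases hx.cols b hb with h2 | h2
    · left; simp [h2, hg]
    · right
      refine key (List.mem_append_left _ ?_)
      rw [cols_map]
      exact List.mem_map.2 ⟨b, h2, rfl⟩
  · exact .inr (key (List.mem_append_right _ h1))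

/-- The colours and the position of the output are preserved by composition. -/
theorem compL_fits (hA : ∀ x ∈ A, Fits t x) {i : ℕ} {q : T.Op}
    (h : (T.inputs t)[i]? = some (T.output q)) : ∀ z ∈ compL A i q, Fits (T.comp t i q h) z := by
  rintro z ⟨x, hx, hz⟩
  have hx := hA x hx
  have hm := meet_outL hx (-2) (by norm_num) i q
  refine ⟨hz.nodup hm, hx.glue_cols hm ?_ (std_can h (-2)).contr hz, fun hκ => ?_⟩
  · simp only [outL]; split_ifs <;> omega
  · obtain ⟨h1, h2⟩ := hx.orient hκ
    have h3 : (x.map (outL (-2) i (T.arity q))).root = x.root := by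
      simp only [Labelled.map, outL]; split_ifs <;> omega
    have h4 : z.root = x.root := by
      rcases hz with ⟨h5, hz⟩ | ⟨h5, hz⟩
      · rcases hz.orient hκ hm with ⟨h6, h7, h8⟩ | ⟨h6, h7, h8⟩
        · rw [h8, h3]
        · rw [h3] at h7
          have := hx.bounds (l := x.root) List.mem_cons_self
          omega
      · rw [hz.root_eq hκ, h3]
    rw [h4]
    refine ⟨h1, fun h0 => h2 ?_⟩
    rcases ((hz.mem_iff hm).1 h0).2 with h5 | ⟨-, h5⟩
    · obtain ⟨l, hl, hl'⟩ := mem_edges_map.1 h5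
      have := hx.bounds hl
      have h6 : l = 0 := by
        simp only [outL] at hl'; split_ifs at hl' <;> omega
      exact h6 ▸ hl
    · obtain ⟨l, hl, hl'⟩ := mem_edges_map.1 h5
      have := mem_can.1 hl
      simp only [innL] at hl'; split_ifs at hl' <;> omega

theorem compR_fits (hA : ∀ x ∈ A, Fits t x) {i : ℕ} {p : T.Op}
    (h : (T.inputs p)[i]? = some (T.output t)) :
    ∀ z ∈ compR p i A (T.arity t), Fits (T.comp p i t h) z := by
  rintro z ⟨x, hx, hz⟩
  have hx := hA x hx
  have hm := meet_innL hx (-2) (by norm_num) i p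
  refine ⟨hz.nodup hm, hx.glue_cols hm ?_ (std_can h (-2)).contr.symm hz, fun hκ => ?_⟩
  · simp [innL]
  · obtain ⟨h1, h2⟩ := hx.orient hκ
    have hb := hx.bounds (l := x.root) List.mem_cons_self
    have hmem : -2 ∈ (x.map (innL (-2) i)).edges ↔ 0 ∈ x.edges := by
      constructor
      · intro h3
        obtain ⟨l, hl, hl'⟩ := mem_edges_map.1 h3
        have := hx.bounds hl
        have h6 : l = 0 := by
          simp only [innL] at hl'; split_ifs at hl' <;> omega
        exact h6 ▸ hl
      · intro h3
        exact mem_edges_map.2 ⟨0, h3, by simp [innL]⟩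
    rcases hz with ⟨h5, hz⟩ | ⟨h5, hz⟩
    · have h6 := h2 (hmem.1 h5)
      rcases hz.orient hκ hm with ⟨h7, -, -⟩ | ⟨-, -, h8⟩
      · have h8 : (x.map (innL (-2) i)).root = -2 := by simp [Labelled.map, innL, h6]
        have := hm.1
        rw [edges, List.nodup_cons, h8] at this
        exact absurd h7 this.1
      · have h9 : z.root = 0 := by
          rw [h8]; simp only [Labelled.map, can, outL]; split_ifs <;> omega
        rw [h9]
        exact ⟨le_rfl, fun _ => rfl⟩
    · have h6 : x.root ≠ 0 := fun hc => h5 (hmem.2 (hc ▸ List.mem_cons_self))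
      have h7 : z.root = -1 := by
        rw [hz.root_eq hκ]; simp only [Labelled.map, innL]; split_ifs <;> omega
      rw [h7]
      refine ⟨by norm_num, fun h0 => ?_⟩
      obtain ⟨l, hl, hl'⟩ := mem_edges_map.1 (hz.edges_perm.subset h0)
      have := hx.bounds hl
      simp only [innL] at hl'; split_ifs at hl' <;> omega

/-- Renumbering of the half-edges. -/
def actS {n : ℕ} (σ : Equiv.Perm (Fin (n + 1))) (A : Set (Labelled T ℤ)) : Set (Labelled T ℤ) :=
  Labelled.map (permL σ) '' A

theorem actS_closed {n : ℕ} (σ : Equiv.Perm (Fin (n + 1)))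
    (hA : ∀ x ∈ A, ∀ y, x.Rel y → y ∈ A) : ∀ x ∈ actS σ A, ∀ y, x.Rel y → y ∈ actS σ A := by
  rintro _ ⟨x, hx, rfl⟩ y h
  obtain ⟨y, h1, rfl⟩ := h.of_map
  exact ⟨y, hA x hx y h1, rfl⟩

theorem actS_fits {n : ℕ} {σ : Equiv.Perm (Fin (n + 1))} (hA : ∀ x ∈ A, Fits t x)
    (h : (T.inputs t).length = n) (hσ : κ.Allows σ) :
    ∀ x ∈ actS σ A, Fits (T.act t n σ h hσ) x := by
  rintro _ ⟨x, hx, rfl⟩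
  have hx := hA x hx
  refine ⟨hx.1.map (permL_injective σ), fun a ha => ?_, fun hκ => ?_⟩
  · rw [cols_map] at ha
    obtain ⟨b, hb, rfl⟩ := List.mem_map.1 ha
    rcases hx.cols b hb with h1 | h1
    · left; rw [h1]; exact permL_of_neg σ (l := -1) (by norm_num)
    · right
      refine (rel_can_act t n σ h hσ).cols_perm.symm.subset ?_
      rw [cols_map]
      exact List.mem_map.2 ⟨b, h1, rfl⟩
  · have h0 : permL σ 0 = 0 := by
      have := permL_coe σ 0
      rw [hσ.map_zero hκ] at this
      simpa using this
    obtain ⟨h1, h2⟩ := hx.orient hκ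
    have h3 : permL σ x.root = x.root := by
      rcases lt_or_eq_of_le h1 with h4 | h4
      · exact permL_of_neg _ h4
      · rw [h4, h0]
    have h5 : (x.map (permL σ)).root = x.root := h3
    rw [h5]
    refine ⟨h1, fun h4 => h2 ?_⟩
    obtain ⟨l, hl, hl'⟩ := mem_edges_map.1 h4
    rwa [permL_injective σ (hl'.trans h0.symm)] at hl

theorem actS_one {n : ℕ} (A : Set (Labelled T ℤ)) :
    actS (1 : Equiv.Perm (Fin (n + 1))) A = A := by
  have : ∀ x : Labelled T ℤ, x.map (permL (1 : Equiv.Perm (Fin (n + 1)))) = x := fun x =>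
    map_eq_self fun l _ => permL_one l
  simp [actS, this]

theorem actS_mul {n : ℕ} (σ ρ : Equiv.Perm (Fin (n + 1))) (A : Set (Labelled T ℤ)) :
    actS ρ (actS σ A) = actS (σ * ρ) A := by
  rw [actS, actS, actS, Set.image_image]
  refine Set.image_congr fun x _ => ?_
  rw [map_map]
  exact map_congr fun l _ => (permL_mul σ ρ l).symm

theorem mem_cols_can {p : T.Op} {k : ℕ} {c : C} (h : ((k : ℤ), c) ∈ (can p).cols) :
    (T.hedges p)[k]? = some c := by
  obtain ⟨i, hi⟩ := List.mem_iff_getElem?.1 h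
  rw [cols, List.getElem?_zip_eq_some] at hi
  have h1 : i < (can p).edges.length := (List.getElem?_eq_some_iff.1 hi.1).1
  rw [length_edges] at h1
  rw [getElem?_can p h1] at hi
  have : i = k := by simpa using hi.1
  exact this ▸ hi.2

/-- Composition with an identity operation at the input `i`. The contraction with the identity
relabels the half-edge `i + 1` by itself, if it is present. -/
theorem compL_one (hA : ∀ x ∈ A, Fits t x) (hA' : ∀ x ∈ A, ∀ y, x.Rel y → y ∈ A) {i : ℕ} {c : C}
    (h : (T.inputs t)[i]? = some (T.output (T.one c))) : compL A i (T.one c) = A := by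
  have har : T.arity (T.one c) = 1 := by rw [arity, T.inputs_one]; rfl
  have key : ∀ x ∈ A, ∀ z, Glue (-2) (x.map (outL (-2) i 1)) ((can (T.one c)).map (innL (-2) i)) z ↔
      x.Rel z := by
    intro x hx z
    have hx := hA x hx
    have hm := meet_outL hx (-2) (by norm_num) i (T.one c)
    rw [har] at hm
    have hmem : -2 ∈ (x.map (outL (-2) i 1)).edges ↔ (i + 1 : ℤ) ∈ x.edges := by
      rw [mem_edges_map]
      constructor
      · rintro ⟨l, hl, hl'⟩
        have := hx.bounds hl
        have h6 : l = i + 1 := by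
          simp only [outL] at hl'; split_ifs at hl' <;> omega
        exact h6 ▸ hl
      · intro h3
        exact ⟨_, h3, by simp [outL]⟩
    by_cases hi : (i + 1 : ℤ) ∈ x.edges
    · have h1 : Contr (-2) (x.map (outL (-2) i 1)) ((can (T.one c)).map (innL (-2) i)) x := by
        obtain ⟨d, hd⟩ := mem_edges_iff.1 hi
        have hdc : d = c := by
          have h1 := (hx.cols _ hd).resolve_left (by simp only; omega)
          have h2 := mem_cols_can (p := t) (c := d) (k := i + 1) (by exact_mod_cast h1)
          rw [hedges, List.getElem?_cons_succ, h, T.output_one] at h2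
          exact (Option.some.inj h2).symm
        have h2 := contr_one (e := -2) (e' := (i + 1 : ℤ)) (c := c) hm.1
          (i := (can (T.one c)).map (innL (-2) i))
          (by rw [cols_map]; exact List.mem_map.2 ⟨_, hd, by simp [outL, hdc]⟩) rfl
          (.inl ⟨by rw [edges_map, edges_can, har]; simp [List.range_succ, innL], fun hκ => ?_⟩)
        · rw [map_map] at h2
          convert h2 using 1
          refine (map_eq_self fun l hl => ?_).symm
          have := hx.bounds hl
          simp only [Function.comp, outL]; push_cast; split_ifs <;> omega
        · obtain ⟨h3, -⟩ := hx.orient hκ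
          refine mem_ins_of_ne (hmem.2 hi) ?_
          have := hx.bounds (l := x.root) List.mem_cons_self
          simp only [Labelled.map, outL]; split_ifs <;> omega
      constructor
      · rintro (⟨-, h2⟩ | ⟨h2, -⟩)
        · exact h1.rel hm h2
        · exact absurd (hmem.2 hi) h2
      · intro h2
        exact .inl ⟨hmem.2 hi, h1.congr (.refl _) (.refl _) h2⟩
    · have h1 : x.map (outL (-2) i 1) = x := by
        refine map_eq_self fun l hl => ?_
        have : l ≠ i + 1 := fun hc => hi (hc ▸ hl)
        simp only [outL]; push_cast; split_ifs <;> omega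
      rw [Glue, hmem, h1]
      simp [hi]
  rw [compL, har]
  ext z
  constructor
  · rintro ⟨x, hx, hz⟩
    exact hA' x hx z ((key x hx z).1 hz)
  · intro hz
    exact ⟨z, hz, (key z hz z).2 (.refl _)⟩

/-- Composition into an identity operation. The contraction with the identity relabels the half-edge
`0` by itself, if it is present. -/
theorem compR_one (hA : ∀ x ∈ A, Fits t x) (hA' : ∀ x ∈ A, ∀ y, x.Rel y → y ∈ A) {c : C}
    (h : (T.inputs (T.one c))[0]? = some (T.output t)) : compR (T.one c) 0 A (T.arity t) = A := by
  have har : T.arity (T.one c) = 1 := by rw [arity, T.inputs_one]; rfl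
  have key : ∀ x ∈ A, ∀ z, Glue (-2) (x.map (innL (-2) 0))
      ((can (T.one c)).map (outL (-2) 0 (T.arity t))) z ↔ x.Rel z := by
    intro x hx z
    have hx := hA x hx
    have hm := meet_innL hx (-2) (by norm_num) 0 (T.one c)
    have hmem : -2 ∈ (x.map (innL (-2) 0)).edges ↔ 0 ∈ x.edges := by
      rw [mem_edges_map]
      constructor
      · rintro ⟨l, hl, hl'⟩
        have := hx.bounds hl
        have h6 : l = 0 := by
          simp only [innL] at hl'; split_ifs at hl' <;> omega
        exact h6 ▸ hl
      · intro h3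
        exact ⟨_, h3, by simp [innL]⟩
    by_cases hi : 0 ∈ x.edges
    · have h1 : Contr (-2) (x.map (innL (-2) 0))
          ((can (T.one c)).map (outL (-2) 0 (T.arity t))) x := by
        obtain ⟨d, hd⟩ := mem_edges_iff.1 hi
        have hdc : d = c := by
          have h1 := (hx.cols _ hd).resolve_left (by norm_num)
          have h2 := mem_cols_can (p := t) (c := d) (k := 0) (by exact_mod_cast h1)
          rw [T.inputs_one] at h
          simp only [hedges, List.getElem?_cons_zero, Option.some.injEq] at h h2
          rw [h, h2]
        have h2 := contr_one (e := -2) (e' := (0 : ℤ)) (c := c) hm.1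
          (i := (can (T.one c)).map (outL (-2) 0 (T.arity t)))
          (by rw [cols_map]; exact List.mem_map.2 ⟨_, hd, by simp [innL, hdc]⟩) rfl
          (.inr ⟨by rw [edges_map, edges_can, har]; simp [List.range_succ, outL], fun hκ => ?_⟩)
        · rw [map_map] at h2
          convert h2 using 1
          refine (map_eq_self fun l hl => ?_).symm
          have := hx.bounds hl
          simp only [Function.comp, innL]; push_cast; split_ifs <;> omega
        · obtain ⟨-, h3⟩ := hx.orient hκ
          simp [Labelled.map, innL, h3 hi]
      constructor
      · rintro (⟨-, h2⟩ | ⟨h2, -⟩)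
        · exact h1.rel hm h2
        · exact absurd (hmem.2 hi) h2
      · intro h2
        exact .inl ⟨hmem.2 hi, h1.congr (.refl _) (.refl _) h2⟩
    · have h1 : x.map (innL (-2) 0) = x := by
        refine map_eq_self fun l hl => ?_
        have : l ≠ 0 := fun hc => hi (hc ▸ hl)
        simp only [innL]; push_cast; split_ifs <;> omega
      rw [Glue, hmem, h1]
      simp [hi]
  rw [compR]
  ext z
  constructor
  · rintro ⟨x, hx, hz⟩
    exact hA' x hx z ((key x hx z).1 hz)
  · intro hz
    exact ⟨z, hz, (key z hz z).2 (.refl _)⟩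

/-! ### Equivariance -/

/-- As the label of the joined half-edges is negative, it is not moved by the permutation. -/
theorem mem_actS_glueSet {N : ℕ} {π : Equiv.Perm (Fin (N + 1))} {g : ℤ → ℤ}
    {y z : Labelled T ℤ} :
    z ∈ actS π (glueSet (-2) A g y) ↔
      ∃ x ∈ A, Glue (-2) (x.map (permL π ∘ g)) (y.map (permL π)) z := by
  have h2 : permL π (-2) = -2 := permL_of_neg _ (by norm_num)
  have key : ∀ x : Labelled T ℤ, ∀ z, Glue (-2) (x.map (permL π ∘ g)) (y.map (permL π)) z ↔
      ∃ z', z = z'.map (permL π) ∧ Glue (-2) (x.map g) y z' := by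
    intro x z
    have := glue_map (e := -2) (x := x.map g) (y := y) (g := permL π) (z' := z)
      (fun l _ h => permL_injective π h) (fun l _ h => permL_injective π h)
    rwa [h2, map_map] at this
  constructor
  · rintro ⟨z, ⟨x, hx, hz⟩, rfl⟩
    exact ⟨x, hx, (key x _).2 ⟨z, rfl, hz⟩⟩
  · rintro ⟨x, hx, hz⟩
    obtain ⟨z', rfl, hz'⟩ := (key x z).1 hz
    exact ⟨z', ⟨x, hx, hz'⟩, rfl⟩

/-- Equivariance of gluing. -/
theorem glueSet_actS {n N : ℕ} {σ : Equiv.Perm (Fin (n + 1))} {π : Equiv.Perm (Fin (N + 1))}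
    {g g' : ℤ → ℤ} {y y' : Labelled T ℤ}
    (hg : ∀ x ∈ A, ∀ l ∈ x.edges, g (permL σ l) = permL π (g' l))
    (hy : (y'.map (permL π)).Rel y) :
    glueSet (-2) (actS σ A) g y = actS π (glueSet (-2) A g' y') := by
  ext z
  rw [mem_actS_glueSet]
  have key : ∀ x ∈ A, x.map (permL π ∘ g') = (x.map (permL σ)).map g := by
    intro x hx
    rw [map_map]
    exact map_congr fun l hl => (hg x hx l hl).symm
  constructor
  · rintro ⟨_, ⟨x, hx, rfl⟩, hz⟩
    refine ⟨x, hx, ?_⟩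
    rw [key x hx]
    exact hz.congr (.refl _) hy.symm (.refl _)
  · rintro ⟨x, hx, hz⟩
    rw [key x hx] at hz
    exact ⟨_, ⟨x, hx, rfl⟩, hz.congr (.refl _) hy (.refl _)⟩

section blockPerm

variable {n m N i i' : ℕ} {σ : Equiv.Perm (Fin (n + 1))} {ρ : Equiv.Perm (Fin (m + 1))}
  {π : Equiv.Perm (Fin (N + 1))}

/-- Block permutations act on the labels of the half-edges of the lower operation by the first of
the permutations. -/
theorem outL_permL (h : IsBlockPerm i i' σ ρ π) (hi : i < n) (hN : N + 1 = n + m) {l : ℤ}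
    (h1 : -1 ≤ l) (h2 : l ≤ n) :
    outL (-2) i m (permL σ l) = permL π (outL (-2) i' m l) := by
  by_cases hl : l = -1
  · subst hl
    rw [permL_of_neg _ (by norm_num)]
    have : ∀ i, outL (-2) i m (-1) = -1 := by
      intro i; simp only [outL]; split_ifs <;> omega
    rw [this, this, permL_of_neg _ (by norm_num)]
  obtain ⟨k, rfl, hk⟩ := exists_fin_of_mem σ (by omega) h2
  rw [hk]
  have hs := h.source ⟨i + 1, by omega⟩ rfl
  by_cases hki : (k : ℕ) = i + 1
  · have h3 := h.source k hki
    rw [h3, hki]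
    simp [outL, permL_of_neg]
  · have h3 : (σ k : ℕ) ≠ i' + 1 := by
      intro hc
      have := σ.injective (Fin.ext (hc.trans hs.symm))
      exact hki (congrArg Fin.val this)
    have hx : outerEdge i m k < N + 1 := by
      have := k.2
      simp only [outerEdge]; split_ifs <;> omega
    have h4 := h.outer k ⟨_, hx⟩ hki rfl
    have h5 := permL_coe π ⟨_, hx⟩
    rw [h4] at h5
    have e1 : ∀ a b : ℕ, b ≠ a + 1 → outL (-2) a m b = (outerEdge a m b : ℕ) := by
      intro a b hab
      simp only [outL, outerEdge]; split_ifs <;> omega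
    rw [e1 _ _ hki, e1 _ _ h3, h5]

/-- Block permutations act on the labels of the half-edges of the upper operation by the second of
the permutations. -/
theorem innL_permL (h : IsBlockPerm i i' σ ρ π) (hi : i < n) (hN : N + 1 = n + m) {l : ℤ}
    (h1 : -1 ≤ l) (h2 : l ≤ m) :
    innL (-2) i (permL ρ l) = permL π (innL (-2) i' l) := by
  by_cases hl : l = -1
  · subst hl
    rw [permL_of_neg _ (by norm_num)]
    have : ∀ i, innL (-2) i (-1) = -1 := by
      intro i; simp [innL]
    rw [this, this, permL_of_neg _ (by norm_num)]
  obtain ⟨k, rfl, hk⟩ := exists_fin_of_mem ρ (by omega) h2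
  rw [hk]
  by_cases hk0 : k = 0
  · subst hk0
    rw [h.root]
    simp [innL, permL_of_neg]
  · have h3 : ρ k ≠ 0 := fun hc => hk0 (ρ.injective (hc.trans h.root.symm))
    have h3' : (ρ k : ℕ) ≠ 0 := fun hc => h3 (Fin.ext hc)
    have hk0' : (k : ℕ) ≠ 0 := fun hc => hk0 (Fin.ext hc)
    have hx : innerEdge i k < N + 1 := by
      have hk3 : (k : ℕ) < m + 1 := k.2
      have hi3 : i < n := hi
      change i + (k : ℕ) < N + 1
      omega
    have h4 := h.inner k ⟨_, hx⟩ hk0 rfl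
    have h5 := permL_coe π ⟨_, hx⟩
    rw [h4] at h5
    have e1 : ∀ a b : ℕ, b ≠ 0 → innL (-2) a b = (innerEdge a b : ℕ) := by
      intro a b hab
      simp only [innL, innerEdge]; split_ifs <;> omega
    rw [e1 _ _ hk0', e1 _ _ h3', h5]

end blockPerm

/-! ### The extension of an operad by sets of labelled operations -/

theorem lt_length {α : Type*} {l : List α} {i : ℕ} {a : α} (h : l[i]? = some a) : i < l.length :=
  (List.getElem?_eq_some_iff.1 h).1

/-- The sets of labelled operations that are admitted as operations with the half-edges of `t`. -/
structure Adm (t : T.Op) (A : Set (Labelled T ℤ)) : Prop where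
  closed : ∀ x ∈ A, ∀ y, x.Rel y → y ∈ A
  fits : ∀ x ∈ A, Fits t x

theorem compL_actS {n m N i i' : ℕ} {σ : Equiv.Perm (Fin (n + 1))} {ρ : Equiv.Perm (Fin (m + 1))}
    {π : Equiv.Perm (Fin (N + 1))} (h : IsBlockPerm i i' σ ρ π) (hA : ∀ x ∈ A, Fits t x)
    (ht : T.arity t = n) {q : T.Op} (hq : (T.inputs q).length = m) (hρ) (hi : i < n)
    (hN : N + 1 = n + m) :
    compL (actS σ A) i (T.act q m ρ hq hρ) = actS π (compL A i' q) := by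
  have hq1 : T.arity (T.act q m ρ hq hρ) = m := T.length_act _ _ _ _ _
  have hq2 : T.arity q = m := hq
  rw [compL, compL, hq1, hq2]
  refine glueSet_actS (fun x hx l hl => ?_) ?_
  · have := (hA x hx).bounds hl
    exact outL_permL h hi hN this.1 (by omega)
  · have := (rel_can_act q m ρ hq hρ).map (innL (-2) i)
    rw [map_map] at this
    rw [map_map]
    convert this using 1
    refine map_congr fun l hl => ?_
    have := mem_can.1 hl
    exact (innL_permL h hi hN (by omega) (by omega)).symm

theorem compR_actS {n m N i i' : ℕ} {σ : Equiv.Perm (Fin (n + 1))} {ρ : Equiv.Perm (Fin (m + 1))}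
    {π : Equiv.Perm (Fin (N + 1))} (h : IsBlockPerm i i' σ ρ π) (hA : ∀ x ∈ A, Fits t x)
    (ht : T.arity t = m) {p : T.Op} (hp : (T.inputs p).length = n) (hσ) (hi : i < n)
    (hN : N + 1 = n + m) :
    compR (T.act p n σ hp hσ) i (actS ρ A) m = actS π (compR p i' A m) := by
  rw [compR, compR]
  have hp2 : T.arity p = n := hp
  refine glueSet_actS (fun x hx l hl => ?_) ?_
  · have := (hA x hx).bounds hl
    exact innL_permL h hi hN this.1 (by omega)
  · have := (rel_can_act p n σ hp hσ).map (outL (-2) i m)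
    rw [map_map] at this
    rw [map_map]
    convert this using 1
    refine map_congr fun l hl => ?_
    have := mem_can.1 hl
    exact (outL_permL h hi hN (by omega) (by omega)).symm

theorem permL_finRotate' {n : ℕ} {l : ℤ} (h' : l ≤ n) :
    permL (finRotate (n + 1)) l = if l < 0 then l else if l = 0 then (n : ℤ) else l - 1 := by
  split_ifs with h h1
  · exact permL_of_neg _ h
  · rw [permL_finRotate (by omega) h', if_pos h1]
  · rw [permL_finRotate (by omega) h', if_neg h1]

theorem outL_finRotate {m n : ℕ} (hm : 0 < m) {l : ℤ} (h1 : -1 ≤ l) (h2 : l ≤ m) :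
    innL (-2) n (permL (finRotate (m + 1)) l) =
      permL (finRotate (m + n + 1)) (outL (-2) 0 (n + 1) l) := by
  rw [permL_finRotate' h2, permL_finRotate']
  · simp only [innL, outL]; push_cast; split_ifs <;> omega
  · simp only [outL]; push_cast; split_ifs <;> omega

theorem innL_finRotate {m n : ℕ} (hm : 0 < m) {l : ℤ} (h1 : -1 ≤ l) (h2 : l ≤ n + 1) :
    outL (-2) n m (permL (finRotate (n + 1 + 1)) l) =
      permL (finRotate (m + n + 1)) (innL (-2) 0 l) := by
  rw [permL_finRotate' (by push_cast; omega), permL_finRotate']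
  · simp only [innL, outL]; push_cast; split_ifs <;> omega
  · simp only [innL]; push_cast; split_ifs <;> omega

/-- The law of cyclic operads on the rotation of a composite at the first input, for a set of
labelled operations that is the lower factor. -/
theorem compL_finRotate {m n N : ℕ} (hA : ∀ x ∈ A, Fits t x) (ht : T.arity t = m) (hm : 0 < m)
    {q : T.Op} (hq : (T.inputs q).length = n + 1) (hN : N = m + n) (hσ) :
    actS (finRotate (N + 1)) (compL A 0 q) =
      compR (T.act q (n + 1) (finRotate (n + 2)) hq hσ) n (actS (finRotate (m + 1)) A) m := by
  subst hN
  have hq2 : T.arity q = n + 1 := hq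
  rw [compL, compR, hq2]
  refine (glueSet_actS (fun x hx l hl => ?_) ?_).symm
  · have := (hA x hx).bounds hl
    exact outL_finRotate hm this.1 (by omega)
  · have := (rel_can_act q (n + 1) (finRotate (n + 2)) hq hσ).map (outL (-2) n m)
    rw [map_map] at this
    rw [map_map]
    convert this using 1
    refine map_congr fun l hl => ?_
    have := mem_can.1 hl
    exact (innL_finRotate hm (by omega) (by omega)).symm

/-- The law of cyclic operads on the rotation of a composite at the first input, for a set of
labelled operations that is the upper factor. -/
theorem compR_finRotate {m n N : ℕ} (hA : ∀ x ∈ A, Fits t x) (ht : T.arity t = n + 1) (hm : 0 < m)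
    {p : T.Op} (hp : (T.inputs p).length = m) (hN : N = m + n) (hσ) :
    actS (finRotate (N + 1)) (compR p 0 A (n + 1)) =
      compL (actS (finRotate (n + 2)) A) n (T.act p m (finRotate (m + 1)) hp hσ) := by
  subst hN
  have hp2 : T.arity p = m := hp
  have hp3 : T.arity (T.act p m (finRotate (m + 1)) hp hσ) = m := T.length_act _ _ _ _ _
  rw [compL, compR, hp3]
  refine (glueSet_actS (fun x hx l hl => ?_) ?_).symm
  · have := (hA x hx).bounds hl
    exact innL_finRotate hm this.1 (by omega)
  · have := (rel_can_act p m (finRotate (m + 1)) hp hσ).map (innL (-2) n)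
    rw [map_map] at this
    rw [map_map]
    convert this using 1
    refine map_congr fun l hl => ?_
    have := mem_can.1 hl
    exact (outL_finRotate hm (by omega) (by omega)).symm

theorem compL_empty (i : ℕ) (q : T.Op) : compL (∅ : Set (Labelled T ℤ)) i q = ∅ := by
  ext; simp [compL, glueSet]

theorem compR_empty (p : T.Op) (i m : ℕ) : compR p i (∅ : Set (Labelled T ℤ)) m = ∅ := by
  ext; simp [compR, glueSet]

theorem actS_empty {n : ℕ} (σ : Equiv.Perm (Fin (n + 1))) :
    actS σ (∅ : Set (Labelled T ℤ)) = ∅ := by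
  simp [actS]

theorem adm_empty (t : T.Op) : Adm t (∅ : Set (Labelled T ℤ)) :=
  ⟨fun _ h => h.elim, fun _ h => h.elim⟩

theorem Adm.compL (hA : Adm t A) {i : ℕ} {q : T.Op} (h : (T.inputs t)[i]? = some (T.output q)) :
    Adm (T.comp t i q h) (compL A i q) :=
  ⟨fun _ hx _ h => glueSet_closed hx h, compL_fits hA.fits h⟩

theorem Adm.compR (hA : Adm t A) {i : ℕ} {p : T.Op} (h : (T.inputs p)[i]? = some (T.output t)) :
    Adm (T.comp p i t h) (compR p i A (T.arity t)) :=
  ⟨fun _ hx _ h => glueSet_closed hx h, compR_fits hA.fits h⟩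

theorem Adm.act (hA : Adm t A) {n : ℕ} {σ : Equiv.Perm (Fin (n + 1))}
    (h : (T.inputs t).length = n) (hσ : κ.Allows σ) : Adm (T.act t n σ h hσ) (actS σ A) :=
  ⟨actS_closed σ hA.closed, actS_fits hA.fits h hσ⟩

/-- The one-variable part of a composite, where `none` stands for an operation of `T`. The composite
of two sets is irrelevant, as the expressions that represent morphisms have one variable only; it is
chosen to be empty, which is compatible with all laws. -/
def partComp (p : T.Op) (i : ℕ) (q : T.Op) :
    Option (Set (Labelled T ℤ)) → Option (Set (Labelled T ℤ)) → Option (Set (Labelled T ℤ))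
  | none, none => none
  | some A, none => some (compL A i q)
  | none, some B => some (compR p i B (T.arity q))
  | some _, some _ => some ∅

theorem partComp_adm {p q : T.Op} {i : ℕ} (h : (T.inputs p)[i]? = some (T.output q))
    (a b : Option (Set (Labelled T ℤ))) (ha : ∀ A ∈ a, Adm p A) (hb : ∀ A ∈ b, Adm q A) :
    ∀ A ∈ partComp p i q a b, Adm (T.comp p i q h) A := by
  rintro A hA
  rcases a with - | a <;> rcases b with - | b <;> simp only [partComp, Option.mem_def] at hA
  · cases hA
  · cases hA; exact (hb b rfl).compR h
  · cases hA; exact (ha a rfl).compL h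
  · cases hA; exact adm_empty _

end Labelled

open Labelled

/-- The operad under `T` whose operations are those of `T` and, for every operation `t` of `T`, the
sets of labelled operations of `T` that are admitted for `t`. Composition with an operation of `T`
glues it to the elements of the set at the appropriate label if this label is present, and shifts
the labels otherwise. The composite of two sets is empty. -/
def ext (T : Operad.{u, v} κ C) : Operad.{u, v} κ C where
  Op := {a : T.Op × Option (Set (Labelled T ℤ)) // ∀ A ∈ a.2, Adm a.1 A}
  inputs a := T.inputs a.1.1
  output a := T.output a.1.1
  one c := ⟨(T.one c, none), by simp⟩
  comp p i q h := ⟨(T.comp p.1.1 i q.1.1 h, partComp p.1.1 i q.1.1 p.1.2 q.1.2),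
    partComp_adm h _ _ p.2 q.2⟩
  act p n σ h hσ := ⟨(T.act p.1.1 n σ h hσ, p.1.2.map (actS σ)), by
    intro A hA
    obtain ⟨B, hB, rfl⟩ := Option.mem_map.1 hA
    exact (p.2 B hB).act h hσ⟩
  inputs_one c := T.inputs_one c
  output_one c := T.output_one c
  inputs_comp _ _ _ _ := T.inputs_comp _ _ _ _
  output_comp _ _ _ _ := T.output_comp _ _ _ _
  length_act _ _ _ _ _ := T.length_act _ _ _ _ _
  edges_act _ _ _ _ _ _ := T.edges_act _ _ _ _ _ _
  comp_one := by
    rintro ⟨⟨p, a⟩, ha⟩ i c h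
    refine Subtype.ext (Prod.ext (T.comp_one _ _ _ _) ?_)
    rcases a with - | A
    · rfl
    · exact congrArg some (compL_one (ha A rfl).fits (ha A rfl).closed h)
  one_comp := by
    rintro c ⟨⟨p, a⟩, ha⟩ h
    refine Subtype.ext (Prod.ext (T.one_comp _ _ _) ?_)
    rcases a with - | A
    · rfl
    · exact congrArg some (compR_one (ha A rfl).fits (ha A rfl).closed h)
  comp_assoc := by
    rintro ⟨⟨p, a⟩, ha⟩ i ⟨⟨q, b⟩, hb⟩ j ⟨⟨r, c⟩, hc⟩ h₁ h₂ h₃ h₄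
    refine Subtype.ext (Prod.ext (T.comp_assoc _ _ _ _ _ _ _ _ _) ?_)
    rcases a with - | A <;> rcases b with - | B <;> rcases c with - | D <;>
      simp only [partComp, compL_empty, compR_empty]
    · exact congrArg some (compR_compR (hc D rfl).fits h₁ (lt_length h₃) (arity_comp_op h₃).1)
    · exact congrArg some (compL_compR_inner (hb B rfl).fits (lt_length h₁) (arity_comp_op h₃).1
        (lt_length h₃) (compL_fits (hb B rfl).fits h₃))
    · exact congrArg some (compL_compL_inner (ha A rfl).fits h₃)
  comp_comm := by
    rintro ⟨⟨p, a⟩, ha⟩ i ⟨⟨q, b⟩, hb⟩ j ⟨⟨r, c⟩, hc⟩ h₁ h₂ h₃ h₄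
    refine Subtype.ext (Prod.ext (T.comp_comm _ _ _ _ _ _ _ _ _) ?_)
    rcases a with - | A <;> rcases b with - | B <;> rcases c with - | D <;>
      simp only [partComp, compL_empty]
    · exact congrArg some (compR_comp_outer (hc D rfl).fits h₁)
    · exact congrArg some (compL_compR_outer (hb B rfl).fits h₃)
    · exact congrArg some (compL_compL_comm (ha A rfl).fits (compL_fits (ha A rfl).fits h₃))
  act_one := by
    rintro ⟨⟨p, a⟩, ha⟩ n h hσ
    refine Subtype.ext (Prod.ext (T.act_one _ _ _ _) ?_)
    rcases a with - | A
    · rfl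
    · exact congrArg some (actS_one A)
  act_act := by
    rintro ⟨⟨p, a⟩, ha⟩ n σ ρ h hσ h' hρ hσρ
    refine Subtype.ext (Prod.ext (T.act_act _ _ _ _ _ _ _ _ _) ?_)
    rcases a with - | A
    · rfl
    · exact congrArg some (actS_mul σ ρ A)
  comp_act := by
    rintro ⟨⟨p, a⟩, ha⟩ n σ h hσ i i' ⟨⟨q, b⟩, hb⟩ m ρ h' hρ h₁ h₂ N π hN hπ hB
    refine Subtype.ext (Prod.ext (T.comp_act _ _ _ _ _ _ _ _ _ _ _ _ _ _ _ _ _ _ hB) ?_)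
    have hi : i < n := by
      have := lt_length h₁
      have h2 := T.length_act p n σ h hσ
      exact lt_of_lt_of_eq this h2
    have hN' : N + 1 = n + m := by
      have h3 : T.arity (T.comp p i' q h₂) + 1 = T.arity p + T.arity q :=
        (arity_comp_op (T := T) h₂).1
      have h4 : T.arity (T.comp p i' q h₂) = N := hN
      have h5 : T.arity p = n := h
      have h6 : T.arity q = m := h'
      omega
    rcases a with - | A <;> rcases b with - | B <;>
      simp only [partComp, Option.map, actS_empty]
    · have h6 : T.arity q = m := h'
      have h7 : T.arity (T.act q m ρ h' hρ) = m := T.length_act _ _ _ _ _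
      rw [h6, h7]
      exact congrArg some (compR_actS hB (hb B rfl).fits h6 _ _ hi hN')
    · exact congrArg some (compL_actS hB (ha A rfl).fits h _ _ hi hN')
  comp_rotate := by
    rintro hκ ⟨⟨p, a⟩, ha⟩ m hm ⟨⟨q, b⟩, hb⟩ n hn h₁ N hN hτ hτ' hτ'' h₂
    refine Subtype.ext (Prod.ext (T.comp_rotate hκ _ _ _ _ _ _ _ _ _ _ _ _ _) ?_)
    have h3 : T.arity (T.comp p 0 q h₁) + 1 = T.arity p + T.arity q ∧ 0 < T.arity p :=
      arity_comp_op (T := T) h₁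
    have h4 : T.arity (T.comp p 0 q h₁) = N := hN
    have h5 : T.arity p = m := hm
    have h6 : T.arity q = n + 1 := hn
    have h8 : 0 < m := by omega
    have h9 : N = m + n := by omega
    rcases a with - | A <;> rcases b with - | B <;>
      simp only [partComp, Option.map, actS_empty]
    · rw [h6]
      exact congrArg some (compR_finRotate (hb B rfl).fits h6 h8 hm h9 _)
    · have h7 : T.arity (T.act p m (finRotate (m + 1)) hm hτ'') = m := T.length_act _ _ _ _ _
      rw [h7]
      exact congrArg some (compL_finRotate (ha A rfl).fits h5 h8 hn h9 _)

/-- The inclusion of `T` into its extension. -/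
def extHom (T : Operad.{u, v} κ C) : Hom T (ext T) where
  map p := ⟨(p, none), by simp⟩
  inputs_map _ := rfl
  output_map _ := rfl
  map_one _ := rfl
  map_comp _ _ _ _ _ := rfl
  map_act _ _ _ _ _ _ := rfl

variable {P T : Operad.{u, v} κ C} {ψ : P.NiceGrading}

/-! ### Morphisms of the twisted arrow category as unary functions -/

/-- The operations of `T` with the colours of the operation `p` of `P`. -/
def El (T : Operad.{u, v} κ C) (p : P.Op) : Type v :=
  {x : T.Op // T.inputs x = P.inputs p ∧ T.output x = P.output p}

theorem El.arity_eq {p : P.Op} (x : El T p) : T.arity x.1 = P.arity p :=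
  congrArg List.length x.2.1

theorem El.hedges_eq {p : P.Op} (x : El T p) : T.hedges x.1 = P.hedges p := by
  rw [hedges, hedges, x.2.1, x.2.2]

/-- The value of a morphism of operads. -/
def Hom.el (F : Hom P T) (p : P.Op) : El T p := ⟨F.map p, F.inputs_map p, F.output_map p⟩

/-- The operation `p`, as an element of `P`. -/
def El.self (p : P.Op) : El P p := ⟨p, rfl, rfl⟩

open Classical in
/-- The values of the variables given by `x` at `p` and by `F` elsewhere. -/
noncomputable def Hom.update (F : Hom P T) {p : P.Op} (x : El T p) (a : P.Op) : T.Op :=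
  if a = p then x.1 else F.map a

theorem Hom.update_self (F : Hom P T) {p : P.Op} (x : El T p) : F.update x p = x.1 := if_pos rfl

theorem Hom.update_inputs (F : Hom P T) {p : P.Op} (x : El T p) (a : P.Op) :
    T.inputs (F.update x a) = P.inputs a := by
  rw [update]
  split_ifs with h
  · rw [h, x.2.1]
  · exact F.inputs_map a

theorem Hom.update_output (F : Hom P T) {p : P.Op} (x : El T p) (a : P.Op) :
    T.output (F.update x a) = P.output a := by
  rw [update]
  split_ifs with h
  · rw [h, x.2.2]
  · exact F.output_map a

theorem interp_congr {f g g' : P.Op → T.Op} {e : Expr P.Op} {p : P.Op} (he : e.vars = {p})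
    (h : g p = g' p) : T.interp f g e = T.interp f g' e := by
  have := T.interp_bind f g g' .var e fun a ha => by
    rw [he, Multiset.mem_singleton] at ha
    rw [ha, interp, h]
  rwa [Expr.bind_eq_self _ _ fun _ _ => rfl] at this

theorem exists_value (F : Hom P T) {p q : P.Tw} (f : p ⟶ q) (x : El T p) :
    ∃ y : El T q, T.interp F.map (F.update x) f.out.1 = some y.1 := by
  obtain ⟨y, h1, h2⟩ := exists_interp F.map (F.update x) F.inputs_map F.output_map
    (F.update_inputs x) (F.update_output x) f.out.1 q f.out.2.2
  exact ⟨⟨y, h2⟩, h1⟩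

/-- The value at `x` of a morphism of `Tw(P)`, in an operad `T` under `P`. -/
noncomputable def app (F : Hom P T) {p q : P.Tw} (f : p ⟶ q) (x : El T p) : El T q :=
  (exists_value F f x).choose

theorem interp_eq_app (F : Hom P T) {p q : P.Tw} {f : p ⟶ q} {e : Expr P.Op}
    (h : Represents f e) {g : P.Op → T.Op} (x : El T p) (hg : g p = x.1) :
    T.interp F.map g e = some (app F f x).1 := by
  obtain ⟨he, rfl⟩ := h
  refine Eq.trans ?_ (exists_value F _ x).choose_spec
  refine (interp_congr he.1 (hg.trans (F.update_self x).symm)).trans ?_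
  exact (Quotient.mk_out (s := P.repSetoid p q) ⟨e, he⟩ T F _ (F.update_inputs x)
    (F.update_output x)).symm

theorem exists_represents {p q : P.Tw} (f : p ⟶ q) : ∃ e, Represents f e :=
  ⟨f.out.1, f.out.2, (Quotient.out_eq f).symm⟩

/-- A morphism of `Tw(P)` is determined by its values in the operads under `P`. -/
theorem hom_ext {p q : P.Tw} {f f' : p ⟶ q}
    (h : ∀ (T : Operad.{u, v} κ C) (F : Hom P T) (x : El T p), app F f x = app F f' x) :
    f = f' := by
  obtain ⟨e, he⟩ := exists_represents f
  obtain ⟨e', he'⟩ := exists_represents f'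
  have := fun T F (x : El T p) (g : P.Op → T.Op) hg =>
    (interp_eq_app F he (g := g) x hg).trans
      ((congrArg (fun y => some y.1) (h T F x)).trans (interp_eq_app F he' x hg).symm)
  obtain ⟨he, rfl⟩ := he
  obtain ⟨he', rfl⟩ := he'
  refine Quotient.sound fun T F g h1 h2 => this T F ⟨g p, h1 p, h2 p⟩ g rfl

theorem represents_id (p : P.Tw) : Represents (𝟙 p) (.var p : Expr P.Op) := ⟨(Rep.id P p).2, rfl⟩

theorem Represents.comp {p q r : P.Tw} {f : p ⟶ q} {g : q ⟶ r} {e e' : Expr P.Op}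
    (h : Represents f e) (h' : Represents g e') : Represents (f ≫ g) (e'.bind fun _ => e) := by
  obtain ⟨h, rfl⟩ := h
  obtain ⟨h', rfl⟩ := h'
  exact ⟨(Rep.comp ⟨e, h⟩ ⟨e', h'⟩).2, rfl⟩

theorem Represents.unique {p q : P.Tw} {f f' : p ⟶ q} {e : Expr P.Op}
    (h : Represents f e) (h' : Represents f' e) : f = f' := by
  obtain ⟨h, rfl⟩ := h
  obtain ⟨h', rfl⟩ := h'
  rfl

theorem app_id (F : Hom P T) {p : P.Tw} (x : El T p) : app F (𝟙 p) x = x := by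
  have := interp_eq_app F (represents_id p) x (F.update_self x)
  rw [interp, F.update_self] at this
  exact Subtype.ext (Option.some.inj this).symm

theorem app_comp (F : Hom P T) {p q r : P.Tw} (f : p ⟶ q) (g : q ⟶ r) (x : El T p) :
    app F (f ≫ g) x = app F g (app F f x) := by
  obtain ⟨e, he⟩ := exists_represents f
  obtain ⟨e', he'⟩ := exists_represents g
  have h1 := interp_eq_app F (he.comp he') x (F.update_self x)
  rw [T.interp_bind F.map (F.update x) (F.update (app F f x)) _ _ fun a ha => ?_] at h1
  · rw [interp_eq_app F he' (app F f x) (F.update_self _)] at h1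
    exact Subtype.ext (Option.some.inj h1).symm
  · obtain rfl : a = q := by
      obtain ⟨h, -⟩ := he'
      rw [h.1] at ha
      exact Multiset.mem_singleton.1 ha
    rw [F.update_self]
    exact interp_eq_app F he x (F.update_self x)

/-- The composition with `c` at the input `i` of the variable. -/
noncomputable def eL (q : P.Tw) (i : ℕ) (c : P.Op) (h : (P.inputs q)[i]? = some (P.output c)) :
    q ⟶ (P.comp q i c h : P.Tw) :=
  Quotient.mk (P.repSetoid _ _) ⟨.comp (.var q) i (.const c), rfl, by
    simp [eval, interp, comp?, h]⟩

/-- The composition of the variable into the input `i` of `c`. -/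
noncomputable def eR (c : P.Op) (i : ℕ) (q : P.Tw) (h : (P.inputs c)[i]? = some (P.output q)) :
    q ⟶ (P.comp c i q h : P.Tw) :=
  Quotient.mk (P.repSetoid _ _) ⟨.comp (.const c) i (.var q), rfl, by
    simp [eval, interp, comp?, h]⟩

/-- The action of a permutation on the variable. -/
noncomputable def eA (q : P.Tw) (n : ℕ) (σ : Equiv.Perm (Fin (n + 1)))
    (h : (P.inputs q).length = n) (hσ : κ.Allows σ) : q ⟶ (P.act q n σ h hσ : P.Tw) :=
  Quotient.mk (P.repSetoid _ _) ⟨.act n σ (.var q), rfl, by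
    have : (P.inputs (q : P.Op)).length = n ∧ κ.Allows σ := ⟨h, hσ⟩
    simp [eval, interp, act?, this]⟩

theorem represents_eL {q : P.Tw} {i : ℕ} {c : P.Op} (h) :
    Represents (eL q i c h) (.comp (.var q) i (.const c)) := ⟨_, rfl⟩

theorem represents_eR {q : P.Tw} {i : ℕ} {c : P.Op} (h) :
    Represents (eR c i q h) (.comp (.const c) i (.var q)) := ⟨_, rfl⟩

theorem represents_eA {q : P.Tw} {n : ℕ} {σ : Equiv.Perm (Fin (n + 1))} (h hσ) :
    Represents (eA q n σ h hσ) (.act n σ (.var q)) := ⟨_, rfl⟩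

theorem El.compL_aux {F : Hom P T} {q : P.Tw} {i : ℕ} {c : P.Op} (x : El T q)
    (h : (P.inputs q)[i]? = some (P.output c)) :
    (T.inputs x.1)[i]? = some (T.output (F.map c)) := by
  rw [x.2.1, F.output_map, h]

theorem El.compR_aux {F : Hom P T} {q : P.Tw} {i : ℕ} {c : P.Op} (x : El T q)
    (h : (P.inputs c)[i]? = some (P.output q)) :
    (T.inputs (F.map c))[i]? = some (T.output x.1) := by
  rw [x.2.2, F.inputs_map, h]

theorem El.act_aux {q : P.Tw} {n : ℕ} (x : El T q) (h : (P.inputs q).length = n) :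
    (T.inputs x.1).length = n := by
  rw [x.2.1, h]

theorem app_eL (F : Hom P T) {q : P.Tw} {i : ℕ} {c : P.Op} (h) (x : El T q) :
    (app F (eL q i c h) x).1 = T.comp x.1 i (F.map c) (x.compL_aux h) := by
  have := interp_eq_app F (represents_eL h) x (F.update_self x)
  rw [interp, interp, interp, F.update_self, Option.bind_some, Option.bind_some, comp?,
    dif_pos (x.compL_aux h)] at this
  exact (Option.some.inj this).symm

theorem app_eR (F : Hom P T) {q : P.Tw} {i : ℕ} {c : P.Op} (h) (x : El T q) :
    (app F (eR c i q h) x).1 = T.comp (F.map c) i x.1 (x.compR_aux h) := by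
  have := interp_eq_app F (represents_eR h) x (F.update_self x)
  rw [interp, interp, interp, F.update_self, Option.bind_some, Option.bind_some, comp?,
    dif_pos (x.compR_aux h)] at this
  exact (Option.some.inj this).symm

theorem app_eA (F : Hom P T) {q : P.Tw} {n : ℕ} {σ : Equiv.Perm (Fin (n + 1))} (h hσ)
    (x : El T q) : (app F (eA q n σ h hσ) x).1 = T.act x.1 n σ (x.act_aux h) hσ := by
  have := interp_eq_app F (represents_eA h hσ) x (F.update_self x)
  rw [interp, interp, F.update_self, Option.bind_some, act?, dif_pos ⟨x.act_aux h, hσ⟩] at this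
  exact (Option.some.inj this).symm

theorem Represents.comp_eL {p q : P.Tw} {f : p ⟶ q} {e : Expr P.Op} (he : Represents f e)
    {i : ℕ} {c : P.Op} (h) : Represents (f ≫ eL q i c h) (.comp e i (.const c)) :=
  he.comp (represents_eL h)

theorem Represents.comp_eR {p q : P.Tw} {f : p ⟶ q} {e : Expr P.Op} (he : Represents f e)
    {i : ℕ} {c : P.Op} (h) : Represents (f ≫ eR c i q h) (.comp (.const c) i e) :=
  he.comp (represents_eR h)

theorem Represents.comp_eA {p q : P.Tw} {f : p ⟶ q} {e : Expr P.Op} (he : Represents f e)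
    {n : ℕ} {σ : Equiv.Perm (Fin (n + 1))} (h hσ) :
    Represents (f ≫ eA q n σ h hσ) (.act n σ e) :=
  he.comp (represents_eA h hσ)

/-- An expression without variables is a constant, the value of which is determined by its
evaluation in `P`. -/
theorem interp_of_vars_eq_zero (F : Hom P T) (g : P.Op → T.Op) {e : Expr P.Op} {c : P.Op}
    (h : e.vars = 0) (hc : P.eval e = some c) : T.interp F.map g e = some (F.map c) := by
  induction e generalizing c with
  | var p => simp [Expr.vars] at h
  | const p =>
    obtain rfl : p = c := by simpa [eval, interp] using hc
    rfl
  | comp t i s iht ihs =>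
    simp only [Expr.vars, add_eq_zero] at h
    simp only [eval, interp, Option.bind_eq_some_iff] at hc
    obtain ⟨a, ha, b, hb, hab⟩ := hc
    unfold comp? at hab
    split at hab
    · rename_i hi
      cases hab
      have hi' : (T.inputs (F.map a))[i]? = some (T.output (F.map b)) := by
        rw [F.inputs_map, F.output_map, hi]
      rw [interp, iht h.1 ha, ihs h.2 hb, Option.bind_some, Option.bind_some, comp?, dif_pos hi',
        F.map_comp _ _ _ _ hi']
    · cases hab
  | act n σ t ih =>
    simp only [eval, interp, Option.bind_eq_some_iff] at hc
    obtain ⟨a, ha, hab⟩ := hc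
    unfold act? at hab
    split at hab
    · rename_i hi
      cases hab
      have hi' : (T.inputs (F.map a)).length = n := by rw [F.inputs_map, hi.1]
      rw [interp, ih h ha, Option.bind_some, act?, dif_pos ⟨hi', hi.2⟩, F.map_act _ _ _ _ _ hi']
    · cases hab

/-- The category `Tw(P)` is generated by the compositions with operations on either side and by the
actions of permutations. -/
theorem tw_induction {p : P.Tw} {M : ∀ q : P.Tw, (p ⟶ q) → Prop} (id : M p (𝟙 p))
    (left : ∀ (q : P.Tw) (f : p ⟶ q), M q f → ∀ i c h, M _ (f ≫ eL q i c h))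
    (right : ∀ (q : P.Tw) (f : p ⟶ q), M q f → ∀ i c h, M _ (f ≫ eR c i q h))
    (act : ∀ (q : P.Tw) (f : p ⟶ q), M q f → ∀ n σ h hσ, M _ (f ≫ eA q n σ h hσ))
    {q : P.Tw} (f : p ⟶ q) : M q f := by
  suffices key : ∀ (e : Expr P.Op) (q : P.Tw), e.vars = {p} → P.eval e = some q →
      ∃ f : p ⟶ q, Represents f e ∧ M q f by
    obtain ⟨e, he⟩ := exists_represents f
    obtain ⟨f', h1, h2⟩ := key e q he.1.1 he.1.2
    rwa [he.unique h1]
  intro e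
  induction e with
  | var a =>
    intro q h hq
    obtain rfl : a = p := by simpa [Expr.vars] using h
    obtain rfl : a = q := by simpa [eval, interp] using hq
    exact ⟨_, represents_id _, id⟩
  | const a => intro q h; simp [Expr.vars] at h
  | comp t i s iht ihs =>
    intro q h hq
    simp only [Expr.vars] at h
    have hq' := hq
    simp only [eval, interp, Option.bind_eq_some_iff] at hq'
    obtain ⟨a, ha, b, hb, hab⟩ := hq'
    unfold comp? at hab
    split at hab
    · rename_i hi
      cases hab
      have hcases : (t.vars = {p} ∧ s.vars = 0) ∨ (t.vars = 0 ∧ s.vars = {p}) := by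
        have hc := congrArg Multiset.card h
        rw [Multiset.card_add, Multiset.card_singleton] at hc
        rcases Nat.eq_zero_or_pos (Multiset.card t.vars) with h0 | h0
        · rw [Multiset.card_eq_zero] at h0
          rw [h0, zero_add] at h
          exact .inr ⟨h0, h⟩
        · have h0 : s.vars = 0 := Multiset.card_eq_zero.1 (by omega)
          rw [h0, add_zero] at h
          exact .inl ⟨h, h0⟩
      rcases hcases with ⟨h1, h2⟩ | ⟨h1, h2⟩
      · obtain ⟨f, hf, hM⟩ := iht a h1 ha
        refine ⟨_, ?_, left a f hM i b hi⟩
        obtain ⟨h3, h4⟩ := hf.comp_eL hi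
        refine ⟨⟨h, hq⟩, h4.trans (Quotient.sound fun T F g _ _ => ?_)⟩
        simp only [interp]
        rw [interp_of_vars_eq_zero F g h2 hb]
      · obtain ⟨f, hf, hM⟩ := ihs b h2 hb
        refine ⟨_, ?_, right b f hM i a hi⟩
        obtain ⟨h3, h4⟩ := hf.comp_eR hi
        refine ⟨⟨h, hq⟩, h4.trans (Quotient.sound fun T F g _ _ => ?_)⟩
        simp only [interp]
        rw [interp_of_vars_eq_zero F g h1 ha]
    · cases hab
  | act n σ t ih =>
    intro q h hq
    simp only [eval, interp, Option.bind_eq_some_iff] at hq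
    obtain ⟨a, ha, hab⟩ := hq
    unfold act? at hab
    split at hab
    · rename_i hi
      cases hab
      obtain ⟨f, hf, hM⟩ := ih a h ha
      exact ⟨_, hf.comp_eA hi.1 hi.2, act a f hM n σ hi.1 hi.2⟩
    · cases hab

/-- The identity morphism of an operad. -/
def Hom.id (P : Operad.{u, v} κ C) : Hom P P where
  map p := p
  inputs_map _ := rfl
  output_map _ := rfl
  map_one _ := rfl
  map_comp _ _ _ _ _ := rfl
  map_act _ _ _ _ _ _ := rfl

theorem app_self {p q : P.Tw} (f : p ⟶ q) : app (Hom.id P) f (El.self p) = El.self q := by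
  obtain ⟨e, he⟩ := exists_represents f
  have h1 := interp_eq_app (Hom.id P) he (g := _root_.id) (El.self p) rfl
  exact Subtype.ext (Option.some.inj (h1.symm.trans he.1.2))

/-- The composite of two morphisms of operads. -/
def Hom.comp {S : Operad.{u, v} κ C} (F : Hom P T) (G : Hom T S) : Hom P S where
  map p := G.map (F.map p)
  inputs_map p := by rw [G.inputs_map, F.inputs_map]
  output_map p := by rw [G.output_map, F.output_map]
  map_one c := by rw [F.map_one, G.map_one]
  map_comp p i q h h' := by
    have h1 : (T.inputs (F.map p))[i]? = some (T.output (F.map q)) := by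
      rw [F.inputs_map, F.output_map, h]
    rw [F.map_comp p i q h h1, G.map_comp _ _ _ h1 h']
  map_act p n σ h hσ h' := by
    have h1 : (T.inputs (F.map p)).length = n := by rw [F.inputs_map, h]
    rw [F.map_act p n σ h hσ h1, G.map_act _ _ _ h1 _ h']

/-! ### The action of morphisms on sets of labelled operations -/

/-- The element of the extension of `T` given by a set of labelled operations. -/
def El.part {p : P.Op} (s : El T p) (A : Set (Labelled T ℤ)) (hA : Adm s.1 A) : El (ext T) p :=
  ⟨⟨(s.1, some A), by rintro _ ⟨⟩; exact hA⟩, s.2⟩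

/-- The morphism `f` sends the set `A` to `B`, in the extension of `T`. -/
def Sends (F : Hom P T) {p q : P.Tw} (f : p ⟶ q) (s : El T p) (A B : Set (Labelled T ℤ)) : Prop :=
  ∃ hA hB, app (F.comp (extHom T)) f (s.part A hA) = (app F f s).part B hB

theorem El.part_ext {p : P.Op} {s : El T p} {A : Set (Labelled T ℤ)} {hA : Adm s.1 A}
    {x : El (ext T) p} (h1 : x.1.1.1 = s.1) (h2 : x.1.1.2 = some A) : x = s.part A hA :=
  Subtype.ext (Subtype.ext (Prod.ext h1 h2))

theorem Sends.unique {F : Hom P T} {p q : P.Tw} {f : p ⟶ q} {s : El T p}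
    {A B B' : Set (Labelled T ℤ)} (h : Sends F f s A B) (h' : Sends F f s A B') : B = B' := by
  obtain ⟨hA, hB, h⟩ := h
  obtain ⟨hA, hB', h'⟩ := h'
  have := congrArg (fun x => x.1.1.2) (h.symm.trans h')
  exact Option.some.inj this

theorem Sends.adm {F : Hom P T} {p q : P.Tw} {f : p ⟶ q} {s : El T p}
    {A B : Set (Labelled T ℤ)} (h : Sends F f s A B) : Adm (app F f s).1 B := by
  obtain ⟨hA, hB, h⟩ := h
  exact hB

theorem sends_id (F : Hom P T) {p : P.Tw} (s : El T p) {A : Set (Labelled T ℤ)}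
    (hA : Adm s.1 A) : Sends F (𝟙 p) s A A := by
  refine ⟨hA, by rwa [app_id], ?_⟩
  rw [app_id]
  exact El.part_ext (by rw [app_id]; rfl) rfl

theorem Sends.comp {F : Hom P T} {p q r : P.Tw} {f : p ⟶ q} {g : q ⟶ r} {s : El T p}
    {A B D : Set (Labelled T ℤ)} (h : Sends F f s A B) (h' : Sends F g (app F f s) B D) :
    Sends F (f ≫ g) s A D := by
  obtain ⟨hA, hB, h⟩ := h
  obtain ⟨hB', hD, h'⟩ := h'
  refine ⟨hA, by rwa [app_comp], ?_⟩
  rw [app_comp, h, h']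
  exact El.part_ext (by rw [app_comp]; rfl) rfl

theorem sends_eL (F : Hom P T) {q : P.Tw} {i : ℕ} {c : P.Op} (h) (s : El T q)
    {A : Set (Labelled T ℤ)} (hA : Adm s.1 A) :
    Sends F (eL q i c h) s A (compL A i (F.map c)) := by
  refine ⟨hA, ?_, ?_⟩
  · rw [app_eL]
    exact hA.compL _
  · refine El.part_ext ?_ ?_
    · rw [app_eL, app_eL]; rfl
    · rw [app_eL]; rfl

theorem sends_eR (F : Hom P T) {q : P.Tw} {i : ℕ} {c : P.Op} (h) (s : El T q)
    {A : Set (Labelled T ℤ)} (hA : Adm s.1 A) :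
    Sends F (eR c i q h) s A (compR (F.map c) i A (P.arity q)) := by
  refine ⟨hA, ?_, ?_⟩
  · rw [app_eR, ← s.arity_eq]
    exact hA.compR _
  · refine El.part_ext ?_ ?_
    · rw [app_eR, app_eR]; rfl
    · rw [app_eR, ← s.arity_eq]; rfl

theorem sends_eA (F : Hom P T) {q : P.Tw} {n : ℕ} {σ : Equiv.Perm (Fin (n + 1))} (h hσ)
    (s : El T q) {A : Set (Labelled T ℤ)} (hA : Adm s.1 A) :
    Sends F (eA q n σ h hσ) s A (actS σ A) := by
  refine ⟨hA, ?_, ?_⟩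
  · rw [app_eA]
    exact hA.act _ _
  · refine El.part_ext ?_ ?_
    · rw [app_eA, app_eA]; rfl
    · rw [app_eA]; rfl

/-- The values of expressions with one variable at sets of labelled operations are of the same kind,
as the composites of two sets do not occur. -/
theorem exists_sends (F : Hom P T) {p q : P.Tw} (f : p ⟶ q) (s : El T p)
    {A : Set (Labelled T ℤ)} (hA : Adm s.1 A) : ∃ B, Sends F f s A B := by
  refine tw_induction (M := fun q f => ∃ B, Sends F f s A B) ⟨A, sends_id F s hA⟩ ?_ ?_ ?_ f
  · rintro q f ⟨B, hB⟩ i c h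
    exact ⟨_, hB.comp (sends_eL F h _ hB.adm)⟩
  · rintro q f ⟨B, hB⟩ i c h
    exact ⟨_, hB.comp (sends_eR F h _ hB.adm)⟩
  · rintro q f ⟨B, hB⟩ n σ h hσ
    exact ⟨_, hB.comp (sends_eA F h hσ _ hB.adm)⟩

/-- The class of a labelled operation. -/
def Labelled.cls {L : Type} (x : Labelled T L) : Set (Labelled T L) := {z | x.Rel z}

theorem Labelled.Rel.cls_eq {L : Type} {x y : Labelled T L} (h : x.Rel y) : x.cls = y.cls :=
  Set.ext fun _ => ⟨h.symm.trans, h.trans⟩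

theorem Labelled.Fits.adm_cls {t : T.Op} {x : Labelled T ℤ} (h : Fits t x) : Adm t x.cls :=
  ⟨fun _ h1 _ h2 => Rel.trans h1 h2, fun _ h1 => h.rel h1⟩

theorem Labelled.mem_cls_self {L : Type} (x : Labelled T L) : x ∈ x.cls := Rel.refl x

theorem actS_cls {n : ℕ} (σ : Equiv.Perm (Fin (n + 1))) (x : Labelled T ℤ) :
    actS σ x.cls = (x.map (permL σ)).cls := by
  ext z
  constructor
  · rintro ⟨y, hy, rfl⟩
    exact Rel.map _ hy
  · intro h
    obtain ⟨y, hy, rfl⟩ := Rel.of_map h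
    exact ⟨y, hy, rfl⟩

theorem glueSet_cls {e : ℤ} {g : ℤ → ℤ} {x y z : Labelled T ℤ} (hm : Meet e (x.map g) y)
    (h : Contr e (x.map g) y z) : glueSet e x.cls g y = z.cls := by
  have he := h.mem_left hm
  ext w
  constructor
  · rintro ⟨x', hx, h'⟩
    have hx' := Rel.map g hx
    rcases h'.congr hx'.symm (.refl _) (.refl _) with ⟨-, h'⟩ | ⟨h', -⟩
    · exact h.rel hm h'
    · exact absurd he h'
  · intro h'
    exact ⟨x, x.mem_cls_self, .inl ⟨he, h.congr (.refl _) (.refl _) h'⟩⟩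

theorem glueSet_cls_of_not_mem {e : ℤ} {g : ℤ → ℤ} {x y : Labelled T ℤ}
    (h : e ∉ (x.map g).edges) : glueSet e x.cls g y = (x.map g).cls := by
  ext w
  constructor
  · rintro ⟨x', hx, h'⟩
    have hx' := Rel.map g hx
    rcases h'.congr hx'.symm (.refl _) (.refl _) with ⟨h', -⟩ | ⟨-, h'⟩
    · exact absurd h' h
    · exact h'
  · intro h'
    exact ⟨x, x.mem_cls_self, .inr ⟨h, h'⟩⟩

theorem fits_can (t : T.Op) : Fits t (can t) :=
  ⟨nodup_can t, fun _ h => .inr h, fun _ => ⟨le_rfl, fun _ => rfl⟩⟩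

theorem compL_cls_can {p q : T.Op} {i : ℕ} (h : (T.inputs p)[i]? = some (T.output q)) :
    compL (can p).cls i q = (can (T.comp p i q h)).cls :=
  glueSet_cls (meet_outL (fits_can p) (-2) (by omega) i q) (std_can h (-2)).contr

theorem compR_cls_can {p q : T.Op} {i : ℕ} (h : (T.inputs p)[i]? = some (T.output q)) :
    compR p i (can q).cls (T.arity q) = (can (T.comp p i q h)).cls :=
  glueSet_cls (meet_innL (fits_can q) (-2) (by omega) i p) (std_can h (-2)).contr.symm

theorem El.cols_can {p : P.Op} (x : El T p) : (can x.1).cols = (can p).cols := by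
  rw [cols, cols, edges_can, edges_can, x.arity_eq, can_op, can_op, x.hedges_eq]

theorem El.fits {p : P.Op} (s x : El T p) : Fits s.1 (can x.1) :=
  ⟨nodup_can _, fun _ h => .inr (by rwa [s.cols_can, ← x.cols_can]),
    fun _ => ⟨le_rfl, fun _ => rfl⟩⟩

/-- The operations of `T` are contained in the one-variable part of the extension. -/
theorem sends_cls_can (F : Hom P T) {p q : P.Tw} (f : p ⟶ q) (s x : El T p) :
    Sends F f s (can x.1).cls (can (app F f x).1).cls := by
  refine tw_induction (M := fun q f => Sends F f s (can x.1).cls (can (app F f x).1).cls)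
    ?_ ?_ ?_ ?_ f
  · rw [app_id]
    exact sends_id F s (s.fits x).adm_cls
  · intro q f ih i c h
    have := ih.comp (sends_eL F h _ ih.adm)
    rw [compL_cls_can ((app F f x).compL_aux h)] at this
    rwa [app_comp, app_eL]
  · intro q f ih i c h
    have := ih.comp (sends_eR F h _ ih.adm)
    rw [← (app F f x).arity_eq, compR_cls_can ((app F f x).compR_aux h)] at this
    rwa [app_comp, app_eR]
  · intro q f ih n σ h hσ
    have := ih.comp (sends_eA F h hσ _ ih.adm)
    rw [actS_cls, (rel_can_act _ _ _ ((app F f x).act_aux h) hσ).cls_eq] at this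
    rwa [app_comp, app_eA]

/-- An operation can be recovered from the class of its labelled operation. -/
theorem eq_of_cls_can_eq {p : P.Op} {x y : El T p} (h : (can x.1).cls = (can y.1).cls) : x = y := by
  have h1 : (can x.1).Rel (can y.1) := by
    have := (can y.1).mem_cls_self
    rw [← h] at this
    exact this
  refine Subtype.ext (h1.op_eq (nodup_can _) ?_)
  rw [edges_can, edges_can, x.arity_eq, y.arity_eq]

/-- A morphism is epi if the operations of `T` at its target are values of it in the extensions. -/
theorem epi_of_sends {p q : P.Tw} {f : p ⟶ q}
    (h : ∀ (T : Operad.{u, v} κ C) (F : Hom P T) (y : El T q), ∃ s A, Sends F f s A (can y.1).cls) :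
    Epi f := by
  refine ⟨fun {r} g g' hg => hom_ext fun T F y => ?_⟩
  obtain ⟨s, A, hA⟩ := h T F y
  have h1 := hA.comp (sends_cls_can F g (app F f s) y)
  have h2 := hA.comp (sends_cls_can F g' (app F f s) y)
  rw [← hg] at h2
  exact eq_of_cls_can_eq (h1.unique h2)

theorem not_mem_can_of_lt {p : T.Op} {l : ℤ} (h : l < 0) : l ∉ (can p).edges := fun h' => by
  have := mem_can.1 h'; omega

/-- Composition with an operation of arity `0` is an epimorphism: an operation at the target is
obtained from the same operation labelled in such a way that the label of the input is absent. -/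
theorem epi_eL {q : P.Tw} {i : ℕ} {c : P.Op} (h : (P.inputs q)[i]? = some (P.output c))
    (hc : P.arity c = 0) : Epi (eL q i c h) := by
  refine epi_of_sends fun T F y => ?_
  let g : ℤ → ℤ := fun l => if l ≤ i then l else l + 1
  have hFc : T.arity (F.map c) = 0 := (congrArg List.length (F.inputs_map c)).trans hc
  have h1 : ∀ l : ℤ, outL (-2) i (T.arity (F.map c)) (g l) = l := by
    intro l
    rw [hFc]
    simp only [g, outL]
    split_ifs <;> omega
  have hcols : ∀ a ∈ ((can y.1).map g).cols, a ∈ (can q).cols := by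
    rw [cols_map, y.cols_can]
    intro a ha
    obtain ⟨⟨l, k⟩, hb, rfl⟩ := List.mem_map.1 ha
    rcases (std_can h (-2)).contr.cols_subset hb with hb' | hb'
    · rw [cols_map] at hb'
      obtain ⟨⟨l', k'⟩, hb1, hb2⟩ := List.mem_map.1 hb'
      obtain ⟨rfl, rfl⟩ := Prod.mk.inj hb2
      have h3 : l' ≠ i + 1 := by
        rintro rfl
        refine not_mem_can_of_lt (p := P.comp q i c h) (l := -2) (by omega)
          (mem_edges_iff.2 ⟨k', ?_⟩)
        simpa [outL] using hb
      have h4 : g (outL (-2) i (P.arity c) l') = l' := by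
        rw [hc]
        simp only [g, outL]
        split_ifs <;> omega
      rwa [h4]
    · have h3 : l ∈ ((can c).map (innL (-2) i)).edges := mem_edges_iff.2 ⟨k, hb'⟩
      obtain ⟨l', h4, rfl⟩ := mem_edges_map.1 h3
      have h5 := mem_can.1 h4
      obtain rfl : l' = 0 := by omega
      exact absurd (mem_edges_iff.2 ⟨k, hb⟩) (not_mem_can_of_lt (by simp [innL]))
  have hfits : Fits (F.el q).1 ((can y.1).map g) := by
    refine ⟨?_, fun a ha => .inr ?_, fun _ => ⟨?_, fun _ => ?_⟩⟩
    · rw [edges_map]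
      exact (nodup_can _).map fun a b hab => by rw [← h1 a, hab, h1]
    · rw [El.cols_can]
      exact hcols a ha
    · simp [Labelled.map, can, g]
    · simp [Labelled.map, can, g]
  have h2 : ((can y.1).map g).map (outL (-2) i (T.arity (F.map c))) = can y.1 := by
    rw [map_map]
    exact map_eq_self fun l _ => h1 l
  have := sends_eL F h (F.el q) hfits.adm_cls
  refine ⟨F.el q, ((can y.1).map g).cls, ?_⟩
  rwa [compL, glueSet_cls_of_not_mem, h2] at this
  rw [h2]
  exact not_mem_can_of_lt (by omega)

/-! ### Tracks of morphisms -/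

/-- Operations of matching colours can be contracted, unless both are closed, which is the reason
for the condition that `x` has a further label. -/
theorem Labelled.exists_contr {L : Type} {e : L} {c : C} {x y : Labelled T L}
    (hm : Meet e x y) (hx : (e, c) ∈ x.cols) (hy : (e, c) ∈ y.cols)
    (h : κ ≠ .cyclic → (e ∈ x.ins ∧ y.root = e) ∨ (e ∈ y.ins ∧ x.root = e))
    (h' : ∃ l ≠ e, l ∈ x.edges) : ∃ z, Contr e x y z := by
  by_cases hκ : κ = .cyclic
  · have hex : e ∈ x.edges := mem_edges_iff.2 ⟨c, hx⟩
    have hey : e ∈ y.edges := mem_edges_iff.2 ⟨c, hy⟩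
    have ha : 1 < T.arity x.op + 1 := by
      obtain ⟨l, h1, h2⟩ := h'
      by_contra h3
      have h4 : x.edges.length = 1 := by rw [length_edges]; omega
      obtain ⟨a, h5⟩ := List.length_eq_one_iff.1 h4
      rw [h5, List.mem_singleton] at h2 hex
      exact h1 (h2.trans hex.symm)
    obtain ⟨x', h1, h2⟩ := exists_rel_getElem? hκ x hex ha
    obtain ⟨y', h3, h4⟩ := exists_rel_root hκ y hey
    have h5 : e ∈ x'.ins := List.mem_of_getElem? (i := 0) (by simpa [edges] using h2)
    have hm' := hm.congr h1 h3
    obtain ⟨z, hz⟩ := exists_std hm'.1 hm'.2 (h1.cols_perm.mem_iff.2 hx)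
      (h3.cols_perm.mem_iff.2 hy) h5 h4
    exact ⟨z, x', y', z, h1, h3, .refl _, .inl hz⟩
  · rcases h hκ with ⟨h1, h2⟩ | ⟨h1, h2⟩
    · obtain ⟨z, hz⟩ := exists_std hm.1 hm.2 hx hy h1 h2
      exact ⟨z, hz.contr⟩
    · obtain ⟨z, hz⟩ := exists_std hm.2 hm.1 hy hx h1 h2
      exact ⟨z, hz.contr.symm⟩

variable (ψ : P.NiceGrading)

theorem Labelled.Rel.deg_eq {L : Type} {x y : Labelled P L} (h : x.Rel y) :
    ψ.deg x.op = ψ.deg y.op := by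
  obtain ⟨n, σ, h1, h2, h3, -⟩ := h
  rw [h3, ψ.deg_act]

theorem Labelled.Contr.deg_eq {L : Type} {e : L} {x y z : Labelled P L} (h : Contr e x y z) :
    ψ.deg z.op = ψ.deg x.op + ψ.deg y.op := by
  obtain ⟨x', y', z', hx, hy, hz, h⟩ := h
  rw [← hz.deg_eq ψ, hx.deg_eq ψ, hy.deg_eq ψ]
  rcases h with ⟨i, h, -, -, rfl⟩ | ⟨i, h, -, -, rfl⟩
  · exact ψ.deg_comp _ _ _ _
  · exact (ψ.deg_comp _ _ _ _).trans (add_comm _ _)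

/-- A track of a morphism `f : p ⟶ q` describes the effect of `f` on labelled operations: the
half-edge `l` of `q` is a half-edge of the vertex attached to the half-edge `loc l` of `p`, and
this vertex has grading `D (loc l)`. The mark `-1` is not affected. The presence of the mark in
`nonempty` ensures that the operations can be contracted: in a cyclic operad, two operations of
arity `0` cannot be joined. -/
structure IsTrack {p q : P.Tw} (f : p ⟶ q) (loc D : ℤ → ℤ) : Prop where
  loc_neg : ∀ l : ℤ, l < 0 → loc l = l
  loc_bounds : ∀ l : ℤ, 0 ≤ l → l ≤ P.arity q → 0 ≤ loc l ∧ loc l ≤ P.arity p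
  deg_neg : ∀ l : ℤ, l < 0 → D l = 0
  nonempty : ∀ A B, Sends (Hom.id P) f (El.self p) A B → A.Nonempty →
    (∀ x ∈ A, -1 ∈ x.edges) → B.Nonempty
  spec : ∀ A B, Sends (Hom.id P) f (El.self p) A B → ∀ z ∈ B, ∃ x ∈ A,
    (∀ l, l ∈ z.edges ↔ l ≤ P.arity q ∧ loc l ∈ x.edges) ∧
      ψ.deg z.op = ψ.deg x.op + ∑ j ∈ x.edges.toFinset, D j ∧ (x.edges = [-1] → z.Rel x)

variable {ψ}

theorem Sends.adm_left {F : Hom P T} {p q : P.Tw} {f : p ⟶ q} {s : El T p}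
    {A B : Set (Labelled T ℤ)} (h : Sends F f s A B) : Adm s.1 A := by
  obtain ⟨hA, hB, h⟩ := h
  exact hA

theorem isTrack_id (p : P.Tw) : IsTrack ψ (𝟙 p) (fun l => l) (fun _ => 0) := by
  refine ⟨fun l _ => rfl, fun l h1 h2 => ⟨h1, h2⟩, fun _ _ => rfl, fun A B hB hA _ => ?_,
    fun A B hB z hz => ?_⟩
  · rw [hB.unique (sends_id _ _ hB.adm_left)]
    exact hA
  · have hA := hB.adm_left
    rw [hB.unique (sends_id _ _ hA)] at hz
    refine ⟨z, hz, fun l => ⟨fun h => ⟨((hA.fits z hz).bounds h).2, h⟩, And.right⟩, by simp,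
      fun _ => .refl z⟩

/-- The gradings of the vertices of a composite. -/
noncomputable def compDeg (N : ℕ) (loc D D' : ℤ → ℤ) (j : ℤ) : ℤ :=
  D j + ∑ k ∈ (Finset.Icc (0 : ℤ) N).filter fun k => loc k = j, D' k

/-- The vertex attached to a half-edge `j` in a composite consists of the vertex attached to `j` in
the first morphism and of the vertices attached to its half-edges in the second one. -/
theorem IsTrack.comp {p q r : P.Tw} {f : p ⟶ q} {g : q ⟶ r} {loc D loc' D' : ℤ → ℤ}
    (hf : IsTrack ψ f loc D) (hg : IsTrack ψ g loc' D') :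
    IsTrack ψ (f ≫ g) (loc ∘ loc') (compDeg (P.arity q) loc D D') := by
  have key : ∀ A E, Sends (Hom.id P) (f ≫ g) (El.self p) A E → ∃ B,
      Sends (Hom.id P) f (El.self p) A B ∧ Sends (Hom.id P) g (El.self q) B E := by
    intro A E hE
    obtain ⟨B, hB⟩ := exists_sends (Hom.id P) f (El.self p) hE.adm_left
    obtain ⟨E', hE'⟩ := exists_sends (Hom.id P) g _ hB.adm
    have := hE.unique (hB.comp hE')
    subst this
    rw [app_self] at hE'
    exact ⟨B, hB, hE'⟩
  refine ⟨fun l hl => ?_, fun l h1 h2 => ?_, fun l hl => ?_, fun A E hE hA h1 => ?_,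
    fun A E hE z hz => ?_⟩
  · rw [Function.comp_apply, hg.loc_neg l hl, hf.loc_neg l hl]
  · have := hg.loc_bounds l h1 h2
    exact hf.loc_bounds _ this.1 this.2
  · rw [compDeg, hf.deg_neg l hl, zero_add]
    refine Finset.sum_eq_zero fun k hk => ?_
    rw [Finset.mem_filter, Finset.mem_Icc] at hk
    have := hf.loc_bounds k hk.1.1 hk.1.2
    omega
  · obtain ⟨B, hB, hE⟩ := key A E hE
    refine hg.nonempty B E hE (hf.nonempty A B hB hA h1) fun y hy => ?_
    obtain ⟨x, hx, h2, -⟩ := hf.spec A B hB y hy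
    rw [h2, hf.loc_neg _ (by omega)]
    exact ⟨by omega, h1 x hx⟩
  · obtain ⟨B, hB, hE⟩ := key A E hE
    obtain ⟨y, hy, h1, h2, h3⟩ := hg.spec B E hE z hz
    obtain ⟨x, hx, h4, h5, h6⟩ := hf.spec A B hB y hy
    refine ⟨x, hx, fun l => ?_, ?_, fun h => ?_⟩
    · rw [h1, h4, Function.comp_apply]
      refine ⟨fun h => ⟨h.1, h.2.2⟩, fun h => ⟨h.1, ?_, h.2⟩⟩
      rcases lt_or_ge l 0 with hl | hl
      · rw [hg.loc_neg l hl]; omega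
      · exact (hg.loc_bounds l hl h.1).2
    · rw [h2, h5, add_assoc]
      congr 1
      simp only [compDeg]
      rw [Finset.sum_add_distrib]
      congr 1
      have hs : ∀ l, l ∈ (Finset.Icc (0 : ℤ) (P.arity q)).filter (fun k => loc k ∈ x.edges) ↔
          l ∈ y.edges ∧ 0 ≤ l := by
        intro l
        rw [h4, Finset.mem_filter, Finset.mem_Icc]
        tauto
      have h7 : ∑ j ∈ y.edges.toFinset, D' j =
          ∑ j ∈ (Finset.Icc (0 : ℤ) (P.arity q)).filter (fun k => loc k ∈ x.edges), D' j := by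
        refine (Finset.sum_subset (fun l hl => ?_) fun l hl hl' => ?_).symm
        · exact List.mem_toFinset.2 ((hs l).1 hl).1
        · rw [hs, not_and] at hl'
          exact hg.deg_neg l (not_le.1 (hl' (List.mem_toFinset.1 hl)))
      rw [h7, ← Finset.sum_fiberwise_of_maps_to (t := x.edges.toFinset) (g := loc)]
      · refine Finset.sum_congr rfl fun j hj => Finset.sum_congr ?_ fun _ _ => rfl
        rw [List.mem_toFinset] at hj
        ext k
        simp only [Finset.mem_filter]
        constructor
        · tauto
        · rintro ⟨hk, rfl⟩; exact ⟨⟨hk, hj⟩, rfl⟩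
      · intro k hk
        exact List.mem_toFinset.2 (Finset.mem_filter.1 hk).2
    · have h7 := h6 h
      have h8 : y.edges = [-1] := by
        have := h7.edges_perm
        rw [h] at this
        exact (List.singleton_perm.1 this).symm
      exact (h3 h8).trans h7

/-- The label of the half-edge of `p` at which the half-edge `l` of `p ∘ᵢ c` is attached. -/
def locL (i m : ℕ) (l : ℤ) : ℤ := if l ≤ i then l else if l ≤ i + m then i + 1 else l - m + 1

/-- The label of the half-edge of `q` at which the half-edge `l` of `c ∘ᵢ q` is attached. -/
def locR (i m : ℕ) (l : ℤ) : ℤ := if l < 0 then l else if i < l ∧ l ≤ i + m then l - i else 0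

theorem sum_ite_mem {x : Labelled P ℤ} {a d : ℤ} :
    ∑ j ∈ x.edges.toFinset, (if j = a then d else 0) = if a ∈ x.edges then d else 0 := by
  rw [Finset.sum_ite_eq']
  simp

/-- The only vertex that is not an identity is `c`, attached to the half-edge `i + 1`. -/
theorem isTrack_eL {q : P.Tw} {i : ℕ} {c : P.Op} (h : (P.inputs q)[i]? = some (P.output c)) :
    IsTrack ψ (eL q i c h) (locL i (P.arity c)) (fun l => if l = i + 1 then ψ.deg c else 0) := by
  have hN : P.arity (P.comp q i c h) + 1 = P.arity q + P.arity c ∧ i < P.arity q :=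
    arity_comp_op h
  refine ⟨fun l hl => ?_, fun l h1 h2 => ?_, fun l hl => ?_, fun A B hB hA h1 => ?_,
    fun A B hB z hz => ?_⟩
  · rw [locL, if_pos (by omega)]
  · rw [locL]; split_ifs <;> omega
  · exact if_neg (by omega)
  · rw [hB.unique (sends_eL _ _ _ hB.adm_left)]
    obtain ⟨x, hx⟩ := hA
    have hfit := hB.adm_left.fits x hx
    have hm := meet_outL hfit (-2) (by omega) i c
    by_cases he : -2 ∈ (x.map (outL (-2) i (P.arity c))).edges
    · have he' : (i : ℤ) + 1 ∈ x.edges := by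
        obtain ⟨l, hl, h2⟩ := mem_edges_map.1 he
        have := hfit.bounds hl
        simp only [outL] at h2
        split_ifs at h2 with h3 <;> first | omega | rwa [← h3]
      obtain ⟨k, hk⟩ := mem_edges_iff.1 he'
      have hk2 : ((i : ℤ) + 1, k) ∈ (can q).cols := by
        rcases hfit.cols _ hk with h2 | h2
        · simp only at h2; omega
        · exact h2
      obtain rfl : P.output c = k := by
        have h2 : (P.hedges q)[i + 1]? = some k := mem_cols_can (by push_cast; exact hk2)
        rw [hedges, List.getElem?_cons_succ, h] at h2
        exact Option.some.inj h2
      have hor : κ ≠ .cyclic → -2 ∈ (x.map (outL (-2) i (P.arity c))).ins := by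
        intro hκ
        refine mem_ins_of_ne he fun h2 => ?_
        have := hfit.orient hκ
        have h3 := hfit.bounds (l := x.root) (by simp [edges])
        simp only [Labelled.map, outL] at h2
        split_ifs at h2 <;> omega
      obtain ⟨z, hz⟩ := exists_contr (c := P.output c) hm (by
          rw [cols_map]
          exact List.mem_map.2 ⟨_, hk, by simp [outL]⟩) (by
          rw [cols_map]
          refine List.mem_map.2 ⟨(0, P.output c), ?_, by simp [innL]⟩
          simp [cols, edges, hedges, can]) (fun hκ => .inl ⟨hor hκ, by simp [can, Labelled.map, innL]⟩)
          ⟨-1, by omega, mem_edges_map.2 ⟨-1, h1 x hx, by simp only [outL]; split_ifs <;> omega⟩⟩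
      exact ⟨z, x, hx, .inl ⟨he, hz⟩⟩
    · exact ⟨_, x, hx, .inr ⟨he, .refl _⟩⟩
  · have hA := hB.adm_left
    rw [hB.unique (sends_eL _ _ _ hA)] at hz
    obtain ⟨x, hx, hz⟩ := hz
    have hfit := hA.fits x hx
    have hm := meet_outL hfit (-2) (by omega) i c
    have hme := fun l => hz.mem_iff hm (l := l)
    have he : -2 ∈ (x.map (outL (-2) i (P.arity c))).edges ↔ (i : ℤ) + 1 ∈ x.edges := by
      rw [mem_edges_map]
      constructor
      · rintro ⟨l, hl, h2⟩
        have := hfit.bounds hl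
        simp only [outL] at h2
        split_ifs at h2 with h3 <;> first | omega | rwa [← h3]
      · exact fun h2 => ⟨_, h2, by simp [outL]⟩
    refine ⟨x, hx, fun l => ?_, ?_, fun h2 => ?_⟩
    · refine (hme l).trans ?_
      rw [he, mem_edges_map, mem_edges_map]
      show _ ↔ l ≤ P.arity (P.comp q i c h) ∧ _
      have hid : P.arity ((Hom.id P).map c) = P.arity c := rfl
      constructor
      · rintro ⟨h2, ⟨a, ha, rfl⟩ | ⟨h3, a, ha, rfl⟩⟩
        · have hb := hfit.bounds ha
          have hb' : a ≤ P.arity q := hb.2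
          have : locL i (P.arity c) (outL (-2) i (P.arity c) a) = a := by
            simp only [locL, outL] at h2 ⊢
            split_ifs at h2 ⊢ <;> omega
          refine ⟨?_, by rwa [this]⟩
          simp only [outL] at h2 ⊢
          split_ifs at h2 ⊢ <;> omega
        · have hb := mem_can.1 ha
          have : locL i (P.arity c) (innL (-2) i a) = i + 1 := by
            simp only [locL, innL] at h2 ⊢
            split_ifs at h2 ⊢ <;> omega
          refine ⟨?_, by rwa [this]⟩
          simp only [innL] at h2 ⊢
          split_ifs at h2 ⊢ <;> omega
      · rintro ⟨h2, h3⟩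
        have hb := hfit.bounds h3
        by_cases h4 : (i : ℤ) < l ∧ l ≤ i + P.arity c
        · have h5 : locL i (P.arity c) l = i + 1 := by
            simp only [locL]; split_ifs <;> omega
          rw [h5] at h3
          refine ⟨by omega, .inr ⟨h3, l - i, mem_can.2 ⟨by omega, by omega⟩, ?_⟩⟩
          simp only [innL]; split_ifs <;> omega
        · refine ⟨?_, .inl ⟨_, h3, ?_⟩⟩
          · simp only [locL] at hb; split_ifs at hb <;> omega
          · simp only [locL, outL]; split_ifs <;> omega
    · rw [sum_ite_mem]
      rcases hz with ⟨h2, h3⟩ | ⟨h2, h3⟩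
      · rw [if_pos (he.1 h2)]
        exact h3.deg_eq ψ
      · rw [if_neg (fun h4 => h2 (he.2 h4)), add_zero]
        exact (h3.deg_eq ψ).symm
    · rcases hz with ⟨h3, -⟩ | ⟨h3, h4⟩
      · have h3 := he.1 h3
        rw [h2, List.mem_singleton] at h3
        omega
      · rw [map_eq_self] at h4
        · exact h4.symm
        · intro l hl
          rw [h2, List.mem_singleton] at hl
          subst hl
          simp only [outL]; split_ifs <;> omega

/-- The only vertex that is not an identity is `c`, attached to the half-edge `0`. -/
theorem isTrack_eR {q : P.Tw} {i : ℕ} {c : P.Op} (h : (P.inputs c)[i]? = some (P.output q)) :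
    IsTrack ψ (eR c i q h) (locR i (P.arity q)) (fun l => if l = 0 then ψ.deg c else 0) := by
  have hN : P.arity (P.comp c i q h) + 1 = P.arity c + P.arity q ∧ i < P.arity c :=
    arity_comp_op h
  refine ⟨fun l hl => ?_, fun l h1 h2 => ?_, fun l hl => ?_, fun A B hB hA h1 => ?_,
    fun A B hB z hz => ?_⟩
  · rw [locR, if_pos (by omega)]
  · rw [locR]; split_ifs <;> omega
  · exact if_neg (by omega)
  · rw [hB.unique (sends_eR _ _ _ hB.adm_left)]
    obtain ⟨x, hx⟩ := hA
    have hfit := hB.adm_left.fits x hx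
    have hm := meet_innL hfit (-2) (by omega) i c
    by_cases he : -2 ∈ (x.map (innL (-2) i)).edges
    · have he' : (0 : ℤ) ∈ x.edges := by
        obtain ⟨l, hl, h2⟩ := mem_edges_map.1 he
        have := hfit.bounds hl
        simp only [innL] at h2
        split_ifs at h2 with h3 <;> first | omega | rwa [← h3]
      obtain ⟨k, hk⟩ := mem_edges_iff.1 he'
      have hk2 : ((0 : ℤ), k) ∈ (can q).cols := by
        rcases hfit.cols _ hk with h2 | h2
        · simp only at h2; omega
        · exact h2
      obtain rfl : P.output q = k := by
        have h2 : (P.hedges q)[0]? = some k := mem_cols_can (by push_cast; exact hk2)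
        rw [hedges, List.getElem?_cons_zero] at h2
        exact Option.some.inj h2
      have hcol : ((i : ℤ) + 1, P.output q) ∈ (can c).cols := by
        have h2 : (can c).cols[i + 1]? = some ((i : ℤ) + 1, P.output q) := by
          rw [cols, List.getElem?_zip_eq_some]
          refine ⟨?_, ?_⟩
          · rw [getElem?_can _ (by omega)]; push_cast; rfl
          · rw [can_op, hedges, List.getElem?_cons_succ, h]
        exact List.mem_of_getElem? h2
      have hor : κ ≠ .cyclic → -2 ∈ ((can c).map (outL (-2) i (P.arity q))).ins ∧
          (x.map (innL (-2) i)).root = -2 := by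
        intro hκ
        constructor
        · refine mem_ins_of_ne (mem_edges_map.2 ⟨(i : ℤ) + 1, mem_edges_iff.2 ⟨_, hcol⟩, ?_⟩) ?_
          · simp [outL]
          · simp only [Labelled.map, can, outL]; split_ifs <;> omega
        · have := (hfit.orient hκ).2 he'
          simp [Labelled.map, this, innL]
      obtain ⟨z, hz⟩ := exists_contr (c := P.output q) hm (by
          rw [cols_map]
          exact List.mem_map.2 ⟨_, hk, by simp [innL]⟩) (by
          rw [cols_map]
          exact List.mem_map.2 ⟨_, hcol, by simp [outL]⟩) (fun hκ => .inr (hor hκ))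
          ⟨-1, by omega, mem_edges_map.2 ⟨-1, h1 x hx, by simp [innL]⟩⟩
      exact ⟨z, x, hx, .inl ⟨he, hz⟩⟩
    · exact ⟨_, x, hx, .inr ⟨he, .refl _⟩⟩
  · have hA := hB.adm_left
    rw [hB.unique (sends_eR _ _ _ hA)] at hz
    obtain ⟨x, hx, hz⟩ := hz
    have hfit := hA.fits x hx
    have hm := meet_innL hfit (-2) (by omega) i c
    have hme := fun l => hz.mem_iff hm (l := l)
    have he : -2 ∈ (x.map (innL (-2) i)).edges ↔ (0 : ℤ) ∈ x.edges := by
      rw [mem_edges_map]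
      constructor
      · rintro ⟨l, hl, h2⟩
        have := hfit.bounds hl
        simp only [innL] at h2
        split_ifs at h2 with h3 <;> first | omega | rwa [← h3]
      · exact fun h2 => ⟨_, h2, by simp [innL]⟩
    refine ⟨x, hx, fun l => ?_, ?_, fun h2 => ?_⟩
    · refine (hme l).trans ?_
      rw [he, mem_edges_map, mem_edges_map]
      show _ ↔ l ≤ P.arity (P.comp c i q h) ∧ _
      have hs : P.arity (El.self q).1 = P.arity q := rfl
      rw [hs]
      constructor
      · rintro ⟨h2, ⟨a, ha, rfl⟩ | ⟨h3, a, ha, rfl⟩⟩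
        · have hb := hfit.bounds ha
          rw [hs] at hb
          have : locR i (P.arity q) (innL (-2) i a) = a := by
            simp only [locR, innL] at h2 ⊢
            split_ifs at h2 ⊢ <;> omega
          refine ⟨?_, by rwa [this]⟩
          simp only [innL] at h2 ⊢
          split_ifs at h2 ⊢ <;> omega
        · have hb : 0 ≤ a ∧ a ≤ P.arity c := mem_can.1 ha
          have : locR i (P.arity q) (outL (-2) i (P.arity q) a) = 0 := by
            simp only [locR, outL] at h2 ⊢
            split_ifs at h2 ⊢ <;> omega
          refine ⟨?_, by rwa [this]⟩
          simp only [outL] at h2 ⊢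
          split_ifs at h2 ⊢ <;> omega
      · rintro ⟨h2, h3⟩
        have hb := hfit.bounds h3
        by_cases h4 : l < 0 ∨ ((i : ℤ) < l ∧ l ≤ i + P.arity q)
        · refine ⟨?_, .inl ⟨_, h3, ?_⟩⟩
          · simp only [locR] at hb; split_ifs at hb <;> omega
          · simp only [locR, innL]; split_ifs <;> omega
        · have h5 : locR i (P.arity q) l = 0 := by
            simp only [locR]; split_ifs <;> omega
          rw [h5] at h3
          refine ⟨by omega, .inr ⟨h3, if l ≤ i then l else l - P.arity q + 1,
            mem_can.2 ?_, ?_⟩⟩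
          · have hid : P.arity ((Hom.id P).map c) = P.arity c := rfl
            split_ifs <;> omega
          · simp only [outL]; split_ifs <;> omega
    · rw [sum_ite_mem]
      rcases hz with ⟨h2, h3⟩ | ⟨h2, h3⟩
      · rw [if_pos (he.1 h2)]
        exact h3.deg_eq ψ
      · rw [if_neg (fun h4 => h2 (he.2 h4)), add_zero]
        exact (h3.deg_eq ψ).symm
    · rcases hz with ⟨h3, -⟩ | ⟨h3, h4⟩
      · have h3 := he.1 h3
        rw [h2, List.mem_singleton] at h3
        omega
      · rw [map_eq_self] at h4
        · exact h4.symm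
        · intro l hl
          rw [h2, List.mem_singleton] at hl
          subst hl
          simp [innL]

/-- Permutations have no vertices; they only rename the half-edges. -/
theorem isTrack_eA {q : P.Tw} {n : ℕ} {σ : Equiv.Perm (Fin (n + 1))} (h hσ) :
    IsTrack ψ (eA q n σ h hσ) (permL σ⁻¹) (fun _ => 0) := by
  have hn : P.arity q = n := h
  have hN : P.arity (P.act q n σ h hσ) = n := P.length_act _ _ _ _ _
  have hinv : ∀ l, permL σ (permL σ⁻¹ l) = l := fun l => by
    rw [← permL_mul, inv_mul_cancel, permL_one]
  have hinv' : ∀ l, permL σ⁻¹ (permL σ l) = l := fun l => by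
    rw [← permL_mul, mul_inv_cancel, permL_one]
  refine ⟨fun l hl => permL_of_neg _ hl, fun l h1 h2 => ?_, fun l hl => rfl,
    fun A B hB hA h1 => ?_, fun A B hB z hz => ?_⟩
  · rw [hN] at h2
    rw [hn]
    exact permL_bounds _ h1 h2
  · rw [hB.unique (sends_eA _ h hσ _ hB.adm_left)]
    exact hA.image _
  · have hA := hB.adm_left
    have hfit' := fun z hz => (hB.adm.fits z hz)
    have hz' := hz
    rw [hB.unique (sends_eA _ h hσ _ hA)] at hz
    obtain ⟨x, hx, rfl⟩ := hz
    refine ⟨x, hx, fun l => ⟨fun h1 => ?_, fun h1 => ?_⟩, by simp [Labelled.map], fun h1 => ?_⟩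
    · have h2 := ((hfit' _ hz').bounds h1).2
      rw [app_self] at h2
      refine ⟨h2, ?_⟩
      obtain ⟨a, ha, rfl⟩ := mem_edges_map.1 h1
      rwa [hinv']
    · exact mem_edges_map.2 ⟨_, h1.2, hinv l⟩
    · rw [map_eq_self]
      · exact .refl _
      · intro l hl
        rw [h1, List.mem_singleton] at hl
        exact permL_of_neg _ (by omega)

theorem exists_isTrack (ψ : P.NiceGrading) {p q : P.Tw} (f : p ⟶ q) :
    ∃ loc D, IsTrack ψ f loc D := by
  refine tw_induction (M := fun q f => ∃ loc D, IsTrack ψ f loc D) ⟨_, _, isTrack_id p⟩ ?_ ?_ ?_ f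
  · rintro q f ⟨_, _, hf⟩ i c h
    exact ⟨_, _, hf.comp (isTrack_eL h)⟩
  · rintro q f ⟨_, _, hf⟩ i c h
    exact ⟨_, _, hf.comp (isTrack_eR h)⟩
  · rintro q f ⟨_, _, hf⟩ n σ h hσ
    exact ⟨_, _, hf.comp (isTrack_eA h hσ)⟩

/-! ### Vertices of a morphism -/

/-- The identity operation with its half-edges labelled by `-1` and by the half-edge `j` of `p`. -/
theorem exists_probe (p : P.Op) {j : ℤ} (h0 : 0 ≤ j) (hj : j ≤ P.arity p) :
    ∃ x : Labelled P ℤ, Fits p x ∧ (∀ l, l ∈ x.edges ↔ l = -1 ∨ l = j) ∧ ψ.deg x.op = 0 ∧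
      ∃ c, x.op = P.one c ∧ (0 < j → x.edges = [-1, j]) ∧ (j = 0 → x.edges = [0, -1]) := by
  obtain ⟨c, hc⟩ := mem_edges_iff.1 (mem_can.2 ⟨h0, hj⟩)
  have h1 : ∀ r k : ℤ, ∃ x : Labelled P ℤ, x.op = P.one c ∧ x.root = r ∧ x.ins = [k] := fun r k =>
    ⟨⟨P.one c, r, [k], by rw [arity, P.inputs_one]; rfl⟩, rfl, rfl, rfl⟩
  have h2 : ∀ {r k : ℤ} {x : Labelled P ℤ}, x.op = P.one c → x.root = r → x.ins = [k] →
      x.cols = [(r, c), (k, c)] := by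
    intro r k x h3 h4 h5
    rw [cols, edges, h4, h5, h3, hedges, P.output_one, P.inputs_one]
    rfl
  by_cases hj0 : j = 0
  · obtain ⟨x, h3, h4, h5⟩ := h1 j (-1)
    have h6 : x.edges = [j, -1] := by rw [edges, h4, h5]
    refine ⟨x, ⟨by rw [h6]; simp; omega, ?_, fun _ => ?_⟩, fun l => ?_, ?_, c, h3, by omega,
      fun h => by rw [h6, h]⟩
    · rw [h2 h3 h4 h5]
      intro a ha
      rcases List.mem_pair.1 ha with rfl | rfl
      · exact .inr hc
      · exact .inl rfl
    · rw [h4]; exact ⟨hj0.le, fun _ => hj0⟩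
    · rw [h6, List.mem_pair, or_comm]
    · rw [h3, ψ.deg_one]
  · obtain ⟨x, h3, h4, h5⟩ := h1 (-1) j
    have h6 : x.edges = [-1, j] := by rw [edges, h4, h5]
    refine ⟨x, ⟨by rw [h6]; simp; omega, ?_, fun _ => ?_⟩, fun l => ?_, ?_, c, h3, fun _ => h6,
      fun h => absurd h hj0⟩
    · rw [h2 h3 h4 h5]
      intro a ha
      rcases List.mem_pair.1 ha with rfl | rfl
      · exact .inl rfl
      · exact .inr hc
    · rw [h4, h6, List.mem_pair]
      exact ⟨by omega, fun h => by omega⟩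
    · rw [h6, List.mem_pair]
    · rw [h3, ψ.deg_one]

/-- The vertex attached to the half-edge `j`, with the half-edge attached to the source labelled
by `-1`. -/
theorem IsTrack.exists_vertex {p q : P.Tw} {f : p ⟶ q} {loc D : ℤ → ℤ} (h : IsTrack ψ f loc D)
    {x : Labelled P ℤ} {j : ℤ} (h0 : 0 ≤ j)
    (h1 : ∀ l, l ∈ x.edges ↔ l = -1 ∨ l = j) (h2 : ψ.deg x.op = 0) {B : Set (Labelled P ℤ)}
    (hB : Sends (Hom.id P) f (El.self p) x.cls B) : B.Nonempty ∧ ∀ z ∈ B,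
      (∀ l, l ∈ z.edges ↔ l = -1 ∨ (0 ≤ l ∧ l ≤ P.arity q ∧ loc l = j)) ∧ ψ.deg z.op = D j := by
  have hm : ∀ y ∈ x.cls, ∀ l, l ∈ y.edges ↔ l = -1 ∨ l = j := fun y hy l => by
    rw [(Rel.edges_perm hy).mem_iff, h1]
  refine ⟨h.nonempty _ _ hB ⟨x, x.mem_cls_self⟩ fun y hy => (hm y hy _).2 (.inl rfl),
    fun z hz => ?_⟩
  obtain ⟨y, hy, h3, h4, -⟩ := h.spec _ _ hB z hz
  constructor
  · intro l
    rw [h3, hm y hy]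
    rcases lt_or_ge l 0 with hl | hl
    · rw [h.loc_neg l hl]; omega
    · constructor
      · rintro ⟨h5, h6⟩
        have := h.loc_bounds l hl h5
        exact .inr ⟨hl, h5, by omega⟩
      · rintro (h5 | h5)
        · omega
        · exact ⟨h5.2.1, .inr h5.2.2⟩
  · rw [h4, ← Rel.deg_eq ψ hy, h2, zero_add]
    have h5 : y.edges.toFinset = {-1, j} := by
      ext l; rw [List.mem_toFinset, hm y hy]; simp
    rw [h5, Finset.sum_pair (by omega), h.deg_neg _ (by omega), zero_add]

/-- A track is determined by the morphism, as the value at an identity operation labelled by `-1`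
and `j` is the vertex attached to `j`. -/
theorem IsTrack.unique {p q : P.Tw} {f : p ⟶ q} {loc D loc' D' : ℤ → ℤ}
    (h : IsTrack ψ f loc D) (h' : IsTrack ψ f loc' D') :
    (∀ j : ℤ, 0 ≤ j → j ≤ P.arity p → D j = D' j) ∧
      ∀ l : ℤ, 0 ≤ l → l ≤ P.arity q → loc l = loc' l := by
  have key : ∀ j : ℤ, 0 ≤ j → j ≤ P.arity p → D j = D' j ∧
      ∀ l : ℤ, 0 ≤ l → l ≤ P.arity q → loc l = j → loc' l = j := by
    intro j h0 hj
    obtain ⟨x, hx, h1, h2, -⟩ := exists_probe (ψ := ψ) p h0 hj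
    obtain ⟨B, hB⟩ := exists_sends (Hom.id P) f (El.self p) hx.adm_cls
    obtain ⟨⟨z, hz⟩, h3⟩ := h.exists_vertex h0 h1 h2 hB
    obtain ⟨h4, h5⟩ := h3 z hz
    obtain ⟨h6, h7⟩ := (h'.exists_vertex h0 h1 h2 hB).2 z hz
    refine ⟨h5.symm.trans h7, fun l hl hl' h8 => ?_⟩
    have := (h6 l).1 ((h4 l).2 (.inr ⟨hl, hl', h8⟩))
    omega
  refine ⟨fun j h0 hj => (key j h0 hj).1, fun l hl hl' => ?_⟩
  have := h.loc_bounds l hl hl'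
  exact ((key _ this.1 this.2).2 l hl hl' rfl).symm

theorem IsTrack.neg_one_le {p q : P.Tw} {f : p ⟶ q} {loc D : ℤ → ℤ} (h : IsTrack ψ f loc D)
    {j : ℤ} (h0 : 0 ≤ j) (hj : j ≤ P.arity p) : -1 ≤ D j := by
  obtain ⟨x, hx, h1, h2, -⟩ := exists_probe (ψ := ψ) p h0 hj
  obtain ⟨B, hB⟩ := exists_sends (Hom.id P) f (El.self p) hx.adm_cls
  obtain ⟨⟨z, hz⟩, h3⟩ := h.exists_vertex h0 h1 h2 hB
  rw [← (h3 z hz).2]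
  exact ψ.neg_one_le _

theorem edges_eq_singleton {x : Labelled P ℤ} (h : P.arity x.op = 0) {l : ℤ} (hl : l ∈ x.edges) :
    x.edges = [l] := by
  have h1 : x.edges.length = 1 := by rw [length_edges, h]
  obtain ⟨a, ha⟩ := List.length_eq_one_iff.1 h1
  rw [ha, List.mem_singleton] at hl
  rw [ha, hl]

/-- A vertex of grading `-1` has arity `0`, so that it has no leaves. -/
theorem IsTrack.loc_ne {p q : P.Tw} {f : p ⟶ q} {loc D : ℤ → ℤ} (h : IsTrack ψ f loc D)
    {j : ℤ} (h0 : 0 ≤ j) (hj : j ≤ P.arity p) (hD : D j = -1) {l : ℤ} (hl : 0 ≤ l)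
    (hl' : l ≤ P.arity q) : loc l ≠ j := by
  obtain ⟨x, hx, h1, h2, -⟩ := exists_probe (ψ := ψ) p h0 hj
  obtain ⟨B, hB⟩ := exists_sends (Hom.id P) f (El.self p) hx.adm_cls
  obtain ⟨⟨z, hz⟩, h3⟩ := h.exists_vertex h0 h1 h2 hB
  obtain ⟨h4, h5⟩ := h3 z hz
  have h6 := edges_eq_singleton (ψ.arity_eq_zero _ (h5.trans hD)) ((h4 (-1)).2 (.inl rfl))
  intro h7
  have h8 := (h4 l).2 (.inr ⟨hl, hl', h7⟩)
  rw [h6, List.mem_singleton] at h8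
  omega

/-- The gradings of the vertices add up to the difference of the degrees: this is the value of the
track at the operation `p` itself. -/
theorem IsTrack.deg_eq {p q : P.Tw} {f : p ⟶ q} {loc D : ℤ → ℤ} (h : IsTrack ψ f loc D) :
    ψ.deg q = ψ.deg p + ∑ j ∈ Finset.Icc (0 : ℤ) (P.arity p), D j := by
  have h1 := sends_cls_can (Hom.id P) f (El.self p) (El.self p)
  rw [app_self] at h1
  obtain ⟨y, hy, -, h2, -⟩ := h.spec _ _ h1 _ (mem_cls_self _)
  refine h2.trans ?_
  rw [← Rel.deg_eq ψ hy]
  congr 1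
  refine Finset.sum_congr ?_ fun _ _ => rfl
  ext l
  rw [List.mem_toFinset, (Rel.edges_perm hy).mem_iff, Finset.mem_Icc]
  exact mem_can

theorem compDeg_nonneg {p q : P.Tw} {loc D D' : ℤ → ℤ}
    (hD : ∀ j : ℤ, 0 ≤ j → j ≤ P.arity p → 0 ≤ D j) (hD' : ∀ j : ℤ, 0 ≤ j → j ≤ P.arity q → 0 ≤ D' j)
    (j : ℤ) (h0 : 0 ≤ j) (hj : j ≤ P.arity p) : 0 ≤ compDeg (P.arity q) loc D D' j := by
  refine add_nonneg (hD j h0 hj) (Finset.sum_nonneg fun k hk => ?_)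
  rw [Finset.mem_filter, Finset.mem_Icc] at hk
  exact hD' k hk.1.1 hk.1.2

theorem compDeg_nonpos {p q : P.Tw} {loc D D' : ℤ → ℤ}
    (hD : ∀ j : ℤ, 0 ≤ j → j ≤ P.arity p → D j ≤ 0) (hD' : ∀ j : ℤ, 0 ≤ j → j ≤ P.arity q → D' j ≤ 0)
    (j : ℤ) (h0 : 0 ≤ j) (hj : j ≤ P.arity p) : compDeg (P.arity q) loc D D' j ≤ 0 := by
  refine add_nonpos (hD j h0 hj) (Finset.sum_nonpos fun k hk => ?_)
  rw [Finset.mem_filter, Finset.mem_Icc] at hk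
  exact hD' k hk.1.1 hk.1.2

/-- An isomorphism only permutes half-edges, so that all its vertices are unary; their gradings are
non-negative and cancel those of the vertices of the inverse. -/
theorem IsTrack.iso {p q : P.Tw} {f : p ⟶ q} [IsIso f] {loc D : ℤ → ℤ} (h : IsTrack ψ f loc D) :
    P.arity p = P.arity q ∧ ∀ j : ℤ, 0 ≤ j → j ≤ P.arity p → D j = 0 := by
  obtain ⟨loc', D', h'⟩ := exists_isTrack ψ (inv f)
  have h1 := h.comp h'
  have h2 := h'.comp h
  rw [IsIso.hom_inv_id] at h1
  rw [IsIso.inv_hom_id] at h2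
  obtain ⟨h3, h4⟩ := h1.unique (isTrack_id p)
  obtain ⟨h5, h6⟩ := h2.unique (isTrack_id q)
  have hD : ∀ j : ℤ, 0 ≤ j → j ≤ P.arity p → 0 ≤ D j := by
    intro j h0 hj
    have h7 := h.neg_one_le h0 hj
    by_contra h8
    have h9 := h'.loc_bounds j h0 hj
    exact h.loc_ne h0 hj (by omega) h9.1 h9.2 (h4 j h0 hj)
  have hD' : ∀ j : ℤ, 0 ≤ j → j ≤ P.arity q → 0 ≤ D' j := by
    intro j h0 hj
    have h7 := h'.neg_one_le h0 hj
    by_contra h8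
    have h9 := h.loc_bounds j h0 hj
    exact h'.loc_ne h0 hj (by omega) h9.1 h9.2 (h6 j h0 hj)
  constructor
  · have hcard : (Finset.Icc (0 : ℤ) (P.arity p)).card = (Finset.Icc (0 : ℤ) (P.arity q)).card := by
      refine Finset.card_bij' (fun j _ => loc' j) (fun l _ => loc l) ?_ ?_ ?_ ?_
      · intro j hj
        rw [Finset.mem_Icc] at hj ⊢
        exact h'.loc_bounds j hj.1 hj.2
      · intro j hj
        rw [Finset.mem_Icc] at hj ⊢
        exact h.loc_bounds j hj.1 hj.2
      · intro j hj
        rw [Finset.mem_Icc] at hj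
        exact h4 j hj.1 hj.2
      · intro j hj
        rw [Finset.mem_Icc] at hj
        exact h6 j hj.1 hj.2
    simp only [Int.card_Icc] at hcard
    omega
  · intro j h0 hj
    have h7 : D j + _ = 0 := h3 j h0 hj
    have h8 := hD j h0 hj
    have h9 : 0 ≤ ∑ k ∈ (Finset.Icc (0 : ℤ) (P.arity q)).filter fun k => loc k = j, D' k := by
      refine Finset.sum_nonneg fun k hk => ?_
      rw [Finset.mem_filter, Finset.mem_Icc] at hk
      exact hD' k hk.1.1 hk.1.2
    omega

/-! ### Attaching several operations -/

namespace Labelled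

variable {L L' : Type}

/-- The image of a labelled operation under a morphism of operads. -/
def push (F : Hom P T) (x : Labelled P L) : Labelled T L where
  op := F.map x.op
  root := x.root
  ins := x.ins
  len := by rw [x.len, arity, arity, F.inputs_map]

@[simp] theorem edges_push (F : Hom P T) (x : Labelled P L) : (x.push F).edges = x.edges := rfl

theorem push_can (F : Hom P T) (p : P.Op) : (can p).push F = can (F.map p) := by
  refine eq_of_edges rfl ?_
  rw [edges_push, edges_can, edges_can, arity, arity, F.inputs_map]

theorem Rel.push {x y : Labelled P L} (F : Hom P T) (h : x.Rel y) : (x.push F).Rel (y.push F) := by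
  obtain ⟨n, σ, h1, h2, h3, h4⟩ := h
  have h1' : (T.inputs (F.map x.op)).length = n := by rw [F.inputs_map, h1]
  refine ⟨n, σ, h1', h2, ?_, h4⟩
  exact (congrArg F.map h3).trans (F.map_act _ _ _ _ _ h1')

theorem Std.push {e : L} {x y z : Labelled P L} (F : Hom P T) (h : Std e x y z) :
    Std e (x.push F) (y.push F) (z.push F) := by
  obtain ⟨i, h, h1, h2, rfl⟩ := h
  have h' : (T.inputs (F.map x.op))[i]? = some (T.output (F.map y.op)) := by
    rw [F.inputs_map, F.output_map, h]
  exact ⟨i, h', h1, h2, eq_of_edges (F.map_comp _ _ _ _ h') rfl⟩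

theorem Contr.push {e : L} {x y z : Labelled P L} (F : Hom P T) (h : Contr e x y z) :
    Contr e (x.push F) (y.push F) (z.push F) := by
  obtain ⟨x', y', z', hx, hy, hz, h⟩ := h
  exact ⟨_, _, _, hx.push F, hy.push F, hz.push F, h.imp (fun h => h.push F) fun h => h.push F⟩

/-- `z` is obtained from `x` by joining the operations in the list to `x`, each at the given
label. -/
def Attach : List (L × Labelled T L) → Labelled T L → Labelled T L → Prop
  | [], x, z => x.Rel z
  | b :: bs, x, z => ∃ t, Contr b.1 x b.2 t ∧ Attach bs t z

/-- The operations in the list can be joined to `x` independently of each other. -/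
structure Indep (x : Labelled T L) (bs : List (L × Labelled T L)) : Prop where
  nodup : x.edges.Nodup
  meet : ∀ b ∈ bs, Meet b.1 x b.2
  disj : bs.Pairwise fun b b' => ∀ l ∈ b.2.edges, l ∉ b'.2.edges
  mem : ∀ b ∈ bs, b.1 ∈ b.2.edges

variable {x x' y z z' t w : Labelled T L} {b : L × Labelled T L} {bs bs' : List (L × Labelled T L)}

theorem Indep.tail (h : Indep x (b :: bs)) : Indep x bs :=
  ⟨h.1, fun b hb => h.2 b (.tail _ hb), (List.pairwise_cons.1 h.3).2,
    fun b hb => h.4 b (.tail _ hb)⟩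

theorem Indep.step (h : Indep x (b :: bs)) (ht : Contr b.1 x b.2 t) : Indep t bs := by
  have hm := h.meet b (.head _)
  refine ⟨ht.nodup hm, fun b' hb' => ⟨ht.nodup hm, (h.meet b' (.tail _ hb')).right,
    fun l hl hl' => ?_⟩, h.tail.3, h.tail.4⟩
  rcases ((ht.mem_iff hm).1 hl).2 with h1 | h1
  · exact (h.meet b' (.tail _ hb')).3 l h1 hl'
  · exact absurd hl' ((List.pairwise_cons.1 h.3).1 b' hb' l h1)

theorem Indep.perm (h : Indep x bs) (hp : bs.Perm bs') : Indep x bs' :=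
  ⟨h.1, fun b hb => h.2 b (hp.mem_iff.2 hb),
    (hp.pairwise_iff (fun h1 l h2 h3 => h1 l h3 h2)).1 h.3, fun b hb => h.4 b (hp.mem_iff.2 hb)⟩

theorem Indep.congr (h : Indep x bs) (hx : x.Rel x') : Indep x' bs :=
  ⟨hx.edges_perm.nodup_iff.2 h.1, fun b hb => (h.2 b hb).congr hx (.refl _), h.3, h.4⟩

theorem Indep.of_append (h : Indep x (bs ++ bs')) : Indep x bs :=
  ⟨h.1, fun b hb => h.2 b (List.mem_append_left _ hb), (List.pairwise_append.1 h.3).1,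
    fun b hb => h.4 b (List.mem_append_left _ hb)⟩

theorem Indep.append (h : Indep x (bs ++ bs')) (ht : Attach bs x t) : Indep t bs' := by
  induction bs generalizing x with
  | nil => exact h.congr ht
  | cons b bs ih =>
    obtain ⟨s, h1, h2⟩ := ht
    exact ih (h.step h1) h2

theorem Attach.congr (h : Attach bs x z) (hx : x.Rel x') (hz : z.Rel z') : Attach bs x' z' := by
  cases bs with
  | nil => exact (hx.symm.trans h).trans hz
  | cons b bs =>
    obtain ⟨t, h1, h2⟩ := h
    refine ⟨t, h1.congr hx (.refl _) (.refl _), ?_⟩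
    clear h1
    induction bs generalizing t with
    | nil => exact Rel.trans h2 hz
    | cons b bs ih =>
      obtain ⟨s, h3, h4⟩ := h2
      exact ⟨s, h3, ih s h4⟩

theorem attach_append : Attach (bs ++ bs') x z ↔ ∃ t, Attach bs x t ∧ Attach bs' t z := by
  induction bs generalizing x with
  | nil => exact ⟨fun h => ⟨x, .refl x, h⟩, fun ⟨t, h1, h2⟩ => h2.congr (Rel.symm h1) (.refl _)⟩
  | cons b bs ih =>
    constructor
    · rintro ⟨s, h1, h2⟩
      obtain ⟨t, h3, h4⟩ := ih.1 h2
      exact ⟨t, ⟨s, h1, h3⟩, h4⟩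
    · rintro ⟨t, ⟨s, h1, h3⟩, h4⟩
      exact ⟨s, h1, ih.2 ⟨t, h3, h4⟩⟩

/-- The result is unique up to renumbering. -/
theorem Attach.rel (h : Indep x bs) (h1 : Attach bs x z) (h2 : Attach bs x z') : z.Rel z' := by
  induction bs generalizing x with
  | nil => exact (Rel.symm h1).trans h2
  | cons b bs ih =>
    obtain ⟨t, h3, h4⟩ := h1
    obtain ⟨s, h5, h6⟩ := h2
    have := h3.rel (h.meet b (.head _)) h5
    exact ih (h.step h3) h4 (h6.congr this.symm (.refl _))

theorem Attach.nodup (h : Indep x bs) (h1 : Attach bs x z) : z.edges.Nodup := by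
  induction bs generalizing x with
  | nil => exact (Rel.edges_perm h1).nodup_iff.2 h.1
  | cons b bs ih =>
    obtain ⟨t, h3, h4⟩ := h1
    exact ih (h.step h3) h4

theorem Attach.mem_iff (h : Indep x bs) (h1 : Attach bs x z) {l : L} :
    l ∈ z.edges ↔ (∀ b ∈ bs, l ≠ b.1) ∧ (l ∈ x.edges ∨ ∃ b ∈ bs, l ∈ b.2.edges) := by
  induction bs generalizing x with
  | nil => simpa using (Rel.edges_perm h1).mem_iff
  | cons b bs ih =>
    obtain ⟨t, h3, h4⟩ := h1
    rw [ih (h.step h3) h4, h3.mem_iff (h.meet b (.head _))]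
    simp only [List.mem_cons, forall_eq_or_imp, exists_eq_or_imp]
    constructor
    · rintro ⟨h5, ⟨h6, h7⟩ | ⟨b', h6, h7⟩⟩
      · exact ⟨⟨h6, h5⟩, by tauto⟩
      · refine ⟨⟨?_, h5⟩, .inr (.inr ⟨b', h6, h7⟩)⟩
        rintro rfl
        exact (List.pairwise_cons.1 h.3).1 b' h6 _ (h.4 b (.head _)) h7
    · rintro ⟨⟨h5, h6⟩, h7⟩
      exact ⟨h6, by tauto⟩

theorem Indep.chain {b' : L × Labelled T L} (h : Indep x (b :: b' :: bs)) :
    Chain3 b.1 b'.1 b.2 x b'.2 :=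
  ⟨(h.2 b (.head _)).symm, h.2 b' (.tail _ (.head _)),
    (List.pairwise_cons.1 h.3).1 b' (.head _)⟩

/-- The order in which the operations are joined is irrelevant. -/
theorem Attach.perm (h : Indep x bs) (h1 : Attach bs x z) (hp : bs.Perm bs') :
    Attach bs' x z := by
  induction hp generalizing x with
  | nil => exact h1
  | cons b _ ih =>
    obtain ⟨t, h3, h4⟩ := h1
    exact ⟨t, h3, ih (h.step h3) h4⟩
  | swap b b' bs =>
    obtain ⟨t, h3, s, h4, h5⟩ := h1
    obtain ⟨r, h6, h7⟩ := h3.symm.assoc h.chain h4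
    exact ⟨r, h6, s, h7.symm, h5⟩
  | trans hp _ ih1 ih2 => exact ih2 (h.perm hp) (ih1 h h1)

theorem Attach.map (g : L → L') (h : Attach bs x z) :
    Attach (bs.map fun b => (g b.1, b.2.map g)) (x.map g) (z.map g) := by
  induction bs generalizing x with
  | nil => exact Rel.map g h
  | cons b bs ih =>
    obtain ⟨t, h3, h4⟩ := h
    exact ⟨_, h3.map g, ih h4⟩

/-- An operation that is joined to `x` has a half-edge of the same colour and, unless the operad is
cyclic, of the opposite direction. -/
theorem Attach.exists_col (h : Indep x bs) (h1 : Attach bs x z) (hb : b ∈ bs) :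
    (∃ c, (b.1, c) ∈ x.cols ∧ (b.1, c) ∈ b.2.cols) ∧
      (κ ≠ .cyclic → (b.1 ∈ x.ins ∧ b.2.root = b.1) ∨ (x.root = b.1 ∧ b.1 ∈ b.2.ins)) := by
  obtain ⟨l₁, l₂, rfl⟩ := List.append_of_mem hb
  have hp : (l₁ ++ b :: l₂).Perm (b :: (l₁ ++ l₂)) := List.perm_middle
  obtain ⟨t, h3, -⟩ := h1.perm h hp
  have hm := h.meet b hb
  refine ⟨h3.exists_col hm, fun hκ => ?_⟩
  rcases h3.orient hκ hm with h4 | h4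
  · exact .inl ⟨h4.1, h4.2.1⟩
  · exact .inr ⟨h4.2.1, h4.1⟩

/-- An operation can be joined to one of the operations that are joined to `x`, instead of the
result. -/
theorem Attach.insert {l : L} (h : Indep x (b :: bs)) (h1 : Attach (b :: bs) x z)
    (h2 : Contr l z w t) (hl : l ∈ b.2.edges) (hw : w.edges.Nodup) (hlw : l ∈ w.edges)
    (hb : ∀ k ∈ b.2.edges, k ∈ w.edges → k = l) (hx : ∀ k ∈ x.edges, k ∉ w.edges)
    (hbs : ∀ b' ∈ bs, ∀ k ∈ b'.2.edges, k ∉ w.edges) :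
    ∃ y, Contr l b.2 w y ∧ Attach ((b.1, y) :: bs) x t := by
  obtain ⟨s, h3, h4⟩ := h1
  have hm := h.meet b (.head _)
  have hle : l ≠ b.1 := by
    rintro rfl
    exact hx _ (h3.mem_left hm) hlw
  have hls : l ∈ s.edges := (h3.mem_iff hm).2 ⟨hle, .inr hl⟩
  have hI := h.step h3
  have hsw : ∀ k ∈ s.edges, k ∈ w.edges → k = l := by
    intro k hk hk'
    rcases ((h3.mem_iff hm).1 hk).2 with h5 | h5
    · exact absurd hk' (hx k h5)
    · exact hb k h5 hk'
  -- the operation `w` is joined before the operations in `bs`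
  have key : ∃ r, Contr l s w r ∧ Attach bs r t := by
    have hz : Meet l z w := by
      refine ⟨h4.nodup hI, hw, fun k hk hk' => ?_⟩
      rcases ((h4.mem_iff hI).1 hk).2 with h5 | ⟨b', h5, h6⟩
      · exact hsw k h5 hk'
      · exact absurd hk' (hbs b' h5 k h6)
    have h5 : Attach (bs ++ [(l, w)]) s t := attach_append.2 ⟨z, h4, t, h2, .refl t⟩
    refine h5.perm ⟨hI.1, fun b' hb' => ?_, List.pairwise_append.2 ⟨hI.3,
      List.pairwise_singleton _ _, fun b' hb' b'' hb'' => ?_⟩, fun b' hb' => ?_⟩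
      (List.perm_append_singleton (l, w) bs)
    · rcases List.mem_append.1 hb' with h6 | h6
      · exact hI.2 b' h6
      · obtain rfl := List.mem_singleton.1 h6
        exact ⟨hI.1, hw, hsw⟩
    · obtain rfl := List.mem_singleton.1 hb''
      exact hbs b' hb'
    · rcases List.mem_append.1 hb' with h6 | h6
      · exact hI.4 b' h6
      · obtain rfl := List.mem_singleton.1 h6
        exact hlw
  obtain ⟨r, h5, h6⟩ := key
  obtain ⟨y, h7, h8⟩ := h3.assoc ⟨hm, ⟨hm.2, hw, hb⟩, hx⟩ h5
  exact ⟨y, h7, r, h8, h6⟩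

/-- The operation with the labels of `X` that is given by an element of `T`. -/
def lab (X : Labelled P L) (x : El T X.op) : Labelled T L where
  op := x.1
  root := X.root
  ins := X.ins
  len := by rw [X.len, x.arity_eq]

@[simp] theorem edges_lab (X : Labelled P L) (x : El T X.op) : (X.lab x).edges = X.edges := rfl

theorem cols_lab (X : Labelled P L) (x : El T X.op) : (X.lab x).cols = X.cols := by
  rw [cols, cols, edges_lab, ← x.hedges_eq]; rfl

end Labelled

/-! ### Decorations of the source of a morphism -/

/-- The label of the half-edge `l` of the source vertex. These labels are smaller than the mark
`-1`, the other labels being used for the leaves. -/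
def src (l : ℤ) : ℤ := -l - 2

/-- The source vertex `p`. -/
def srcVertex (p : P.Op) : Labelled P ℤ := (can p).map src

/-- The labelled operations `y e`, for `e` in a list, in an operad under `P`. -/
def decos (F : Hom P T) (y : ℤ → Labelled P ℤ) (E : List ℤ) : List (ℤ × Labelled T ℤ) :=
  E.map fun e => (e, (y e).push F)

theorem mem_srcVertex {p : P.Op} {l : ℤ} :
    l ∈ (srcVertex p).edges ↔ l ≤ -2 ∧ -2 - P.arity p ≤ l := by
  rw [srcVertex, mem_edges_map]
  constructor
  · rintro ⟨k, hk, rfl⟩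
    have := mem_can.1 hk
    rw [src]; omega
  · intro h
    exact ⟨-l - 2, mem_can.2 (by omega), by rw [src]; omega⟩

theorem nodup_srcVertex (p : P.Op) : (srcVertex p).edges.Nodup := by
  rw [srcVertex, edges_map]
  exact (nodup_can p).map fun a b h => by simp only [src] at h; omega

/-- The morphism `f` is represented by the tree whose vertices are the source vertex and the
labelled operations `y e`, attached to the half-edges `e` of the source vertex; the leaves of this
tree are labelled by the half-edges of the target. -/
structure Decorates {p q : P.Tw} (f : p ⟶ q) (y : ℤ → Labelled P ℤ) : Prop where
  indep : Indep (srcVertex p) (decos (Hom.id P) y (srcVertex p).edges)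
  attach : ∀ (T : Operad.{u, v} κ C) (F : Hom P T) (x : El T p),
    Attach (decos F y (srcVertex p).edges) ((srcVertex p).lab x) (can (app F f x).1)

theorem indep_decos {X : Labelled P ℤ} {y : ℤ → Labelled P ℤ} {E : List ℤ}
    (h : Indep X (decos (Hom.id P) y E)) (F : Hom P T) {Z : Labelled T ℤ} (hZ : Z.edges = X.edges) :
    Indep Z (decos F y E) := by
  refine ⟨by rw [hZ]; exact h.1, fun b hb => ?_, ?_, fun b hb => ?_⟩
  · obtain ⟨e, he, rfl⟩ := List.mem_map.1 hb
    have := h.2 _ (List.mem_map.2 ⟨e, he, rfl⟩)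
    exact ⟨by rw [hZ]; exact h.1, this.2, by rw [hZ]; exact this.3⟩
  · have := h.3
    rw [decos, List.pairwise_map] at this ⊢
    exact this
  · obtain ⟨e, he, rfl⟩ := List.mem_map.1 hb
    exact h.4 _ (List.mem_map.2 ⟨e, he, rfl⟩)

theorem Decorates.attach_self {p q : P.Tw} {f : p ⟶ q} {y : ℤ → Labelled P ℤ}
    (h : Decorates f y) :
    Attach (decos (Hom.id P) y (srcVertex p).edges) (srcVertex p) (can (q : P.Op)) := by
  have := h.attach P (Hom.id P) (El.self p)
  rwa [app_self] at this

theorem Decorates.mem {p q : P.Tw} {f : p ⟶ q} {y : ℤ → Labelled P ℤ} (h : Decorates f y) {e : ℤ}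
    (he : e ∈ (srcVertex p).edges) :
    (y e).edges.Nodup ∧ e ∈ (y e).edges ∧ ∀ l ∈ (y e).edges, l = e ∨ 0 ≤ l ∧ l ≤ P.arity q := by
  have hb : (e, (y e).push (Hom.id P)) ∈ decos (Hom.id P) y (srcVertex p).edges :=
    List.mem_map.2 ⟨e, he, rfl⟩
  refine ⟨(h.indep.2 _ hb).2, h.indep.4 _ hb, fun l hl => ?_⟩
  by_cases hle : l = e
  · exact .inl hle
  · right
    refine mem_can.1 ((h.attach_self.mem_iff h.indep).2 ⟨fun b hb' => ?_, .inr ⟨_, hb, hl⟩⟩)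
    obtain ⟨e', he', rfl⟩ := List.mem_map.1 hb'
    rintro rfl
    exact hle ((h.indep.2 _ hb).3 _ he' hl)

theorem Decorates.disj {p q : P.Tw} {f : p ⟶ q} {y : ℤ → Labelled P ℤ} (h : Decorates f y)
    {e e' : ℤ} (he : e ∈ (srcVertex p).edges) (he' : e' ∈ (srcVertex p).edges) (hne : e ≠ e') :
    ∀ l ∈ (y e).edges, l ∉ (y e').edges := by
  have h1 := h.indep.3
  rw [decos, List.pairwise_map] at h1
  have : _root_.Std.Symm fun a b => ∀ l ∈ (a, (y a).push (Hom.id P)).2.edges,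
      l ∉ (b, (y b).push (Hom.id P)).2.edges := ⟨fun _ _ h2 l h3 h4 => h2 l h4 h3⟩
  exact h1.forall he he' hne

theorem decos_map {F : Hom P T} {y : ℤ → Labelled P ℤ} {E : List ℤ} {g : ℤ → ℤ}
    (hg : ∀ e ∈ E, g e = e) :
    (decos F y E).map (fun b => (g b.1, b.2.map g)) = decos F (fun e => (y e).map g) E := by
  rw [decos, decos, List.map_map]
  refine List.map_congr_left fun e he => ?_
  simp only [Function.comp_apply, hg e he]
  rfl

theorem lab_srcVertex_map {p : P.Op} (x : El T p) {g : ℤ → ℤ} (hg : ∀ l < 0, g l = l) :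
    ((srcVertex p).lab x).map g = (srcVertex p).lab x :=
  map_eq_self fun l hl => hg l (by have := mem_srcVertex.1 hl; omega)

/-- The decorations after a relabelling of the leaves. -/
theorem Decorates.relabel {p q : P.Tw} {f : p ⟶ q} {y : ℤ → Labelled P ℤ} (h : Decorates f y)
    {g : ℤ → ℤ} (hg : ∀ l < 0, g l = l) (hg' : ∀ l : ℤ, 0 ≤ l → l ≤ P.arity q → -1 ≤ g l)
    (hinj : ∀ l l' : ℤ, 0 ≤ l → l ≤ P.arity q → 0 ≤ l' → l' ≤ P.arity q → g l = g l' → l = l') :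
    Indep (srcVertex p) (decos (Hom.id P) (fun e => (y e).map g) (srcVertex p).edges) ∧
      ∀ (T : Operad.{u, v} κ C) (F : Hom P T) (x : El T p),
        Attach (decos F (fun e => (y e).map g) (srcVertex p).edges) ((srcVertex p).lab x)
          ((can (app F f x).1).map g) := by
  have hneg : ∀ e ∈ (srcVertex p).edges, g e = e := fun e he =>
    hg e (by have := mem_srcVertex.1 he; omega)
  refine ⟨⟨nodup_srcVertex p, fun b hb => ?_, ?_, fun b hb => ?_⟩, fun T F x => ?_⟩
  · obtain ⟨e, he, rfl⟩ := List.mem_map.1 hb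
    have hm := h.mem he
    refine ⟨nodup_srcVertex p, ?_, fun l hl hl' => ?_⟩
    · rw [edges_push, edges_map]
      refine hm.1.map_on fun a ha b hb hab => ?_
      have h1 := mem_srcVertex.1 he
      rcases hm.2.2 a ha with rfl | h2 <;> rcases hm.2.2 b hb with rfl | h3
      · rfl
      · have := hg' b h3.1 h3.2
        rw [hneg _ he] at hab; omega
      · have := hg' a h2.1 h2.2
        rw [hneg _ he] at hab; omega
      · exact hinj a b h2.1 h2.2 h3.1 h3.2 hab
    · have h1 := mem_srcVertex.1 hl
      obtain ⟨a, ha, rfl⟩ := mem_edges_map.1 hl'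
      rcases hm.2.2 a ha with rfl | h2
      · exact hneg _ he
      · have := hg' a h2.1 h2.2; omega
  · rw [decos, List.pairwise_map]
    refine (nodup_srcVertex p).imp_of_mem fun {e e'} he he' hne l hl hl' => ?_
    have hm := h.mem he
    have hm' := h.mem he'
    obtain ⟨a, ha, rfl⟩ := mem_edges_map.1 hl
    obtain ⟨b, hb, hab⟩ := mem_edges_map.1 hl'
    have h1 := mem_srcVertex.1 he
    have h1' := mem_srcVertex.1 he'
    rcases hm.2.2 a ha with rfl | h2 <;> rcases hm'.2.2 b hb with rfl | h3
    · rw [hneg _ he, hneg _ he'] at hab; exact hne hab.symm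
    · have := hg' b h3.1 h3.2
      rw [hneg _ he] at hab; omega
    · have := hg' a h2.1 h2.2
      rw [hneg _ he'] at hab; omega
    · obtain rfl := hinj b a h3.1 h3.2 h2.1 h2.2 hab
      exact h.disj he he' hne b ha hb
  · obtain ⟨e, he, rfl⟩ := List.mem_map.1 hb
    exact mem_edges_map.2 ⟨e, (h.mem he).2.1, hneg e he⟩
  · have := (h.attach T F x).map g
    rwa [decos_map hneg, lab_srcVertex_map x hg] at this

/-- The decorations after a renaming of the half-edges of the target. -/
theorem Decorates.rel {p q q' : P.Tw} {f : p ⟶ q} {f' : p ⟶ q'} {y : ℤ → Labelled P ℤ}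
    (h : Decorates f y) {g : ℤ → ℤ} (hg : ∀ l < 0, g l = l)
    (hg' : ∀ l : ℤ, 0 ≤ l → l ≤ P.arity q → -1 ≤ g l)
    (hinj : ∀ l l' : ℤ, 0 ≤ l → l ≤ P.arity q → 0 ≤ l' → l' ≤ P.arity q → g l = g l' → l = l')
    (hr : ∀ (T : Operad.{u, v} κ C) (F : Hom P T) (x : El T p),
      ((can (app F f x).1).map g).Rel (can (app F f' x).1)) : ∃ y', Decorates f' y' := by
  obtain ⟨h1, h2⟩ := h.relabel hg hg' hinj
  exact ⟨_, h1, fun T F x => (h2 T F x).congr (.refl _) (hr T F x)⟩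

/-- An operation that is joined to the value of a morphism is joined to one of the vertices of the
tree. -/
theorem Decorates.contr {p q q' : P.Tw} {f : p ⟶ q} {f' : p ⟶ q'} {y : ℤ → Labelled P ℤ}
    (h : Decorates f y) {g : ℤ → ℤ} (hg : ∀ l < 0, g l = l)
    (hg' : ∀ l : ℤ, 0 ≤ l → l ≤ P.arity q → -1 ≤ g l)
    (hinj : ∀ l l' : ℤ, 0 ≤ l → l ≤ P.arity q → 0 ≤ l' → l' ≤ P.arity q → g l = g l' → l = l')
    {w : Labelled P ℤ} (hw : w.edges.Nodup) (hw' : ∀ l ∈ w.edges, -1 ≤ l) (hlw : -1 ∈ w.edges)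
    (hgw : ∀ l : ℤ, 0 ≤ l → l ≤ P.arity q → g l ∈ w.edges → g l = -1)
    (hlg : ∃ l : ℤ, 0 ≤ l ∧ l ≤ P.arity q ∧ g l = -1)
    (hC : ∀ (T : Operad.{u, v} κ C) (F : Hom P T) (x : El T p),
      Contr (-1) ((can (app F f x).1).map g) (w.push F) (can (app F f' x).1)) :
    ∃ y', Decorates f' y' := by
  obtain ⟨h1, h2⟩ := h.relabel hg hg' hinj
  set y₁ : ℤ → Labelled P ℤ := fun e => (y e).map g with hy₁
  have h3 := h2 P (Hom.id P) (El.self p)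
  have hmem : ∀ e ∈ (srcVertex p).edges, ∀ l ∈ (y₁ e).edges, l = e ∨ (-1 ≤ l ∧
      (l ∈ w.edges → l = -1)) := by
    intro e he l hl
    obtain ⟨a, ha, rfl⟩ := mem_edges_map.1 hl
    rcases (h.mem he).2.2 a ha with rfl | h4
    · exact .inl (hg _ (by have := mem_srcVertex.1 he; omega))
    · exact .inr ⟨hg' a h4.1 h4.2, hgw a h4.1 h4.2⟩
  obtain ⟨e, he, hle⟩ : ∃ e ∈ (srcVertex p).edges, -1 ∈ (y₁ e).edges := by
    obtain ⟨l, h4, h5, h6⟩ := hlg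
    have h7 : -1 ∈ ((can (app (Hom.id P) f (El.self p)).1).map g).edges := by
      rw [app_self]
      exact mem_edges_map.2 ⟨l, mem_can.2 ⟨h4, h5⟩, h6⟩
    rcases ((h3.mem_iff (indep_decos h1 _ rfl)).1 h7).2 with h8 | ⟨b, h8, h9⟩
    · have := mem_srcVertex.1 h8; omega
    · obtain ⟨e, he, rfl⟩ := List.mem_map.1 h8
      exact ⟨e, he, h9⟩
  obtain ⟨E, hE⟩ : ∃ E, (srcVertex p).edges.Perm (e :: E) := by
    obtain ⟨l₁, l₂, h4⟩ := List.append_of_mem he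
    exact ⟨l₁ ++ l₂, h4 ▸ List.perm_middle⟩
  have heE : e ∉ E := (List.nodup_cons.1 (hE.nodup_iff.1 (nodup_srcVertex p))).1
  have hdecos : ∀ {T : Operad.{u, v} κ C} (F : Hom P T) (y : ℤ → Labelled P ℤ),
      (decos F y (srcVertex p).edges).Perm (decos F y (e :: E)) := fun F y => hE.map _
  have hI := h1.perm (hdecos _ _)
  -- the new vertex exists in every operad under `P`
  have key : ∀ (T : Operad.{u, v} κ C) (F : Hom P T) (x : El T p), ∃ z,
      Contr (-1) ((y₁ e).push F) (w.push F) z ∧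
        Attach ((e, z) :: decos F y₁ E) ((srcVertex p).lab x) (can (app F f' x).1) := by
    intro T F x
    refine Attach.insert (indep_decos hI F rfl)
      ((h2 T F x).perm (indep_decos h1 F rfl) (hdecos _ _)) (hC T F x) hle hw hlw ?_ ?_ ?_
    · intro k hk hk'
      rcases hmem e he k hk with rfl | h4
      · have := hw' _ hk'
        have := mem_srcVertex.1 he
        omega
      · exact h4.2 hk'
    · intro k hk hk'
      have := mem_srcVertex.1 hk
      have := hw' _ hk'
      omega
    · intro b hb k hk hk'
      obtain ⟨e', he', rfl⟩ := List.mem_map.1 hb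
      have he'' : e' ∈ (srcVertex p).edges := hE.mem_iff.2 (.tail _ he')
      rcases hmem e' he'' k hk with rfl | h4
      · have := hw' _ hk'
        have := mem_srcVertex.1 he''
        omega
      · obtain rfl := h4.2 hk'
        exact (List.pairwise_cons.1 hI.3).1 _ (List.mem_map.2 ⟨e', he', rfl⟩) _ hle hk
  obtain ⟨z, hz, -⟩ := key P (Hom.id P) (El.self p)
  have hz : Contr (-1) (y₁ e) w z := hz
  have hm : Meet (-1) (y₁ e) w := by
    refine ⟨(hI.2 _ (.head _)).2, hw, fun k hk hk' => ?_⟩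
    rcases hmem e he k hk with rfl | h4
    · have := hw' _ hk'
      have := mem_srcVertex.1 he
      omega
    · exact h4.2 hk'
  have hzmem : ∀ l ∈ z.edges, l ≠ -1 ∧ (l ∈ (y₁ e).edges ∨ l ∈ w.edges) := fun l hl =>
    (hz.mem_iff hm).1 hl
  have hupd : ∀ {T : Operad.{u, v} κ C} (F : Hom P T),
      decos F (Function.update y₁ e z) (e :: E) = (e, z.push F) :: decos F y₁ E := by
    intro T F
    rw [decos, List.map_cons, Function.update_self, decos]
    congr 1
    refine List.map_congr_left fun e' he' => ?_
    rw [Function.update_of_ne (by rintro rfl; exact heE he')]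
  have hI' : Indep (srcVertex p) ((e, z.push (Hom.id P)) :: decos (Hom.id P) y₁ E) := by
    refine ⟨hI.1, fun b hb => ?_, List.pairwise_cons.2 ⟨fun b hb l hl hl' => ?_, hI.tail.3⟩,
      fun b hb => ?_⟩
    · rcases List.mem_cons.1 hb with rfl | hb
      · refine ⟨hI.1, hz.nodup hm, fun l hl hl' => ?_⟩
        rcases (hzmem l hl').2 with h5 | h5
        · exact (hI.2 _ (.head _)).3 l hl h5
        · have := hw' l h5
          have := mem_srcVertex.1 hl
          omega
      · exact hI.2 b (.tail _ hb)
    · obtain ⟨h4, h5⟩ := hzmem l hl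
      rcases h5 with h5 | h5
      · exact (List.pairwise_cons.1 hI.3).1 b hb l h5 hl'
      · obtain ⟨e', he', rfl⟩ := List.mem_map.1 hb
        have he'' : e' ∈ (srcVertex p).edges := hE.mem_iff.2 (.tail _ he')
        rcases hmem e' he'' l hl' with rfl | h6
        · have := hw' _ h5
          have := mem_srcVertex.1 he''
          omega
        · exact h4 (h6.2 h5)
    · rcases List.mem_cons.1 hb with rfl | hb
      · refine (hz.mem_iff hm).2 ⟨?_, .inl (hI.4 _ (.head _))⟩
        have := mem_srcVertex.1 he
        simp only; omega
      · exact hI.4 b (.tail _ hb)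
  refine ⟨Function.update y₁ e z, ?_, fun T F x => ?_⟩
  · rw [← hupd] at hI'
    exact hI'.perm (hdecos _ _).symm
  · obtain ⟨z', h4, s, h5, h6⟩ := key T F x
    have h7 : z'.Rel (z.push F) :=
      Contr.rel (x := (y₁ e).push F) (y := w.push F) ⟨hm.1, hm.2, hm.3⟩ h4 (hz.push F)
    have h8 : Attach (decos F (Function.update y₁ e z) (e :: E)) ((srcVertex p).lab x)
        (can (app F f' x).1) := by
      rw [hupd]
      exact ⟨s, h5.congr (.refl _) h7 (.refl _), h6⟩
    refine h8.perm ?_ (hdecos _ _).symm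
    rw [← hupd] at hI'
    exact indep_decos hI' F rfl

theorem push_map {L L' : Type} (F : Hom P T) (x : Labelled P L) (g : L → L') :
    (x.map g).push F = (x.push F).map g := rfl

open Classical in
/-- Identity operations attached to all half-edges. -/
theorem attach_one {y : ℤ → Labelled P ℤ} {F : Hom P T} (c : ℤ → C)
    (hy : ∀ e, (y e).op = P.one (c e) ∧
      (y e).edges = if e = -2 then [-e - 2, e] else [e, -e - 2])
    {E : List ℤ} (hE : E.Nodup) {X : Labelled T ℤ} (hX : X.edges.Nodup)
    (h : ∀ e ∈ E, e ≤ -2 ∧ -e - 2 ∉ X.edges ∧ (e, c e) ∈ X.cols ∧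
      (κ ≠ .cyclic → (e = -2 → X.root = e) ∧ (e ≠ -2 → e ∈ X.ins))) :
    Attach (decos F y E) X (X.map fun l => if l ∈ E then -l - 2 else l) := by
  induction E generalizing X with
  | nil => rw [map_eq_self (by simp)]; exact .refl X
  | cons e E ih =>
    obtain ⟨h1, h2, h3, h4⟩ := h e (.head _)
    have heX : e ∈ X.edges := mem_edges_iff.2 ⟨_, h3⟩
    have heE := (List.nodup_cons.1 hE).1
    have hstep : Contr e X ((y e).push F) (X.map fun k => if k = e then -e - 2 else k) := by
      refine contr_one hX h3 ((congrArg F.map (hy e).1).trans (F.map_one _)) ?_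
      rw [edges_push, (hy e).2]
      split_ifs with h5
      · exact .inr ⟨rfl, fun hκ => (h4 hκ).1 h5⟩
      · exact .inl ⟨rfl, fun hκ => (h4 hκ).2 h5⟩
    refine ⟨_, hstep, ?_⟩
    have := ih (List.nodup_cons.1 hE).2 (X := X.map fun k => if k = e then -e - 2 else k) ?_ ?_
    · rw [Labelled.map_map] at this
      show Attach (decos F y E) _ _
      convert this using 1
      refine Labelled.map_congr fun l hl => ?_
      simp only [Function.comp_apply, List.mem_cons]
      by_cases hle : l = e
      · subst hle
        rw [if_pos (.inl rfl), if_pos rfl, if_neg]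
        intro h6
        have := (h _ (.tail _ h6)).1
        omega
      · simp only [hle, false_or, if_false]
    · rw [edges_map]
      refine hX.map_on fun a ha b hb hab => ?_
      split_ifs at hab with h6 h7 h7
      · rw [h6, h7]
      · exact absurd (hab ▸ hb) h2
      · exact absurd (hab ▸ ha) h2
      · exact hab
    · intro e' he'
      obtain ⟨h6, h7, h8, h9⟩ := h e' (.tail _ he')
      have hne : e' ≠ e := by rintro rfl; exact heE he'
      have hmap : ∀ l : ℤ, l ≤ -2 → l ≠ e → ∀ k, (if k = e then -e - 2 else k) = l ↔ k = l := by
        intro l hl hle k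
        split_ifs with h10
        · subst h10; constructor <;> intro h11 <;> omega
        · exact Iff.rfl
      refine ⟨h6, fun h10 => ?_, ?_, fun hκ => ⟨fun h10 => ?_, fun h10 => ?_⟩⟩
      · obtain ⟨k, hk, hk'⟩ := mem_edges_map.1 h10
        split_ifs at hk' with h11
        · omega
        · exact h7 (hk' ▸ hk)
      · rw [cols_map]
        exact List.mem_map.2 ⟨_, h8, by simp [hne]⟩
      · have := (h9 hκ).1 h10
        simp [Labelled.map, this, hne]
      · have := (h9 hκ).2 h10
        exact List.mem_map.2 ⟨_, this, by simp [hne]⟩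

/-- The identity morphism is a tree with identity vertices. -/
theorem exists_decorates_id (p : P.Tw) : ∃ y, Decorates (𝟙 p) y := by
  classical
  let c : ℤ → C := fun e => ((P.hedges p)[(-e - 2).toNat]?).getD (P.output p)
  have hy : ∀ e, ∃ y : Labelled P ℤ, y.op = P.one (c e) ∧
      y.edges = if e = -2 then [-e - 2, e] else [e, -e - 2] := by
    intro e
    split_ifs
    · exact ⟨⟨P.one (c e), -e - 2, [e], by rw [arity, P.inputs_one]; rfl⟩, rfl, rfl⟩
    · exact ⟨⟨P.one (c e), e, [-e - 2], by rw [arity, P.inputs_one]; rfl⟩, rfl, rfl⟩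
  choose y hy using hy
  have hedge : ∀ e l, l ∈ (y e).edges ↔ l = e ∨ l = -e - 2 := by
    intro e l
    rw [(hy e).2]
    split_ifs <;> simp [or_comm]
  have hsrc : ∀ l, src (src l) = l := fun l => by simp only [src]; omega
  refine ⟨y, ⟨nodup_srcVertex p, fun b hb => ?_, ?_, fun b hb => ?_⟩, fun T F x => ?_⟩
  · obtain ⟨e, he, rfl⟩ := List.mem_map.1 hb
    have h1 := mem_srcVertex.1 he
    refine ⟨nodup_srcVertex p, ?_, fun l hl hl' => ?_⟩
    · rw [edges_push, (hy e).2]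
      split_ifs <;> simp <;> omega
    · have h2 := mem_srcVertex.1 hl
      rw [edges_push, hedge] at hl'
      omega
  · rw [decos, List.pairwise_map]
    refine (nodup_srcVertex p).imp_of_mem fun {e e'} he he' hne l hl hl' => ?_
    have h1 := mem_srcVertex.1 he
    have h1' := mem_srcVertex.1 he'
    rw [edges_push, hedge] at hl hl'
    omega
  · obtain ⟨e, he, rfl⟩ := List.mem_map.1 hb
    rw [edges_push, hedge]
    exact .inl rfl
  · rw [app_id]
    have hcol : ∀ e ∈ (srcVertex p).edges, (e, c e) ∈ (srcVertex p).cols := by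
      intro e he
      obtain ⟨k, hk⟩ := mem_edges_iff.1 he
      have h1 := hk
      rw [srcVertex, cols_map] at h1
      obtain ⟨⟨l, k'⟩, h2, h3⟩ := List.mem_map.1 h1
      obtain ⟨rfl, rfl⟩ := Prod.mk.inj h3
      have h4 := mem_can.1 (mem_edges_iff.2 ⟨_, h2⟩)
      have h5 : (P.hedges p)[l.toNat]? = some k' := mem_cols_can (by rwa [Int.toNat_of_nonneg h4.1])
      have h6 : (-src l - 2).toNat = l.toNat := by simp only [src]; omega
      have h7 : c (src l) = k' := by
        simp only [c]
        rw [h6, h5]; rfl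
      rw [h7]; exact hk
    have := attach_one (F := F) c hy (nodup_srcVertex p) (X := (srcVertex p).lab x)
      (nodup_srcVertex p) fun e he => ?_
    · convert this using 1
      refine eq_of_edges rfl ?_
      rw [edges_map]
      change _ = (srcVertex p).edges.map _
      rw [srcVertex, edges_map, List.map_map]
      rw [edges_can, edges_can, x.arity_eq]
      refine (List.map_id _).symm.trans (List.map_congr_left fun l hl => ?_)
      rw [← edges_can] at hl
      have h1 : src l ∈ ((can (p : P.Op)).map src).edges := mem_edges_map.2 ⟨l, hl, rfl⟩
      have h2 := hsrc l
      simp only [Function.comp_apply, edges_map] at h1 ⊢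
      rw [if_pos (by rwa [edges_can] at h1)]
      simp only [src, id]; omega
    · have h1 := mem_srcVertex.1 he
      refine ⟨h1.1, fun h2 => ?_, ?_, fun _ => ⟨fun h2 => ?_, fun h2 => ?_⟩⟩
      · have := mem_srcVertex.1 h2; omega
      · exact (congrArg (_ ∈ ·) (cols_lab (srcVertex p) x)).mpr (hcol e he)
      · subst h2; rfl
      · exact mem_ins_of_ne he h2

/-- Every morphism of the twisted arrow category is represented by a tree. -/
theorem exists_decorates {p q : P.Tw} (f : p ⟶ q) : ∃ y, Decorates f y := by
  refine tw_induction (M := fun q f => ∃ y, Decorates f y) (exists_decorates_id p) ?_ ?_ ?_ f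
  · rintro q f ⟨y, hy⟩ i c h
    have hi : i < P.arity q := lt_length h
    refine hy.contr (g := outL (-1) i (P.arity c)) (w := (can c).map (innL (-1) i))
      (fun l hl => ?_) (fun l h1 h2 => ?_) (fun l l' h1 h2 h3 h4 h5 => ?_) ?_ (fun l hl => ?_)
      (mem_edges_map.2 ⟨0, mem_can.2 (by omega), by simp [innL]⟩) (fun l h1 h2 h3 => ?_)
      ⟨i + 1, by omega, by omega, by simp [outL]⟩ (fun T F x => ?_)
    · simp only [outL]; split_ifs <;> omega
    · simp only [outL]; split_ifs <;> omega
    · simp only [outL] at h5; split_ifs at h5 <;> omega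
    · rw [edges_map]
      refine (nodup_can c).map_on fun a ha b hb hab => ?_
      have := mem_can.1 ha
      have := mem_can.1 hb
      simp only [innL] at hab; split_ifs at hab <;> omega
    · obtain ⟨k, hk, rfl⟩ := mem_edges_map.1 hl
      have := mem_can.1 hk
      simp only [innL]; split_ifs <;> omega
    · obtain ⟨k, hk, hk'⟩ := mem_edges_map.1 h3
      have := mem_can.1 hk
      simp only [innL, outL] at hk' ⊢; split_ifs at hk' ⊢ <;> omega
    · have h1 := (std_can ((app F f x).compL_aux (F := F) h) (-1)).contr
      have h2 : T.arity (F.map c) = P.arity c := congrArg List.length (F.inputs_map c)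
      rw [app_comp, app_eL, push_map, push_can]
      rwa [h2] at h1
  · rintro q f ⟨y, hy⟩ i c h
    have hi : i < P.arity c := lt_length h
    refine hy.contr (g := innL (-1) i) (w := (can c).map (outL (-1) i (P.arity q)))
      (fun l hl => ?_) (fun l h1 h2 => ?_) (fun l l' h1 h2 h3 h4 h5 => ?_) ?_ (fun l hl => ?_)
      (mem_edges_map.2 ⟨i + 1, mem_can.2 (by omega), by simp [outL]⟩) (fun l h1 h2 h3 => ?_)
      ⟨0, by omega, by omega, by simp [innL]⟩ (fun T F x => ?_)
    · simp only [innL]; split_ifs <;> omega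
    · simp only [innL]; split_ifs <;> omega
    · simp only [innL] at h5; split_ifs at h5 <;> omega
    · rw [edges_map]
      refine (nodup_can c).map_on fun a ha b hb hab => ?_
      have := mem_can.1 ha
      have := mem_can.1 hb
      simp only [outL] at hab; split_ifs at hab <;> omega
    · obtain ⟨k, hk, rfl⟩ := mem_edges_map.1 hl
      have := mem_can.1 hk
      simp only [outL]; split_ifs <;> omega
    · obtain ⟨k, hk, hk'⟩ := mem_edges_map.1 h3
      have := mem_can.1 hk
      simp only [innL, outL] at hk' ⊢; split_ifs at hk' ⊢ <;> omega
    · have h1 := (std_can ((app F f x).compR_aux (F := F) h) (-1)).contr.symm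
      rw [app_comp, app_eR, push_map, push_can]
      rwa [(app F f x).arity_eq] at h1
  · rintro q f ⟨y, hy⟩ n σ h hσ
    have hn : P.arity q = n := h
    refine hy.rel (g := permL σ) (fun l hl => permL_of_neg _ hl) (fun l h1 h2 => ?_)
      (fun l l' _ _ _ _ h5 => permL_injective σ h5) (fun T F x => ?_)
    · have := permL_bounds σ h1 (by omega)
      omega
    · rw [app_comp, app_eA]
      exact rel_can_act _ _ _ _ _

/-! ### Trees -/

/-- The morphism `f` composes the operations in the list into the inputs `k, k + 1, …`. -/
inductive IsGraft {p : P.Tw} : ℕ → List P.Op → ∀ {q : P.Tw}, (p ⟶ q) → Prop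
  | nil (k : ℕ) : IsGraft k [] (𝟙 p)
  | cons {k : ℕ} {a : P.Op} {as : List P.Op} {q : P.Tw} {f : p ⟶ q} (h)
      (hf : IsGraft (k + 1) as f) : IsGraft k (a :: as) (f ≫ eL q k a h)

/-- The morphism `f` is given by a tree whose source vertex is attached to the input `i` of `a₀`. -/
inductive IsRooted {p : P.Tw} (as : List P.Op) (a₀ : P.Op) (i : ℕ) :
    ∀ {q : P.Tw}, (p ⟶ q) → Prop
  | mk {q : P.Tw} {f : p ⟶ q} (h) (hf : IsGraft 0 as f) : IsRooted as a₀ i (f ≫ eR a₀ i q h)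

/-- The morphism `f` is given by a tree whose source vertex is attached to the output of `a₀`. -/
inductive IsCapped {p : P.Tw} (as : List P.Op) (a₀ : P.Op) (M : ℕ) :
    ∀ {q : P.Tw}, (p ⟶ q) → Prop
  | mk {q : P.Tw} {f : p ⟶ q} (h hσ h') (hf : IsGraft 0 as f) :
      IsCapped as a₀ M (f ≫ eA q M (finRotate (M + 1)) h hσ ≫ eL _ (M - 1) a₀ h')

theorem IsGraft.represents {p q : P.Tw} {f : p ⟶ q} {k : ℕ} {as : List P.Op}
    (h : IsGraft k as f) : Represents f (graft (.var (p : P.Op)) k as) := by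
  induction h with
  | nil k => exact represents_id p
  | cons h hf ih => exact ih.comp_eL h

theorem IsRooted.represents {p q : P.Tw} {f : p ⟶ q} {as : List P.Op} {a₀ : P.Op} {i : ℕ}
    (h : IsRooted as a₀ i f) : Represents f (rootedTree (p : P.Op) as a₀ i) := by
  obtain ⟨h, hf⟩ := h
  exact hf.represents.comp_eR h

theorem IsCapped.represents {p q : P.Tw} {f : p ⟶ q} {as : List P.Op} {a₀ : P.Op} {M : ℕ}
    (h : IsCapped as a₀ M f) : Represents f (cappedTree (p : P.Op) as a₀ M) := by
  obtain ⟨h, hσ, h', hf⟩ := h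
  rw [← Category.assoc]
  exact (hf.represents.comp_eA h hσ).comp_eL h'

/-- A morphism represented by a composite with a constant factors accordingly. -/
theorem Represents.comp_const {p q : P.Tw} {f : p ⟶ q} {e : Expr P.Op} {i : ℕ} {c : P.Op}
    (hf : Represents f (.comp e i (.const c))) {M : ∀ q : P.Tw, (p ⟶ q) → Prop}
    (H : ∀ (r : P.Tw) (g : p ⟶ r) (h), Represents g e → M _ (g ≫ eL r i c h)) : M q f := by
  obtain ⟨⟨hv, hq⟩, -⟩ := id hf
  simp only [eval, interp, Option.bind_eq_some_iff] at hq
  obtain ⟨a, ha, b, hb, hab⟩ := hq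
  obtain rfl : c = b := by simpa using hb
  unfold comp? at hab
  split at hab
  · rename_i hi
    cases hab
    have hg : Represents (Quotient.mk (P.repSetoid p a) ⟨e, by simpa [Expr.vars] using hv, ha⟩) e :=
      ⟨_, rfl⟩
    rw [hf.unique (hg.comp_eL hi)]
    exact H a _ hi hg
  · cases hab

/-- A morphism represented by a composite into a constant factors accordingly. -/
theorem Represents.const_comp {p q : P.Tw} {f : p ⟶ q} {e : Expr P.Op} {i : ℕ} {c : P.Op}
    (hf : Represents f (.comp (.const c) i e)) {M : ∀ q : P.Tw, (p ⟶ q) → Prop}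
    (H : ∀ (r : P.Tw) (g : p ⟶ r) (h), Represents g e → M _ (g ≫ eR c i r h)) : M q f := by
  obtain ⟨⟨hv, hq⟩, -⟩ := id hf
  simp only [eval, interp, Option.bind_eq_some_iff] at hq
  obtain ⟨b, hb, a, ha, hab⟩ := hq
  obtain rfl : c = b := by simpa using hb
  unfold comp? at hab
  split at hab
  · rename_i hi
    cases hab
    have hg : Represents (Quotient.mk (P.repSetoid p a) ⟨e, by simpa [Expr.vars] using hv, ha⟩) e :=
      ⟨_, rfl⟩
    rw [hf.unique (hg.comp_eR hi)]
    exact H a _ hi hg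
  · cases hab

/-- A morphism represented by a permuted expression factors accordingly. -/
theorem Represents.of_act {p q : P.Tw} {f : p ⟶ q} {e : Expr P.Op} {n : ℕ}
    {σ : Equiv.Perm (Fin (n + 1))} (hf : Represents f (.act n σ e))
    {M : ∀ q : P.Tw, (p ⟶ q) → Prop}
    (H : ∀ (r : P.Tw) (g : p ⟶ r) (h hσ), Represents g e → M _ (g ≫ eA r n σ h hσ)) : M q f := by
  obtain ⟨⟨hv, hq⟩, -⟩ := id hf
  simp only [eval, interp, Option.bind_eq_some_iff] at hq
  obtain ⟨a, ha, hab⟩ := hq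
  unfold act? at hab
  split at hab
  · rename_i hi
    cases hab
    have hg : Represents (Quotient.mk (P.repSetoid p a) ⟨e, by simpa [Expr.vars] using hv, ha⟩) e :=
      ⟨_, rfl⟩
    rw [hf.unique (hg.comp_eA hi.1 hi.2)]
    exact H a _ hi.1 hi.2 hg
  · cases hab

theorem isGraft_of_represents {p q : P.Tw} {f : p ⟶ q} {k : ℕ} {as : List P.Op}
    (h : Represents f (graft (.var (p : P.Op)) k as)) : IsGraft k as f := by
  induction as generalizing k q with
  | nil =>
    obtain ⟨⟨-, hq⟩, -⟩ := id h
    obtain rfl : p = q := by simpa [graft, eval, interp] using hq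
    rw [h.unique (represents_id p)]
    exact .nil k
  | cons a as ih =>
    exact h.comp_const (M := fun _ f => IsGraft k (a :: as) f) fun r g h' hg => .cons h' (ih hg)

theorem isRooted_of_represents {p q : P.Tw} {f : p ⟶ q} {as : List P.Op} {a₀ : P.Op} {i : ℕ}
    (h : Represents f (rootedTree (p : P.Op) as a₀ i)) : IsRooted as a₀ i f :=
  h.const_comp (M := fun _ f => IsRooted as a₀ i f) fun _ _ h' hg => .mk h' (isGraft_of_represents hg)

theorem isCapped_of_represents {p q : P.Tw} {f : p ⟶ q} {as : List P.Op} {a₀ : P.Op} {M : ℕ}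
    (h : Represents f (cappedTree (p : P.Op) as a₀ M)) : IsCapped as a₀ M f := by
  refine h.comp_const (M := fun _ f => IsCapped as a₀ M f) fun r g h' hg => ?_
  refine hg.of_act (M := fun r g => ∀ h', IsCapped as a₀ M (g ≫ eL r (M - 1) a₀ h'))
    (fun r g h hσ hg h' => ?_) h'
  rw [Category.assoc]
  exact .mk h hσ h' (isGraft_of_represents hg)

theorem app_eL_one (F : Hom P T) {q : P.Tw} {i : ℕ} {c : C} (h) (x : El T q) :
    (app F (eL q i (P.one c) h) x).1 = x.1 := by
  rw [app_eL]
  have h1 := x.compL_aux (F := F) h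
  have h2 : (T.inputs x.1)[i]? = some (T.output (T.one c)) := by rw [← F.map_one]; exact h1
  exact (comp_congr T rfl (F.map_one c) rfl h1 h2).trans (T.comp_one _ _ _ _)

theorem app_eR_one (F : Hom P T) {q : P.Tw} {c : C} (h) (x : El T q) :
    (app F (eR (P.one c) 0 q h) x).1 = x.1 := by
  rw [app_eR]
  have h1 := x.compR_aux (F := F) h
  have h2 : (T.inputs (T.one c))[0]? = some (T.output x.1) := by rw [← F.map_one]; exact h1
  exact (comp_congr T (F.map_one c) rfl rfl h1 h2).trans (T.one_comp _ _ _)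

theorem decos_append (F : Hom P T) (y : ℤ → Labelled P ℤ) (E E' : List ℤ) :
    decos F y (E ++ E') = decos F y E ++ decos F y E' := List.map_append

theorem lab_app_self {X Λ : Labelled P ℤ} (g : (X.op : P.Tw) ⟶ Λ.op) :
    Λ.lab (app (Hom.id P) g (El.self X.op)) = Λ := by
  rw [app_self]; rfl

section Vertices

variable {X : Labelled P ℤ} {y : ℤ → Labelled P ℤ} {S : ℤ → Prop} [DecidablePred S]

/-- A label of `X` to which an operation will be attached keeps its colour while operations are
attached to other labels. -/
theorem exists_col_of_attach {E E' : List ℤ} {e : ℤ} {z Λ : Labelled P ℤ}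
    (hI : Indep X (decos (Hom.id P) y (E ++ e :: E')))
    (hz : Attach (decos (Hom.id P) y (E ++ e :: E')) X z)
    (hΛ : Attach (decos (Hom.id P) y E) X Λ) :
    (∃ c, (e, c) ∈ Λ.cols ∧ (e, c) ∈ (y e).cols) ∧ (κ ≠ .cyclic →
      (e ∈ Λ.ins ∧ (y e).root = e) ∨ (Λ.root = e ∧ e ∈ (y e).ins)) ∧
        Λ.edges.Nodup ∧ (y e).edges.Nodup ∧ ∃ z, Contr e Λ (y e) z := by
  rw [decos_append] at hI hz
  obtain ⟨t, h1, h2⟩ := attach_append.1 hz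
  have h3 := h1.rel hI.of_append hΛ
  have h4 := hI.append hΛ
  have h5 := h2.congr h3 (.refl _)
  obtain ⟨h6, h7⟩ := h5.exists_col h4 (b := (e, y e)) (.head _)
  obtain ⟨s, h8, -⟩ := h5
  exact ⟨h6, h7, h4.1, (h4.2 _ (.head _)).2, s, h8⟩

/-! ### Trees with given vertices -/

/-- The vertex `a` is the operation `y e` for a half-edge `e` in the set `S`, up to a permutation
of its half-edges, or it is an identity operation, for a half-edge not in `S`. -/
def IsVertex (y : ℤ → Labelled P ℤ) (S : ℤ → Prop) (e : ℤ) (a : P.Op) : Prop :=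
  (S e ∧ ∃ y', (y e).Rel y' ∧ a = y'.op) ∨ (¬ S e ∧ ∃ c, a = P.one c)

/-- The part of a tree above the source vertex. The vertices are attached from the last input to the
first, so that the labels of the inputs with smaller numbers keep their positions. -/
theorem exists_graft {z : Labelled P ℤ}
    (hI : Indep X (decos (Hom.id P) y (X.edges.reverse.filter S)))
    (hz : Attach (decos (Hom.id P) y (X.edges.reverse.filter S)) X z) (l₂ : List ℤ) :
    ∀ l₁, X.ins = l₁ ++ l₂ → ∃ (as : List P.Op) (Λ : Labelled P ℤ) (g : (X.op : P.Tw) ⟶ Λ.op)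
      (tail : List ℤ), as.length = l₂.length ∧ (∀ a ∈ as, ∃ e ∈ l₂, IsVertex y S e a) ∧
        IsGraft l₁.length as g ∧ Λ.root = X.root ∧ Λ.ins = l₁ ++ tail ∧
          ∀ (T : Operad.{u, v} κ C) (F : Hom P T) (x : El T X.op),
            Attach (decos F y (l₂.reverse.filter S)) (X.lab x) (Λ.lab (app F g x)) := by
  induction l₂ with
  | nil =>
    intro l₁ h
    refine ⟨[], X, 𝟙 _, [], rfl, by simp, .nil _, rfl, h, fun T F x => ?_⟩
    rw [app_id]
    exact Rel.refl _
  | cons e l₂ ih =>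
    intro l₁ h
    obtain ⟨as, Λ, g, tail, h1, h2, h3, h4, h5, h6⟩ := ih (l₁ ++ [e]) (by simp [h])
    rw [List.length_append, List.length_singleton] at h3
    have hk : l₁.length < P.arity Λ.op := by
      rw [← Λ.len, h5]; simp
    by_cases hS : S e
    · have hlist : X.edges.reverse.filter S =
          l₂.reverse.filter S ++ e :: (l₁.reverse ++ [X.root]).filter S := by
        rw [edges, h]
        simp [hS]
      have hΛ := h6 P (Hom.id P) (El.self _)
      rw [lab_app_self] at hΛ
      rw [hlist] at hI hz
      obtain ⟨⟨c, hc, hc'⟩, h7, h8, h9, -⟩ := exists_col_of_attach hI hz hΛ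
      have he : e ∈ Λ.ins := by rw [h5]; simp
      obtain ⟨y₁, hy, hr⟩ : ∃ y₁, (y e).Rel y₁ ∧ y₁.root = e := by
        by_cases hκ : κ = .cyclic
        · exact exists_rel_root hκ _ (mem_edges_iff.2 ⟨_, hc'⟩)
        · rcases h7 hκ with h10 | h10
          · exact ⟨_, .refl _, h10.2⟩
          · rw [edges, h10.1] at h8
            exact absurd he (List.nodup_cons.1 h8).1
      obtain ⟨_, i, h10, h11, h12, -⟩ := exists_std h8 (hy.edges_perm.nodup_iff.2 h9) hc
        (hy.cols_perm.mem_iff.2 hc') he hr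
      have hie : Λ.ins[l₁.length]? = some e := by rw [h5]; simp
      obtain rfl : l₁.length = i :=
        (List.getElem?_inj (by rwa [Λ.len]) (List.nodup_cons.1 h8).2).1 (hie.trans h11.symm)
      refine ⟨y₁.op :: as, Λ.comp l₁.length y₁ h10, g ≫ eL Λ.op l₁.length y₁.op h10,
        y₁.ins ++ tail, by simp [h1], ?_, .cons h10 h3, h4, ?_, fun T F x => ?_⟩
      · rintro a (- | ⟨_, ha⟩)
        · exact ⟨e, .head _, .inl ⟨hS, y₁, hy, rfl⟩⟩
        · obtain ⟨e', he', ha'⟩ := h2 a ‹_›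
          exact ⟨e', .tail _ he', ha'⟩
      · simp [Labelled.comp, h5]
      · have hlist' : (e :: l₂).reverse.filter S = l₂.reverse.filter S ++ [e] := by simp [hS]
        rw [hlist', decos_append]
        refine attach_append.2 ⟨_, h6 T F x, _, ?_, .refl _⟩
        refine Contr.congr (y := y₁.push F) (Std.contr ?_) (.refl _) (hy.push F).symm (.refl _)
        refine ⟨l₁.length, (app F g x).compL_aux h10, h11, h12, eq_of_edges ?_ rfl⟩
        exact (congrArg Subtype.val (app_comp F g _ x)).trans (app_eL F h10 _)
    · obtain ⟨c, hc⟩ : ∃ c, (P.inputs Λ.op)[l₁.length]? = some (P.output (P.one c)) :=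
        ⟨_, by rw [P.output_one]; exact List.getElem?_eq_getElem hk⟩
      refine ⟨P.one c :: as, ⟨P.comp Λ.op l₁.length (P.one c) hc, Λ.root, Λ.ins, ?_⟩,
        g ≫ eL Λ.op l₁.length (P.one c) hc, e :: tail, by simp [h1], ?_, .cons hc h3, h4, ?_,
        fun T F x => ?_⟩
      · rw [P.comp_one, Λ.len]
      · rintro a (- | ⟨_, ha⟩)
        · exact ⟨e, .head _, .inr ⟨hS, c, rfl⟩⟩
        · obtain ⟨e', he', ha'⟩ := h2 a ‹_›
          exact ⟨e', .tail _ he', ha'⟩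
      · simp [h5]
      · have hlist' : (e :: l₂).reverse.filter S = l₂.reverse.filter S := by simp [hS]
        rw [hlist']
        have h10 := h6 T F x
        convert h10 using 1
        exact eq_of_edges ((congrArg Subtype.val (app_comp F g _ x)).trans
          (app_eL_one F hc _)) rfl

theorem lab_rel_act {Λ : Labelled P ℤ} {n : ℕ} {σ : Equiv.Perm (Fin (n + 1))} (h hσ) (F : Hom P T)
    (x : El T Λ.op) :
    (Λ.lab x).Rel ((Λ.act n σ h hσ).lab (app F (eA Λ.op n σ h hσ) x)) :=
  ⟨n, σ, x.act_aux h, hσ, app_eA F h hσ x, Λ.edges_act n σ h hσ⟩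

/-- The tree whose vertices are the labelled operations `y e` attached to the half-edges `e` of `X`
that are in `S`, and identities elsewhere. -/
theorem exists_tree {z : Labelled P ℤ}
    (hI : Indep X (decos (Hom.id P) y (X.edges.reverse.filter S)))
    (hz : Attach (decos (Hom.id P) y (X.edges.reverse.filter S)) X z) :
    ∃ (as : List P.Op) (a₀ : P.Op) (Λ : Labelled P ℤ) (t : (X.op : P.Tw) ⟶ Λ.op),
      as.length = P.arity X.op ∧ (∀ a ∈ a₀ :: as, ∃ e ∈ X.edges, IsVertex y S e a) ∧
        ((∃ i, IsRooted as a₀ i t ∧ (¬ S X.root → i = 0)) ∨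
          (S X.root ∧ P.arity a₀ = 0 ∧ ∃ M, IsCapped as a₀ M t)) ∧ IsVertex y S X.root a₀ ∧
          ∀ (T : Operad.{u, v} κ C) (F : Hom P T) (x : El T X.op),
            Attach (decos F y (X.edges.reverse.filter S)) (X.lab x) (Λ.lab (app F t x)) := by
  obtain ⟨as, Λ, g, tail, h1, h2, h3, h4, h5, h6⟩ := exists_graft hI hz X.ins [] rfl
  have hlen : as.length = P.arity X.op := h1.trans X.len
  have h2' : ∀ a₀, IsVertex y S X.root a₀ → ∀ a ∈ a₀ :: as, ∃ e ∈ X.edges, IsVertex y S e a := by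
    rintro a₀ ha₀ a (- | ⟨_, ha⟩)
    · exact ⟨X.root, .head _, ha₀⟩
    · obtain ⟨e, he, ha'⟩ := h2 a ‹_›
      exact ⟨e, .tail _ he, ha'⟩
  by_cases hS : S X.root
  -- the root vertex is attached last
  · have hlist : X.edges.reverse.filter S = X.ins.reverse.filter S ++ [X.root] := by
      simp [edges, hS]
    have hΛ := h6 P (Hom.id P) (El.self _)
    rw [lab_app_self] at hΛ
    rw [hlist] at hI hz ⊢
    obtain ⟨⟨c, hc, hc'⟩, h7, h8, h9, w, hw⟩ := exists_col_of_attach hI hz hΛ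
    by_cases hcap : κ = .cyclic ∧ P.arity (y X.root).op = 0
    -- a closed root vertex has no input, so that the source is rotated to bring its output last
    · obtain ⟨hκ, har⟩ := hcap
      have hM : 0 < P.arity Λ.op := by
        have := hw.edges_perm.length_eq
        simp only [List.length_cons, List.length_append, length_edges, har] at this
        omega
      have hσ : κ.Allows (finRotate (P.arity Λ.op + 1)) := Kind.allows_cyclic hκ _
      obtain ⟨y₁, hy, hr⟩ := exists_rel_root hκ _ (mem_edges_iff.2 ⟨_, hc'⟩)
      set Λ₁ := Λ.act (P.arity Λ.op) (finRotate (P.arity Λ.op + 1)) rfl hσ with hΛ₁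
      have hrel : Λ.Rel Λ₁ := rel_act _ _ _ _ _
      have hed : Λ₁.edges = Λ.ins ++ [Λ.root] := edges_act_finRotate _ _ _ _
      have hnd : Λ₁.edges.Nodup := hrel.edges_perm.nodup_iff.2 h8
      have hlast : Λ₁.ins[P.arity Λ.op - 1]? = some X.root := by
        have h10 : Λ₁.edges[P.arity Λ.op]? = some X.root := by
          rw [hed, List.getElem?_append_right (by rw [Λ.len]), Λ.len, h4]; simp
        obtain ⟨m, hm⟩ : ∃ m, P.arity Λ.op = m + 1 := ⟨P.arity Λ.op - 1, by omega⟩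
        rw [hm] at h10 ⊢
        rwa [edges, List.getElem?_cons_succ] at h10
      obtain ⟨_, i, h10, h11, h12, -⟩ := exists_std hnd (hy.edges_perm.nodup_iff.2 h9)
        (hrel.cols_perm.mem_iff.2 hc) (hy.cols_perm.mem_iff.2 hc') (List.mem_of_getElem? hlast) hr
      have hlen1 : Λ₁.ins.length = P.arity Λ.op := Λ₁.len.trans (P.length_act _ _ _ _ _)
      obtain rfl : P.arity Λ.op - 1 = i :=
        (List.getElem?_inj (by omega) (List.nodup_cons.1 hnd).2).1 (hlast.trans h11.symm)
      have hv : IsVertex y S X.root y₁.op := .inl ⟨hS, y₁, hy, rfl⟩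
      refine ⟨as, y₁.op, Λ₁.comp (P.arity Λ.op - 1) y₁ h10,
        g ≫ eA Λ.op (P.arity Λ.op) _ rfl hσ ≫ eL Λ₁.op (P.arity Λ.op - 1) y₁.op h10, hlen,
        h2' _ hv, .inr ⟨hS, hy.arity_eq.symm.trans har, P.arity Λ.op, .mk rfl hσ h10 h3⟩, hv,
        fun T F x => ?_⟩
      rw [decos_append]
      refine attach_append.2 ⟨_, h6 T F x, _, ?_, .refl _⟩
      refine Contr.congr (y := y₁.push F) (Std.contr ?_) (lab_rel_act rfl hσ F (app F g x)).symm
        (hy.push F).symm (.refl _)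
      refine ⟨P.arity Λ.op - 1, (app F (eA Λ.op _ _ rfl hσ) (app F g x)).compL_aux h10, h11, h12,
        eq_of_edges ?_ rfl⟩
      refine (congrArg Subtype.val (app_comp F g _ x)).trans ?_
      exact (congrArg Subtype.val (app_comp F _ _ _)).trans (app_eL F h10 _)
    · obtain ⟨y₁, hy, hr⟩ : ∃ y₁, (y X.root).Rel y₁ ∧ X.root ∈ y₁.ins := by
        by_cases hκ : κ = .cyclic
        · have har : 1 < P.arity (y X.root).op + 1 := by
            have := mt (And.intro hκ) hcap
            omega
          obtain ⟨y₁, h10, h11⟩ := exists_rel_getElem? hκ _ (mem_edges_iff.2 ⟨_, hc'⟩) har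
          exact ⟨y₁, h10, List.mem_of_getElem? (i := 0) (by simpa [edges] using h11)⟩
        · rcases h7 hκ with h10 | h10
          · rw [edges, h4] at h8
            exact absurd h10.1 (List.nodup_cons.1 h8).1
          · exact ⟨_, .refl _, h10.2⟩
      obtain ⟨_, i, h10, h11, h12, -⟩ := exists_std (hy.edges_perm.nodup_iff.2 h9) h8
        (hy.cols_perm.mem_iff.2 hc') hc hr h4
      have hv : IsVertex y S X.root y₁.op := .inl ⟨hS, y₁, hy, rfl⟩
      refine ⟨as, y₁.op, y₁.comp i Λ h10, g ≫ eR y₁.op i Λ.op h10, hlen, h2' _ hv,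
        .inl ⟨i, .mk h10 h3, fun h => absurd hS h⟩, hv, fun T F x => ?_⟩
      rw [decos_append]
      refine attach_append.2 ⟨_, h6 T F x, _, ?_, .refl _⟩
      refine Contr.congr (y := y₁.push F) (Contr.symm (Std.contr ?_)) (.refl _) (hy.push F).symm
        (.refl _)
      refine ⟨i, (app F g x).compR_aux h10, h11, h12, eq_of_edges ?_ rfl⟩
      exact (congrArg Subtype.val (app_comp F g _ x)).trans (app_eR F h10 _)
  · have hlist : X.edges.reverse.filter S = X.ins.reverse.filter S := by simp [edges, hS]
    rw [hlist]
    have hc : (P.inputs (P.one (P.output Λ.op)))[0]? = some (P.output Λ.op) := by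
      rw [P.inputs_one]; rfl
    have hv : IsVertex y S X.root (P.one (P.output Λ.op)) := .inr ⟨hS, _, rfl⟩
    refine ⟨as, P.one (P.output Λ.op),
      ⟨P.comp (P.one (P.output Λ.op)) 0 Λ.op hc, Λ.root, Λ.ins, ?_⟩,
      g ≫ eR (P.one (P.output Λ.op)) 0 Λ.op hc, hlen, h2' _ hv,
      .inl ⟨0, .mk hc h3, fun _ => rfl⟩, hv, fun T F x => ?_⟩
    · rw [P.one_comp, Λ.len]
    · convert h6 T F x using 1
      exact eq_of_edges ((congrArg Subtype.val (app_comp F g _ x)).trans (app_eR_one F hc _)) rfl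

/-- Two trees with the same vertices differ by a permutation of the leaves, which is the same in all
operads under `P`. -/
theorem exists_act_of_rel {Λ : Labelled P ℤ} {p q : P.Tw} (t : p ⟶ Λ.op) (f : p ⟶ q)
    (hΛ : Λ.edges.Nodup) (h : ∀ (T : Operad.{u, v} κ C) (F : Hom P T) (x : El T p),
      (Λ.lab (app F t x)).Rel (can (app F f x).1)) :
    ∃ (N : ℕ) (σ : Equiv.Perm (Fin (N + 1))) (u : (Λ.op : P.Tw) ⟶ q),
      Represents u (.act N σ (.var Λ.op)) ∧ f = t ≫ u := by
  have h1 := h P (Hom.id P) (El.self p)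
  rw [app_self, app_self] at h1
  have h1 : Λ.Rel (can (q : P.Op)) := h1
  obtain ⟨n, σ, h2, hσ, h3, h4⟩ := h1
  have h3 : q = P.act Λ.op n σ h2 hσ := h3
  subst h3
  refine ⟨n, σ, eA Λ.op n σ h2 hσ, represents_eA h2 hσ, hom_ext fun T F x => ?_⟩
  obtain ⟨n', σ', h5, hσ', h6, h7⟩ := h T F x
  have hn : n' = n := by
    have h8 : (T.inputs (app F t x).1).length = n' := h5
    rw [← h8, (app F t x).2.1]; exact h2
  subst hn
  have hσσ : σ' = σ := by
    ext k
    have h8 : (can (app F f x).1).edges = (can (P.act Λ.op n' σ h2 hσ)).edges := by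
      rw [edges_can, edges_can, (app F f x).arity_eq]
    have h9 : Λ.edges[(σ' k : ℕ)]? = Λ.edges[(σ k : ℕ)]? :=
      (h7 k).symm.trans ((congrArg (·[(k : ℕ)]?) h8).trans (h4 k))
    refine (List.getElem?_inj ?_ hΛ).1 h9
    rw [length_edges, arity, h2]
    exact (σ' k).2
  subst hσσ
  refine Subtype.ext ?_
  rw [app_comp]
  exact h6.trans (app_eA F h2 hσ _).symm

end Vertices

/-! ### Factorization of morphisms -/

theorem IsVertex.deg_eq {y : ℤ → Labelled P ℤ} {S : ℤ → Prop} {e : ℤ} {a : P.Op}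
    (h : IsVertex y S e a) (hS : S e) : ψ.deg a = ψ.deg (y e).op := by
  rcases h with ⟨-, y', h1, rfl⟩ | ⟨h, -⟩
  · exact (h1.deg_eq ψ).symm
  · exact absurd hS h

theorem IsRooted.lt_arity {p q : P.Tw} {f : p ⟶ q} {as : List P.Op} {a₀ : P.Op} {i : ℕ}
    (h : IsRooted as a₀ i f) : i < P.arity a₀ := by
  obtain ⟨h, -⟩ := h
  exact lt_length h

theorem decos_perm {F : Hom P T} {y : ℤ → Labelled P ℤ} {E E' : List ℤ} (h : E.Perm E') :
    (decos F y E).Perm (decos F y E') := h.map _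

theorem Represents.act_tree {p r q : P.Tw} {t : p ⟶ r} {e : Expr P.Op} (ht : Represents t e)
    {N : ℕ} {σ : Equiv.Perm (Fin (N + 1))} {u : r ⟶ q} (hu : Represents u (.act N σ (.var (r : P.Op)))) :
    Represents (t ≫ u) (.act N σ e) := ht.comp hu

/-- Every morphism factors: the vertices of grading `-1` of its tree are closed, so that they are
attached to the source without creating leaves, and the others are attached afterwards. -/
theorem exists_factorization (ψ : P.NiceGrading) {p q : P.Tw} (f : p ⟶ q) :
    ∃ (z : P.Tw) (l : p ⟶ z) (r : z ⟶ q), RNegOne ψ l ∧ RNonneg ψ r ∧ l ≫ r = f := by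
  classical
  obtain ⟨y, hy⟩ := exists_decorates f
  -- the half-edges of the source to which a vertex of grading `-1` is attached
  let S : ℤ → Prop := fun e => ψ.deg (y e).op = -1
  set X := srcVertex (p : P.Op) with hX
  have hperm : X.edges.Perm (X.edges.reverse.filter S ++ X.edges.reverse.filter fun e => ¬ S e) := by
    refine (List.reverse_perm _).symm.trans ?_
    have := (List.filter_append_perm (fun e => decide (S e)) X.edges.reverse).symm
    simpa using this
  have hI : Indep X (decos (Hom.id P) y (X.edges.reverse.filter S) ++
      decos (Hom.id P) y (X.edges.reverse.filter fun e => ¬ S e)) := by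
    rw [← decos_append]
    exact hy.indep.perm (decos_perm hperm)
  have hA : ∀ (T : Operad.{u, v} κ C) (F : Hom P T) (x : El T p), ∃ t,
      Attach (decos F y (X.edges.reverse.filter S)) (X.lab x) t ∧
        Attach (decos F y (X.edges.reverse.filter fun e => ¬ S e)) t (can (app F f x).1) := by
    intro T F x
    rw [← attach_append, ← decos_append]
    exact (hy.attach T F x).perm (indep_decos hy.indep F rfl) (decos_perm hperm)
  obtain ⟨t₀, ht₀, -⟩ := hA P (Hom.id P) (El.self p)
  obtain ⟨as, a₀, Λ, l, h1, h2, h3, h4, h5⟩ := exists_tree (X := X) (S := S) hI.of_append ht₀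
  have hl : RNegOne ψ l := by
    refine ⟨as, a₀, h1, fun a ha => ?_, ?_⟩
    · obtain ⟨e, -, ⟨hS, y', h6, rfl⟩ | ⟨-, h6⟩⟩ := h2 a ha
      · exact .inr ((h6.deg_eq ψ).symm.trans hS)
      · exact .inl h6
    · rcases h3 with ⟨i, h6, h7⟩ | ⟨-, h6, M, h7⟩
      · by_cases hS : S X.root
        · have h8 := ψ.arity_eq_zero _ ((h4.deg_eq hS).trans hS)
          have := h6.lt_arity
          omega
        · rw [h7 hS] at h6
          exact .inl h6.represents
      · exact .inr ⟨h6, M, h7.represents⟩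
  have hΛ := h5 P (Hom.id P) (El.self X.op)
  have hΛ : Attach (decos (Hom.id P) y (X.edges.reverse.filter S)) X Λ := by
    rwa [lab_app_self] at hΛ
  have hI' := hI.append hΛ
  -- closed vertices bring no new labels, so that the labels left are those outside `S`
  have hedges : (Λ.edges.reverse.filter fun _ => True).Perm
      (X.edges.reverse.filter fun e => ¬ S e) := by
    rw [List.filter_eq_self.2 (by simp)]
    refine (List.perm_ext_iff_of_nodup (List.nodup_reverse.2 hI'.1)
      ((List.nodup_reverse.2 hI.1).filter _)).2 fun k => ?_
    rw [List.mem_reverse, hΛ.mem_iff hI.of_append, List.mem_filter, List.mem_reverse]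
    simp only [decide_eq_true_eq]
    constructor
    · rintro ⟨h6, h7 | ⟨b, hb, h7⟩⟩
      · refine ⟨h7, fun h8 => h6 (k, y k) (List.mem_map.2 ⟨k, ?_, rfl⟩) rfl⟩
        rw [List.mem_filter, List.mem_reverse]
        exact ⟨h7, by simpa using h8⟩
      · obtain ⟨e, he, rfl⟩ := List.mem_map.1 hb
        have h8 : S e := by simpa using (List.mem_filter.1 he).2
        have h9 := (hy.mem (List.mem_reverse.1 (List.mem_filter.1 he).1)).2.1
        have h10 := edges_eq_singleton (ψ.arity_eq_zero _ h8) h9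
        rw [edges_push, h10, List.mem_singleton] at h7
        exact absurd h7 (h6 _ (List.mem_map.2 ⟨e, he, rfl⟩))
    · rintro ⟨h6, h7⟩
      refine ⟨fun b hb => ?_, .inl h6⟩
      obtain ⟨e, he, rfl⟩ := List.mem_map.1 hb
      rintro rfl
      exact h7 (by simpa using (List.mem_filter.1 he).2)
  have hI'' : Indep Λ (decos (Hom.id P) y (Λ.edges.reverse.filter fun _ => True)) :=
    hI'.perm (decos_perm hedges.symm)
  have hB : ∀ (T : Operad.{u, v} κ C) (F : Hom P T) (x : El T p),
      Attach (decos F y (Λ.edges.reverse.filter fun _ => True)) (Λ.lab (app F l x))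
        (can (app F f x).1) := by
    intro T F x
    obtain ⟨t, h6, h7⟩ := hA T F x
    have h8 := Attach.rel (indep_decos hI.of_append F rfl) h6 (h5 T F x)
    exact (h7.congr h8 (.refl _)).perm (indep_decos hI' F rfl) (decos_perm hedges.symm)
  have hB₀ := hB P (Hom.id P) (El.self p)
  have hB₀ : Attach (decos (Hom.id P) y (Λ.edges.reverse.filter fun _ => True)) Λ
      (can (q : P.Op)) := by
    rw [app_self] at hB₀
    have : app (Hom.id P) l (El.self p) = El.self Λ.op := app_self l
    rw [this] at hB₀
    exact hB₀
  obtain ⟨as', a₀', Λ', t, h6, h7, h8, h9, h10⟩ := exists_tree (X := Λ) (S := fun _ => True) hI'' hB₀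
  have hΛ' : Λ'.edges.Nodup := by
    have := h10 P (Hom.id P) (El.self Λ.op)
    rw [lab_app_self] at this
    exact this.nodup hI''
  -- the leaves of the second tree are those of `q`, up to a permutation
  obtain ⟨N, σ, u, hu, rfl⟩ := exists_act_of_rel (l ≫ t) f hΛ' fun T F x => by
    have h11 := h10 T F (app F l x)
    have := Attach.rel (indep_decos hI'' F rfl) h11 (hB T F x)
    rw [app_comp]
    exact this
  refine ⟨Λ.op, l, t ≫ u, hl, ⟨as', a₀', N, σ, h6, fun a ha => ?_, ?_⟩, (Category.assoc _ _ _).symm⟩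
  · obtain ⟨e, he, h11⟩ := h7 a ha
    rw [h11.deg_eq trivial]
    have h12 : e ∈ X.edges.reverse.filter fun e => ¬ S e :=
      hedges.mem_iff.1 (List.mem_filter.2 ⟨List.mem_reverse.2 he, by simp⟩)
    have h13 : ¬ S e := by simpa using (List.mem_filter.1 h12).2
    have := ψ.neg_one_le (y e).op
    have h14 : ψ.deg (y e).op ≠ -1 := h13
    omega
  · rcases h8 with ⟨i, h11, -⟩ | ⟨-, h11, M, h12⟩
    · exact .inl ⟨i, h11.represents.act_tree hu⟩
    · exact .inr ⟨h11, M, h12.represents.act_tree hu⟩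

/-! ### Tracks of trees -/

theorem compDeg_single {N : ℕ} {loc D : ℤ → ℤ} {b d j : ℤ} (h0 : 0 ≤ b) (hb : b ≤ N) :
    compDeg N loc D (fun l => if l = b then d else 0) j = D j + if loc b = j then d else 0 := by
  rw [compDeg, Finset.sum_ite_eq']
  simp [h0, hb]

theorem compDeg_zero {N : ℕ} {loc D : ℤ → ℤ} : compDeg N loc D (fun _ => 0) = D := by
  funext j
  simp [compDeg]

/-- The gradings in the track of a morphism that attaches operations to inputs are those of these
operations. -/
theorem IsGraft.exists_track {p q : P.Tw} {f : p ⟶ q} {k : ℕ} {as : List P.Op}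
    (h : IsGraft k as f) : ∃ loc D, IsTrack ψ f loc D ∧ (∀ l : ℤ, l ≤ k → loc l = l) ∧
      (∀ j : ℤ, j ≤ k → D j = 0) ∧ ∀ (n : ℕ) (a : P.Op), as[n]? = some a →
        D (k + 1 + n) = ψ.deg a := by
  induction h with
  | nil k => exact ⟨_, _, isTrack_id p, fun _ _ => rfl, fun _ _ => rfl, fun n a h => by simp at h⟩
  | @cons k a as q f h hf ih =>
    obtain ⟨loc, D, h1, h2, h3, h4⟩ := ih
    have hk : k < P.arity q := lt_length h
    push_cast at h2 h3 h4
    have hD : ∀ j : ℤ, compDeg (P.arity q) loc D (fun l => if l = k + 1 then ψ.deg a else 0) j =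
        D j + if k + 1 = j then ψ.deg a else 0 := fun j => by
      rw [compDeg_single (by omega) (by omega), h2 _ le_rfl]
    refine ⟨_, _, h1.comp (isTrack_eL h), fun l hl => ?_, fun j hj => ?_, fun n b hb => ?_⟩
    · rw [Function.comp_apply, locL, if_pos hl, h2 l (by omega)]
    · rw [hD, h3 j (by omega), if_neg (by omega)]; rfl
    · rw [hD]
      rcases n with - | n
      · obtain rfl : a = b := by simpa using hb
        rw [h3 _ (by simp), if_pos (by simp)]; simp
      · rw [if_neg (by push_cast; omega), add_zero, ← h4 n b (by simpa using hb)]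
        congr 1
        push_cast; ring

/-- A morphism given by a tree. -/
def IsTree {p q : P.Tw} (as : List P.Op) (a₀ : P.Op) (f : p ⟶ q) : Prop :=
  (∃ i, IsRooted as a₀ i f) ∨ (P.arity a₀ = 0 ∧ ∃ M, IsCapped as a₀ M f)

theorem permL_inv_finRotate {M : ℕ} : permL (finRotate (M + 1))⁻¹ (M : ℤ) = 0 := by
  have h := permL_finRotate (n := M) (l := 0) le_rfl (by omega)
  rw [if_pos rfl] at h
  rw [← h, ← permL_mul, mul_inv_cancel, permL_one]

/-- The gradings in the track of a tree are those of its vertices. -/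
theorem IsTree.exists_track {p q : P.Tw} {f : p ⟶ q} {as : List P.Op} {a₀ : P.Op}
    (h : IsTree as a₀ f) : ∃ loc D, IsTrack ψ f loc D ∧ D 0 = ψ.deg a₀ ∧
      ∀ (n : ℕ) (a : P.Op), as[n]? = some a → D (n + 1) = ψ.deg a := by
  have key : ∀ {D : ℤ → ℤ} {as : List P.Op}, (∀ j : ℤ, j ≤ (0 : ℕ) → D j = 0) →
      (∀ (n : ℕ) (a : P.Op), as[n]? = some a → D ((0 : ℕ) + 1 + n) = ψ.deg a) →
        (D 0 + if (0 : ℤ) = 0 then ψ.deg a₀ else 0) = ψ.deg a₀ ∧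
          ∀ (n : ℕ) (a : P.Op), as[n]? = some a →
            (D (n + 1) + if (0 : ℤ) = n + 1 then ψ.deg a₀ else 0) = ψ.deg a := by
    intro D as h3 h4
    refine ⟨by rw [h3 0 le_rfl]; simp, fun n a ha => ?_⟩
    rw [if_neg (by omega), add_zero, ← h4 n a ha]
    congr 1
    push_cast; ring
  rcases h with ⟨i, h, hf⟩ | ⟨-, M, h, hσ, h', hf⟩
  · obtain ⟨loc, D, h1, h2, h3, h4⟩ := hf.exists_track (ψ := ψ)
    refine ⟨_, _, h1.comp (isTrack_eR h), ?_⟩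
    simp only [compDeg_single (b := 0) le_rfl (Int.natCast_nonneg _), h2 0 le_rfl]
    exact key h3 h4
  · rename_i r g
    obtain ⟨loc, D, h1, h2, h3, h4⟩ := hf.exists_track (ψ := ψ)
    have hM : P.arity r = M := h
    have hM' : P.arity (P.act r M (finRotate (M + 1)) h hσ) = M := P.length_act _ _ _ _ _
    have hM0 : M - 1 < M := by
      have := lt_length h'
      rwa [P.length_act] at this
    have h5 := h1.comp ((isTrack_eA h hσ).comp (isTrack_eL (ψ := ψ) h'))
    have h6 : compDeg (P.arity (P.act r M (finRotate (M + 1)) h hσ)) (permL (finRotate (M + 1))⁻¹)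
        (fun _ => 0) (fun l => if l = ((M - 1 : ℕ) : ℤ) + 1 then ψ.deg a₀ else 0) =
          fun l => if l = 0 then ψ.deg a₀ else 0 := by
      funext j
      have h7 : ((M - 1 : ℕ) : ℤ) + 1 = M := by omega
      rw [h7, compDeg_single (by omega) (by rw [hM']), permL_inv_finRotate, zero_add]
      simp only [eq_comm]
    rw [h6] at h5
    refine ⟨_, _, h5, ?_⟩
    simp only [compDeg_single (b := 0) le_rfl (Int.natCast_nonneg _), h2 0 le_rfl]
    exact key h3 h4

/-- The vertices of a tree correspond to the half-edges of the source. -/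
theorem IsTree.exists_track' {p q : P.Tw} {f : p ⟶ q} {as : List P.Op} {a₀ : P.Op}
    (h : IsTree as a₀ f) (hlen : as.length = P.arity p) : ∃ loc D, IsTrack ψ f loc D ∧
      (∀ j : ℤ, 0 ≤ j → j ≤ P.arity p → ∃ a ∈ a₀ :: as, D j = ψ.deg a) ∧
        ∀ a ∈ a₀ :: as, ∃ j : ℤ, 0 ≤ j ∧ j ≤ P.arity p ∧ D j = ψ.deg a := by
  obtain ⟨loc, D, h1, h2, h3⟩ := h.exists_track (ψ := ψ)
  refine ⟨loc, D, h1, fun j h0 hj => ?_, fun a ha => ?_⟩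
  · by_cases hj0 : j = 0
    · exact ⟨a₀, .head _, by rw [hj0, h2]⟩
    · have hlt : (j - 1).toNat < as.length := by omega
      refine ⟨as[(j - 1).toNat], .tail _ (List.getElem_mem hlt), ?_⟩
      rw [← h3 _ _ (List.getElem?_eq_getElem hlt)]
      congr 1
      omega
  · rcases List.mem_cons.1 ha with rfl | ha
    · exact ⟨0, le_rfl, by omega, h2⟩
    · obtain ⟨n, hn, rfl⟩ := List.getElem_of_mem ha
      exact ⟨n + 1, by omega, by omega, h3 n _ (List.getElem?_eq_getElem hn)⟩

/-- A morphism of grading `-1` is a tree whose root vertex is an identity or closed. -/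
theorem RNegOne.exists_tree {p q : P.Tw} {f : p ⟶ q} (h : RNegOne ψ f) :
    ∃ (as : List P.Op) (a₀ : P.Op), as.length = P.arity p ∧
      (∀ a ∈ a₀ :: as, (∃ c, a = P.one c) ∨ ψ.deg a = -1) ∧ IsTree as a₀ f ∧
        (((∃ c, a₀ = P.one c) ∧ IsRooted as a₀ 0 f) ∨
          (ψ.deg a₀ = -1 ∧ ∃ M, IsCapped as a₀ M f)) := by
  obtain ⟨as, a₀, h1, h2, h3⟩ := h
  have harity : ∀ c, P.arity (P.one c) = 1 := fun c => by rw [arity, P.inputs_one]; rfl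
  rcases h3 with h3 | ⟨h3, M, h4⟩
  · have h4 := isRooted_of_represents h3
    refine ⟨as, a₀, h1, h2, .inl ⟨0, h4⟩, .inl ⟨?_, h4⟩⟩
    rcases h2 a₀ (.head _) with h5 | h5
    · exact h5
    · have := ψ.arity_eq_zero _ h5
      have := h4.lt_arity
      omega
  · have h5 := isCapped_of_represents h4
    refine ⟨as, a₀, h1, h2, .inr ⟨h3, M, h5⟩, .inr ⟨?_, M, h5⟩⟩
    rcases h2 a₀ (.head _) with ⟨c, rfl⟩ | h6
    · rw [harity] at h3; omega
    · exact h6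

theorem RNegOne.exists_track {p q : P.Tw} {f : p ⟶ q} (h : RNegOne ψ f) :
    ∃ loc D, IsTrack ψ f loc D ∧ ∀ j : ℤ, 0 ≤ j → j ≤ P.arity p → D j = 0 ∨ D j = -1 := by
  obtain ⟨as, a₀, h1, h2, h3, -⟩ := h.exists_tree
  obtain ⟨loc, D, h4, h5, -⟩ := h3.exists_track' (ψ := ψ) h1
  refine ⟨loc, D, h4, fun j h0 hj => ?_⟩
  obtain ⟨a, ha, h6⟩ := h5 j h0 hj
  rw [h6]
  rcases h2 a ha with ⟨c, rfl⟩ | h7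
  · exact .inl (ψ.deg_one c)
  · exact .inr h7

/-- A morphism of non-negative grading is a tree followed by a permutation of the leaves. -/
theorem RNonneg.exists_tree {p q : P.Tw} {f : p ⟶ q} (h : RNonneg ψ f) :
    ∃ (r : P.Tw) (g : p ⟶ r) (θ : r ⟶ q) (as : List P.Op) (a₀ : P.Op) (n : ℕ)
      (σ : Equiv.Perm (Fin (n + 1))), as.length = P.arity p ∧
      (∀ a ∈ a₀ :: as, 0 ≤ ψ.deg a) ∧ IsTree as a₀ g ∧ f = g ≫ θ ∧
        Represents θ (.act n σ (.var (r : P.Op))) := by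
  obtain ⟨as, a₀, N, σ, h1, h2, h3⟩ := h
  rcases h3 with ⟨i, h3⟩ | ⟨h3, M, h4⟩
  · exact h3.of_act (M := fun q f => ∃ (r : P.Tw) (g : p ⟶ r) (θ : r ⟶ q) (as : List P.Op)
      (a₀ : P.Op) (n : ℕ) (σ : Equiv.Perm (Fin (n + 1))), as.length = P.arity p ∧
      (∀ a ∈ a₀ :: as, 0 ≤ ψ.deg a) ∧ IsTree as a₀ g ∧ f = g ≫ θ ∧
        Represents θ (.act n σ (.var (r : P.Op)))) fun r g h hσ hg =>
      ⟨r, g, _, as, a₀, N, σ, h1, h2, .inl ⟨i, isRooted_of_represents hg⟩, rfl,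
        represents_eA h hσ⟩
  · exact h4.of_act (M := fun q f => ∃ (r : P.Tw) (g : p ⟶ r) (θ : r ⟶ q) (as : List P.Op)
      (a₀ : P.Op) (n : ℕ) (σ : Equiv.Perm (Fin (n + 1))), as.length = P.arity p ∧
      (∀ a ∈ a₀ :: as, 0 ≤ ψ.deg a) ∧ IsTree as a₀ g ∧ f = g ≫ θ ∧
        Represents θ (.act n σ (.var (r : P.Op)))) fun r g h hσ hg =>
      ⟨r, g, _, as, a₀, N, σ, h1, h2, .inr ⟨h3, M, isCapped_of_represents hg⟩, rfl,
        represents_eA h hσ⟩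

theorem exists_track_of_act {p q : P.Tw} {f : p ⟶ q} {n : ℕ} {σ : Equiv.Perm (Fin (n + 1))}
    (h : Represents f (.act n σ (.var (p : P.Op)))) : ∃ loc, IsTrack ψ f loc fun _ => 0 := by
  refine h.of_act (M := fun q f => ∃ loc, IsTrack ψ f loc fun _ => 0) fun r g h hσ hg => ?_
  obtain ⟨⟨-, hr⟩, -⟩ := id hg
  obtain rfl : p = r := by simpa [eval, interp] using hr
  rw [hg.unique (represents_id p), Category.id_comp]
  exact ⟨_, isTrack_eA h hσ⟩

theorem RNonneg.exists_track {p q : P.Tw} {f : p ⟶ q} (h : RNonneg ψ f) :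
    ∃ loc D, IsTrack ψ f loc D ∧ ∀ j : ℤ, 0 ≤ j → j ≤ P.arity p → 0 ≤ D j := by
  obtain ⟨r, g, θ, as, a₀, n, σ, h1, h2, h3, rfl, h4⟩ := h.exists_tree
  obtain ⟨loc, D, h5, h6, -⟩ := h3.exists_track' (ψ := ψ) h1
  obtain ⟨loc', h7⟩ := exists_track_of_act (ψ := ψ) h4
  have h8 := h5.comp h7
  rw [compDeg_zero] at h8
  refine ⟨_, D, h8, fun j h0 hj => ?_⟩
  obtain ⟨a, ha, h9⟩ := h6 j h0 hj
  rw [h9]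
  exact h2 a ha

/-! ### Isomorphisms -/

theorem isIso_of_app_eq {p q : P.Tw} {f : p ⟶ q}
    (h : ∀ (T : Operad.{u, v} κ C) (F : Hom P T) (x : El T p), (app F f x).1 = x.1) : IsIso f := by
  obtain rfl : q = p := by
    have := h P (Hom.id P) (El.self p)
    rwa [app_self] at this
  have : f = 𝟙 _ := hom_ext fun T F x => Subtype.ext (by rw [h, app_id])
  rw [this]
  infer_instance

/-- The first part of the two-out-of-six property. -/
theorem isIso_of_comp_isIso {D : Type*} [Category* D] {a b c d : D} {f : a ⟶ b} {g : b ⟶ c}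
    {h : c ⟶ d} (h1 : IsIso (f ≫ g)) (h2 : IsIso (g ≫ h)) : IsIso f := by
  have h3 : g ≫ h ≫ inv (g ≫ h) = 𝟙 _ := by
    rw [← Category.assoc, IsIso.hom_inv_id]
  have h4 : inv (f ≫ g) ≫ f ≫ g = 𝟙 _ := IsIso.inv_hom_id _
  have h5 : (h ≫ inv (g ≫ h)) ≫ g = 𝟙 _ := by
    have h6 : h ≫ inv (g ≫ h) = inv (f ≫ g) ≫ f := by
      rw [← Category.id_comp (h ≫ inv (g ≫ h)), ← h4]
      simp only [Category.assoc]
      rw [h3, Category.comp_id]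
    rw [h6, Category.assoc, h4]
  have : IsIso g := ⟨_, h3, h5⟩
  exact IsIso.of_isIso_comp_right f g

theorem isIso_eL_one {q : P.Tw} {i : ℕ} {c : C} (h) : IsIso (eL q i (P.one c) h) :=
  isIso_of_app_eq fun _ F x => app_eL_one F h x

theorem isIso_eR_one {q : P.Tw} {c : C} (h) : IsIso (eR (P.one c) 0 q h) :=
  isIso_of_app_eq fun _ F x => app_eR_one F h x

theorem isIso_eA {q : P.Tw} {n : ℕ} {σ : Equiv.Perm (Fin (n + 1))} (h hσ) :
    IsIso (eA q n σ h hσ) := by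
  have key : ∀ (q : P.Tw) (σ : Equiv.Perm (Fin (n + 1))) (h hσ h' hσ'),
      IsIso (eA q n σ h hσ ≫ eA _ n σ⁻¹ h' hσ') := fun q σ h hσ h' hσ' =>
    isIso_of_app_eq fun T F x => by
      rw [app_comp, app_eA]
      have h1 := app_eA F h hσ x
      refine (act_congr T h1 n σ⁻¹ _ (T.length_act _ _ _ _ _) _).trans ?_
      have h2 : κ.Allows (σ * σ⁻¹) := hσ.mul hσ'
      rw [T.act_act _ _ _ _ _ _ _ _ h2]
      simp only [mul_inv_cancel]
      exact T.act_one _ _ _ _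
  exact isIso_of_comp_isIso (key q σ h hσ (P.length_act _ _ _ _ _) hσ.inv)
    (key _ σ⁻¹ _ hσ.inv (P.length_act _ _ _ _ _) (by rwa [inv_inv]))

/-- A two-sided inverse of a unary operation. -/
structure IsInverse (a b : P.Op) : Prop where
  inputs : P.inputs a = [P.output b]
  inputs' : P.inputs b = [P.output a]
  comp : ∀ h, P.comp a 0 b h = P.one (P.output a)
  comp' : ∀ h, P.comp b 0 a h = P.one (P.output b)

theorem IsInverse.symm {a b : P.Op} (h : IsInverse a b) : IsInverse b a :=
  ⟨h.2, h.1, h.4, h.3⟩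

theorem IsInverse.map {a b : P.Op} (h : IsInverse a b) (F : Hom P T) :
    IsInverse (F.map a) (F.map b) := by
  have key : ∀ {a b : P.Op}, IsInverse a b → ∀ h', T.comp (F.map a) 0 (F.map b) h' =
      T.one (T.output (F.map a)) := fun {a b} h h' => by
    have h1 : (P.inputs a)[0]? = some (P.output b) := by rw [h.inputs]; rfl
    rw [← F.map_comp a 0 b h1 h', h.comp, F.map_one, F.output_map]
  exact ⟨by rw [F.inputs_map, F.output_map, h.1], by rw [F.inputs_map, F.output_map, h.2],
    key h, key h.symm⟩

theorem IsInverse.isIso_eL {a b : P.Op} (hab : IsInverse a b) {q : P.Tw} {i : ℕ} (h) :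
    IsIso (eL q i a h) := by
  have key : ∀ {a b : P.Op} (_ : IsInverse a b) (q : P.Tw) (h h'),
      IsIso (eL q i a h ≫ eL _ i b h') := fun {a b} hab q h h' =>
    isIso_of_app_eq fun T F x => by
      have hF := hab.map F
      have h0 : (T.inputs (F.map a))[0]? = some (T.output (F.map b)) := by rw [hF.inputs]; rfl
      have h1 : (T.inputs x.1)[i]? = some (T.output (F.map a)) := x.compL_aux h
      have h2 := (app F (eL q i a h) x).compL_aux (F := F) h'
      rw [app_eL] at h2
      rw [app_comp, app_eL]
      refine (comp_congr T (app_eL F h x) rfl rfl _ h2).trans ?_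
      refine (T.comp_assoc x.1 i (F.map a) 0 (F.map b) h1 h2 h0
        (by rw [T.output_comp, h1])).trans ?_
      refine (comp_congr T rfl (hF.comp h0) rfl _ (by rw [T.output_one, h1])).trans ?_
      exact T.comp_one _ _ _ _
  have h2 : ∀ {a b : P.Op} (_ : IsInverse a b) (q : P.Tw) (h),
      (P.inputs (P.comp q i a h))[i]? = some (P.output b) := fun {a b} hab q h => by
    have hi := lt_length h
    rw [P.inputs_comp, hab.inputs]
    have := getElem?_splice_inner (P.inputs q) [P.output b] (i := i) (j := 0) hi.le (by simp)
    simpa using this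
  exact isIso_of_comp_isIso (key hab q h (h2 hab q h))
    (key hab.symm _ _ (h2 hab.symm _ _))

theorem IsInverse.isIso_eR {a b : P.Op} (hab : IsInverse a b) {q : P.Tw} (h) :
    IsIso (eR a 0 q h) := by
  have key : ∀ {a b : P.Op} (_ : IsInverse b a) (q : P.Tw) (h h'),
      IsIso (eR a 0 q h ≫ eR b 0 _ h') := fun {a b} hab q h h' =>
    isIso_of_app_eq fun T F x => by
      have hF := hab.map F
      have h0 : (T.inputs (F.map b))[0]? = some (T.output (F.map a)) := by rw [hF.inputs]; rfl
      have h1 : (T.inputs (F.map a))[0]? = some (T.output x.1) := x.compR_aux h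
      have h2 := (app F (eR a 0 q h) x).compR_aux (F := F) h'
      rw [app_eR] at h2
      have h3 : (T.inputs (T.comp (F.map b) 0 (F.map a) h0))[0]? = some (T.output x.1) := by
        rw [T.inputs_comp, hF.inputs]
        simpa using h1
      rw [app_comp, app_eR]
      refine (comp_congr T rfl (app_eR F h x) rfl _ h2).trans ?_
      refine (T.comp_assoc (F.map b) 0 (F.map a) 0 x.1 h0 h3 h1 h2).symm.trans ?_
      refine (comp_congr T (hF.comp h0) rfl rfl _ (by rw [← hF.comp h0]; exact h3)).trans ?_
      exact T.one_comp _ _ _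
  have h2 : ∀ {a b : P.Op} (_ : IsInverse b a) (q : P.Tw) (h),
      (P.inputs b)[0]? = some (P.output (P.comp a 0 q h)) := fun {a b} hab q h => by
    rw [hab.inputs, P.output_comp]; rfl
  exact isIso_of_comp_isIso (key hab.symm q h (h2 hab.symm q h))
    (key hab _ _ (h2 hab _ _))

/-! ### The two classes in terms of the gradings of the vertices -/

/-- If the operations of grading `0` are unary and form a groupoid, then each of them is invertible.
-/
theorem exists_isInverse (hψ : ∀ p, ψ.deg p = 0 → P.arity p = 1) (hG : IsGroupoid (GradeZero ψ))
    {a : P.Op} (ha : ψ.deg a = 0) : ∃ b, IsInverse a b := by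
  obtain ⟨c, hc⟩ := List.length_eq_one_iff.1 (hψ a ha)
  let f : @Quiver.Hom (GradeZero ψ) _ c (P.output a) := ⟨a, hc, rfl, ha⟩
  have := hG.all_isIso f
  have h1 := congrArg Subtype.val (IsIso.hom_inv_id f)
  have h2 := congrArg Subtype.val (IsIso.inv_hom_id f)
  obtain ⟨h3, h4, -⟩ := (inv f).2
  refine ⟨(inv f).1, ?_, h3, fun h => h2, fun h => ?_⟩
  · rw [h4, hc]
  · rw [h4]; exact h1

theorem IsGraft.isIso (hψ : ∀ p, ψ.deg p = 0 → P.arity p = 1) (hG : IsGroupoid (GradeZero ψ))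
    {p q : P.Tw} {f : p ⟶ q} {k : ℕ} {as : List P.Op} (h : IsGraft k as f)
    (has : ∀ a ∈ as, ψ.deg a = 0) : IsIso f := by
  induction h with
  | nil k => infer_instance
  | cons h hf ih =>
    have := ih fun a ha => has a (.tail _ ha)
    obtain ⟨b, hb⟩ := exists_isInverse hψ hG (has _ (.head _))
    have := hb.isIso_eL h
    infer_instance

theorem IsTree.isIso (hψ : ∀ p, ψ.deg p = 0 → P.arity p = 1) (hG : IsGroupoid (GradeZero ψ))
    {p q : P.Tw} {f : p ⟶ q} {as : List P.Op} {a₀ : P.Op} (h : IsTree as a₀ f)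
    (has : ∀ a ∈ a₀ :: as, ψ.deg a = 0) : IsIso f := by
  have h0 := hψ _ (has a₀ (.head _))
  rcases h with ⟨i, h⟩ | ⟨h1, -⟩
  · have hi := h.lt_arity
    obtain rfl : i = 0 := by omega
    obtain ⟨h, hf⟩ := h
    have := hf.isIso hψ hG fun a ha => has a (.tail _ ha)
    obtain ⟨b, hb⟩ := exists_isInverse hψ hG (has a₀ (.head _))
    have := hb.isIso_eR h
    infer_instance
  · omega

theorem isIso_of_act {p q : P.Tw} {f : p ⟶ q} {n : ℕ} {σ : Equiv.Perm (Fin (n + 1))}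
    (h : Represents f (.act n σ (.var (p : P.Op)))) : IsIso f := by
  refine h.of_act (M := fun q f => IsIso f) fun r g h hσ hg => ?_
  obtain ⟨⟨-, hr⟩, -⟩ := id hg
  obtain rfl : p = r := by simpa [eval, interp] using hr
  rw [hg.unique (represents_id p), Category.id_comp]
  exact isIso_eA h hσ

theorem RNegOne.isIso {p q : P.Tw} {f : p ⟶ q} (hf : RNegOne ψ f)
    (hψ : ∀ p, ψ.deg p = 0 → P.arity p = 1) (hG : IsGroupoid (GradeZero ψ)) {loc D : ℤ → ℤ}
    (h : IsTrack ψ f loc D) (hD : ∀ j : ℤ, 0 ≤ j → j ≤ P.arity p → D j = 0) : IsIso f := by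
  obtain ⟨as, a₀, h1, -, h2, -⟩ := hf.exists_tree
  obtain ⟨loc', D', h3, -, h4⟩ := h2.exists_track' (ψ := ψ) h1
  refine h2.isIso hψ hG fun a ha => ?_
  obtain ⟨j, h0, hj, h5⟩ := h4 a ha
  rw [← h5, ← (h.unique h3).1 j h0 hj, hD j h0 hj]

theorem RNonneg.isIso {p q : P.Tw} {f : p ⟶ q} (hf : RNonneg ψ f)
    (hψ : ∀ p, ψ.deg p = 0 → P.arity p = 1) (hG : IsGroupoid (GradeZero ψ)) {loc D : ℤ → ℤ}
    (h : IsTrack ψ f loc D) (hD : ∀ j : ℤ, 0 ≤ j → j ≤ P.arity p → D j = 0) : IsIso f := by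
  obtain ⟨r, g, θ, as, a₀, n, σ, h1, -, h2, rfl, h6⟩ := hf.exists_tree
  obtain ⟨loc', D', h3, -, h4⟩ := h2.exists_track' (ψ := ψ) h1
  obtain ⟨loc'', h7⟩ := exists_track_of_act (ψ := ψ) h6
  have h8 := h3.comp h7
  rw [compDeg_zero] at h8
  have := h2.isIso hψ hG fun a ha => by
    obtain ⟨j, h0, hj, h5⟩ := h4 a ha
    rw [← h5, ← (h.unique h8).1 j h0 hj, hD j h0 hj]
  have := isIso_of_act h6
  infer_instance

/-- In a composite of a morphism of grading `-1` with one whose vertices have non-negative grading,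
the vertices of grading `-1` are those of the first morphism, as these are closed. -/
theorem compDeg_cases {p z : P.Tw} {l : p ⟶ z} {loc D D' : ℤ → ℤ}
    (hl : IsTrack ψ l loc D) (hD : ∀ j : ℤ, 0 ≤ j → j ≤ P.arity p → D j = 0 ∨ D j = -1)
    (hD' : ∀ j : ℤ, 0 ≤ j → j ≤ P.arity z → 0 ≤ D' j) {j : ℤ} (h0 : 0 ≤ j) (hj : j ≤ P.arity p) :
    (D j = -1 ∧ compDeg (P.arity z) loc D D' j = -1) ∨
      (D j = 0 ∧ 0 ≤ compDeg (P.arity z) loc D D' j) := by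
  rcases hD j h0 hj with h1 | h1
  · refine .inr ⟨h1, ?_⟩
    rw [compDeg, h1, zero_add]
    refine Finset.sum_nonneg fun k hk => ?_
    rw [Finset.mem_filter, Finset.mem_Icc] at hk
    exact hD' k hk.1.1 hk.1.2
  · refine .inl ⟨h1, ?_⟩
    rw [compDeg, h1, Finset.sum_eq_zero, add_zero]
    intro k hk
    rw [Finset.mem_filter, Finset.mem_Icc] at hk
    exact absurd hk.2 (hl.loc_ne h0 hj h1 hk.1.1 hk.1.2)

/-- The class `R₊` consists of the morphisms whose vertices have non-negative grading: in the
factorization of such a morphism, the first morphism has no vertices of grading `-1`, so that it is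
an isomorphism. -/
theorem rPlus_iff (hψ : ∀ p, ψ.deg p = 0 → P.arity p = 1) (hG : IsGroupoid (GradeZero ψ))
    {p q : P.Tw} {f : p ⟶ q} {loc D : ℤ → ℤ} (h : IsTrack ψ f loc D) :
    RPlus ψ f ↔ ∀ j : ℤ, 0 ≤ j → j ≤ P.arity p → 0 ≤ D j := by
  constructor
  · rintro ⟨r, θ, l, hθ, hl, rfl⟩ j h0 hj
    obtain ⟨loc₁, D₁, h1⟩ := exists_isTrack ψ θ
    obtain ⟨loc₂, D₂, h2, h3⟩ := hl.exists_track
    rw [(h.unique (h1.comp h2)).1 j h0 hj]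
    exact compDeg_nonneg (p := p) (fun j h0 hj => (h1.iso.2 j h0 hj).ge) h3 j h0 hj
  · intro hD
    obtain ⟨z, l, r, hl, hr, rfl⟩ := exists_factorization ψ f
    obtain ⟨loc₁, D₁, h1, h2⟩ := hl.exists_track
    obtain ⟨loc₂, D₂, h3, h4⟩ := hr.exists_track
    have := hl.isIso hψ hG h1 fun j h0 hj => by
      have h5 := hD j h0 hj
      rw [(h.unique (h1.comp h3)).1 j h0 hj] at h5
      rcases compDeg_cases h1 h2 h4 h0 hj with h6 | h6
      · omega
      · exact h6.1
    exact ⟨z, l, r, this, hr, rfl⟩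

/-- The class `R₋` consists of the morphisms whose vertices have grading at most `0`: in the
factorization of such a morphism, the second morphism has no vertices of positive grading, as the
vertices of non-negative grading attached to the same half-edge of the source add up, so that it is
an isomorphism. -/
theorem rMinus_iff (hψ : ∀ p, ψ.deg p = 0 → P.arity p = 1) (hG : IsGroupoid (GradeZero ψ))
    {p q : P.Tw} {f : p ⟶ q} {loc D : ℤ → ℤ} (h : IsTrack ψ f loc D) :
    RMinus ψ f ↔ ∀ j : ℤ, 0 ≤ j → j ≤ P.arity p → D j ≤ 0 := by
  constructor
  · rintro ⟨r, l, θ, hl, hθ, rfl⟩ j h0 hj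
    obtain ⟨loc₁, D₁, h1, h2⟩ := hl.exists_track
    obtain ⟨loc₂, D₂, h3⟩ := exists_isTrack ψ θ
    rw [(h.unique (h1.comp h3)).1 j h0 hj]
    refine compDeg_nonpos (p := p) (fun j h0 hj => ?_) (fun j h0 hj => (h3.iso.2 j h0 hj).le) j h0 hj
    rcases h2 j h0 hj with h | h <;> omega
  · intro hD
    obtain ⟨z, l, r, hl, hr, rfl⟩ := exists_factorization ψ f
    obtain ⟨loc₁, D₁, h1, h2⟩ := hl.exists_track
    obtain ⟨loc₂, D₂, h3, h4⟩ := hr.exists_track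
    refine ⟨z, l, r, hl, hr.isIso hψ hG h3 fun k h0 hk => ?_, rfl⟩
    have hb := h1.loc_bounds k h0 hk
    have h5 := hD _ hb.1 hb.2
    rw [(h.unique (h1.comp h3)).1 _ hb.1 hb.2] at h5
    rcases compDeg_cases h1 h2 h4 hb.1 hb.2 with ⟨h6, -⟩ | ⟨h6, -⟩
    · exact absurd rfl (h1.loc_ne hb.1 hb.2 h6 h0 hk)
    · rw [compDeg, h6, zero_add] at h5
      have h7 : D₂ k ≤ ∑ k' ∈ (Finset.Icc (0 : ℤ) (P.arity z)).filter fun k' => loc₁ k' = loc₁ k,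
          D₂ k' := by
        refine Finset.single_le_sum (f := D₂) (fun k' hk' => ?_) ?_
        · rw [Finset.mem_filter, Finset.mem_Icc] at hk'
          exact h4 k' hk'.1.1 hk'.1.2
        · rw [Finset.mem_filter, Finset.mem_Icc]
          exact ⟨⟨h0, hk⟩, rfl⟩
      have := h4 k h0 hk
      omega

/-- Conversely to `IsTrack.iso`, a morphism whose vertices all have grading `0` is an isomorphism.
-/
theorem isIso_of_deg_eq_zero (hψ : ∀ p, ψ.deg p = 0 → P.arity p = 1)
    (hG : IsGroupoid (GradeZero ψ)) {p q : P.Tw} {f : p ⟶ q} {loc D : ℤ → ℤ}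
    (h : IsTrack ψ f loc D) (hD : ∀ j : ℤ, 0 ≤ j → j ≤ P.arity p → D j = 0) : IsIso f := by
  obtain ⟨r, l, θ, hl, hθ, rfl⟩ := (rMinus_iff hψ hG h).2 fun j h0 hj => (hD j h0 hj).le
  obtain ⟨loc₁, D₁, h1, h2⟩ := hl.exists_track
  obtain ⟨loc₂, D₂, h3⟩ := exists_isTrack ψ θ
  have := hl.isIso hψ hG h1 fun j h0 hj => by
    have h5 := hD j h0 hj
    rw [(h.unique (h1.comp h3)).1 j h0 hj] at h5
    rcases compDeg_cases h1 h2 (fun j h0 hj => (h3.iso.2 j h0 hj).ge) h0 hj with h6 | h6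
    · omega
    · exact h6.1
  infer_instance

/-! ### Morphisms of grading `-1` are epimorphisms -/

/-- Composition with identities and with operations of arity `0` is an epimorphism. -/
theorem IsGraft.epi {p q : P.Tw} {f : p ⟶ q} {k : ℕ} {as : List P.Op} (h : IsGraft k as f)
    (has : ∀ a ∈ as, (∃ c, a = P.one c) ∨ ψ.deg a = -1) : Epi f := by
  induction h with
  | nil k => infer_instance
  | cons h hf ih =>
    have := ih fun a ha => has a (.tail _ ha)
    rcases has _ (.head _) with ⟨c, rfl⟩ | ha
    · have := isIso_eL_one h
      exact epi_comp _ _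
    · have := epi_eL h (ψ.arity_eq_zero _ ha)
      exact epi_comp _ _

theorem RNegOne.epi {p q : P.Tw} {f : p ⟶ q} (hf : RNegOne ψ f) : Epi f := by
  obtain ⟨as, a₀, h1, h2, -, h3⟩ := hf.exists_tree
  rcases h3 with ⟨⟨c, rfl⟩, h, hg⟩ | ⟨ha, M, h, hσ, h', hg⟩
  · have := hg.epi fun a ha => h2 a (.tail _ ha)
    have := isIso_eR_one h
    exact epi_comp _ _
  · have := hg.epi fun a ha => h2 a (.tail _ ha)
    have := isIso_eA h hσ
    have := epi_eL h' (ψ.arity_eq_zero _ ha)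
    have := epi_comp (eA _ M (finRotate (M + 1)) h hσ) (eL _ (M - 1) a₀ h')
    exact epi_comp _ _

theorem RMinus.epi {p q : P.Tw} {f : p ⟶ q} (hf : RMinus ψ f) : Epi f := by
  obtain ⟨r, l, θ, hl, hθ, rfl⟩ := hf
  have := hl.epi
  exact epi_comp _ _

/-! ### The vertices of a morphism of grading `-1` -/

theorem Sends.adm_self {p q : P.Tw} {f : p ⟶ q} {A B : Set (Labelled P ℤ)}
    (h : Sends (Hom.id P) f (El.self p) A B) : Adm (q : P.Op) B := by
  have := h.adm
  rwa [app_self] at this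

theorem Sends.comp_self {p q r : P.Tw} {f : p ⟶ q} {g : q ⟶ r} {A B D : Set (Labelled P ℤ)}
    (h : Sends (Hom.id P) f (El.self p) A B) (h' : Sends (Hom.id P) g (El.self q) B D) :
    Sends (Hom.id P) (f ≫ g) (El.self p) A D :=
  h.comp (by rwa [app_self])

/-- Composition at an input is not seen by operations with smaller labels. -/
theorem compL_of_le {t q : T.Op} {A : Set (Labelled T ℤ)} (hA : Adm t A) {i : ℕ}
    (h : ∀ x ∈ A, ∀ l ∈ x.edges, l ≤ i) : compL A i q = A := by
  have h1 : ∀ x ∈ A, x.map (outL (-2) i (T.arity q)) = x := fun x hx => map_eq_self fun l hl => by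
    have := h x hx l hl
    rw [outL, if_neg (by omega), if_pos this]
  have h2 : ∀ x ∈ A, (-2 : ℤ) ∉ x.edges := fun x hx h' => by
    have := ((hA.fits x hx).bounds h').1
    omega
  ext z
  constructor
  · rintro ⟨x, hx, h3⟩
    rw [h1 x hx] at h3
    rcases h3 with ⟨h3, -⟩ | ⟨-, h3⟩
    · exact absurd h3 (h2 x hx)
    · exact hA.closed x hx z h3
  · intro hz
    refine ⟨z, hz, ?_⟩
    rw [h1 z hz]
    exact .inr ⟨h2 z hz, .refl z⟩

/-- The operation `a`, of arity `0`, labelled by the mark `-1`. -/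
def leaf (a : T.Op) (ha : T.arity a = 0) : Labelled T ℤ := ⟨a, -1, [], ha.symm⟩

theorem edges_leaf {a : T.Op} (ha : T.arity a = 0) : (leaf a ha).edges = [-1] := rfl

theorem edges_of_mem_cls_leaf {a : T.Op} {ha : T.arity a = 0} {x : Labelled T ℤ}
    (h : x ∈ (leaf a ha).cls) : x.edges = [-1] :=
  List.perm_singleton.1 (Rel.edges_perm h)

theorem eq_of_cls_leaf_eq {a b : T.Op} {ha : T.arity a = 0} {hb : T.arity b = 0}
    (h : (leaf a ha).cls = (leaf b hb).cls) : a = b := by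
  have h1 : (leaf a ha).Rel (leaf b hb) := by
    have := (leaf b hb).mem_cls_self
    rwa [← h] at this
  exact h1.op_eq (by simp [edges_leaf]) rfl

/-- A vertex without leaves is not affected by further compositions. -/
theorem sends_leaf (ψ : P.NiceGrading) {p q : P.Tw} (f : p ⟶ q) {a : P.Op} {ha : P.arity a = 0}
    (h : Adm (p : P.Op) (leaf a ha).cls) :
    Sends (Hom.id P) f (El.self p) (leaf a ha).cls (leaf a ha).cls := by
  obtain ⟨B, hB⟩ := exists_sends (Hom.id P) f (El.self p) h
  obtain ⟨loc, D, h1⟩ := exists_isTrack ψ f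
  have key : ∀ z ∈ B, z.Rel (leaf a ha) := fun z hz => by
    obtain ⟨x, hx, -, -, h2⟩ := h1.spec _ _ hB z hz
    exact (h2 (edges_of_mem_cls_leaf hx)).trans (Rel.symm hx)
  obtain ⟨z, hz⟩ := h1.nonempty _ _ hB ⟨_, mem_cls_self _⟩ fun x hx => by
    rw [edges_of_mem_cls_leaf hx]; simp
  have : B = (leaf a ha).cls := by
    ext x
    exact ⟨fun hx => (key x hx).symm, fun hx => hB.adm.closed z hz x ((key z hz).trans hx)⟩
  rwa [this] at hB

/-- The identity operation labelled by the mark and by an input becomes, under composition at this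
input, the operation that is composed. -/
theorem compL_unit {t a : T.Op} {i : ℕ} {c : C} (h : (T.inputs t)[i]? = some (T.output a))
    (ha : T.arity a = 0) {x : Labelled T ℤ} (hx : Fits t x) (hop : x.op = T.one c)
    (hed : x.edges = [-1, (i : ℤ) + 1]) : compL x.cls i a = (leaf a ha).cls := by
  obtain ⟨h1, h2⟩ : x.root = -1 ∧ x.ins = [(i : ℤ) + 1] := by simpa [edges] using hed
  have hcol : ((i : ℤ) + 1, c) ∈ x.cols := by
    rw [cols, hed, hop, hedges, T.inputs_one]; simp
  have hc : c = T.output a := by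
    rcases hx.cols _ hcol with h3 | h3
    · simp only at h3; omega
    · have h4 := mem_cols_can (p := t) (k := i + 1) (c := c) (by push_cast; exact h3)
      rw [hedges, List.getElem?_cons_succ, h] at h4
      exact (Option.some.inj h4).symm
  subst hc
  have h0 : (T.inputs x.op)[0]? = some (T.output a) := by rw [hop, T.inputs_one]; rfl
  refine glueSet_cls (meet_outL hx _ (by omega) i a) (Std.contr ⟨0, h0, ?_, ?_, ?_⟩)
  · simp [Labelled.map, h2, outL]
  · simp [Labelled.map, can, innL]
  · refine eq_of_edges ?_ ?_
    · exact (T.one_comp _ _ (by rw [T.inputs_one]; rfl)).symm.trans (T.comp_congr hop.symm rfl rfl _ _)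
    · refine Eq.trans ?_ (edges_comp _ _ _ _).symm
      simp [edges_leaf, Labelled.map, h1, h2, outL, can, ha]
      simp [edges]
      omega

/-- Composition at the inputs `k, k + 1, …` is not seen by operations with smaller labels. -/
theorem IsGraft.sends_of_le {p q : P.Tw} {f : p ⟶ q} {k : ℕ} {as : List P.Op}
    (h : IsGraft k as f) {A : Set (Labelled P ℤ)} (hA : Adm (p : P.Op) A)
    (hk : ∀ x ∈ A, ∀ l ∈ x.edges, l ≤ k) : Sends (Hom.id P) f (El.self p) A A := by
  induction h with
  | nil k => exact sends_id _ _ hA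
  | cons h hf ih =>
    have h1 := ih fun x hx l hl => by
      have := hk x hx l hl
      push_cast
      omega
    have h2 := h1.comp (sends_eL _ h _ h1.adm)
    rwa [compL_of_le h1.adm hk] at h2

/-- The operation attached to an input is seen at the identity operation labelled by this input and
the mark, if it is closed. -/
theorem IsGraft.sends_vertex {p q : P.Tw} {f : p ⟶ q} {k : ℕ} {as : List P.Op}
    (h : IsGraft k as f) {n : ℕ} {a : P.Op} (ha : as[n]? = some a) (ha0 : P.arity a = 0)
    {x : Labelled P ℤ} (hx : Fits (p : P.Op) x) {c : C} (hop : x.op = P.one c)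
    (hed : x.edges = [-1, (k : ℤ) + 1 + n]) :
    Sends (Hom.id P) f (El.self p) x.cls (leaf a ha0).cls := by
  induction h generalizing n with
  | nil k => simp at ha
  | @cons k b as q f h hf ih =>
    rcases n with - | n
    · obtain rfl : b = a := by simpa using ha
      have h1 := hf.sends_of_le hx.adm_cls fun y hy l hl => by
        have := (Rel.edges_perm hy).mem_iff.1 hl
        rw [hed] at this
        simp at this
        push_cast
        omega
      have h2 := h1.comp (sends_eL _ h _ h1.adm)
      have h3 : Fits (app (Hom.id P) f (El.self p)).1 x := h1.adm.fits _ (mem_cls_self x)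
      have h4 : (P.inputs (app (Hom.id P) f (El.self p)).1)[k]? = some (P.output b) := by
        rw [app_self]; exact h
      have h5 : compL x.cls k ((Hom.id P).map b) = (leaf b ha0).cls :=
        compL_unit h4 ha0 h3 hop (by simpa using hed)
      rwa [h5] at h2
    · have h1 := ih (n := n) (by simpa using ha) (by rw [hed]; push_cast; ring_nf)
      have h2 := h1.comp (sends_eL _ h _ h1.adm)
      rwa [compL_of_le h1.adm] at h2
      intro y hy l hl
      rw [edges_of_mem_cls_leaf hy, List.mem_singleton] at hl
      omega

/-- A closed vertex attached to an input of the source is the value of the tree at an identity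
operation. -/
theorem IsTree.sends_vertex {p q : P.Tw} {f : p ⟶ q} {as : List P.Op} {a₀ : P.Op}
    (ψ : P.NiceGrading) (h : IsTree as a₀ f) {n : ℕ} {a : P.Op} (ha : as[n]? = some a)
    (ha0 : P.arity a = 0) {x : Labelled P ℤ} (hx : Fits (p : P.Op) x) {c : C}
    (hop : x.op = P.one c) (hed : x.edges = [-1, (n : ℤ) + 1]) :
    Sends (Hom.id P) f (El.self p) x.cls (leaf a ha0).cls := by
  have key : ∀ {r q : P.Tw} {g : p ⟶ r} (g' : r ⟶ q), IsGraft 0 as g →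
      Sends (Hom.id P) (g ≫ g') (El.self p) x.cls (leaf a ha0).cls := fun {r q g} g' hg => by
    have h1 := hg.sends_vertex ha ha0 hx hop (by rw [hed]; push_cast; ring_nf)
    exact h1.comp_self (sends_leaf ψ g' h1.adm_self)
  rcases h with ⟨i, h, hg⟩ | ⟨-, M, h, hσ, h', hg⟩
  · exact key _ hg
  · exact key _ hg

/-- A closed vertex attached to the output of the source is the value of the tree at an identity
operation. -/
theorem IsCapped.sends_vertex {p q : P.Tw} {f : p ⟶ q} {as : List P.Op} {a₀ : P.Op} {M : ℕ}
    (h : IsCapped as a₀ M f) (ha0 : P.arity a₀ = 0) {x : Labelled P ℤ} (hx : Fits (p : P.Op) x)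
    {c : C} (hop : x.op = P.one c) (hed : x.edges = [0, -1]) :
    Sends (Hom.id P) f (El.self p) x.cls (leaf a₀ ha0).cls := by
  obtain ⟨h, hσ, h', hg⟩ := h
  rename_i r g
  have h1 := hg.sends_of_le hx.adm_cls fun y hy l hl => by
    have := (Rel.edges_perm hy).mem_iff.1 hl
    rw [hed] at this
    simp at this
    omega
  have h3 := sends_eA (Hom.id P) h hσ (El.self r) h1.adm_self
  have hM : M - 1 < M := by
    have := lt_length h'
    rwa [P.length_act] at this
  obtain ⟨N, rfl⟩ : ∃ N, M = N + 1 := ⟨M - 1, by omega⟩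
  have hκ : κ = .cyclic := by
    by_contra hκ
    have := hσ.map_zero hκ
    simp at this
  -- the permutation makes the output the last input, so that the identity has to be rotated
  have hx1 : (x.map (permL (finRotate (N + 1 + 1)))).edges = [((N + 1 : ℕ) : ℤ), -1] := by
    rw [edges_map, hed]
    simp only [List.map_cons, List.map_nil]
    rw [permL_finRotate le_rfl (by omega), permL_of_neg _ (by omega), if_pos rfl]
  set x₁ := x.map (permL (finRotate (N + 1 + 1))) with hx₁
  have hlen : (P.inputs x₁.op).length = 1 := by rw [map_op, hop, P.inputs_one]; rfl
  have hrel := rel_act x₁ 1 (finRotate 2) hlen (Kind.allows_cyclic hκ _)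
  set x₂ := x₁.act 1 (finRotate 2) hlen (Kind.allows_cyclic hκ _) with hx₂
  have hop2 : x₂.op = P.one c :=
    (P.act_congr hop _ _ _ (by rw [P.inputs_one]; rfl) _).trans (P.act_one_finRotate hκ c _ _)
  have hed2 : x₂.edges = [-1, (N : ℤ) + 1] := by
    have h4 : x₁.root = ((N + 1 : ℕ) : ℤ) ∧ x₁.ins = [-1] := by simpa [edges] using hx1
    rw [hx₂, edges_act_finRotate, h4.1, h4.2]
    simp
  rw [actS_cls, ← hx₁, hrel.cls_eq] at h3
  have h4 := h3.adm_self
  have h5 := sends_eL (Hom.id P) h' (El.self _) h4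
  have h6 : compL x₂.cls (N + 1 - 1) ((Hom.id P).map a₀) = (leaf a₀ ha0).cls :=
    compL_unit (t := P.act r (N + 1) (finRotate (N + 1 + 1)) h hσ) h' ha0
      (h4.fits _ (mem_cls_self x₂)) hop2 (by simpa using hed2)
  rw [h6] at h5
  exact h1.comp_self (h3.comp_self h5)

theorem IsGraft.colours {p q : P.Tw} {f : p ⟶ q} {k : ℕ} {as : List P.Op} (h : IsGraft k as f) :
    P.output q = P.output p ∧ (∀ m < k, (P.inputs q)[m]? = (P.inputs p)[m]?) ∧
      ∀ (n : ℕ) (a : P.Op), as[n]? = some a → (P.inputs p)[k + n]? = some (P.output a) := by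
  induction h with
  | nil k => exact ⟨rfl, fun _ _ => rfl, fun n a h => by simp at h⟩
  | @cons k a as q f h hf ih =>
    obtain ⟨h1, h2, h3⟩ := ih
    refine ⟨(P.output_comp _ _ _ _).trans h1, fun m hm => ?_, fun n b hb => ?_⟩
    · rw [← h2 m (by omega), P.inputs_comp, List.append_assoc, List.getElem?_append_left]
      · rw [List.getElem?_take_of_lt hm]
      · have := lt_length h
        rw [List.length_take]
        omega
    · rcases n with - | n
      · obtain rfl : a = b := by simpa using hb
        rw [← h, h2 _ (by omega)]; rfl
      · rw [← h3 n b (by simpa using hb)]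
        congr 1
        ring

theorem IsTree.inputs_eq {p q : P.Tw} {f : p ⟶ q} {as : List P.Op} {a₀ : P.Op}
    (h : IsTree as a₀ f) {n : ℕ} {a : P.Op} (ha : as[n]? = some a) :
    (P.inputs p)[n]? = some (P.output a) := by
  have key : ∀ {r : P.Tw} {g : p ⟶ r}, IsGraft 0 as g →
      (P.inputs p)[n]? = some (P.output a) := fun {r g} hg => by
    simpa using hg.colours.2.2 n a ha
  rcases h with ⟨i, h, hg⟩ | ⟨-, M, h, hσ, h', hg⟩
  · exact key hg
  · exact key hg

theorem IsRooted.one_eq {p q : P.Tw} {f : p ⟶ q} {as : List P.Op} {c : C} {i : ℕ}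
    (h : IsRooted as (P.one c) i f) : c = P.output p := by
  obtain ⟨h, hg⟩ := h
  rw [hg.colours.1, P.inputs_one] at h
  have := lt_length h
  obtain rfl : i = 0 := by simpa using this
  simpa using h

/-- The number of leaves is determined by the vertices. -/
theorem IsCapped.eq {p q q' : P.Tw} {f : p ⟶ q} {f' : p ⟶ q'} {as : List P.Op} {a₀ : P.Op}
    {M M' : ℕ} (h : IsCapped as a₀ M f) (h' : IsCapped as a₀ M' f') : M = M' := by
  obtain ⟨h, -, -, hg⟩ := h
  obtain ⟨h', -, -, hg'⟩ := h'
  obtain ⟨⟨-, h1⟩, -⟩ := hg.represents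
  obtain ⟨⟨-, h2⟩, -⟩ := hg'.represents
  have := Option.some.inj (h1.symm.trans h2)
  rw [← h, ← h', this]

/-- An expression determines the target of the morphism and the morphism. -/
theorem Represents.eq_of_represents {p q q' : P.Tw} {f : p ⟶ q} {f' : p ⟶ q'} {e : Expr P.Op}
    (h : Represents f e) (h' : Represents f' e) : ∃ hq : q = q', f ≫ eqToHom hq = f' := by
  obtain ⟨⟨-, h1⟩, -⟩ := id h
  obtain ⟨⟨-, h2⟩, -⟩ := id h'
  obtain rfl : q = q' := Option.some.inj (h1.symm.trans h2)
  exact ⟨rfl, by rw [eqToHom_refl, Category.comp_id]; exact h.unique h'⟩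

/-- The factorization is unique: the vertices of grading `-1` are seen in the composite, and the
other vertices of the first morphism are identities. -/
theorem RNegOne.eq_of_comp_eq {p z z' q : P.Tw} {l : p ⟶ z} {l' : p ⟶ z'} {r : z ⟶ q}
    {r' : z' ⟶ q} (hl : RNegOne ψ l) (hl' : RNegOne ψ l') {loc₁ D₁ loc₁' D₁' : ℤ → ℤ}
    (hr : IsTrack ψ r loc₁ D₁) (hr' : IsTrack ψ r' loc₁' D₁')
    (hD : ∀ j : ℤ, 0 ≤ j → j ≤ P.arity z → 0 ≤ D₁ j)
    (hD' : ∀ j : ℤ, 0 ≤ j → j ≤ P.arity z' → 0 ≤ D₁' j) (h : l ≫ r = l' ≫ r') :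
    ∃ hz : z = z', l ≫ eqToHom hz = l' := by
  obtain ⟨as, a₀, hlen, h1, htree, h3⟩ := hl.exists_tree
  obtain ⟨as', a₀', hlen', h1', htree', h3'⟩ := hl'.exists_tree
  obtain ⟨loc, D, ht, h4⟩ := hl.exists_track
  obtain ⟨loc', D', ht', h4'⟩ := hl'.exists_track
  obtain ⟨loc₂, D₂, ht₂, h5, h6⟩ := htree.exists_track (ψ := ψ)
  obtain ⟨loc₂', D₂', ht₂', h5', h6'⟩ := htree'.exists_track (ψ := ψ)
  -- both morphisms have vertices of grading `-1` at the same half-edges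
  have hDD : ∀ j : ℤ, 0 ≤ j → j ≤ P.arity p → D₂ j = D₂' j := fun j h0 hj => by
    rw [← (ht.unique ht₂).1 j h0 hj, ← (ht'.unique ht₂').1 j h0 hj]
    have h7 := ht.comp hr
    rw [h] at h7
    have h8 := (h7.unique (ht'.comp hr')).1 j h0 hj
    have h9 := compDeg_cases ht h4 hD h0 hj
    have h10 := compDeg_cases ht' h4' hD' h0 hj
    omega
  have hleaf : ∀ {z : P.Tw} {l : p ⟶ z} (r : z ⟶ q) {x : Labelled P ℤ} {a : P.Op}
      {ha : P.arity a = 0}, Sends (Hom.id P) l (El.self p) x.cls (leaf a ha).cls →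
        Sends (Hom.id P) (l ≫ r) (El.self p) x.cls (leaf a ha).cls := fun {z l} r {x a ha} hs =>
    hs.comp_self (sends_leaf ψ r hs.adm_self)
  -- closed vertices are seen in the composite, and the others are identities of given colours
  have has : as = as' := by
    refine List.ext_getElem (hlen.trans hlen'.symm) fun n hn hn' => ?_
    have ha := List.getElem?_eq_getElem hn
    have ha' := List.getElem?_eq_getElem hn'
    have hdeg : ψ.deg as[n] = ψ.deg as'[n] := by
      rw [← h6 n _ ha, ← h6' n _ ha', hDD _ (by omega) (by omega)]
    have hm := h1 _ (.tail _ (List.getElem_mem hn))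
    have hm' := h1' _ (.tail _ (List.getElem_mem hn'))
    by_cases hd : ψ.deg as[n] = -1
    · obtain ⟨x, hx, -, -, c, hop, hed, -⟩ := exists_probe (ψ := ψ) p (j := n + 1) (by omega)
        (by omega)
      have h7 := hleaf r (htree.sends_vertex ψ ha (ψ.arity_eq_zero _ hd) hx hop (hed (by omega)))
      have h8 := hleaf r' (htree'.sends_vertex ψ ha' (ψ.arity_eq_zero _ (hdeg.symm.trans hd)) hx hop
        (hed (by omega)))
      rw [h] at h7
      exact eq_of_cls_leaf_eq (h7.unique h8)
    · obtain ⟨c, hc⟩ := hm.resolve_right hd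
      obtain ⟨c', hc'⟩ := hm'.resolve_right (hdeg ▸ hd)
      have h7 := (htree.inputs_eq ha).symm.trans (htree'.inputs_eq ha')
      rw [hc, hc', P.output_one, P.output_one] at h7
      rw [hc, hc', Option.some.inj h7]
  subst has
  have hdeg : ψ.deg a₀ = ψ.deg a₀' := by
    rw [← h5, ← h5', hDD _ (by omega) (by omega)]
  rcases h3 with ⟨⟨c, rfl⟩, h3⟩ | ⟨h2, M, h3⟩ <;> rcases h3' with ⟨⟨c', rfl⟩, h3'⟩ | ⟨h2', M', h3'⟩
  · obtain rfl : c = c' := h3.one_eq.trans h3'.one_eq.symm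
    exact h3.represents.eq_of_represents h3'.represents
  · rw [ψ.deg_one] at hdeg; omega
  · rw [ψ.deg_one] at hdeg; omega
  · obtain ⟨x, hx, -, -, c, hop, -, hed⟩ := exists_probe (ψ := ψ) p (j := 0) (by omega) (by omega)
    have h7 := hleaf r (h3.sends_vertex (ψ.arity_eq_zero _ h2) hx hop (hed rfl))
    have h8 := hleaf r' (h3'.sends_vertex (ψ.arity_eq_zero _ h2') hx hop (hed rfl))
    rw [h] at h7
    obtain rfl := eq_of_cls_leaf_eq (h7.unique h8)
    obtain rfl := h3.eq h3'
    exact h3.represents.eq_of_represents h3'.represents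

/-! ### The generalized Reedy structure -/

theorem rMinus_of_isIso (ψ : P.NiceGrading) (hψ : ∀ p, ψ.deg p = 0 → P.arity p = 1)
    (hG : IsGroupoid (GradeZero ψ)) {p q : P.Tw} (f : p ⟶ q) [IsIso f] : RMinus ψ f := by
  obtain ⟨loc, D, h⟩ := exists_isTrack ψ f
  exact (rMinus_iff hψ hG h).2 fun j h0 hj => (h.iso.2 j h0 hj).le

theorem rPlus_of_isIso (ψ : P.NiceGrading) (hψ : ∀ p, ψ.deg p = 0 → P.arity p = 1)
    (hG : IsGroupoid (GradeZero ψ)) {p q : P.Tw} (f : p ⟶ q) [IsIso f] : RPlus ψ f := by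
  obtain ⟨loc, D, h⟩ := exists_isTrack ψ f
  exact (rPlus_iff hψ hG h).2 fun j h0 hj => (h.iso.2 j h0 hj).ge

theorem degree_lt_degree {p q : P.Tw} (h : ψ.deg p < ψ.deg q) : degree ψ p < degree ψ q := by
  have := ψ.neg_one_le p
  simp only [degree, Nat.cast_lt]
  omega

theorem degree_eq_degree {p q : P.Tw} (h : ψ.deg p = ψ.deg q) : degree ψ p = degree ψ q := by
  rw [degree, degree, h]

/-- Uniqueness of the factorization. The isomorphism is unique because the morphisms in `R₋` are
epimorphisms, and it exists because the morphisms of grading `-1` in the two factorizations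
coincide. -/
theorem existsUnique_iso (hψ : ∀ p, ψ.deg p = 0 → P.arity p = 1) (hG : IsGroupoid (GradeZero ψ))
    {p q z z' : P.Tw} {l : p ⟶ z} {r : z ⟶ q} {l' : p ⟶ z'} {r' : z' ⟶ q} (hl : RMinus ψ l)
    (hr : RPlus ψ r) (hl' : RMinus ψ l') (hr' : RPlus ψ r') (h : l ≫ r = l' ≫ r') :
    ∃! e : z ≅ z', l ≫ e.hom = l' ∧ e.hom ≫ r' = r := by
  have hepi := hl.epi
  suffices ∃ e : z ≅ z', l ≫ e.hom = l' by
    obtain ⟨e, he⟩ := this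
    refine ⟨e, ⟨he, ?_⟩, fun e' he' => Iso.ext ?_⟩
    · rw [← cancel_epi l, ← Category.assoc, he, h]
    · rw [← cancel_epi l, he'.1, he]
  obtain ⟨loc₁, D₁, h1⟩ := exists_isTrack ψ r
  obtain ⟨loc₁', D₁', h1'⟩ := exists_isTrack ψ r'
  rw [rPlus_iff hψ hG h1] at hr
  rw [rPlus_iff hψ hG h1'] at hr'
  obtain ⟨w, l, θ, hl, hθ, rfl⟩ := hl
  obtain ⟨w', l', θ', hl', hθ', rfl⟩ := hl'
  obtain ⟨loc₂, D₂, h2⟩ := exists_isTrack ψ θ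
  obtain ⟨loc₂', D₂', h2'⟩ := exists_isTrack ψ θ'
  rw [Category.assoc, Category.assoc] at h
  obtain ⟨rfl, rfl⟩ := hl.eq_of_comp_eq hl' (h2.comp h1) (h2'.comp h1')
    (compDeg_nonneg (p := w) (fun j h0 hj => (h2.iso.2 j h0 hj).ge) hr)
    (compDeg_nonneg (p := w') (fun j h0 hj => (h2'.iso.2 j h0 hj).ge) hr') h
  exact ⟨(asIso θ).symm ≪≫ asIso θ', by simp⟩

/-- With `R₋` and `R₊` described by the gradings of the vertices, the axioms follow from the
additivity of these gradings. -/
theorem isGeneralizedReedy (hψ : ∀ p, ψ.deg p = 0 → P.arity p = 1)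
    (hG : IsGroupoid (GradeZero ψ)) :
    IsGeneralizedReedy (RMinus ψ) (RPlus ψ) (degree ψ) where
  fac :=
    { left_mul :=
        { id_mem := fun p => rMinus_of_isIso ψ hψ hG (𝟙 p)
          comp_mem := fun f g hf hg => by
            obtain ⟨loc, D, h⟩ := exists_isTrack ψ f
            obtain ⟨loc', D', h'⟩ := exists_isTrack ψ g
            exact (rMinus_iff hψ hG (h.comp h')).2
              (compDeg_nonpos ((rMinus_iff hψ hG h).1 hf) ((rMinus_iff hψ hG h').1 hg)) }
      right_mul :=
        { id_mem := fun p => rPlus_of_isIso ψ hψ hG (𝟙 p)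
          comp_mem := fun f g hf hg => by
            obtain ⟨loc, D, h⟩ := exists_isTrack ψ f
            obtain ⟨loc', D', h'⟩ := exists_isTrack ψ g
            exact (rPlus_iff hψ hG (h.comp h')).2
              (compDeg_nonneg ((rPlus_iff hψ hG h).1 hf) ((rPlus_iff hψ hG h').1 hg)) }
      left_iso := fun _ _ f _ => rMinus_of_isIso ψ hψ hG f
      right_iso := fun _ _ f _ => rPlus_of_isIso ψ hψ hG f
      exists_fac := fun p q f => by
        obtain ⟨z, l, r, hl, hr, h⟩ := exists_factorization ψ f
        exact ⟨z, l, r, ⟨z, l, 𝟙 z, hl, inferInstance, (Category.comp_id l).symm⟩,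
          ⟨z, 𝟙 z, r, inferInstance, hr, (Category.id_comp r).symm⟩, h⟩
      unique_fac := fun _ _ _ _ _ _ _ _ hl hr hl' hr' h =>
        existsUnique_iso hψ hG hl hr hl' hr' h }
  deg_minus p q f hf hiso := by
    obtain ⟨loc, D, h⟩ := exists_isTrack ψ f
    have hD := (rMinus_iff hψ hG h).1 hf
    refine degree_lt_degree ?_
    rw [h.deg_eq]
    suffices ∑ j ∈ Finset.Icc (0 : ℤ) (P.arity p), D j < 0 by omega
    refine Finset.sum_neg' (fun j hj => ?_) ?_
    · rw [Finset.mem_Icc] at hj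
      exact hD j hj.1 hj.2
    · by_contra! hcon
      refine hiso (isIso_of_deg_eq_zero hψ hG h fun j h0 hj => ?_)
      have := hcon j (Finset.mem_Icc.2 ⟨h0, hj⟩)
      exact le_antisymm (hD j h0 hj) this
  deg_plus p q f hf hiso := by
    obtain ⟨loc, D, h⟩ := exists_isTrack ψ f
    have hD := (rPlus_iff hψ hG h).1 hf
    refine degree_lt_degree ?_
    rw [h.deg_eq]
    suffices 0 < ∑ j ∈ Finset.Icc (0 : ℤ) (P.arity p), D j by omega
    refine Finset.sum_pos' (fun j hj => ?_) ?_
    · rw [Finset.mem_Icc] at hj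
      exact hD j hj.1 hj.2
    · by_contra! hcon
      refine hiso (isIso_of_deg_eq_zero hψ hG h fun j h0 hj => ?_)
      have := hcon j (Finset.mem_Icc.2 ⟨h0, hj⟩)
      exact le_antisymm this (hD j h0 hj)
  deg_iso p q f hf := by
    obtain ⟨loc, D, h⟩ := exists_isTrack ψ f
    refine degree_eq_degree ?_
    rw [h.deg_eq, Finset.sum_eq_zero, add_zero]
    intro j hj
    rw [Finset.mem_Icc] at hj
    exact h.iso.2 j hj.1 hj.2
  eq_id p q f θ hf _ h := by
    have := hf.epi
    rw [← cancel_epi f, h, Category.comp_id]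

/-! ### Invertibility of the operations of grading `0` -/

/-- Every morphism is given by a tree and a permutation of its leaves. -/
theorem exists_isTree_comp {p q : P.Tw} (f : p ⟶ q) :
    ∃ (r : P.Tw) (t : p ⟶ r) (θ : r ⟶ q) (as : List P.Op) (a₀ : P.Op) (n : ℕ)
      (σ : Equiv.Perm (Fin (n + 1))), as.length = P.arity p ∧ IsTree as a₀ t ∧
        Represents θ (.act n σ (.var (r : P.Op))) ∧ f = t ≫ θ := by
  classical
  obtain ⟨y, hy⟩ := exists_decorates f
  set X := srcVertex (p : P.Op) with hX
  have hperm : X.edges.Perm (X.edges.reverse.filter fun _ => True) := by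
    rw [List.filter_eq_self.2 (by simp)]
    exact (List.reverse_perm _).symm
  have hI : Indep X (decos (Hom.id P) y (X.edges.reverse.filter fun _ => True)) :=
    hy.indep.perm (decos_perm hperm)
  have hA : ∀ (T : Operad.{u, v} κ C) (F : Hom P T) (x : El T p),
      Attach (decos F y (X.edges.reverse.filter fun _ => True)) (X.lab x) (can (app F f x).1) :=
    fun T F x => (hy.attach T F x).perm (indep_decos hy.indep F rfl) (decos_perm hperm)
  obtain ⟨as, a₀, Λ, t, h1, -, h2, -, h3⟩ := exists_tree (X := X) (S := fun _ => True) hI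
    (hA P (Hom.id P) (El.self p))
  have hΛ : Λ.edges.Nodup := by
    have := h3 P (Hom.id P) (El.self X.op)
    rw [lab_app_self] at this
    exact this.nodup hI
  obtain ⟨N, σ, θ, hθ, rfl⟩ := exists_act_of_rel t f hΛ fun T F x =>
    Attach.rel (indep_decos hI F rfl) (h3 T F x) (hA T F x)
  refine ⟨Λ.op, t, θ, as, a₀, N, σ, h1, ?_, hθ, rfl⟩
  rcases h2 with ⟨i, h4, -⟩ | ⟨-, h4, h5⟩
  · exact .inl ⟨i, h4⟩
  · exact .inr ⟨h4, h5⟩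

/-- The unary operation `a` with output labelled by the mark `-1` and input labelled by `1`. -/
def marked (a : T.Op) (ha : T.arity a = 1) : Labelled T ℤ := ⟨a, -1, [1], ha.symm⟩

theorem arity_comp_unary {a b : T.Op} {h} (ha : T.arity a = 1) (hb : T.arity b = 1) :
    T.arity (T.comp a 0 b h) = 1 := by
  have := (arity_comp_op h).1
  omega

theorem edges_marked (a : T.Op) (ha : T.arity a = 1) : (marked a ha).edges = [-1, 1] := rfl

/-- Composition at the input of a marked operation. -/
theorem compL_marked {t a b : T.Op} {h} (ha : T.arity a = 1) (hb : T.arity b = 1)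
    (hx : Fits t (marked a ha)) :
    compL (marked a ha).cls 0 b = (marked (T.comp a 0 b h) (arity_comp_unary ha hb)).cls := by
  refine glueSet_cls (meet_outL hx _ (by omega) 0 b) (Std.contr ⟨0, h, ?_, ?_, ?_⟩)
  · simp [Labelled.map, marked, outL]
  · simp [Labelled.map, can, innL]
  · refine eq_of_edges rfl (Eq.trans ?_ (edges_comp _ _ _ _).symm)
    simp [marked, edges, Labelled.map, outL, innL, can, hb]

/-- Composition into another operation is not seen by a marked operation, which lacks the label of
the output. -/
theorem compR_marked {p a : T.Op} {m : ℕ} (ha : T.arity a = 1) :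
    compR p 0 (marked a ha).cls m = (marked a ha).cls := by
  have h : (marked a ha).map (innL (-2) 0) = marked a ha :=
    map_eq_self fun l hl => by
      have : l = -1 ∨ l = 1 := by simpa [marked, edges] using hl
      rcases this with rfl | rfl <;> simp [innL]
  rw [compR, glueSet_cls_of_not_mem, h]
  rw [h]
  simp [marked, edges]

theorem arity_one (c : C) : T.arity (T.one c) = 1 := congrArg List.length (T.inputs_one c)

theorem fits_marked_one {c : C} : Fits (T.one c) (marked (T.one c) (arity_one c)) := by
  refine ⟨by simp [marked, edges], fun a ha => ?_, fun _ => by simp [marked, edges]⟩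
  simp only [marked, cols, edges, hedges, T.output_one, T.inputs_one] at ha
  rcases List.mem_pair.1 ha with rfl | rfl
  · exact .inl rfl
  · right
    simp [can, cols, edges, hedges, T.inputs_one, T.output_one, arity]

theorem sends_of_act {p q : P.Tw} {f : p ⟶ q} {n : ℕ} {σ : Equiv.Perm (Fin (n + 1))}
    (h : Represents f (.act n σ (.var (p : P.Op)))) {A : Set (Labelled P ℤ)}
    (hA : Adm (p : P.Op) A) : Sends (Hom.id P) f (El.self p) A (actS σ A) := by
  refine h.of_act (M := fun q f => Sends (Hom.id P) f (El.self p) A (actS σ A))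
    fun r g h hσ hg => ?_
  obtain ⟨⟨-, hr⟩, -⟩ := id hg
  obtain rfl : p = r := by simpa [eval, interp] using hr
  rw [hg.unique (represents_id p), Category.id_comp]
  exact sends_eA (Hom.id P) h hσ (El.self p) hA

/-- A morphism that composes an operation of grading `0` into an identity has non-negative grading
and preserves the degree. -/
theorem IsGraft.isIso_of_isGeneralizedReedy
    (h : IsGeneralizedReedy (RMinus ψ) (RPlus ψ) (degree ψ)) {p : P.Op} (hp : ψ.deg p = 0) {c : C}
    {q : P.Tw} {f : (P.one c : P.Tw) ⟶ q} (hf : IsGraft 0 [p] f) (hq : ψ.deg q = 0) : IsIso f := by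
  have h1 : (P.inputs (P.one (P.output q)))[0]? = some (P.output q) := by
    rw [P.inputs_one]; rfl
  obtain ⟨n, hn⟩ : ∃ n, (P.inputs (P.comp (P.one (P.output q)) 0 q h1)).length = n := ⟨_, rfl⟩
  have := isIso_eR_one h1
  have := isIso_eA hn κ.allows_one
  have h2 : RNonneg ψ ((f ≫ eR _ 0 q h1) ≫ eA _ n 1 hn κ.allows_one) := by
    refine ⟨[p], P.one (P.output q), n, 1, ?_, ?_, .inl ⟨0, ?_⟩⟩
    · rw [arity, P.inputs_one]; rfl
    · intro a ha
      rcases List.mem_pair.1 ha with rfl | rfl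
      · exact (ψ.deg_one _).ge
      · exact hp.ge
    · exact Represents.comp_eA (IsRooted.represents (IsRooted.mk h1 hf)) hn κ.allows_one
  have h3 : IsIso ((f ≫ eR _ 0 q h1) ≫ eA _ n 1 hn κ.allows_one) := by
    by_contra h4
    refine (h.deg_plus _ ⟨_, 𝟙 _, _, inferInstance, h2, (Category.id_comp _).symm⟩ h4).ne
      (degree_eq_degree ?_)
    rw [ψ.deg_act, ψ.deg_comp, ψ.deg_one, hq, ψ.deg_one]
    rfl
  rw [Category.assoc] at h3
  exact IsIso.of_isIso_comp_right f (eR _ 0 q h1 ≫ eA _ n 1 hn κ.allows_one)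

theorem isGraft_eL {q : P.Tw} {i : ℕ} {a : P.Op} (h) : IsGraft i [a] (eL q i a h) := by
  have := IsGraft.cons (k := i) (a := a) (f := 𝟙 q) h (.nil (i + 1))
  rwa [Category.id_comp] at this

theorem isIso_eL_of_deg_eq_zero (h : IsGeneralizedReedy (RMinus ψ) (RPlus ψ) (degree ψ)) {p : P.Op}
    (hp : ψ.deg p = 0) {c : C} (hc : (P.inputs (P.one c))[0]? = some (P.output p)) :
    IsIso (eL (P.one c) 0 p hc) :=
  (isGraft_eL hc).isIso_of_isGeneralizedReedy h hp (by rw [ψ.deg_comp, ψ.deg_one, hp]; rfl)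

/-- The morphism that composes `p` into an identity is an isomorphism, and isomorphisms preserve the
arity. -/
theorem arity_eq_one_of_deg_eq_zero (h : IsGeneralizedReedy (RMinus ψ) (RPlus ψ) (degree ψ))
    {p : P.Op} (hp : ψ.deg p = 0) : P.arity p = 1 := by
  have hc : (P.inputs (P.one (P.output p)))[0]? = some (P.output p) := by rw [P.inputs_one]; rfl
  have := isIso_eL_of_deg_eq_zero h hp hc
  have h1 := (isTrack_eL (ψ := ψ) hc).iso.1
  rw [P.one_comp] at h1
  rw [← h1, arity, P.inputs_one]
  rfl

/-- The vertex attached to the input of `p` in the inverse of the morphism to `p` from an identity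
is a right inverse of `p`. -/
theorem exists_right_inverse (h : IsGeneralizedReedy (RMinus ψ) (RPlus ψ) (degree ψ)) {p : P.Op}
    (hp : ψ.deg p = 0) : ∃ a, ψ.deg a = 0 ∧ ∃ h, P.comp p 0 a h = P.one (P.output p) := by
  have har : ∀ {a : P.Op}, ψ.deg a = 0 → P.arity a = 1 := arity_eq_one_of_deg_eq_zero h
  set c := P.output p with hc'
  have hc : (P.inputs (P.one c))[0]? = some (P.output p) := by rw [P.inputs_one]; rfl
  have := isIso_eL_of_deg_eq_zero h hp hc
  set f := eL (P.one c) 0 p hc with hf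
  have hq : P.comp (P.one c) 0 p hc = p := P.one_comp _ _ _
  obtain ⟨r, t, θ, as, a₀, n, σ, h1, h2, h3, h4⟩ := exists_isTree_comp (inv f)
  have hlen : as.length = 1 := by rw [h1, hq, har hp]
  obtain ⟨a, rfl⟩ := List.length_eq_one_iff.1 hlen
  obtain ⟨loc, D, h5, h6, h7⟩ := h2.exists_track (ψ := ψ)
  obtain ⟨loc', h8⟩ := exists_track_of_act (ψ := ψ) h3
  have h9 := h5.comp h8
  rw [compDeg_zero, ← h4] at h9
  have ha₀ : ψ.deg a₀ = 0 := by rw [← h6]; exact h9.iso.2 0 le_rfl (by omega)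
  have ha : ψ.deg a = 0 := by
    rw [← h7 0 a rfl]
    exact h9.iso.2 _ (by simp) (by rw [hq, har hp]; simp)
  refine ⟨a, ha, ?_⟩
  rcases h2 with ⟨i, h2⟩ | ⟨h2, -⟩
  swap
  · rw [har ha₀] at h2; omega
  have hi := h2.lt_arity
  rw [har ha₀] at hi
  obtain rfl : i = 0 := by omega
  obtain ⟨h10, hg⟩ := h2
  obtain - | ⟨h11, hg⟩ := hg
  obtain - | - := hg
  have h12 : P.arity (P.comp (P.one c) 0 p hc) = 1 := by rw [hq, har hp]
  -- the composite with the inverse sends the marked identity to `p ∘ a`, up to a permutation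
  have h13 := sends_eL (Hom.id P) hc (El.self _) (fits_marked_one (c := c)).adm_cls
  have h14 : compL _ 0 ((Hom.id P).map p) = _ := compL_marked (h := hc) _ (har hp) fits_marked_one
  rw [h14] at h13
  have h16 := sends_eL (Hom.id P) h11 (El.self _) h13.adm_self
  have h17 : compL _ 0 ((Hom.id P).map a) = _ := compL_marked (h := h11) _ (har ha)
    (h13.adm_self.fits _ (mem_cls_self _))
  rw [h17] at h16
  have h19 := sends_eR (Hom.id P) h10 (El.self _) h16.adm_self
  rw [compR_marked] at h19
  have h22 := h13.comp_self (((h16.comp_self h19).comp_self (sends_of_act h3 h19.adm_self)))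
  rw [Category.id_comp] at h4
  rw [← h4, ← hf, IsIso.hom_inv_id] at h22
  have h23 := (sends_id _ _ fits_marked_one.adm_cls).unique h22
  rw [actS_cls] at h23
  have h24 : (marked (P.one c) _).Rel _ := (Set.ext_iff.1 h23 _).2 (mem_cls_self _)
  have h25 : ∀ {w : P.Op} (hw : P.arity w = 1), ((marked w hw).map (permL σ)).edges =
      [-1, permL σ 1] := fun hw => by
    rw [edges_map, edges_marked, List.map_cons, List.map_cons, List.map_nil, permL_of_neg _ (by omega)]
  -- the composite is the identity, so that the permutation is trivial
  have h26 : permL σ 1 = 1 := by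
    have := h24.edges_perm.mem_iff.2 (by simp [edges_marked] : (1 : ℤ) ∈ _)
    rw [h25] at this
    exact ((List.mem_pair.1 this).resolve_left (by omega)).symm
  have h27 := h24.op_eq (by simp [edges_marked]) (by rw [h25, h26, edges_marked])
  have h28 : (P.inputs p)[0]? = some (P.output a) := by rw [← h11, hq]
  refine ⟨h28, ?_⟩
  exact (P.comp_congr hq.symm rfl rfl _ _).trans h27.symm

/-- A category in which all morphisms have right inverses is a groupoid. -/
theorem isGroupoid_gradeZero (h : IsGeneralizedReedy (RMinus ψ) (RPlus ψ) (degree ψ)) :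
    IsGroupoid (GradeZero ψ) := by
  have key : ∀ {c d : GradeZero ψ} (f : c ⟶ d), ∃ g : d ⟶ c, g ≫ f = 𝟙 d := by
    rintro c d ⟨p, hc, rfl, hp⟩
    obtain ⟨a, ha, h1, h2⟩ := exists_right_inverse h hp
    refine ⟨⟨a, ?_, ?_, ha⟩, Subtype.ext h2⟩
    · have h3 := congrArg P.inputs h2
      rw [P.inputs_comp, hc, P.inputs_one] at h3
      exact (List.append_nil _).symm.trans h3
    · rw [hc] at h1
      exact (Option.some.inj h1).symm
  refine ⟨fun f => ?_⟩
  obtain ⟨g, hg⟩ := key f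
  obtain ⟨g', hg'⟩ := key g
  have : g' = f := by
    rw [← Category.comp_id g', ← hg, ← Category.assoc, hg', Category.id_comp]
  subst this
  exact ⟨g, hg', hg⟩

end Operad

end TwistedArrow

theorem mainTheorem5 {κ : TwistedArrow.Kind} {C : Type u} (P : TwistedArrow.Operad.{u, v} κ C)
    (ψ : P.NiceGrading) :
    TwistedArrow.IsGeneralizedReedy (TwistedArrow.Operad.RMinus ψ) (TwistedArrow.Operad.RPlus ψ)
        (TwistedArrow.Operad.degree ψ) ↔
      (∀ p : P.Op, ψ.deg p = 0 → P.arity p = 1) ∧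
        CategoryTheory.IsGroupoid (TwistedArrow.Operad.GradeZero ψ) :=
  ⟨fun h => ⟨fun _ => TwistedArrow.Operad.arity_eq_one_of_deg_eq_zero h,
    TwistedArrow.Operad.isGroupoid_gradeZero h⟩,
    fun h => TwistedArrow.Operad.isGeneralizedReedy h.1 h.2⟩
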